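/- Let $\mathcal S\subset\{-1,0,1\}^2\setminus\{(0,0)\}$ be a non-singular step set (that is, $\mathcal S$ is contained in no closed half-plane whose boundary line passes through the origin), and let $0<z<1/|\mathcal S|$. Let $q(i,j;n)$ be the number of walks with $n$ steps in $\mathcal S$ that start at the origin, stay in $\mathbf Z_{\ge 0}^2$ and end at $(i,j)$, and put $$Q(x,y)=\sum_{i,j,n\ge 0}q(i,j;n)x^iy^jz^n,\qquad K(x,y)=xyz\Big[\sum_{(i,j)\in\mathcal S}x^iy^j-\tfrac1z\Big]=a(x)y^2+b(x)y+c(x)=\tilde a(y)x^2+\tilde b(y)x+\tilde c(y).$$ Let $d=b^2-4ac$ and $\tilde d=\tilde b^2-4\tilde a\tilde c$. Let $x_1<x_2$ be the roots of $d$ in the open unit disc, $x_3$ its smallest root in $(1,\infty)$ and $x_4$ its remaining root ($x_4=\infty$ if $\deg d=3$); let $y_1,y_2,y_3,y_4$ be the analogous points for $\tilde d$, and $X(y_1)=-\tilde b(y_1)/(2\tilde a(y_1))\in\mathbf R\cup\{\infty\}$. Put $$\omega_1=i\int_{x_1}^{x_2}\frac{dx}{\sqrt{-d(x)}},\qquad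 \omega_2=\int_{x_2}^{x_3}\frac{dx}{\sqrt{d(x)}},\qquad \omega_3=\int_{X(y_1)}^{x_1}\frac{dx}{\sqrt{d(x)}}$$ (the last integral is over the arc of $\mathbf R\cup\{\infty\}$ that leads from $X(y_1)$ to $x_1$ in the increasing direction). Let $\wp$ be the Weierstrass function with periods $\omega_1,\omega_2$, let $g_x(t)=d''(x_4)/6+d'(x_4)/(t-x_4)$ if $x_4\ne\infty$ and $g_x(t)=d''(0)/6+d'''(0)t/6$ if $x_4=\infty$, and define $g_y$ in the same way from $\tilde d$ and $y_4$. Put $$x(\omega)=g_x^{-1}(\wp(\omega)),\qquad y(\omega)=g_y^{-1}(\wp(\omega-\omega_3/2)),\qquad \omega_{x_2}=\frac{\omega_1+\omega_2}2,\qquad \omega_{y_2}=\frac{\omega_1+\omega_2+\omega_3}2,$$ $$\widehat\xi\omega=-\omega+2\omega_{x_2},\qquad \widehat\eta\omega=-\omega+2\omega_{y_2},$$ $$\Delta_x=\{\omega\in\omega_1\mathbf R+(0,\omega_2):|x(\omega)|<1\},\qquad \Delta_y=\{\omega\in\omega_1\mathbf R+\tfrac{\omega_3}2+(0,\omega_2):|y(\omega)|<1\}.$$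 Let $r_x=K(x(\omega),0)Q(x(\omega),0)$ on $\Delta_x$ and $r_x=-K(0,y(\omega))Q(0,y(\omega))+K(0,0)Q(0,0)+x(\omega)y(\omega)$ on $\Delta_y$; let $r_y=K(0,y(\omega))Q(0,y(\omega))$ on $\Delta_y$ and $r_y=-K(x(\omega),0)Q(x(\omega),0)+K(0,0)Q(0,0)+x(\omega)y(\omega)$ on $\Delta_x$. Then $r_x$ and $r_y$ can be continued from $\Delta_x\cup\Delta_y$ to meromorphic functions on the whole of $\mathbf C$, and the following identities of meromorphic functions hold on $\mathbf C$: $$r_x(\omega-\omega_3)=r_x(\omega)+y(\omega)\,[x(-\omega+2\omega_{y_2})-x(\omega)],$$ $$r_y(\omega+\omega_3)=r_y(\omega)+x(\omega)\,[y(-\omega+2\omega_{x_2})-y(\omega)],$$ $$r_x(\omega)+r_y(\omega)-K(0,0)Q(0,0)-x(\omega)y(\omega)=0,$$ $$r_x(\widehat\xi\omega)=r_x(\omega),\qquad r_y(\widehat\eta\omega)=r_y(\omega),$$ $$r_x(\omega+\omega_1)=r_x(\omega),\qquad r_y(\omega+\omega_1)=r_y(\omega).$$ -/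

import Mathlib

open Filter Polynomial OnePoint

namespace QuarterPlane

/-! ### Step sets, walks and the generating function -/

/-- `S` is a set of steps to some of the eight nearest neighbours. -/
def IsSmallStepSet (S : Finset (ℤ × ℤ)) : Prop :=
  S ⊆ (Finset.Icc (-1) 1 ×ˢ Finset.Icc (-1) 1).erase (0, 0)

/-- The walk is non-singular: its steps do not all lie in one closed half-plane whose boundary line
passes through the origin. -/
def IsNonsingular (S : Finset (ℤ × ℤ)) : Prop :=
  ∀ a b : ℝ, (a ≠ 0 ∨ b ≠ 0) → ∃ s ∈ S, a * (s.1 : ℝ) + b * (s.2 : ℝ) < 0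

/-- The step set with the two coordinates exchanged. All objects attached to the variable `y` are
those attached to `x` for the transposed step set. -/
def transpose (S : Finset (ℤ × ℤ)) : Finset (ℤ × ℤ) := S.image Prod.swap

/-- The number `q(i, j; n)` of walks with `n` steps in `S` that start at the origin, stay in the
quarter plane, and end at `(i, j)`; a walk is given by the sequence of its steps. -/
def q (S : Finset (ℤ × ℤ)) (i j n : ℕ) : ℕ :=
  ((Fintype.piFinset fun _ : Fin n => S).filter fun w =>
    (∀ m : Fin (n + 1), 0 ≤ ∑ k with (k : Fin n).val < m.val, w k) ∧
      ∑ k, w k = ((i : ℤ), (j : ℤ))).card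

/-- The generating function `Q(x, y; z) = ∑ q(i, j; n) x ^ i y ^ j z ^ n`. -/
noncomputable def Q (S : Finset (ℤ × ℤ)) (z : ℝ) (x y : ℂ) : ℂ :=
  ∑' p : ℕ × ℕ × ℕ, (q S p.1 p.2.1 p.2.2 : ℂ) * x ^ p.1 * y ^ p.2.1 * (z : ℂ) ^ p.2.2

/-- The kernel `K(x, y; z) = x y z (∑ x ^ i y ^ j - 1 / z)`, with the product expanded so that it is
visibly a polynomial in `x` and `y` (the exponents `i + 1`, `j + 1` are nonnegative). -/
noncomputable def K (S : Finset (ℤ × ℤ)) (z : ℝ) (x y : ℂ) : ℂ :=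
  (z : ℂ) * ∑ s ∈ S, x ^ (s.1 + 1).toNat * y ^ (s.2 + 1).toNat - x * y

/-! ### The discriminant and its roots

`K(x, y) = a(x) y ^ 2 + b(x) y + c(x)`. -/

noncomputable def a (S : Finset (ℤ × ℤ)) (z : ℝ) : ℝ[X] :=
  C z * ∑ s ∈ S with s.2 = 1, X ^ (s.1 + 1).toNat

noncomputable def b (S : Finset (ℤ × ℤ)) (z : ℝ) : ℝ[X] :=
  C z * ∑ s ∈ S with s.2 = 0, X ^ (s.1 + 1).toNat - X

noncomputable def c (S : Finset (ℤ × ℤ)) (z : ℝ) : ℝ[X] :=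
  C z * ∑ s ∈ S with s.2 = -1, X ^ (s.1 + 1).toNat

/-- The discriminant `d = b ^ 2 - 4 a c`. -/
noncomputable def d (S : Finset (ℤ × ℤ)) (z : ℝ) : ℝ[X] :=
  b S z ^ 2 - 4 * a S z * c S z

/-- `x₁`: the smaller of the two roots of `d` in the unit disc. -/
noncomputable def x₁ (S : Finset (ℤ × ℤ)) (z : ℝ) : ℝ :=
  sInf {t : ℝ | |t| < 1 ∧ (d S z).IsRoot t}

/-- `x₂`: the larger of the two roots of `d` in the unit disc. -/
noncomputable def x₂ (S : Finset (ℤ × ℤ)) (z : ℝ) : ℝ :=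
  sSup {t : ℝ | |t| < 1 ∧ (d S z).IsRoot t}

/-- `x₃`: the smallest root of `d` in `(1, ∞)`. -/
noncomputable def x₃ (S : Finset (ℤ × ℤ)) (z : ℝ) : ℝ :=
  sInf {t : ℝ | 1 < t ∧ (d S z).IsRoot t}

open Classical in
/-- `x₄`: the other root of `d` outside of the unit disc, or `∞` if there is none, that is, if `d`
has degree three. -/
noncomputable def x₄ (S : Finset (ℤ × ℤ)) (z : ℝ) : OnePoint ℝ :=
  if h : ∃ t : ℝ, 1 < |t| ∧ (d S z).IsRoot t ∧ t ≠ x₃ S z then ((h.choose : ℝ) : OnePoint ℝ) else ∞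

/-- `y₁`: the smaller of the two roots of the discriminant in `y` in the unit disc. -/
noncomputable def y₁ (S : Finset (ℤ × ℤ)) (z : ℝ) : ℝ := x₁ (transpose S) z

/-- `y₄`: the root, other than `y₃`, of the discriminant in `y` outside of the unit disc, or `∞`. -/
noncomputable def y₄ (S : Finset (ℤ × ℤ)) (z : ℝ) : OnePoint ℝ := x₄ (transpose S) z

open Classical in
/-- The common value `-b(t) / (2 a(t))` (possibly `∞`) of the two branches of the algebraic
function `Y(x)` at a branch point `t`. -/
noncomputable def branchValue (S : Finset (ℤ × ℤ)) (z t : ℝ) : OnePoint ℝ :=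
  if (a S z).eval t = 0 then ∞ else ((-(b S z).eval t / (2 * (a S z).eval t) : ℝ) : OnePoint ℝ)

/-- The value `X(y₁)` of the algebraic function `X(y)` at `y₁`. -/
noncomputable def Xy₁ (S : Finset (ℤ × ℤ)) (z : ℝ) : OnePoint ℝ :=
  branchValue (transpose S) z (y₁ S z)

/-! ### Periods -/

open Classical in
/-- The finite points of the arc of the real projective line that leads from `p` to `r` in the
increasing direction (through `∞` if `r < p`). -/
noncomputable def arc : OnePoint ℝ → ℝ → Set ℝ
  | ∞, r => Set.Iic r
  | OnePoint.some p, r => if p ≤ r then Set.Icc p r else Set.Ici p ∪ Set.Iic r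

noncomputable def ω₁ (S : Finset (ℤ × ℤ)) (z : ℝ) : ℂ :=
  Complex.I * ((∫ t in (x₁ S z)..(x₂ S z), 1 / √(-(d S z).eval t) : ℝ) : ℂ)

noncomputable def ω₂ (S : Finset (ℤ × ℤ)) (z : ℝ) : ℝ :=
  ∫ t in (x₂ S z)..(x₃ S z), 1 / √((d S z).eval t)

noncomputable def ω₃ (S : Finset (ℤ × ℤ)) (z : ℝ) : ℝ :=
  ∫ t in arc (Xy₁ S z) (x₁ S z), 1 / √((d S z).eval t)

/-! ### Uniformization -/

open Classical in
/-- The Weierstrass function `℘(·; w₁, w₂)` as a map to the Riemann sphere. -/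
noncomputable def wp (w₁ w₂ : ℂ) (ω : ℂ) : OnePoint ℂ :=
  if h : LinearIndependent ℝ ![w₁, w₂] then
    if ω ∈ (PeriodPair.mk w₁ w₂ h).lattice then ∞
    else (((PeriodPair.mk w₁ w₂ h).weierstrassP ω : ℂ) : OnePoint ℂ)
  else ∞

open Classical in
/-- The Möbius transformation `g`, for a polynomial `f` and a root `r` of `f` (or `r = ∞`):
`g(t) = f''(r) / 6 + f'(r) / (t - r)` if `r ≠ ∞`, and `g(t) = f''(0) / 6 + f'''(0) t / 6`
if `r = ∞`. -/
noncomputable def g (f : ℝ[X]) : OnePoint ℝ → OnePoint ℂ → OnePoint ℂ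
  | OnePoint.some r, OnePoint.some t =>
    if t = (r : ℂ) then ∞
    else ((((derivative^[2] f).eval r / 6 : ℝ) + ((derivative f).eval r : ℝ) / (t - r) : ℂ) :
      OnePoint ℂ)
  | OnePoint.some r, ∞ => ((((derivative^[2] f).eval r / 6 : ℝ) : ℂ) : OnePoint ℂ)
  | ∞, OnePoint.some t =>
    ((((derivative^[2] f).eval 0 / 6 : ℝ) + ((derivative^[3] f).eval 0 : ℝ) * t / 6 : ℂ) :
      OnePoint ℂ)
  | ∞, ∞ => ∞

open Classical in
/-- The inverse of the Möbius transformation `g`. -/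
noncomputable def gInv (f : ℝ[X]) : OnePoint ℝ → OnePoint ℂ → OnePoint ℂ
  | OnePoint.some r, OnePoint.some u =>
    if u = (((derivative^[2] f).eval r / 6 : ℝ) : ℂ) then ∞
    else ((r + ((derivative f).eval r : ℝ) / (u - ((derivative^[2] f).eval r / 6 : ℝ)) : ℂ) :
      OnePoint ℂ)
  | OnePoint.some r, ∞ => ((r : ℂ) : OnePoint ℂ)
  | ∞, OnePoint.some u =>
    ((6 * (u - ((derivative^[2] f).eval 0 / 6 : ℝ)) / ((derivative^[3] f).eval 0 : ℝ) : ℂ) :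
      OnePoint ℂ)
  | ∞, ∞ => ∞

theorem g_gInv_some (f : ℝ[X]) (r : ℝ) (hr : (derivative f).eval r ≠ 0) (u : OnePoint ℂ) :
    g f (r : OnePoint ℝ) (gInv f (r : OnePoint ℝ) u) = u := by
  have hr' : (((derivative f).eval r : ℝ) : ℂ) ≠ 0 := by exact_mod_cast hr
  induction u using OnePoint.rec with
  | infty => simp [g, gInv]
  | coe u =>
    by_cases hu : u = (((derivative^[2] f).eval r / 6 : ℝ) : ℂ)
    · simp only [gInv, if_pos hu, g]
      rw [hu]
    · have hu' := sub_ne_zero.mpr hu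
      have hne : (r : ℂ) + ((derivative f).eval r : ℝ) / (u - ((derivative^[2] f).eval r / 6 : ℝ))
          ≠ r := by
        rw [Ne, add_eq_left]
        exact div_ne_zero hr' hu'
      simp only [gInv, if_neg hu, g, if_neg hne]
      congr 1
      rw [add_sub_cancel_left, div_div_cancel₀ hr', add_sub_cancel]

theorem g_gInv_infty (f : ℝ[X]) (hr : (derivative^[3] f).eval 0 ≠ 0) (u : OnePoint ℂ) :
    g f ∞ (gInv f ∞ u) = u := by
  have hr' : (((derivative^[3] f).eval 0 : ℝ) : ℂ) ≠ 0 := by exact_mod_cast hr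
  induction u using OnePoint.rec with
  | infty => simp [g, gInv]
  | coe u =>
    simp only [gInv, g]
    congr 1
    rw [mul_div_cancel₀ _ hr', mul_div_cancel_left₀ _ (by norm_num), add_sub_cancel]

/-- The coordinate `x(ω) = g_x⁻¹(℘(ω))`, with values in the Riemann sphere. -/
noncomputable def xS (S : Finset (ℤ × ℤ)) (z : ℝ) (ω : ℂ) : OnePoint ℂ :=
  gInv (d S z) (x₄ S z) (wp (ω₁ S z) (ω₂ S z) ω)

/-- The coordinate `y(ω) = g_y⁻¹(℘(ω - ω₃ / 2))`, with values in the Riemann sphere. -/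
noncomputable def yS (S : Finset (ℤ × ℤ)) (z : ℝ) (ω : ℂ) : OnePoint ℂ :=
  gInv (d (transpose S) z) (y₄ S z) (wp (ω₁ S z) (ω₂ S z) (ω - (ω₃ S z : ℂ) / 2))

/-- The value of a finite point of the Riemann sphere (and `0` at `∞`). -/
noncomputable def fin : OnePoint ℂ → ℂ
  | OnePoint.some t => t
  | ∞ => 0

/-- `x(ω)` as a meromorphic function (with value `0` at its poles). -/
noncomputable def x (S : Finset (ℤ × ℤ)) (z : ℝ) (ω : ℂ) : ℂ := fin (xS S z ω)

/-- `y(ω)` as a meromorphic function (with value `0` at its poles). -/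
noncomputable def y (S : Finset (ℤ × ℤ)) (z : ℝ) (ω : ℂ) : ℂ := fin (yS S z ω)

/-- The point `ω_{x₂} = (ω₁ + ω₂) / 2`, at which `x = x₂`. -/
noncomputable def ωx₂ (S : Finset (ℤ × ℤ)) (z : ℝ) : ℂ := (ω₁ S z + ω₂ S z) / 2

/-- The point `ω_{y₂} = (ω₁ + ω₂ + ω₃) / 2`, at which `y = y₂`. -/
noncomputable def ωy₂ (S : Finset (ℤ × ℤ)) (z : ℝ) : ℂ := (ω₁ S z + ω₂ S z + ω₃ S z) / 2

/-- The lifted Galois automorphism `ξ`, the involution that fixes `ω_{x₂}`. -/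
noncomputable def ξ (S : Finset (ℤ × ℤ)) (z : ℝ) (ω : ℂ) : ℂ := -ω + 2 * ωx₂ S z

/-- The lifted Galois automorphism `η`, the involution that fixes `ω_{y₂}`. -/
noncomputable def η (S : Finset (ℤ × ℤ)) (z : ℝ) (ω : ℂ) : ℂ := -ω + 2 * ωy₂ S z

/-- The part of `{|x(ω)| < 1}` in the strip `ω₁ ℝ + (0, ω₂)`; recall that `ω₁` is purely imaginary
and `ω₂` is real. -/
def Δx (S : Finset (ℤ × ℤ)) (z : ℝ) : Set ℂ :=
  {ω | ω.re ∈ Set.Ioo 0 (ω₂ S z) ∧ ∃ t : ℂ, xS S z ω = t ∧ ‖t‖ < 1}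

/-- The part of `{|y(ω)| < 1}` in the strip `ω₁ ℝ + ω₃ / 2 + (0, ω₂)`. -/
def Δy (S : Finset (ℤ × ℤ)) (z : ℝ) : Set ℂ :=
  {ω | ω.re ∈ Set.Ioo (ω₃ S z / 2) (ω₃ S z / 2 + ω₂ S z) ∧ ∃ t : ℂ, yS S z ω = t ∧ ‖t‖ < 1}

end QuarterPlane

open QuarterPlane

/-!
# Continuation of the generating functions of walks in the quarter plane

**The uniformization.** The discriminants `d` and `d̃` of the kernel `K(x, y)`, a biquadratic
polynomial, have the same invariants, hence the same Weierstrass cubic `4 u³ - g₂ u - g₃`, which has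
three real roots `e₃ < e₂ < e₁` (`Branch.IsBranch.cubic_eq`). The integrals for `ω₁` and `ω₂` are
transformed to Legendre normal form, and they are the periods of the cubic (`QuarterPlane.ω₁_eq`,
`QuarterPlane.ω₂_eq`). That the Weierstrass function of the lattice spanned by the two integrals has
the roots `e₁, e₂, e₃` is shown by constructing the Jacobi functions on the complex plane from the
inversion of the real elliptic integrals, and by comparing principal parts
(`RealCubic.weierstrassP_eq`). In the coordinates `u = ℘(ω)` and `v = ℘(ω - ω₃ / 2)` the kernel is a
biquadratic polynomial `F(u, v)` with discriminants `E² (4 u³ - g₂ u - g₃) / 4` and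
`E² (4 v³ - g₂ v - g₃) / 4`. The functions `F`, `E ℘'(ω) ∓ 2 F_v` and `E ℘'(ω - ω₃ / 2) ± 2 F_u` of
`ω` satisfy a homogeneous linear differential system. They vanish at one point, because `ω₃` is
defined by a branch point of the kernel curve, so they vanish everywhere
(`Biquad.uniformization`). Thus `K(x(ω), y(ω)) = 0`, and the two values of `y` that belong to
`x(ω)` are `y(ω)` and `y(ω + ω₃)` (`Biquad.exists_uniformizes`).

**The domains.** On the circle `|x| = 1` the middle coefficient of the kernel dominates, so that
exactly one of the two values of `y` lies in the unit disc. By connectedness of the circle and a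
check at one real point this is the value `y(ω)` if `ω` lies in the right half of the fundamental
strip (`Biquad.IsUniform.inner_of_circle`). Hence the closed strip between the lines of symmetry of
`x` and of `y` is covered by the domains `|x| < 1` and `|y| < 1` (`Biquad.IsUniform.strip`).

**The continuation.** By the functional equation `K Q = K(x, 0) Q(x, 0) + K(0, y) Q(0, y)
- K(0, 0) Q(0, 0) - x y` (`QuarterPlane.functional_equation`), the two definitions of `r_x` agree
where both apply. They give a meromorphic function on the strip, which is extended by reflection in
the line of symmetry of `x` to a strip of width `ω₃`, and from there to the plane by the relation for
`r_x(ω - ω₃)`, with which it is compatible at the boundary by the invariance of `y` under its own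
reflection (`exists_meromorphic_of_strip`). A clopen argument in the unit disc, the range of `x` or
of `y`, shows that the result is the prescribed function on all of `Δx` and `Δy`
(`Branch.eventuallyEq_comp_coord`), and the remaining identities follow from the identity theorem.
-/

open QuarterPlane

/-! ### Elliptic integrals and the Jacobi functions on the real line -/

section

namespace Jacobi

open Real intervalIntegral Set

/-- The incomplete elliptic integral of the first kind `F(φ | m)`. -/
noncomputable def ellF (m φ : ℝ) : ℝ := ∫ θ in (0 : ℝ)..φ, 1 / √(1 - m * sin θ ^ 2)

/-- The complete elliptic integral of the first kind `K(m) = F(π / 2 | m)`. -/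
noncomputable def ellK (m : ℝ) : ℝ := ellF m (π / 2)

section

variable {m : ℝ}

lemma one_sub_mul_sin_sq_pos (h0 : 0 < m) (h1 : m < 1) (θ : ℝ) : 0 < 1 - m * sin θ ^ 2 := by
  nlinarith [sin_sq_le_one θ, sq_nonneg (sin θ)]

lemma continuous_ellF_integrand (h0 : 0 < m) (h1 : m < 1) :
    Continuous fun θ : ℝ => 1 / √(1 - m * sin θ ^ 2) := by
  refine continuous_const.div (by fun_prop) fun θ => ?_
  exact (sqrt_pos.2 (one_sub_mul_sin_sq_pos h0 h1 θ)).ne'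

lemma hasDerivAt_ellF (h0 : 0 < m) (h1 : m < 1) (φ : ℝ) :
    HasDerivAt (ellF m) (1 / √(1 - m * sin φ ^ 2)) φ :=
  (continuous_ellF_integrand h0 h1).integral_hasStrictDerivAt 0 φ |>.hasDerivAt

lemma ellF_zero : ellF m 0 = 0 := by simp [ellF]

lemma strictMono_ellF (h0 : 0 < m) (h1 : m < 1) : StrictMono (ellF m) := by
  refine strictMono_of_deriv_pos fun φ => ?_
  rw [(hasDerivAt_ellF h0 h1 φ).deriv]
  have := sqrt_pos.2 (one_sub_mul_sin_sq_pos h0 h1 φ)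
  positivity

lemma eq_of_hasDerivAt_eq {f g f' : ℝ → ℝ} (hf : ∀ t, HasDerivAt f (f' t) t)
    (hg : ∀ t, HasDerivAt g (f' t) t) {c : ℝ} (hc : f c = g c) (t : ℝ) : f t = g t := by
  have h : ∀ t, HasDerivAt (fun t => f t - g t) 0 t := fun t => by
    simpa using (hf t).fun_sub (hg t)
  have := is_const_of_deriv_eq_zero (fun t => (h t).differentiableAt) (fun t => (h t).deriv) t c
  linarith

lemma ellF_neg (h0 : 0 < m) (h1 : m < 1) (φ : ℝ) : ellF m (-φ) = -ellF m φ := by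
  refine eq_of_hasDerivAt_eq (f := fun φ => ellF m (-φ)) (g := fun φ => -ellF m φ)
    (f' := fun t => -(1 / √(1 - m * sin t ^ 2))) (c := 0)
    (fun t => ?_) (fun t => (hasDerivAt_ellF h0 h1 t).fun_neg) (by simp [ellF_zero]) φ
  simpa [Function.comp_def] using (hasDerivAt_ellF h0 h1 (-t)).scomp t (hasDerivAt_neg t)

lemma ellF_add_pi' (h0 : 0 < m) (h1 : m < 1) (φ : ℝ) :
    ellF m (φ + π) = ellF m φ + ellF m π := by
  refine eq_of_hasDerivAt_eq (f := fun φ => ellF m (φ + π)) (g := fun φ => ellF m φ + ellF m π)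
    (f' := fun t => (1 / √(1 - m * sin t ^ 2))) (c := 0)
    (fun t => ?_) (fun t => (hasDerivAt_ellF h0 h1 t).add_const _) (by simp [ellF_zero]) φ
  simpa using (hasDerivAt_ellF h0 h1 (t + π)).comp_add_const t π

lemma ellF_pi (h0 : 0 < m) (h1 : m < 1) : ellF m π = 2 * ellK m := by
  have h := ellF_add_pi' h0 h1 (-(π / 2))
  rw [ellF_neg h0 h1, show -(π / 2) + π = π / 2 by ring] at h
  unfold ellK
  linarith

lemma ellF_add_pi (h0 : 0 < m) (h1 : m < 1) (φ : ℝ) :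
    ellF m (φ + π) = ellF m φ + 2 * ellK m := by
  rw [ellF_add_pi' h0 h1, ellF_pi h0 h1]

lemma ellK_pos (h0 : 0 < m) (h1 : m < 1) : 0 < ellK m := by
  have := strictMono_ellF h0 h1 (show (0 : ℝ) < π / 2 by positivity)
  rwa [ellF_zero] at this

lemma ellF_add_int_mul_pi (h0 : 0 < m) (h1 : m < 1) (φ : ℝ) (n : ℤ) :
    ellF m (φ + n * π) = ellF m φ + n * (2 * ellK m) := by
  induction n using Int.induction_on with
  | zero => simp
  | succ n ih =>
    push_cast at ih ⊢
    rw [show φ + (n + 1) * π = φ + n * π + π by ring, ellF_add_pi h0 h1, ih]; ring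
  | pred n ih =>
    push_cast at ih ⊢
    have := ellF_add_pi h0 h1 (φ + (-n - 1) * π)
    rw [show φ + (-n - 1) * π + π = φ + -n * π by ring, ih] at this
    linarith

lemma surjective_ellF (h0 : 0 < m) (h1 : m < 1) : Function.Surjective (ellF m) := by
  intro y
  have hK := ellK_pos h0 h1
  have hc : Continuous (ellF m) :=
    continuous_iff_continuousAt.2 fun φ => (hasDerivAt_ellF h0 h1 φ).continuousAt
  obtain ⟨n, hn⟩ := exists_nat_gt (|y| / (2 * ellK m))
  rw [div_lt_iff₀ (by positivity)] at hn
  have ha := ellF_add_int_mul_pi h0 h1 0 n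
  have hb := ellF_add_int_mul_pi h0 h1 0 (-n)
  rw [ellF_zero] at ha hb
  push_cast at ha hb
  have := abs_lt.1 hn
  exact mem_range_of_exists_le_of_exists_ge hc ⟨_, hb.le.trans (by linarith)⟩
    ⟨_, le_trans (by linarith) ha.ge⟩

end

open Classical in
/-- The Jacobi amplitude, the inverse function of `F(· | m)` for `0 < m < 1`. -/
noncomputable def am (m : ℝ) : ℝ → ℝ := Function.invFun (ellF m)

/-- The Jacobi function `sn` on the real line. -/
noncomputable def sn (m s : ℝ) : ℝ := sin (am m s)

/-- The Jacobi function `cn` on the real line. -/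
noncomputable def cn (m s : ℝ) : ℝ := cos (am m s)

/-- The Jacobi function `dn` on the real line. -/
noncomputable def dn (m s : ℝ) : ℝ := √(1 - m * sin (am m s) ^ 2)

section

variable {m : ℝ}

lemma ellF_am (h0 : 0 < m) (h1 : m < 1) (s : ℝ) : ellF m (am m s) = s :=
  Function.rightInverse_invFun (surjective_ellF h0 h1) s

lemma am_ellF (h0 : 0 < m) (h1 : m < 1) (φ : ℝ) : am m (ellF m φ) = φ :=
  Function.leftInverse_invFun (strictMono_ellF h0 h1).injective φ

lemma strictMono_am (h0 : 0 < m) (h1 : m < 1) : StrictMono (am m) := fun s t hst => by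
  by_contra h
  have := (strictMono_ellF h0 h1).monotone (not_lt.1 h)
  rw [ellF_am h0 h1, ellF_am h0 h1] at this
  linarith

lemma continuous_am (h0 : 0 < m) (h1 : m < 1) : Continuous (am m) :=
  (strictMono_am h0 h1).monotone.continuous_of_surjective
    fun φ => ⟨ellF m φ, am_ellF h0 h1 φ⟩

lemma dn_pos (h0 : 0 < m) (h1 : m < 1) (s : ℝ) : 0 < dn m s :=
  sqrt_pos.2 (one_sub_mul_sin_sq_pos h0 h1 _)

lemma hasDerivAt_am (h0 : 0 < m) (h1 : m < 1) (s : ℝ) : HasDerivAt (am m) (dn m s) s := by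
  have hd := dn_pos h0 h1 s
  have h := HasDerivAt.of_local_left_inverse (continuous_am h0 h1).continuousAt
    (hasDerivAt_ellF h0 h1 (am m s)) (by unfold dn at hd; positivity)
    (Eventually.of_forall fun t => ellF_am h0 h1 t)
  simpa [dn] using h

lemma dn_sq (h0 : 0 < m) (h1 : m < 1) (s : ℝ) : dn m s ^ 2 = 1 - m * sn m s ^ 2 :=
  sq_sqrt (one_sub_mul_sin_sq_pos h0 h1 _).le

lemma cn_sq (s : ℝ) : cn m s ^ 2 = 1 - sn m s ^ 2 := by
  unfold cn sn; rw [cos_sq']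

lemma hasDerivAt_sn (h0 : 0 < m) (h1 : m < 1) (s : ℝ) :
    HasDerivAt (sn m) (cn m s * dn m s) s := (hasDerivAt_am h0 h1 s).sin

lemma hasDerivAt_cn (h0 : 0 < m) (h1 : m < 1) (s : ℝ) :
    HasDerivAt (cn m) (-sn m s * dn m s) s := (hasDerivAt_am h0 h1 s).cos

lemma hasDerivAt_dn (h0 : 0 < m) (h1 : m < 1) (s : ℝ) :
    HasDerivAt (dn m) (-m * sn m s * cn m s) s := by
  have hd := dn_pos h0 h1 s
  have h := ((((hasDerivAt_sn h0 h1 s).fun_pow 2).const_mul m).const_sub 1).sqrt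
    (by simpa [sn] using (one_sub_mul_sin_sq_pos h0 h1 (am m s)).ne')
  refine h.congr_deriv ?_
  · symm
    change _ = -(m * (_ * _ ^ 1 * _)) / (2 * dn m s)
    field_simp
    push_cast
    ring

lemma am_add (h0 : 0 < m) (h1 : m < 1) (s : ℝ) (n : ℤ) :
    am m (s + n * (2 * ellK m)) = am m s + n * π := by
  apply (strictMono_ellF h0 h1).injective
  rw [ellF_am h0 h1, ellF_add_int_mul_pi h0 h1, ellF_am h0 h1]

lemma am_zero (h0 : 0 < m) (h1 : m < 1) : am m 0 = 0 := by
  simpa [ellF_zero] using am_ellF h0 h1 0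

lemma am_ellK (h0 : 0 < m) (h1 : m < 1) : am m (ellK m) = π / 2 := am_ellF h0 h1 _

lemma am_neg (h0 : 0 < m) (h1 : m < 1) (s : ℝ) : am m (-s) = -am m s := by
  apply (strictMono_ellF h0 h1).injective
  rw [ellF_am h0 h1, ellF_neg h0 h1, ellF_am h0 h1]

lemma sn_neg (h0 : 0 < m) (h1 : m < 1) (s : ℝ) : sn m (-s) = -sn m s := by
  rw [sn, am_neg h0 h1, sin_neg, sn]

lemma cn_neg (h0 : 0 < m) (h1 : m < 1) (s : ℝ) : cn m (-s) = cn m s := by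
  rw [cn, am_neg h0 h1, cos_neg, cn]

lemma dn_neg (h0 : 0 < m) (h1 : m < 1) (s : ℝ) : dn m (-s) = dn m s := by
  rw [dn, am_neg h0 h1, sin_neg, neg_sq, dn]

lemma sn_add (h0 : 0 < m) (h1 : m < 1) (s : ℝ) : sn m (s + 2 * ellK m) = -sn m s := by
  have := am_add h0 h1 s 1
  simp only [Int.cast_one, one_mul] at this
  rw [sn, this, sin_add_pi, sn]

lemma cn_add (h0 : 0 < m) (h1 : m < 1) (s : ℝ) : cn m (s + 2 * ellK m) = -cn m s := by
  have := am_add h0 h1 s 1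
  simp only [Int.cast_one, one_mul] at this
  rw [cn, this, cos_add_pi, cn]

lemma dn_add (h0 : 0 < m) (h1 : m < 1) (s : ℝ) : dn m (s + 2 * ellK m) = dn m s := by
  have := am_add h0 h1 s 1
  simp only [Int.cast_one, one_mul] at this
  rw [dn, this, sin_add_pi, neg_sq, dn]

lemma sn_eq_zero_iff (h0 : 0 < m) (h1 : m < 1) (s : ℝ) :
    sn m s = 0 ↔ ∃ n : ℤ, n * (2 * ellK m) = s := by
  rw [sn, sin_eq_zero_iff]
  refine exists_congr fun n => ⟨fun h => ?_, fun h => ?_⟩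
  · rw [← ellF_am h0 h1 s, ← h]
    have := ellF_add_int_mul_pi h0 h1 0 n
    rw [zero_add, ellF_zero, zero_add] at this
    exact this.symm
  · have := am_add h0 h1 0 n
    rw [zero_add, am_zero h0 h1, zero_add, h] at this
    exact this.symm

lemma sn_zero (h0 : 0 < m) (h1 : m < 1) : sn m 0 = 0 := by simp [sn, am_zero h0 h1]
lemma cn_zero (h0 : 0 < m) (h1 : m < 1) : cn m 0 = 1 := by simp [cn, am_zero h0 h1]
lemma dn_zero (h0 : 0 < m) (h1 : m < 1) : dn m 0 = 1 := by simp [dn, am_zero h0 h1]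
lemma sn_ellK (h0 : 0 < m) (h1 : m < 1) : sn m (ellK m) = 1 := by simp [sn, am_ellK h0 h1]
lemma cn_ellK (h0 : 0 < m) (h1 : m < 1) : cn m (ellK m) = 0 := by simp [cn, am_ellK h0 h1]

end

end Jacobi

end

/-! ### The Jacobi functions on the complex plane -/

section

namespace Jacobi

open Complex

/-- A real differentiable function of `s + t i` is complex differentiable if its two partial
derivatives satisfy the Cauchy-Riemann equations. -/
lemma hasDerivAt_of_partial {f : ℂ → ℂ} {g : ℝ → ℝ → ℂ} (hfg : ∀ w : ℂ, f w = g w.re w.im)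
    {w a : ℂ} (hf : DifferentiableAt ℝ f w) (h₁ : HasDerivAt (fun s => g s w.im) a w.re)
    (h₂ : HasDerivAt (fun t => g w.re t) (I * a) w.im) : HasDerivAt f a w := by
  have hF := hf.hasFDerivAt
  set L := fderiv ℝ f w
  have e₁ : L 1 = a := by
    have hl : HasDerivAt (fun s : ℝ => (s : ℂ) + w.im * I) 1 w.re :=
      (hasDerivAt_id w.re).ofReal_comp.add_const _
    have hF' : HasFDerivAt f L ((w.re : ℂ) + w.im * I) := by rwa [re_add_im]
    have h := hF'.comp_hasDerivAt w.re hl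
    refine h.unique (h₁.congr_of_eventuallyEq (Eventually.of_forall fun s => ?_))
    simp [hfg]
  have e₂ : L I = I * a := by
    have hl : HasDerivAt (fun t : ℝ => (w.re : ℂ) + t * I) I w.im := by
      simpa using ((hasDerivAt_id w.im).ofReal_comp.mul_const I).const_add (w.re : ℂ)
    have hF' : HasFDerivAt f L ((w.re : ℂ) + w.im * I) := by rwa [re_add_im]
    have h := hF'.comp_hasDerivAt w.im hl
    refine h.unique (h₂.congr_of_eventuallyEq (Eventually.of_forall fun s => ?_))
    simp [hfg]
  refine hasFDerivAt_of_restrictScalars ℝ hF ?_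
  ext v
  have : L v = L ((v.re : ℝ) • (1 : ℂ) + (v.im : ℝ) • I) := by simp
  rw [this, map_add, _root_.map_smul, _root_.map_smul, e₁, e₂]
  apply Complex.ext <;> simp [add_comm, sub_eq_add_neg]

variable {m : ℝ}

/-- The common denominator of `ns`, `cs` and `ds` at `s + t i`, which vanishes only at their
poles. -/
noncomputable def den (m : ℝ) (s t : ℝ) : ℝ :=
  sn m s ^ 2 * cn (1 - m) t ^ 2 + sn (1 - m) t ^ 2

/-- The Jacobi function `ns = 1 / sn` at `s + t i`, by the addition theorem and Jacobi's imaginary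
transformation. -/
noncomputable def ns₂ (m : ℝ) (s t : ℝ) : ℂ :=
  (sn m s * dn (1 - m) t - I * (cn m s * dn m s * sn (1 - m) t * cn (1 - m) t)) / den m s t

/-- The Jacobi function `cs = cn / sn` at `s + t i`. -/
noncomputable def cs₂ (m : ℝ) (s t : ℝ) : ℂ :=
  (sn m s * cn m s * cn (1 - m) t * dn (1 - m) t - I * (dn m s * sn (1 - m) t)) / den m s t

/-- The Jacobi function `ds = dn / sn` at `s + t i`. -/
noncomputable def ds₂ (m : ℝ) (s t : ℝ) : ℂ :=
  (sn m s * dn m s * cn (1 - m) t - I * (cn m s * sn (1 - m) t * dn (1 - m) t)) / den m s t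

/-- The Jacobi function `ns` of a complex variable. -/
noncomputable def ns (m : ℝ) (w : ℂ) : ℂ := ns₂ m w.re w.im
/-- The Jacobi function `cs` of a complex variable. -/
noncomputable def cs (m : ℝ) (w : ℂ) : ℂ := cs₂ m w.re w.im
/-- The Jacobi function `ds` of a complex variable. -/
noncomputable def ds (m : ℝ) (w : ℂ) : ℂ := ds₂ m w.re w.im

lemma den_eq_zero_iff (s t : ℝ) : den m s t = 0 ↔ sn m s = 0 ∧ sn (1 - m) t = 0 := by
  constructor
  · intro h
    have h1 := mul_nonneg (sq_nonneg (sn m s)) (sq_nonneg (cn (1 - m) t))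
    have h2 := sq_nonneg (sn (1 - m) t)
    unfold den at h
    have h3 : sn (1 - m) t = 0 := by
      rw [← sq_eq_zero_iff]; linarith
    have h4 : cn (1 - m) t ^ 2 = 1 := by rw [cn_sq, h3]; ring
    rw [h3, h4] at h
    exact ⟨by rw [← sq_eq_zero_iff]; linarith, h3⟩
  · rintro ⟨h, h'⟩
    simp [den, h, h']

section

variable (h0 : 0 < m) (h1 : m < 1)
include h0 h1

lemma cs₂_sq {s t : ℝ} (h : den m s t ≠ 0) : cs₂ m s t ^ 2 = ns₂ m s t ^ 2 - 1 := by
  have h0' : 0 < 1 - m := by linarith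
  have h1' : 1 - m < 1 := by linarith
  have hS : (cn m s : ℂ) ^ 2 = 1 - sn m s ^ 2 := by exact_mod_cast cn_sq (m := m) s
  have hD : (dn m s : ℂ) ^ 2 = 1 - m * sn m s ^ 2 := by exact_mod_cast dn_sq h0 h1 s
  have hc : (cn (1 - m) t : ℂ) ^ 2 = 1 - sn (1 - m) t ^ 2 := by
    exact_mod_cast cn_sq (m := 1 - m) t
  have hd : (dn (1 - m) t : ℂ) ^ 2 = 1 - (1 - m) * sn (1 - m) t ^ 2 := by
    exact_mod_cast dn_sq h0' h1' t
  have hI := I_sq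
  have hM : (den m s t : ℂ) = sn m s ^ 2 * cn (1 - m) t ^ 2 + sn (1 - m) t ^ 2 := by
    simp [den]
  have hM0 : (den m s t : ℂ) ≠ 0 := by exact_mod_cast h
  rw [cs₂, ns₂, div_pow, div_pow, div_eq_iff (pow_ne_zero 2 hM0), sub_mul,
    div_mul_cancel₀ _ (pow_ne_zero 2 hM0), hM]
  generalize (sn m s : ℂ) = S at *
  generalize (cn m s : ℂ) = C at *
  generalize (dn m s : ℂ) = D at *
  generalize (sn (1 - m) t : ℂ) = s at *
  generalize (cn (1 - m) t : ℂ) = c at *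
  generalize (dn (1 - m) t : ℂ) = d at *
  grind

lemma ds₂_sq {s t : ℝ} (h : den m s t ≠ 0) : ds₂ m s t ^ 2 = ns₂ m s t ^ 2 - m := by
  have h0' : 0 < 1 - m := by linarith
  have h1' : 1 - m < 1 := by linarith
  have hS : (cn m s : ℂ) ^ 2 = 1 - sn m s ^ 2 := by exact_mod_cast cn_sq (m := m) s
  have hD : (dn m s : ℂ) ^ 2 = 1 - m * sn m s ^ 2 := by exact_mod_cast dn_sq h0 h1 s
  have hc : (cn (1 - m) t : ℂ) ^ 2 = 1 - sn (1 - m) t ^ 2 := by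
    exact_mod_cast cn_sq (m := 1 - m) t
  have hd : (dn (1 - m) t : ℂ) ^ 2 = 1 - (1 - m) * sn (1 - m) t ^ 2 := by
    exact_mod_cast dn_sq h0' h1' t
  have hI := I_sq
  have hM : (den m s t : ℂ) = sn m s ^ 2 * cn (1 - m) t ^ 2 + sn (1 - m) t ^ 2 := by
    simp [den]
  have hM0 : (den m s t : ℂ) ≠ 0 := by exact_mod_cast h
  rw [ds₂, ns₂, div_pow, div_pow, div_eq_iff (pow_ne_zero 2 hM0), sub_mul,
    div_mul_cancel₀ _ (pow_ne_zero 2 hM0), hM]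
  generalize (sn m s : ℂ) = S at *
  generalize (cn m s : ℂ) = C at *
  generalize (dn m s : ℂ) = D at *
  generalize (sn (1 - m) t : ℂ) = s at *
  generalize (cn (1 - m) t : ℂ) = c at *
  generalize (dn (1 - m) t : ℂ) = d at *
  grind

lemma hasDerivAt_ns {w : ℂ} (h : den m w.re w.im ≠ 0) :
    HasDerivAt (ns m) (-(cs m w * ds m w)) w := by
  have h0' : 0 < 1 - m := by linarith
  have h1' : 1 - m < 1 := by linarith
  have hS : (cn m w.re : ℂ) ^ 2 = 1 - sn m w.re ^ 2 := by exact_mod_cast cn_sq (m := m) _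
  have hD : (dn m w.re : ℂ) ^ 2 = 1 - m * sn m w.re ^ 2 := by exact_mod_cast dn_sq h0 h1 _
  have hc : (cn (1 - m) w.im : ℂ) ^ 2 = 1 - sn (1 - m) w.im ^ 2 := by
    exact_mod_cast cn_sq (m := 1 - m) _
  have hd : (dn (1 - m) w.im : ℂ) ^ 2 = 1 - (1 - m) * sn (1 - m) w.im ^ 2 := by
    exact_mod_cast dn_sq h0' h1' _
  have hI := I_sq
  have hM : (den m w.re w.im : ℂ) =
      sn m w.re ^ 2 * cn (1 - m) w.im ^ 2 + sn (1 - m) w.im ^ 2 := by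
    simp [den]
  have hM0 : (den m w.re w.im : ℂ) ≠ 0 := by exact_mod_cast h
  refine hasDerivAt_of_partial (g := ns₂ m) (fun _ => rfl) ?_ ?_ ?_
  · have a1 : DifferentiableAt ℝ (fun w : ℂ => sn m w.re) w :=
      (hasDerivAt_sn h0 h1 w.re).differentiableAt.comp w reCLM.differentiableAt
    have a2 : DifferentiableAt ℝ (fun w : ℂ => cn m w.re) w :=
      (hasDerivAt_cn h0 h1 w.re).differentiableAt.comp w reCLM.differentiableAt
    have a3 : DifferentiableAt ℝ (fun w : ℂ => dn m w.re) w :=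
      (hasDerivAt_dn h0 h1 w.re).differentiableAt.comp w reCLM.differentiableAt
    have b1 : DifferentiableAt ℝ (fun w : ℂ => sn (1 - m) w.im) w :=
      (hasDerivAt_sn h0' h1' w.im).differentiableAt.comp w imCLM.differentiableAt
    have b2 : DifferentiableAt ℝ (fun w : ℂ => cn (1 - m) w.im) w :=
      (hasDerivAt_cn h0' h1' w.im).differentiableAt.comp w imCLM.differentiableAt
    have b3 : DifferentiableAt ℝ (fun w : ℂ => dn (1 - m) w.im) w :=
      (hasDerivAt_dn h0' h1' w.im).differentiableAt.comp w imCLM.differentiableAt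
    have up : ∀ {f : ℂ → ℝ}, DifferentiableAt ℝ f w →
        DifferentiableAt ℝ (fun w => (f w : ℂ)) w := fun hf =>
      ofRealCLM.differentiableAt.comp w hf
    have a1 := up a1
    have a2 := up a2
    have a3 := up a3
    have b1 := up b1
    have b2 := up b2
    have b3 := up b3
    simp only [ns₂, div_eq_mul_inv, den, ofReal_add, ofReal_mul, ofReal_pow]
    rw [hM] at hM0
    exact DifferentiableAt.mul (by fun_prop) (DifferentiableAt.fun_inv (by fun_prop) hM0)
  · have a1 := (hasDerivAt_sn h0 h1 w.re).ofReal_comp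
    have a2 := (hasDerivAt_cn h0 h1 w.re).ofReal_comp
    have a3 := (hasDerivAt_dn h0 h1 w.re).ofReal_comp
    have hden : HasDerivAt (fun s => (den m s w.im : ℂ))
        (2 * sn m w.re * (cn m w.re * dn m w.re) * cn (1 - m) w.im ^ 2) w.re := by
      have := ((a1.fun_pow 2).mul_const ((cn (1 - m) w.im : ℂ) ^ 2)).add_const
        ((sn (1 - m) w.im : ℂ) ^ 2)
      simp only [den, ofReal_add, ofReal_mul, ofReal_pow]
      refine this.congr_deriv ?_
      push_cast; ring
    have := ((a1.mul_const (dn (1 - m) w.im : ℂ)).fun_sub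
      ((((a2.fun_mul a3).mul_const (sn (1 - m) w.im : ℂ)).mul_const
        (cn (1 - m) w.im : ℂ)).const_mul I)).fun_div hden hM0
    refine this.congr_deriv ?_
    simp only [cs, ds, cs₂, ds₂]
    rw [div_mul_div_comm, ← neg_div, ← sq, div_left_inj' (pow_ne_zero 2 hM0), hM]
    push_cast
    generalize (sn m w.re : ℂ) = S at *
    generalize (cn m w.re : ℂ) = C at *
    generalize (dn m w.re : ℂ) = D at *
    generalize (sn (1 - m) w.im : ℂ) = s at *
    generalize (cn (1 - m) w.im : ℂ) = c at *
    generalize (dn (1 - m) w.im : ℂ) = d at *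
    clear this hden a1 a2 a3
    grind
  · have a1 := (hasDerivAt_sn h0' h1' w.im).ofReal_comp
    have a2 := (hasDerivAt_cn h0' h1' w.im).ofReal_comp
    have a3 := (hasDerivAt_dn h0' h1' w.im).ofReal_comp
    have hden : HasDerivAt (fun s => (den m w.re s : ℂ))
        (sn m w.re ^ 2 * (2 * cn (1 - m) w.im * (-sn (1 - m) w.im * dn (1 - m) w.im)) +
          2 * sn (1 - m) w.im * (cn (1 - m) w.im * dn (1 - m) w.im)) w.im := by
      have := ((a2.fun_pow 2).const_mul ((sn m w.re : ℂ) ^ 2)).fun_add (a1.fun_pow 2)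
      simp only [den, ofReal_add, ofReal_mul, ofReal_pow]
      refine this.congr_deriv ?_
      push_cast; ring
    have := ((a3.const_mul (sn m w.re : ℂ)).fun_sub
      (((a1.const_mul (cn m w.re * dn m w.re : ℂ)).fun_mul a2).const_mul I)).fun_div hden hM0
    refine this.congr_deriv ?_
    simp only [cs, ds, cs₂, ds₂]
    rw [div_mul_div_comm, ← neg_div, ← sq, ← mul_div_assoc,
      div_left_inj' (pow_ne_zero 2 hM0), hM]
    push_cast
    generalize (sn m w.re : ℂ) = S at *
    generalize (cn m w.re : ℂ) = C at *
    generalize (dn m w.re : ℂ) = D at *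
    generalize (sn (1 - m) w.im : ℂ) = s at *
    generalize (cn (1 - m) w.im : ℂ) = c at *
    generalize (dn (1 - m) w.im : ℂ) = d at *
    clear this hden a1 a2 a3
    grind

end

end Jacobi

end

/-! ### Poles and periods of the Jacobi functions -/

section

namespace Jacobi

open Complex Topology

variable {m : ℝ}

section

variable (h0 : 0 < m) (h1 : m < 1)
include h0 h1

lemma ns_neg (w : ℂ) : ns m (-w) = -ns m w := by
  have h0' : 0 < 1 - m := by linarith
  have h1' : 1 - m < 1 := by linarith
  simp only [ns, ns₂, den, neg_re, neg_im, sn_neg h0 h1, cn_neg h0 h1, dn_neg h0 h1,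
    sn_neg h0' h1', cn_neg h0' h1', dn_neg h0' h1', neg_sq]
  push_cast
  ring

lemma ns_sq_add_re (w : ℂ) : ns m (w + (2 * ellK m : ℝ)) ^ 2 = ns m w ^ 2 := by
  rw [← neg_sq (ns m w)]
  congr 1
  simp only [ns, ns₂, den, add_re, add_im, ofReal_re, ofReal_im, add_zero,
    sn_add h0 h1, cn_add h0 h1, dn_add h0 h1, neg_sq]
  push_cast
  ring

lemma ns_sq_add_im (w : ℂ) : ns m (w + I * (2 * ellK (1 - m) : ℝ)) ^ 2 = ns m w ^ 2 := by
  have h0' : 0 < 1 - m := by linarith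
  have h1' : 1 - m < 1 := by linarith
  congr 1
  simp only [ns, ns₂, den, add_re, add_im, mul_re, mul_im, I_re, I_im, ofReal_re, ofReal_im,
    mul_zero, zero_mul, sub_zero, one_mul, zero_add, add_zero,
    sn_add h0' h1', cn_add h0' h1', dn_add h0' h1', neg_sq]
  push_cast
  ring

lemma inv_ns_eq {w : ℂ} (h : (1 - dn m w.re ^ 2 * sn (1 - m) w.im ^ 2 : ℝ) ≠ 0) :
    (ns m w)⁻¹ = (sn m w.re * dn (1 - m) w.im +
      I * (cn m w.re * dn m w.re * sn (1 - m) w.im * cn (1 - m) w.im)) /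
      ((1 - dn m w.re ^ 2 * sn (1 - m) w.im ^ 2 : ℝ) : ℂ) := by
  have h0' : 0 < 1 - m := by linarith
  have h1' : 1 - m < 1 := by linarith
  by_cases hden : den m w.re w.im = 0
  · have := (den_eq_zero_iff _ _).1 hden
    simp [ns, ns₂, hden, this.1, this.2]
  have hS : (cn m w.re : ℂ) ^ 2 = 1 - sn m w.re ^ 2 := by exact_mod_cast cn_sq (m := m) _
  have hD : (dn m w.re : ℂ) ^ 2 = 1 - m * sn m w.re ^ 2 := by exact_mod_cast dn_sq h0 h1 _
  have hc : (cn (1 - m) w.im : ℂ) ^ 2 = 1 - sn (1 - m) w.im ^ 2 := by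
    exact_mod_cast cn_sq (m := 1 - m) _
  have hd : (dn (1 - m) w.im : ℂ) ^ 2 = 1 - (1 - m) * sn (1 - m) w.im ^ 2 := by
    exact_mod_cast dn_sq h0' h1' _
  have hI := I_sq
  have hM : (den m w.re w.im : ℂ) =
      sn m w.re ^ 2 * cn (1 - m) w.im ^ 2 + sn (1 - m) w.im ^ 2 := by
    simp [den]
  have hM0 : (den m w.re w.im : ℂ) ≠ 0 := by exact_mod_cast hden
  have hN0 : ((1 - dn m w.re ^ 2 * sn (1 - m) w.im ^ 2 : ℝ) : ℂ) ≠ 0 := by exact_mod_cast h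
  rw [inv_eq_iff_eq_inv, inv_div, ns, ns₂]
  have key : (sn m w.re * dn (1 - m) w.im -
      I * (cn m w.re * dn m w.re * sn (1 - m) w.im * cn (1 - m) w.im)) *
      (sn m w.re * dn (1 - m) w.im +
      I * (cn m w.re * dn m w.re * sn (1 - m) w.im * cn (1 - m) w.im)) =
      ((1 - dn m w.re ^ 2 * sn (1 - m) w.im ^ 2 : ℝ) : ℂ) * den m w.re w.im := by
    rw [hM]
    push_cast
    generalize (sn m w.re : ℂ) = S at *
    generalize (cn m w.re : ℂ) = C at *
    generalize (dn m w.re : ℂ) = D at *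
    generalize (sn (1 - m) w.im : ℂ) = s at *
    generalize (cn (1 - m) w.im : ℂ) = c at *
    generalize (dn (1 - m) w.im : ℂ) = d at *
    grind
  have hne := mul_ne_zero hN0 hM0
  rw [← key] at hne
  rw [div_eq_div_iff hM0 (right_ne_zero_of_mul hne), key]

lemma continuous_sn : Continuous (sn m) :=
  continuous_iff_continuousAt.2 fun s => (hasDerivAt_sn h0 h1 s).continuousAt

lemma continuous_cn : Continuous (cn m) :=
  continuous_iff_continuousAt.2 fun s => (hasDerivAt_cn h0 h1 s).continuousAt

lemma continuous_dn : Continuous (dn m) :=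
  continuous_iff_continuousAt.2 fun s => (hasDerivAt_dn h0 h1 s).continuousAt

lemma continuousAt_inv_ns : ContinuousAt (fun w => (ns m w)⁻¹) 0 := by
  have h0' : 0 < 1 - m := by linarith
  have h1' : 1 - m < 1 := by linarith
  have c1 := continuous_sn h0 h1
  have c2 := continuous_cn h0 h1
  have c3 := continuous_dn h0 h1
  have d1 := continuous_sn h0' h1'
  have d2 := continuous_cn h0' h1'
  have d3 := continuous_dn h0' h1'
  have hN : Continuous fun w : ℂ => (1 - dn m w.re ^ 2 * sn (1 - m) w.im ^ 2 : ℝ) := by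
    fun_prop
  have hN0 : (1 - dn m (0 : ℂ).re ^ 2 * sn (1 - m) (0 : ℂ).im ^ 2 : ℝ) ≠ 0 := by
    simp [sn_zero h0' h1']
  have hev := hN.continuousAt.eventually_ne hN0
  have : ContinuousAt (fun w : ℂ => (sn m w.re * dn (1 - m) w.im +
      I * (cn m w.re * dn m w.re * sn (1 - m) w.im * cn (1 - m) w.im)) /
      ((1 - dn m w.re ^ 2 * sn (1 - m) w.im ^ 2 : ℝ) : ℂ)) 0 := by
    refine ContinuousAt.div (by fun_prop) (by fun_prop) (by exact_mod_cast hN0)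
  exact this.congr (hev.mono fun w hw => (inv_ns_eq h0 h1 hw).symm)

lemma ns_ofReal (s : ℝ) : ns m s = ((sn m s)⁻¹ : ℝ) := by
  have h0' : 0 < 1 - m := by linarith
  have h1' : 1 - m < 1 := by linarith
  by_cases h : sn m s = 0
  · simp [ns, ns₂, h, sn_zero h0' h1']
  · have : (sn m s : ℂ) ≠ 0 := by exact_mod_cast h
    simp [ns, ns₂, den, sn_zero h0' h1', dn_zero h0' h1', cn_zero h0' h1']
    field_simp

lemma eventually_den_ne_zero : ∀ᶠ w in 𝓝[≠] (0 : ℂ), den m w.re w.im ≠ 0 := by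
  have h0' : 0 < 1 - m := by linarith
  have h1' : 1 - m < 1 := by linarith
  have e : ∀ {m : ℝ}, 0 < m → m < 1 → ∀ᶠ s in 𝓝[≠] (0 : ℝ), sn m s ≠ 0 := fun h0 h1 => by
    have := (hasDerivAt_sn h0 h1 0).eventually_ne (c := 0)
      (by simp [cn_zero h0 h1, dn_zero h0 h1])
    simpa using this
  have e1 := eventually_nhdsWithin_iff.1 (e h0 h1)
  have e2 := eventually_nhdsWithin_iff.1 (e h0' h1')
  rw [eventually_nhdsWithin_iff]
  have t1 : Tendsto Complex.re (𝓝 0) (𝓝 0) := by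
    simpa using continuous_re.tendsto (0 : ℂ)
  have t2 : Tendsto Complex.im (𝓝 0) (𝓝 0) := by
    simpa using continuous_im.tendsto (0 : ℂ)
  filter_upwards [t1.eventually e1, t2.eventually e2] with w hw1 hw2 hw hd
  rw [den_eq_zero_iff] at hd
  refine hw (Complex.ext ?_ ?_)
  · by_contra h; exact hw1 h hd.1
  · by_contra h; exact hw2 h hd.2

lemma ns_ne_zero_or (w : ℂ) (h : den m w.re w.im ≠ 0) (hw : ns m w = 0) :
    (1 - dn m w.re ^ 2 * sn (1 - m) w.im ^ 2 : ℝ) = 0 := by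
  by_contra hN
  have := inv_ns_eq h0 h1 hN
  rw [hw, inv_zero, eq_comm, div_eq_zero_iff] at this
  have hN0 : ((1 - dn m w.re ^ 2 * sn (1 - m) w.im ^ 2 : ℝ) : ℂ) ≠ 0 := by exact_mod_cast hN
  have h0' : 0 < 1 - m := by linarith
  have h1' : 1 - m < 1 := by linarith
  have h2 := this.resolve_right hN0
  have hre := congrArg Complex.re h2
  have him := congrArg Complex.im h2
  simp [← ofReal_mul] at hre him
  have hS : sn m w.re = 0 := hre.resolve_right (dn_pos h0' h1' _).ne'
  have hC : cn m w.re ≠ 0 := fun hc => by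
    have := cn_sq (m := m) w.re
    rw [hS, hc] at this; norm_num at this
  have hD : dn m w.re = 1 := by
    have := dn_sq h0 h1 w.re
    rw [hS] at this
    have hp := dn_pos h0 h1 w.re
    nlinarith
  rw [hD] at hN
  rcases him with (him | him) | him
  · rcases him with him | him
    · exact hC him
    · rw [hD] at him; norm_num at him
  · exact h ((den_eq_zero_iff _ _).2 ⟨hS, him⟩)
  · have := cn_sq (m := 1 - m) w.im
    rw [him] at this
    apply hN
    linarith

/-- Near the origin `ns² - 1 / w²` extends to an analytic function. -/
lemma exists_analyticAt_ns_sq : ∃ A : ℂ → ℂ, AnalyticAt ℂ A 0 ∧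
    ∀ᶠ w in 𝓝[≠] (0 : ℂ), ns m w ^ 2 = 1 / w ^ 2 + A w := by
  set h : ℂ → ℂ := fun w => (ns m w)⁻¹ with hh
  have hns0 : ns m 0 = 0 := by
    have := ns_ofReal h0 h1 0
    simpa [sn_zero h0 h1] using this
  have hne : ∀ᶠ w in 𝓝[≠] (0 : ℂ), ns m w ≠ 0 := by
    have h0' : 0 < 1 - m := by linarith
    have h1' : 1 - m < 1 := by linarith
    have c3 := continuous_dn h0 h1
    have d1 := continuous_sn h0' h1'
    have hN : Continuous fun w : ℂ => (1 - dn m w.re ^ 2 * sn (1 - m) w.im ^ 2 : ℝ) := by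
      fun_prop
    have hN0 : (1 - dn m (0 : ℂ).re ^ 2 * sn (1 - m) (0 : ℂ).im ^ 2 : ℝ) ≠ 0 := by
      simp [sn_zero h0' h1']
    filter_upwards [eventually_den_ne_zero h0 h1,
      (hN.continuousAt.eventually_ne hN0).filter_mono nhdsWithin_le_nhds] with w hw hw' hz
    exact hw' (ns_ne_zero_or h0 h1 w hw hz)
  have han : AnalyticAt ℂ h 0 := by
    refine Complex.analyticAt_of_differentiable_on_punctured_nhds_of_continuousAt ?_
      (continuousAt_inv_ns h0 h1)
    filter_upwards [eventually_den_ne_zero h0 h1, hne] with w hw hw'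
    exact (hasDerivAt_ns h0 h1 hw).differentiableAt.inv hw'
  have hh0 : h 0 = 0 := by simp [hh, hns0]
  have hder : deriv h 0 = 1 := by
    have d1 := han.differentiableAt.hasDerivAt
    have d2 : HasDerivAt (fun s : ℝ => h s) (deriv h 0) 0 := by
      simpa using HasDerivAt.comp_ofReal (z := 0) (by simpa using d1)
    have d3 : HasDerivAt (fun s : ℝ => ((sn m s : ℝ) : ℂ)) ((cn m 0 * dn m 0 : ℝ) : ℂ) 0 :=
      (hasDerivAt_sn h0 h1 0).ofReal_comp
    rw [cn_zero h0 h1, dn_zero h0 h1] at d3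
    have : (fun s : ℝ => h s) = fun s : ℝ => ((sn m s : ℝ) : ℂ) := by
      funext s; simp [hh, ns_ofReal h0 h1]
    rw [this] at d2
    simpa using d2.unique d3
  obtain ⟨E, hE, hEh⟩ := (natCast_le_analyticOrderAt han (n := 1)).1 (by
    rw [Nat.cast_one, Order.one_le_iff_ne_zero]
    exact (analyticOrderAt_ne_zero).2 ⟨han, hh0⟩)
  simp only [sub_zero, pow_one, smul_eq_mul] at hEh
  have hE0 : E 0 = 1 := by
    have : HasDerivAt (fun w => w * E w) (E 0) 0 := by
      simpa using (hasDerivAt_id (0 : ℂ)).fun_mul hE.differentiableAt.hasDerivAt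
    rw [← hder, (this.congr_of_eventuallyEq hEh).deriv]
  have hneg : Tendsto (fun w : ℂ => -w) (𝓝 0) (𝓝 0) := by simpa using continuous_neg.tendsto (0 : ℂ)
  have hEneg : ∀ᶠ w in 𝓝 (0 : ℂ), E (-w) = E w := by
    filter_upwards [hEh, hneg.eventually hEh] with w hw hw'
    by_cases hw0 : w = 0
    · simp [hw0]
    · have : h (-w) = -h w := by simp [hh, ns_neg h0 h1, inv_neg]
      rw [this, hw] at hw'
      exact mul_left_cancel₀ hw0 (by linear_combination hw')
  set A : ℂ → ℂ := fun w => (E w)⁻¹ ^ 2 - 1 with hA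
  have hAan : AnalyticAt ℂ A 0 := by
    have := hE.fun_inv (by simp [hE0])
    fun_prop
  have hA1 : deriv A 0 = 0 := by
    have : (fun w => A (-w)) =ᶠ[𝓝 0] A := by
      filter_upwards [hEneg] with w hw
      simp [hA, hw]
    have h1 := this.deriv_eq
    rw [deriv_comp_neg, neg_zero] at h1
    exact self_eq_neg.1 h1.symm
  obtain ⟨B, hB, hBA⟩ := (natCast_le_analyticOrderAt hAan (n := 2)).1 (by
    rw [natCast_le_analyticOrderAt_iff_iteratedDeriv_eq_zero hAan]
    intro i hi
    interval_cases i
    · simp [hA, hE0]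
    · simpa using hA1)
  refine ⟨B, hB, ?_⟩
  have hEne : ∀ᶠ w in 𝓝 (0 : ℂ), E w ≠ 0 := hE.continuousAt.eventually_ne (by simp [hE0])
  filter_upwards [hEh.filter_mono nhdsWithin_le_nhds, hBA.filter_mono nhdsWithin_le_nhds,
    hEne.filter_mono nhdsWithin_le_nhds, self_mem_nhdsWithin] with w hw1 hw2 hw3 hw0
  have hw0 : w ≠ 0 := hw0
  have e1 : ns m w = (w * E w)⁻¹ := by rw [← hw1]; simp [hh]
  simp only [hA, sub_zero, smul_eq_mul] at hw2
  have e2 : (E w)⁻¹ ^ 2 = 1 + w ^ 2 * B w := by linear_combination hw2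
  rw [e1, mul_inv, mul_pow, e2]
  field_simp

end

end Jacobi

end

/-! ### Rectangular lattices and their Weierstrass functions -/

section

open Complex Topology Jacobi

/-- Three real numbers `e₃ < e₂ < e₁` with sum zero: the roots of a Weierstrass cubic
`4 u³ - g₂ u - g₃` with three real roots. -/
structure RealCubic where
  e₁ : ℝ
  e₂ : ℝ
  e₃ : ℝ
  lt₃₂ : e₃ < e₂
  lt₂₁ : e₂ < e₁
  sum_eq : e₁ + e₂ + e₃ = 0

namespace RealCubic

variable (R : RealCubic)

/-- The scaling factor `√(e₁ - e₃)` between the Weierstrass and the Jacobi normal form. -/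
noncomputable def kap : ℝ := √(R.e₁ - R.e₃)

/-- The parameter `k²` of the associated Jacobi functions. -/
noncomputable def m : ℝ := (R.e₂ - R.e₃) / (R.e₁ - R.e₃)

/-- The imaginary part of the imaginary period. -/
noncomputable def per₁ : ℝ := 2 * ellK (1 - R.m) / R.kap

/-- The real period. -/
noncomputable def per₂ : ℝ := 2 * ellK R.m / R.kap

lemma sub_pos₁₃ : 0 < R.e₁ - R.e₃ := by linarith [R.lt₃₂, R.lt₂₁]
lemma kap_pos : 0 < R.kap := Real.sqrt_pos.2 R.sub_pos₁₃
lemma kap_sq : R.kap ^ 2 = R.e₁ - R.e₃ := Real.sq_sqrt R.sub_pos₁₃.le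
lemma m_pos : 0 < R.m := div_pos (by linarith [R.lt₃₂]) R.sub_pos₁₃
lemma m_lt_one : R.m < 1 := (div_lt_one R.sub_pos₁₃).2 (by linarith [R.lt₂₁])
lemma m'_pos : 0 < 1 - R.m := by linarith [R.m_lt_one]
lemma m'_lt_one : 1 - R.m < 1 := by linarith [R.m_pos]
lemma per₁_pos : 0 < R.per₁ := by
  have := ellK_pos R.m'_pos R.m'_lt_one
  have := R.kap_pos
  unfold per₁; positivity
lemma per₂_pos : 0 < R.per₂ := by
  have := ellK_pos R.m_pos R.m_lt_one
  have := R.kap_pos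
  unfold per₂; positivity

lemma kap_sq_mul_m : R.kap ^ 2 * R.m = R.e₂ - R.e₃ := by
  rw [kap_sq, m, mul_div_cancel₀]
  exact R.sub_pos₁₃.ne'

lemma linearIndependent_I_mul {a b : ℝ} (ha : 0 < a) (hb : 0 < b) :
    LinearIndependent ℝ ![I * (a : ℂ), (b : ℂ)] := by
  rw [LinearIndependent.pair_iff]
  intro s t hst
  have h1 := congrArg Complex.re hst
  have h2 := congrArg Complex.im hst
  simp at h1 h2
  exact ⟨h2.resolve_right ha.ne', h1.resolve_right hb.ne'⟩

/-- The rectangular period lattice of the cubic. -/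
noncomputable def L : PeriodPair :=
  PeriodPair.mk (I * (R.per₁ : ℂ)) (R.per₂ : ℂ) (linearIndependent_I_mul R.per₁_pos R.per₂_pos)

lemma mem_L {w : ℂ} : w ∈ R.L.lattice ↔
    ∃ a b : ℤ, w.im = a * R.per₁ ∧ w.re = b * R.per₂ := by
  rw [PeriodPair.mem_lattice]
  refine exists_congr fun a => exists_congr fun b => ?_
  rw [Complex.ext_iff]
  simp [L]
  constructor
  · rintro ⟨h, h'⟩; exact ⟨h'.symm, h.symm⟩
  · rintro ⟨h, h'⟩; exact ⟨h'.symm, h.symm⟩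

lemma den_eq_zero_iff_mem {w : ℂ} :
    den R.m (R.kap * w).re (R.kap * w).im = 0 ↔ w ∈ R.L.lattice := by
  have hk := R.kap_pos
  rw [den_eq_zero_iff, sn_eq_zero_iff R.m_pos R.m_lt_one, sn_eq_zero_iff R.m'_pos R.m'_lt_one,
    mem_L, and_comm]
  simp only [per₁, per₂, re_ofReal_mul, im_ofReal_mul]
  constructor
  · rintro ⟨⟨a, ha⟩, ⟨b, hb⟩⟩
    refine ⟨a, b, ?_, ?_⟩
    · field_simp; linarith
    · field_simp; linarith
  · rintro ⟨a, b, ha, hb⟩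
    refine ⟨⟨a, ?_⟩, ⟨b, ?_⟩⟩
    · rw [ha]; field_simp
    · rw [hb]; field_simp

/-- The Weierstrass function of the cubic, expressed through Jacobi functions. -/
noncomputable def P (w : ℂ) : ℂ := R.e₃ + R.kap ^ 2 * ns R.m (R.kap * w) ^ 2

lemma P_periodic₁ : Function.Periodic R.P (I * R.per₁) := fun w => by
  have hk : (R.kap : ℂ) ≠ 0 := by exact_mod_cast R.kap_pos.ne'
  have : (R.kap : ℂ) * (w + I * R.per₁) = R.kap * w + I * (2 * ellK (1 - R.m) : ℝ) := by
    simp only [per₁]; push_cast; field_simp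
  rw [P, this, ns_sq_add_im R.m_pos R.m_lt_one, P]

lemma P_periodic₂ : Function.Periodic R.P R.per₂ := fun w => by
  have hk : (R.kap : ℂ) ≠ 0 := by exact_mod_cast R.kap_pos.ne'
  have : (R.kap : ℂ) * (w + R.per₂) = R.kap * w + (2 * ellK R.m : ℝ) := by
    simp only [per₂]; push_cast; field_simp
  rw [P, this, ns_sq_add_re R.m_pos R.m_lt_one, P]

lemma P_periodic {l : ℂ} (hl : l ∈ R.L.lattice) : Function.Periodic R.P l := by
  obtain ⟨a, b, h⟩ := PeriodPair.mem_lattice.1 hl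
  rw [← h]
  exact (R.P_periodic₁.int_mul a).add_period (R.P_periodic₂.int_mul b)

lemma P_sq {w : ℂ} (hw : w ∉ R.L.lattice) :
    ∃ p', HasDerivAt R.P p' w ∧
      p' ^ 2 = 4 * (R.P w - R.e₁) * (R.P w - R.e₂) * (R.P w - R.e₃) := by
  have hd : den R.m (R.kap * w).re (R.kap * w).im ≠ 0 := fun h => hw (R.den_eq_zero_iff_mem.1 h)
  have h := hasDerivAt_ns R.m_pos R.m_lt_one hd
  have hc := cs₂_sq R.m_pos R.m_lt_one hd
  have hds := ds₂_sq R.m_pos R.m_lt_one hd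
  have hl : HasDerivAt (fun w : ℂ => (R.kap : ℂ) * w) R.kap w := by
    simpa using (hasDerivAt_id w).const_mul (R.kap : ℂ)
  have h2 := (((h.comp w hl).pow 2).const_mul ((R.kap : ℂ) ^ 2)).const_add (R.e₃ : ℂ)
  refine ⟨_, h2, ?_⟩
  have hk : (R.kap : ℂ) ^ 2 = R.e₁ - R.e₃ := by exact_mod_cast R.kap_sq
  have hm : (R.kap : ℂ) ^ 2 * R.m = R.e₂ - R.e₃ := by exact_mod_cast R.kap_sq_mul_m
  change cs R.m (R.kap * w) ^ 2 = ns R.m (R.kap * w) ^ 2 - 1 at hc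
  change ds R.m (R.kap * w) ^ 2 = ns R.m (R.kap * w) ^ 2 - R.m at hds
  simp only [P, Function.comp_apply]
  push_cast
  generalize cs R.m (R.kap * w) = c at *
  generalize ds R.m (R.kap * w) = d at *
  generalize ns R.m (R.kap * w) = n at *
  have e1 : (R.e₁ : ℂ) = R.e₃ + R.kap ^ 2 := by rw [hk]; ring
  have e2 : (R.e₂ : ℂ) = R.e₃ + R.kap ^ 2 * R.m := by rw [hm]; ring
  rw [e1, e2]
  have : c ^ 2 * d ^ 2 = (n ^ 2 - 1) * (n ^ 2 - R.m) := by rw [hc, hds]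
  simp only [pow_one]
  linear_combination 4 * (R.kap : ℂ) ^ 6 * n ^ 2 * this

lemma L_isOpen : IsOpen ((R.L.lattice : Set ℂ)ᶜ) := R.L.isClosed_lattice.isOpen_compl

lemma P_analyticAt {w : ℂ} (hw : w ∉ R.L.lattice) : AnalyticAt ℂ R.P w := by
  have : DifferentiableOn ℂ R.P (R.L.lattice : Set ℂ)ᶜ := fun v hv => by
    obtain ⟨p, hp, -⟩ := R.P_sq hv
    exact hp.differentiableAt.differentiableWithinAt
  exact this.analyticAt (R.L_isOpen.mem_nhds hw)

/-- `P` and `℘` have the same principal parts. -/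
lemma exists_P_sub_weierstrassP : ∃ A : ℂ → ℂ, AnalyticAt ℂ A 0 ∧
    ∀ᶠ w in 𝓝[≠] (0 : ℂ), R.P w - R.L.weierstrassP w = A w := by
  obtain ⟨A, hA, hAns⟩ := exists_analyticAt_ns_sq R.m_pos R.m_lt_one
  have hk : (R.kap : ℂ) ≠ 0 := by exact_mod_cast R.kap_pos.ne'
  have hcont : Continuous fun w : ℂ => (R.kap : ℂ) * w := by fun_prop
  have ht : Tendsto (fun w : ℂ => (R.kap : ℂ) * w) (𝓝[≠] 0) (𝓝[≠] 0) := by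
    rw [tendsto_nhdsWithin_iff]
    refine ⟨Tendsto.mono_left (by simpa using hcont.tendsto 0) nhdsWithin_le_nhds, ?_⟩
    filter_upwards [self_mem_nhdsWithin] with w hw
    exact mul_ne_zero hk hw
  refine ⟨fun w => R.e₃ + R.kap ^ 2 * A (R.kap * w) - R.L.weierstrassPExcept 0 w, ?_, ?_⟩
  · have h1 : AnalyticAt ℂ (fun w => A (R.kap * w)) 0 := by
      have hA' : AnalyticAt ℂ A ((R.kap : ℂ) * 0) := by simpa using hA
      exact AnalyticAt.comp_of_eq (f := fun w : ℂ => (R.kap : ℂ) * w) hA (by fun_prop) (by simp)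
    have h2 := R.L.analyticAt_weierstrassPExcept 0
    exact (analyticAt_const.add (analyticAt_const.mul h1)).sub h2
  · filter_upwards [ht.eventually hAns, self_mem_nhdsWithin] with w hw hw0
    have hw0 : w ≠ 0 := hw0
    have h0 : (0 : ℂ) ∈ R.L.lattice := zero_mem _
    have := R.L.weierstrassPExcept_def ⟨0, h0⟩ w
    simp only at this
    rw [this, P, hw]
    field_simp
    simp
    ring

lemma exists_P_eq_add : ∃ c : ℂ, ∀ w, w ∉ R.L.lattice → R.P w = R.L.weierstrassP w + c := by
  classical
  obtain ⟨A, hA, hAP⟩ := R.exists_P_sub_weierstrassP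
  set G : ℂ → ℂ := fun w => if w ∈ R.L.lattice then A 0 else R.P w - R.L.weierstrassP w with hG
  have hper : ∀ w l, l ∈ R.L.lattice → G (w + l) = G w := by
    intro w l hl
    have e1 : w + l ∈ R.L.lattice ↔ w ∈ R.L.lattice :=
      (R.L.lattice.toAddSubgroup.add_mem_cancel_right (y := w) hl)
    have e2 := R.L.weierstrassP_add_coe w ⟨l, hl⟩
    simp only at e2
    simp only [hG, e1, R.P_periodic hl w, e2]
  have h0 : AnalyticAt ℂ G 0 := by
    refine hA.congr ?_
    rw [eventually_nhdsWithin_iff] at hAP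
    filter_upwards [hAP, R.L.compl_lattice_sdiff_singleton_mem_nhds 0] with w hw hw'
    by_cases hw0 : w = 0
    · simp [hG, hw0]
    · rw [← hw hw0]
      have : w ∉ R.L.lattice := fun h => hw' ⟨h, hw0⟩
      simp [hG, this]
  have hdiff : Differentiable ℂ G := by
    intro w
    by_cases hw : w ∈ R.L.lattice
    · have e : G = fun v => G (v - w) := by
        funext v
        have := hper (v - w) w hw
        rw [sub_add_cancel] at this
        exact this
      rw [e]
      have h0' : DifferentiableAt ℂ G (w - w) := by simpa using h0.differentiableAt
      exact DifferentiableAt.comp w (f := fun v => v - w) h0' (by fun_prop)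
    · have h1 := (R.P_analyticAt hw).differentiableAt
      have h2 := (R.L.analyticOnNhd_weierstrassP w hw).differentiableAt
      refine (h1.sub h2).congr_of_eventuallyEq ?_
      filter_upwards [R.L_isOpen.mem_nhds hw] with v hv
      exact if_neg hv
  have hb := (IsZLattice.isCompact_range_of_periodic R.L.lattice _ hdiff.continuous
    fun z w hw => hper z w hw).isBounded
  refine ⟨G 0, fun w hw => ?_⟩
  have := hdiff.apply_eq_apply_of_bounded hb w 0
  rw [← this]
  simp [hG, hw]

lemma tendsto_weierstrassP : Tendsto R.L.weierstrassP (𝓝[≠] 0) (Bornology.cobounded ℂ) := by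
  rw [tendsto_cobounded_iff_meromorphicOrderAt_neg (by fun_prop),
    R.L.order_weierstrassP 0 (zero_mem _)]
  decide

lemma eventually_notMem_L : ∀ᶠ w in 𝓝[≠] (0 : ℂ), w ∉ R.L.lattice := by
  rw [eventually_nhdsWithin_iff]
  filter_upwards [R.L.compl_lattice_sdiff_singleton_mem_nhds 0] with w hw hw0 h
  exact hw ⟨h, hw0⟩

/-- The Jacobi expression is the Weierstrass function of the rectangular lattice. -/
theorem weierstrassP_eq {w : ℂ} (hw : w ∉ R.L.lattice) : R.L.weierstrassP w = R.P w := by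
  obtain ⟨c, hc⟩ := R.exists_P_eq_add
  suffices c = 0 by rw [hc w hw, this, add_zero]
  have hpoly : ∀ v, v ∉ R.L.lattice → 12 * c * R.L.weierstrassP v ^ 2 +
      (12 * c ^ 2 + R.L.g₂ + 4 * (R.e₁ * R.e₂ + R.e₁ * R.e₃ + R.e₂ * R.e₃)) * R.L.weierstrassP v +
      (4 * (c - R.e₁) * (c - R.e₂) * (c - R.e₃) + R.L.g₃) = 0 := by
    intro v hv
    obtain ⟨p, hp, hp2⟩ := R.P_sq hv
    have h1 : HasDerivAt R.P (R.L.derivWeierstrassP v) v := by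
      have h2 := (R.L.analyticOnNhd_weierstrassP v hv).differentiableAt.hasDerivAt
      rw [R.L.deriv_weierstrassP] at h2
      refine (h2.add_const c).congr_of_eventuallyEq ?_
      filter_upwards [R.L_isOpen.mem_nhds hv] with u hu
      exact hc u hu
    rw [hp.unique h1, R.L.derivWeierstrassP_sq v hv, hc v hv] at hp2
    have hs : (R.e₁ : ℂ) + R.e₂ + R.e₃ = 0 := by exact_mod_cast R.sum_eq
    linear_combination -hp2 + 4 * (R.L.weierstrassP v ^ 2 + 2 * c * R.L.weierstrassP v) * hs
  have hlim : Tendsto (fun v => (R.L.weierstrassP v)⁻¹) (𝓝[≠] 0) (𝓝 0) :=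
    tendsto_inv₀_cobounded.comp R.tendsto_weierstrassP
  have hne : ∀ᶠ v in 𝓝[≠] (0 : ℂ), R.L.weierstrassP v ≠ 0 :=
    R.tendsto_weierstrassP.eventually (Bornology.eventually_ne_cobounded 0)
  set a := 12 * c ^ 2 + R.L.g₂ + 4 * (R.e₁ * R.e₂ + R.e₁ * R.e₃ + R.e₂ * R.e₃ : ℂ)
  set b := (4 * (c - R.e₁) * (c - R.e₂) * (c - R.e₃) + R.L.g₃ : ℂ)
  have h1 : Tendsto (fun v => 12 * c + a * (R.L.weierstrassP v)⁻¹ +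
      b * (R.L.weierstrassP v)⁻¹ ^ 2) (𝓝[≠] 0) (𝓝 (12 * c + a * 0 + b * 0 ^ 2)) :=
    ((hlim.const_mul a).const_add _).add ((hlim.pow 2).const_mul b)
  have h2 : (fun v => 12 * c + a * (R.L.weierstrassP v)⁻¹ +
      b * (R.L.weierstrassP v)⁻¹ ^ 2) =ᶠ[𝓝[≠] 0] fun _ => 0 := by
    filter_upwards [hne, R.eventually_notMem_L] with v hv hv'
    have := hpoly v hv'
    field_simp
    linear_combination this
  have := tendsto_nhds_unique (h1.congr' h2) tendsto_const_nhds
  simpa using this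

/-- The differential equation of `℘` in factored form. -/
lemma derivWeierstrassP_sq' {w : ℂ} (hw : w ∉ R.L.lattice) :
    R.L.derivWeierstrassP w ^ 2 = 4 * (R.L.weierstrassP w - R.e₁) * (R.L.weierstrassP w - R.e₂) *
      (R.L.weierstrassP w - R.e₃) := by
  obtain ⟨p, hp, hp2⟩ := R.P_sq hw
  have h : HasDerivAt R.P (R.L.derivWeierstrassP w) w := by
    have h2 := (R.L.analyticOnNhd_weierstrassP w hw).differentiableAt.hasDerivAt
    rw [R.L.deriv_weierstrassP] at h2
    refine h2.congr_of_eventuallyEq ?_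
    filter_upwards [R.L_isOpen.mem_nhds hw] with u hu
    exact (R.weierstrassP_eq hu).symm
  rw [R.weierstrassP_eq hw, ← hp2, hp.unique h]

end RealCubic

end

/-! ### Values of the Weierstrass function -/

section

open Complex Topology Jacobi

/-- A solution of a linear differential inequality that vanishes at a point vanishes nearby. -/
theorem eventually_eq_zero_of_norm_deriv_le {E : Type*} [NormedAddCommGroup E] [NormedSpace ℂ E]
    {v v' : ℂ → E} {w₀ : ℂ} {K : ℝ}
    (hv : ∀ᶠ w in 𝓝 w₀, HasDerivAt v (v' w) w ∧ ‖v' w‖ ≤ K * ‖v w‖) (h0 : v w₀ = 0) :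
    ∀ᶠ w in 𝓝 w₀, v w = 0 := by
  let _ : NormedSpace ℝ E := NormedSpace.restrictScalars ℝ ℂ E
  obtain ⟨r, hr, hball⟩ := Metric.eventually_nhds_iff_ball.1 hv
  filter_upwards [Metric.ball_mem_nhds w₀ hr] with w hw
  have hmem : ∀ t ∈ Set.Icc (0 : ℝ) 1, w₀ + t * (w - w₀) ∈ Metric.ball w₀ r := by
    intro t ht
    rw [Metric.mem_ball, dist_eq_norm] at hw ⊢
    rw [add_sub_cancel_left, norm_mul, norm_real, Real.norm_eq_abs, abs_of_nonneg ht.1]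
    exact (mul_le_of_le_one_left (norm_nonneg _) ht.2).trans_lt hw
  have hder : ∀ t ∈ Set.Icc (0 : ℝ) 1, HasDerivAt (fun t : ℝ => v (w₀ + t * (w - w₀)))
      ((w - w₀) • v' (w₀ + t * (w - w₀))) t := by
    intro t ht
    have h1 : HasDerivAt (fun t : ℝ => w₀ + (t : ℂ) * (w - w₀)) (w - w₀) t := by
      simpa using ((hasDerivAt_id t).ofReal_comp.mul_const (w - w₀)).const_add w₀
    exact (hball _ (hmem t ht)).1.scomp t h1
  have := norm_le_gronwallBound_of_norm_deriv_right_le (δ := 0) (K := ‖w - w₀‖ * K) (ε := 0)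
    (f := fun t : ℝ => v (w₀ + t * (w - w₀)))
    (f' := fun t : ℝ => (w - w₀) • v' (w₀ + t * (w - w₀))) (a := 0) (b := 1)
    (fun t ht => (hder t ht).continuousAt.continuousWithinAt)
    (fun t ht => (hder t ⟨ht.1, ht.2.le⟩).hasDerivWithinAt)
    (by simp [h0]) (fun t ht => by
      rw [norm_smul, add_zero, mul_assoc]
      exact mul_le_mul_of_nonneg_left (hball _ (hmem t ⟨ht.1, ht.2.le⟩)).2 (norm_nonneg _))
    1 (by simp)
  simpa [gronwallBound_ε0_δ0] using this

/-- The identity theorem on the complement of a closed countable set. -/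
theorem eqOn_compl_of_eventuallyEq {Z : Set ℂ} (hZ : Z.Countable)
    {f g : ℂ → ℂ} (hf : ∀ w ∉ Z, AnalyticAt ℂ f w) (hg : ∀ w ∉ Z, AnalyticAt ℂ g w)
    {w₀ : ℂ} (hw₀ : w₀ ∉ Z) (h : f =ᶠ[𝓝 w₀] g) : ∀ w ∉ Z, f w = g w := by
  have hc : IsPreconnected Zᶜ :=
    (hZ.isConnected_compl_of_one_lt_rank (by simp)).isPreconnected
  exact AnalyticOnNhd.eqOn_of_preconnected_of_eventuallyEq (U := Zᶜ) (fun w hw => hf w hw)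
    (fun w hw => hg w hw) hc hw₀ h

namespace RealCubic

variable (R : RealCubic)

lemma countable_L : (R.L.lattice : Set ℂ).Countable := by
  rw [← Set.countable_coe_iff]
  exact R.L.latticeEquivProd.toEquiv.countable_iff.2 inferInstance

lemma P_continuousAt {w : ℂ} (hw : w ∉ R.L.lattice) : ContinuousAt R.L.weierstrassP w :=
  (R.L.analyticOnNhd_weierstrassP w hw).continuousAt

lemma hasDerivAt_weierstrassP {w : ℂ} (hw : w ∉ R.L.lattice) :
    HasDerivAt R.L.weierstrassP (R.L.derivWeierstrassP w) w := by
  have h2 := (R.L.analyticOnNhd_weierstrassP w hw).differentiableAt.hasDerivAt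
  rwa [R.L.deriv_weierstrassP] at h2

lemma add_mem_L_iff {w l : ℂ} (hl : l ∈ R.L.lattice) : w + l ∈ R.L.lattice ↔ w ∈ R.L.lattice :=
  R.L.lattice.toAddSubgroup.add_mem_cancel_right (y := w) hl

lemma weierstrassP_add {w l : ℂ} (hl : l ∈ R.L.lattice) :
    R.L.weierstrassP (w + l) = R.L.weierstrassP w := R.L.weierstrassP_add_coe w ⟨l, hl⟩

lemma tendsto_weierstrassP_of_mem {l : ℂ} (hl : l ∈ R.L.lattice) :
    Tendsto R.L.weierstrassP (𝓝[≠] l) (Bornology.cobounded ℂ) := by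
  rw [tendsto_cobounded_iff_meromorphicOrderAt_neg (by fun_prop),
    R.L.order_weierstrassP l hl]
  decide

lemma eventually_notMem_L' (l : ℂ) : ∀ᶠ w in 𝓝[≠] l, w ∉ R.L.lattice := by
  rw [eventually_nhdsWithin_iff]
  filter_upwards [R.L.compl_lattice_sdiff_singleton_mem_nhds l] with w hw hw0 h
  exact hw ⟨h, hw0⟩

lemma not_eventually_derivWeierstrassP_eq_zero {w : ℂ} (hw : w ∉ R.L.lattice) :
    ¬ ∀ᶠ v in 𝓝 w, R.L.derivWeierstrassP v = 0 := by
  intro h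
  have h1 := eqOn_compl_of_eventuallyEq R.countable_L
    (fun w hw => R.L.analyticOnNhd_derivWeierstrassP w hw)
    (fun w _ => analyticAt_const (v := (0 : ℂ))) hw h
  have h2 : ∀ v ∉ R.L.lattice, R.L.weierstrassP v = R.e₁ ∨ R.L.weierstrassP v = R.e₂ ∨
      R.L.weierstrassP v = R.e₃ := by
    intro v hv
    have h3 := R.derivWeierstrassP_sq' hv
    rw [h1 v hv] at h3
    simp only [ne_eq, OfNat.ofNat_ne_zero, not_false_eq_true, zero_pow, zero_eq_mul, mul_eq_zero,
      sub_eq_zero] at h3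
    tauto
  have h4 : ∀ c : ℂ, ∀ᶠ v in 𝓝[≠] (0 : ℂ), R.L.weierstrassP v ≠ c := fun c =>
    R.tendsto_weierstrassP.eventually (Bornology.eventually_ne_cobounded c)
  obtain ⟨v, hv, a, b, c⟩ := (R.eventually_notMem_L.and
    ((h4 R.e₁).and ((h4 R.e₂).and (h4 R.e₃)))).exists
  rcases h2 v hv with h | h | h
  exacts [a h, b h, c h]

lemma hasDerivAt_derivWeierstrassP {w : ℂ} (hw : w ∉ R.L.lattice) :
    HasDerivAt R.L.derivWeierstrassP (6 * R.L.weierstrassP w ^ 2 +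
      2 * (R.e₁ * R.e₂ + R.e₁ * R.e₃ + R.e₂ * R.e₃)) w := by
  have key : ∀ v ∉ R.L.lattice, R.L.derivWeierstrassP v ≠ 0 → deriv R.L.derivWeierstrassP v =
      6 * R.L.weierstrassP v ^ 2 + 2 * (R.e₁ * R.e₂ + R.e₁ * R.e₃ + R.e₂ * R.e₃) := by
    intro v hv hne
    have h1 := (R.L.analyticOnNhd_derivWeierstrassP v hv).differentiableAt.hasDerivAt
    have h2 := R.hasDerivAt_weierstrassP hv
    have h3 := h1.fun_pow 2
    have h4 := (((h2.sub_const (R.e₁ : ℂ)).const_mul 4).fun_mul (h2.sub_const (R.e₂ : ℂ))).fun_mul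
      (h2.sub_const (R.e₃ : ℂ))
    have h5 := h3.unique (h4.congr_of_eventuallyEq (by
      filter_upwards [R.L_isOpen.mem_nhds hv] with u hu using R.derivWeierstrassP_sq' hu))
    simp only [Nat.add_one_sub_one, pow_one] at h5
    have hs : (R.e₁ : ℂ) + R.e₂ + R.e₃ = 0 := by exact_mod_cast R.sum_eq
    refine mul_left_cancel₀ (mul_ne_zero two_ne_zero hne) ?_
    push_cast at h5
    rw [h5]
    linear_combination (-8 * R.L.derivWeierstrassP v * R.L.weierstrassP v) * hs
  have han := R.L.analyticOnNhd_derivWeierstrassP w hw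
  have h1 := han.differentiableAt.hasDerivAt
  suffices h : deriv R.L.derivWeierstrassP w = 6 * R.L.weierstrassP w ^ 2 +
      2 * (R.e₁ * R.e₂ + R.e₁ * R.e₃ + R.e₂ * R.e₃) by rwa [h] at h1
  have hne : ∀ᶠ v in 𝓝[≠] w, R.L.derivWeierstrassP v ≠ 0 :=
    han.eventually_eq_zero_or_eventually_ne_zero.resolve_left
      (R.not_eventually_derivWeierstrassP_eq_zero hw)
  have hc1 : ContinuousAt (deriv R.L.derivWeierstrassP) w := han.deriv.continuousAt
  have hc2 : ContinuousAt (fun v => 6 * R.L.weierstrassP v ^ 2 +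
      2 * (R.e₁ * R.e₂ + R.e₁ * R.e₃ + R.e₂ * R.e₃ : ℂ)) w := by
    have := R.P_continuousAt hw
    fun_prop
  refine tendsto_nhds_unique (hc1.mono_left nhdsWithin_le_nhds)
    ((hc2.mono_left nhdsWithin_le_nhds).congr' (f₂ := deriv R.L.derivWeierstrassP)
      (l₁ := 𝓝[≠] w) ?_)
  filter_upwards [hne, mem_nhdsWithin_of_mem_nhds (R.L_isOpen.mem_nhds hw)] with v hv hv'
  exact (key v hv' hv).symm

/-- Two translates of `℘` with the same value and the same derivative at a point coincide. -/
lemma sub_mem_L_of_eq {w w' : ℂ} (hw : w ∉ R.L.lattice) (hw' : w' ∉ R.L.lattice)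
    (h : R.L.weierstrassP w = R.L.weierstrassP w')
    (h' : R.L.derivWeierstrassP w = R.L.derivWeierstrassP w') : w - w' ∈ R.L.lattice := by
  set u₁ : ℂ → ℂ := fun t => R.L.weierstrassP (w + t)
  set u₂ : ℂ → ℂ := fun t => R.L.weierstrassP (w' + t)
  set p₁ : ℂ → ℂ := fun t => R.L.derivWeierstrassP (w + t)
  set p₂ : ℂ → ℂ := fun t => R.L.derivWeierstrassP (w' + t)
  have ho : ∀ {w : ℂ}, w ∉ R.L.lattice → ∀ᶠ t in 𝓝 (0 : ℂ), w + t ∉ R.L.lattice := fun {w} hw => by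
    have hc : Tendsto (fun t : ℂ => w + t) (𝓝 0) (𝓝 w) := by
      simpa using (by fun_prop : Continuous fun t : ℂ => w + t).tendsto 0
    exact hc.eventually (R.L_isOpen.mem_nhds hw)
  have hd : ∀ {w t : ℂ}, w + t ∉ R.L.lattice →
      HasDerivAt (fun t => R.L.weierstrassP (w + t)) (R.L.derivWeierstrassP (w + t)) t ∧
      HasDerivAt (fun t => R.L.derivWeierstrassP (w + t)) (6 * R.L.weierstrassP (w + t) ^ 2 +
        2 * (R.e₁ * R.e₂ + R.e₁ * R.e₃ + R.e₂ * R.e₃)) t := fun {w t} ht =>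
    ⟨(R.hasDerivAt_weierstrassP ht).comp_const_add w t,
      (R.hasDerivAt_derivWeierstrassP ht).comp_const_add w t⟩
  have hcont : ContinuousAt (fun t => ‖6 * (u₁ t + u₂ t)‖) 0 := by
    have a1 : ContinuousAt u₁ 0 := (hd (by simpa using hw)).1.continuousAt
    have a2 : ContinuousAt u₂ 0 := (hd (by simpa using hw')).1.continuousAt
    fun_prop
  obtain ⟨M, hM⟩ : ∃ M, ‖6 * (u₁ 0 + u₂ 0)‖ < M := exists_gt _
  have hbound := hcont.eventually_lt_const hM
  have hzero := eventually_eq_zero_of_norm_deriv_le (K := max M 1)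
    (v := fun t => (u₁ t - u₂ t, p₁ t - p₂ t))
    (v' := fun t => (p₁ t - p₂ t, 6 * (u₁ t + u₂ t) * (u₁ t - u₂ t))) (w₀ := 0) (by
      filter_upwards [ho hw, ho hw', hbound] with t h1 h2 h3
      refine ⟨?_, ?_⟩
      · refine ((hd h1).1.fun_sub (hd h2).1).prodMk
          (((hd h1).2.fun_sub (hd h2).2).congr_deriv ?_)
        simp only [u₁, u₂]
        ring
      · rw [Prod.norm_def, Prod.norm_def]
        refine max_le ?_ ?_
        · calc ‖p₁ t - p₂ t‖ = 1 * ‖p₁ t - p₂ t‖ := (one_mul _).symm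
            _ ≤ max M 1 * max ‖u₁ t - u₂ t‖ ‖p₁ t - p₂ t‖ := by
              gcongr
              · exact le_max_right _ _
              · exact le_max_right _ _
        · simp only
          rw [norm_mul]
          gcongr
          · exact h3.le.trans (le_max_left _ _)
          · exact le_max_left _ _) (by simp [u₁, u₂, p₁, p₂, h, h'])
  have heq : u₁ =ᶠ[𝓝 0] u₂ := by
    filter_upwards [hzero] with t ht
    exact sub_eq_zero.1 (Prod.mk_eq_zero.1 ht).1
  by_contra hmem
  set Z : Set ℂ := (fun t => t - w) '' R.L.lattice ∪ (fun t => t - w') '' R.L.lattice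
  have hZ : Z.Countable := (R.countable_L.image _).union (R.countable_L.image _)
  have hZ1 : ∀ t ∉ Z, w + t ∉ R.L.lattice := fun t ht h => ht (Or.inl ⟨_, h, by ring⟩)
  have hZ2 : ∀ t ∉ Z, w' + t ∉ R.L.lattice := fun t ht h => ht (Or.inr ⟨_, h, by ring⟩)
  have han : ∀ w t : ℂ, w + t ∉ R.L.lattice →
      AnalyticAt ℂ (fun t => R.L.weierstrassP (w + t)) t := fun w t ht =>
    AnalyticAt.comp_of_eq (f := fun t : ℂ => w + t) (R.L.analyticOnNhd_weierstrassP _ ht)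
      (by fun_prop) rfl
  have h0Z : (0 : ℂ) ∉ Z := by
    rintro (⟨l, hl, h⟩ | ⟨l, hl, h⟩)
    · exact hw (by rw [← sub_eq_zero.1 h]; exact hl)
    · exact hw' (by rw [← sub_eq_zero.1 h]; exact hl)
  have hall := eqOn_compl_of_eventuallyEq hZ (fun t ht => han w t (hZ1 t ht))
    (fun t ht => han w' t (hZ2 t ht)) h0Z heq
  have hmem' : w' + (-w) ∉ R.L.lattice := fun h => hmem (by
    have := neg_mem h; rwa [neg_add_rev, neg_neg, ← sub_eq_add_neg] at this)
  have ht1 : Tendsto (fun t => w + t) (𝓝[≠] (-w)) (𝓝[≠] 0) := by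
    rw [tendsto_nhdsWithin_iff]
    refine ⟨Tendsto.mono_left ?_ nhdsWithin_le_nhds, ?_⟩
    · simpa using (by fun_prop : Continuous fun t : ℂ => w + t).tendsto (-w)
    · filter_upwards [self_mem_nhdsWithin] with t ht h
      exact ht (by simp only [Set.mem_singleton_iff] at h ⊢; linear_combination h)
  have hlim1 : Tendsto u₁ (𝓝[≠] (-w)) (Bornology.cobounded ℂ) := R.tendsto_weierstrassP.comp ht1
  have hlim2 : Tendsto u₂ (𝓝[≠] (-w)) (𝓝 (u₂ (-w))) :=
    (han w' _ hmem').continuousAt.mono_left nhdsWithin_le_nhds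
  have hev : u₁ =ᶠ[𝓝[≠] (-w)] u₂ := by
    have e1 := ht1.eventually R.eventually_notMem_L
    have e2 : ∀ᶠ t in 𝓝 (-w), w' + t ∉ R.L.lattice :=
      (by fun_prop : Continuous fun t : ℂ => w' + t).continuousAt.eventually
        (R.L_isOpen.mem_nhds hmem')
    filter_upwards [e1, e2.filter_mono nhdsWithin_le_nhds] with t h1 h2
    refine hall t ?_
    rintro (⟨l, hl, h⟩ | ⟨l, hl, h⟩)
    · exact h1 (by rw [← h]; simpa using hl)
    · exact h2 (by rw [← h]; simpa using hl)
  exact (hlim1.congr' hev).not_tendsto (Metric.disjoint_cobounded_nhds _) hlim2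

/-- `℘` takes the same value at two points only if they agree up to sign modulo the lattice. -/
theorem sub_mem_or_add_mem_of_weierstrassP_eq {w w' : ℂ} (hw : w ∉ R.L.lattice) (hw' : w' ∉ R.L.lattice)
    (h : R.L.weierstrassP w = R.L.weierstrassP w') :
    w - w' ∈ R.L.lattice ∨ w + w' ∈ R.L.lattice := by
  have h1 := R.derivWeierstrassP_sq' hw
  rw [h, ← R.derivWeierstrassP_sq' hw', sq_eq_sq_iff_eq_or_eq_neg] at h1
  rcases h1 with h1 | h1
  · exact Or.inl (R.sub_mem_L_of_eq hw hw' h h1)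
  · right
    have := R.sub_mem_L_of_eq (w' := -w') hw (by simpa using hw') (by simpa using h)
      (by simpa using h1)
    simpa using this

theorem exists_weierstrassP_eq (u : ℂ) : ∃ w, w ∉ R.L.lattice ∧ R.L.weierstrassP w = u := by
  classical
  by_contra! hne
  set G : ℂ → ℂ := fun w => if w ∈ R.L.lattice then 0 else (R.L.weierstrassP w - u)⁻¹ with hG
  have hper : ∀ w l, l ∈ R.L.lattice → G (w + l) = G w := by
    intro w l hl
    simp only [hG, R.add_mem_L_iff hl, R.weierstrassP_add hl]
  have hoff : ∀ w ∉ R.L.lattice, DifferentiableAt ℂ G w := fun w hw => by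
    have h2 := (R.hasDerivAt_weierstrassP hw).differentiableAt
    refine ((h2.sub_const u).inv (sub_ne_zero.2 (hne w hw))).congr_of_eventuallyEq ?_
    filter_upwards [R.L_isOpen.mem_nhds hw] with v hv
    exact if_neg hv
  have h0 : AnalyticAt ℂ G 0 := by
    refine Complex.analyticAt_of_differentiable_on_punctured_nhds_of_continuousAt ?_ ?_
    · filter_upwards [R.eventually_notMem_L] with w hw using hoff w hw
    · rw [continuousAt_iff_punctured_nhds]
      have : G 0 = 0 := by simp [hG]
      rw [this]
      have h1 : Tendsto (fun w => (R.L.weierstrassP w - u)⁻¹) (𝓝[≠] 0) (𝓝 0) := by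
        refine tendsto_inv₀_cobounded.comp ?_
        rw [← tendsto_norm_atTop_iff_cobounded]
        refine tendsto_atTop_mono (fun w => norm_sub_norm_le _ _)
          (tendsto_atTop_add_const_right _ (-‖u‖)
            (tendsto_norm_atTop_iff_cobounded.2 R.tendsto_weierstrassP))
      refine h1.congr' ?_
      filter_upwards [R.eventually_notMem_L] with w hw
      exact (if_neg hw).symm
  have hdiff : Differentiable ℂ G := by
    intro w
    by_cases hw : w ∈ R.L.lattice
    · have e : G = fun v => G (v - w) := by
        funext v
        have := hper (v - w) w hw
        rw [sub_add_cancel] at this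
        exact this
      rw [e]
      have h0' : DifferentiableAt ℂ G (w - w) := by simpa using h0.differentiableAt
      exact DifferentiableAt.comp w (f := fun v => v - w) h0' (by fun_prop)
    · exact hoff w hw
  have hb := (IsZLattice.isCompact_range_of_periodic R.L.lattice _ hdiff.continuous
    fun z w hw => hper z w hw).isBounded
  obtain ⟨w, hw⟩ := R.eventually_notMem_L.exists
  have := hdiff.apply_eq_apply_of_bounded hb w 0
  rw [show G 0 = 0 by simp [hG]] at this
  simp only [hG, if_neg hw, inv_eq_zero] at this
  exact hne w hw (sub_eq_zero.1 this)

end RealCubic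

end

/-! ### The Weierstrass function on lines of symmetry -/

section

open Complex Topology Jacobi

namespace RealCubic

variable (R : RealCubic)

/-- On the line through the half period `ω₂ / 2`, the function `℘` takes values in `[e₂, e₁]`. -/
lemma weierstrassP_of_re_half {w : ℂ} (hw : w.re = R.per₂ / 2) :
    w ∉ R.L.lattice ∧ ∃ r : ℝ, R.e₂ ≤ r ∧ r ≤ R.e₁ ∧ R.L.weierstrassP w = r := by
  have hk := R.kap_pos
  have hre : (R.kap * w).re = ellK R.m := by
    rw [re_ofReal_mul, hw, per₂]; field_simp
  have hS := sn_ellK R.m_pos R.m_lt_one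
  have hC := cn_ellK R.m_pos R.m_lt_one
  set t := (R.kap * w).im
  have hden : den R.m (R.kap * w).re t = 1 := by
    have := cn_sq (m := 1 - R.m) t
    rw [den, hre, hS, this]; ring
  have hmem : w ∉ R.L.lattice := fun h => by
    rw [← R.den_eq_zero_iff_mem, hden] at h
    exact one_ne_zero h
  refine ⟨hmem, R.e₃ + R.kap ^ 2 * dn (1 - R.m) t ^ 2, ?_, ?_, ?_⟩
  · rw [dn_sq R.m'_pos R.m'_lt_one]
    have h1 : sn (1 - R.m) t ^ 2 ≤ 1 := Real.sin_sq_le_one _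
    have h2 := R.kap_sq_mul_m
    have h3 := R.m'_pos
    have : 0 ≤ R.kap ^ 2 * (1 - R.m) * (1 - sn (1 - R.m) t ^ 2) := by
      have : 0 ≤ 1 - sn (1 - R.m) t ^ 2 := by linarith
      positivity
    nlinarith
  · rw [dn_sq R.m'_pos R.m'_lt_one]
    have h2 := R.kap_sq
    have h3 := R.m'_pos
    have : 0 ≤ R.kap ^ 2 * ((1 - R.m) * sn (1 - R.m) t ^ 2) := by positivity
    nlinarith
  · rw [R.weierstrassP_eq hmem, P, ns, ns₂]
    change _ + _ * (_ / (den R.m (R.kap * w).re t : ℂ)) ^ 2 = _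
    rw [hden, hre, hS, hC]
    simp [t]

/-- On the vertical lines through lattice points, the function `℘` takes values in `[-∞, e₃]`. -/
lemma weierstrassP_of_re_zero {w : ℂ} (hw : w.re = 0) (hmem : w ∉ R.L.lattice) :
    ∃ r : ℝ, r ≤ R.e₃ ∧ R.L.weierstrassP w = r := by
  have hre : (R.kap * w).re = 0 := by rw [re_ofReal_mul, hw, mul_zero]
  have hS := sn_zero R.m_pos R.m_lt_one
  have hC := cn_zero R.m_pos R.m_lt_one
  have hD := dn_zero R.m_pos R.m_lt_one
  set t := (R.kap * w).im
  have hs : sn (1 - R.m) t ≠ 0 := fun h => hmem (by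
    rw [← R.den_eq_zero_iff_mem, hre, den_eq_zero_iff]; exact ⟨hS, h⟩)
  refine ⟨R.e₃ - R.kap ^ 2 * (cn (1 - R.m) t ^ 2 / sn (1 - R.m) t ^ 2), ?_, ?_⟩
  · have : 0 ≤ R.kap ^ 2 * (cn (1 - R.m) t ^ 2 / sn (1 - R.m) t ^ 2) := by positivity
    linarith
  · have hs' : (sn (1 - R.m) t : ℂ) ≠ 0 := by exact_mod_cast hs
    rw [R.weierstrassP_eq hmem, P, ns, ns₂]
    have ht : (R.kap * w).im = t := rfl
    rw [ht, hre, hS, hC, hD, den, hS]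
    push_cast
    simp only [zero_mul, one_mul, ne_eq, OfNat.ofNat_ne_zero, not_false_eq_true, zero_pow,
      zero_add, zero_sub]
    field_simp
    linear_combination (R.kap : ℂ) ^ 2 * cn (1 - R.m) t ^ 2 * I_sq

/-- The restriction of `℘` to the real line. -/
noncomputable def realP (s : ℝ) : ℝ := R.e₃ + R.kap ^ 2 / sn R.m (R.kap * s) ^ 2

lemma weierstrassP_ofReal {s : ℝ} (hs : (s : ℂ) ∉ R.L.lattice) :
    R.L.weierstrassP s = R.realP s := by
  rw [R.weierstrassP_eq hs, P, ← ofReal_mul, ns_ofReal R.m_pos R.m_lt_one, realP]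
  push_cast
  ring

lemma notMem_L_of_re {w : ℂ} (h0 : 0 < w.re) (h1 : w.re < R.per₂) : w ∉ R.L.lattice := by
  rw [mem_L]
  rintro ⟨a, b, -, hb⟩
  rw [hb] at h0 h1
  have hp := R.per₂_pos
  have h2 : (0 : ℝ) < b := pos_of_mul_pos_left h0 hp.le
  have h3 : (b : ℝ) < 1 := by
    by_contra h
    nlinarith
  have h2' : 0 < b := by exact_mod_cast h2
  have h3' : b < 1 := by exact_mod_cast h3
  lia

/-- The real half period segment is parametrized by the amplitude. -/
lemma realP_ellF (φ : ℝ) :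
    R.realP (ellF R.m φ / R.kap) = R.e₃ + R.kap ^ 2 / Real.sin φ ^ 2 := by
  have := R.kap_pos
  rw [realP, mul_div_cancel₀ _ this.ne', sn, am_ellF R.m_pos R.m_lt_one]

lemma ellF_div_kap_mem {φ : ℝ} (h0 : 0 < φ) (h1 : φ ≤ Real.pi / 2) :
    0 < ellF R.m φ / R.kap ∧ ellF R.m φ / R.kap ≤ R.per₂ / 2 := by
  have hk := R.kap_pos
  have hmono := strictMono_ellF R.m_pos R.m_lt_one
  have a := hmono h0
  rw [ellF_zero] at a
  refine ⟨by positivity, ?_⟩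
  have b := hmono.monotone h1
  rw [per₂, div_le_iff₀ hk]
  change _ ≤ ellK R.m at b
  field_simp
  linarith

lemma exists_ellF_eq {s : ℝ} (h0 : 0 < s) (h1 : s ≤ R.per₂ / 2) :
    ∃ φ, 0 < φ ∧ φ ≤ Real.pi / 2 ∧ ellF R.m φ / R.kap = s := by
  have hk := R.kap_pos
  have hmono := strictMono_ellF R.m_pos R.m_lt_one
  obtain ⟨φ, hφ⟩ := surjective_ellF R.m_pos R.m_lt_one (R.kap * s)
  refine ⟨φ, ?_, ?_, ?_⟩
  · rw [← hmono.lt_iff_lt, ellF_zero, hφ]; positivity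
  · rw [← hmono.le_iff_le, hφ]
    change _ ≤ ellK R.m
    rw [per₂] at h1
    field_simp at h1
    linarith
  · rw [hφ]; field_simp

lemma strictAntiOn_realP : StrictAntiOn R.realP (Set.Ioc 0 (R.per₂ / 2)) := by
  rintro s ⟨hs0, hs1⟩ t ⟨ht0, ht1⟩ hst
  obtain ⟨φ, hφ0, hφ1, rfl⟩ := R.exists_ellF_eq hs0 hs1
  obtain ⟨ψ, hψ0, hψ1, rfl⟩ := R.exists_ellF_eq ht0 ht1
  have hk := R.kap_pos
  have hlt : φ < ψ := by
    rw [← (strictMono_ellF R.m_pos R.m_lt_one).lt_iff_lt]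
    exact (div_lt_div_iff_of_pos_right hk).1 hst
  rw [realP_ellF, realP_ellF]
  have h1 : 0 < Real.sin φ := Real.sin_pos_of_pos_of_lt_pi hφ0 (by linarith [Real.pi_pos])
  have h2 : Real.sin φ < Real.sin ψ :=
    Real.sin_lt_sin_of_lt_of_le_pi_div_two (by linarith) hψ1 hlt
  gcongr

lemma realP_half : R.realP (R.per₂ / 2) = R.e₁ := by
  have := R.realP_ellF (Real.pi / 2)
  have hk := R.kap_pos
  rw [Real.sin_pi_div_two] at this
  rw [show R.per₂ / 2 = ellF R.m (Real.pi / 2) / R.kap by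
    rw [per₂]; change _ = ellK R.m / _; field_simp, this, R.kap_sq]
  ring

lemma exists_sin_eq {u : ℝ} (hu : R.e₁ ≤ u) :
    ∃ φ, 0 < φ ∧ φ ≤ Real.pi / 2 ∧ R.e₃ + R.kap ^ 2 / Real.sin φ ^ 2 = u := by
  have hk := R.kap_pos
  have h13 := R.sub_pos₁₃
  have hpos : 0 < u - R.e₃ := by linarith
  have hs := Real.sqrt_pos.2 hpos
  have hle : R.kap / √(u - R.e₃) ≤ 1 := by
    rw [div_le_one hs]
    exact Real.sqrt_le_sqrt (by linarith)
  have h0 : 0 < R.kap / √(u - R.e₃) := by positivity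
  refine ⟨Real.arcsin (R.kap / √(u - R.e₃)), Real.arcsin_pos.2 h0, Real.arcsin_le_pi_div_two _, ?_⟩
  rw [Real.sin_arcsin (by linarith) hle, div_pow, Real.sq_sqrt hpos.le]
  field_simp
  ring

lemma e₁_le_realP {s : ℝ} (h0 : 0 < s) (h1 : s ≤ R.per₂ / 2) : R.e₁ ≤ R.realP s := by
  rw [← R.realP_half]
  exact R.strictAntiOn_realP.antitoneOn ⟨h0, h1⟩ ⟨by linarith [R.per₂_pos], le_rfl⟩ h1

end RealCubic

end

/-! ### The functional equation for the generating function -/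

section

namespace QuarterPlane

/-- The walks with `n` steps that start at the origin and stay in the quarter plane. -/
def walks (S : Finset (ℤ × ℤ)) (n : ℕ) : Finset (Fin n → ℤ × ℤ) :=
  (Fintype.piFinset fun _ : Fin n => S).filter fun w =>
    ∀ m : Fin (n + 1), 0 ≤ ∑ k with (k : Fin n).val < m.val, w k

lemma sum_nonneg_of_mem_walks {S : Finset (ℤ × ℤ)} {n : ℕ} {w : Fin n → ℤ × ℤ}
    (hw : w ∈ walks S n) : 0 ≤ ∑ k, w k := by
  have := (Finset.mem_filter.1 hw).2 (Fin.last n)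
  simpa using this

lemma card_walks_le (S : Finset (ℤ × ℤ)) (n : ℕ) : (walks S n).card ≤ S.card ^ n := by
  refine (Finset.card_filter_le _ _).trans ?_
  simp

/-- The generating polynomial of the end points of the walks with `n` steps. -/
noncomputable def walkPoly (S : Finset (ℤ × ℤ)) (n : ℕ) (x y : ℂ) : ℂ :=
  ∑ w ∈ walks S n, x ^ (∑ k, w k).1.toNat * y ^ (∑ k, w k).2.toNat

lemma norm_walkPoly_le (S : Finset (ℤ × ℤ)) (n : ℕ) {x y : ℂ} (hx : ‖x‖ ≤ 1) (hy : ‖y‖ ≤ 1) :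
    ‖walkPoly S n x y‖ ≤ (S.card : ℝ) ^ n := by
  refine (norm_sum_le _ _).trans ((Finset.sum_le_card_nsmul _ _ 1 fun w _ => ?_).trans ?_)
  · rw [norm_mul, norm_pow, norm_pow]
    exact mul_le_one₀ (pow_le_one₀ (norm_nonneg _) hx) (by positivity)
      (pow_le_one₀ (norm_nonneg _) hy)
  · rw [nsmul_eq_mul, mul_one]
    exact_mod_cast card_walks_le S n

lemma hasSum_q (S : Finset (ℤ × ℤ)) (n : ℕ) (x y : ℂ) :
    HasSum (fun p : ℕ × ℕ => (q S p.1 p.2 n : ℂ) * x ^ p.1 * y ^ p.2) (walkPoly S n x y) := by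
  have h : ∀ w ∈ walks S n, HasSum (fun p : ℕ × ℕ =>
      if p = ((∑ k, w k).1.toNat, (∑ k, w k).2.toNat) then x ^ p.1 * y ^ p.2 else 0)
      (x ^ (∑ k, w k).1.toNat * y ^ (∑ k, w k).2.toNat) := fun w _ => by
    convert! hasSum_single (α := ℂ) ((∑ k, w k).1.toNat, (∑ k, w k).2.toNat) ?_ using 1
    · simp
    · intro p hp
      rw [if_neg hp]
  have h2 := hasSum_sum h
  refine h2.congr_fun fun p => ?_
  rw [← Finset.sum_filter, Finset.sum_const, nsmul_eq_mul, mul_assoc]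
  congr 2
  unfold q walks
  rw [Finset.filter_filter]
  congr 1
  refine Finset.filter_congr fun w hw => and_congr_right fun hw' => ?_
  have := hw' (Fin.last n)
  have h0 : 0 ≤ ∑ k, w k := by simpa using this
  have h1 : 0 ≤ (∑ k, w k).1 := h0.1
  have h2 : 0 ≤ (∑ k, w k).2 := h0.2
  rw [Prod.ext_iff, Prod.ext_iff]
  simp only
  lia

lemma mem_walks_succ {S : Finset (ℤ × ℤ)} {n : ℕ} (w : Fin n → ℤ × ℤ) (s : ℤ × ℤ) :
    (Fin.snoc w s : Fin (n + 1) → ℤ × ℤ) ∈ walks S (n + 1) ↔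
      w ∈ walks S n ∧ s ∈ S ∧ 0 ≤ ∑ k, w k + s := by
  unfold walks
  rw [Finset.mem_filter, Finset.mem_filter, Fintype.mem_piFinset, Fintype.mem_piFinset,
    Fin.forall_fin_succ', Fin.forall_fin_succ' (n := n + 1)]
  have h1 : ∀ m : Fin (n + 1), ∑ k with (k : Fin (n + 1)).val < m.castSucc.val,
      (Fin.snoc w s : Fin (n + 1) → ℤ × ℤ) k = ∑ k with (k : Fin n).val < m.val, w k := by
    intro m
    rw [Finset.sum_filter, Finset.sum_filter, Fin.sum_univ_castSucc]
    have := m.2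
    simp only [Fin.snoc_castSucc, Fin.val_castSucc, Fin.val_last, Fin.snoc_last]
    rw [if_neg (by lia), add_zero]
  have h2 : ∑ k with (k : Fin (n + 1)).val < (Fin.last (n + 1)).val,
      (Fin.snoc w s : Fin (n + 1) → ℤ × ℤ) k = ∑ k, w k + s := by
    rw [Finset.filter_true_of_mem (by intro k _; have := k.2; simp; lia), Fin.sum_univ_castSucc]
    simp
  simp only [h1, h2, Fin.snoc_castSucc, Fin.snoc_last]
  tauto

lemma sum_walks_succ {S : Finset (ℤ × ℤ)} {n : ℕ} (F : ℤ × ℤ → ℂ) :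
    ∑ w ∈ walks S (n + 1), F (∑ k, w k) =
      ∑ w ∈ walks S n, ∑ s ∈ S with 0 ≤ ∑ k, w k + s, F (∑ k, w k + s) := by
  rw [Finset.sum_sigma']
  refine Finset.sum_bij' (fun w _ => ⟨Fin.init w, w (Fin.last n)⟩)
    (fun p _ => Fin.snoc p.1 p.2) ?_ ?_ ?_ ?_ ?_
  · intro w hw
    have := (mem_walks_succ (S := S) (Fin.init w) (w (Fin.last n))).1 (by
      rwa [Fin.snoc_init_self])
    simp only [Finset.mem_sigma, Finset.mem_filter]
    exact this
  · rintro ⟨w, s⟩ hp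
    simp only [Finset.mem_sigma, Finset.mem_filter] at hp
    exact (mem_walks_succ w s).2 hp
  · intro w _
    exact Fin.snoc_init_self w
  · rintro ⟨w, s⟩ _
    simp
  · intro w _
    rw [Fin.sum_univ_castSucc]
    rfl

/-- The generating polynomial `∑ x ^ (i + 1) y ^ (j + 1)` of the steps. -/
noncomputable def stepPoly (S : Finset (ℤ × ℤ)) (x y : ℂ) : ℂ :=
  ∑ s ∈ S, x ^ (s.1 + 1).toNat * y ^ (s.2 + 1).toNat

lemma neg_one_le_of_mem {S : Finset (ℤ × ℤ)} (hS : IsSmallStepSet S) {s : ℤ × ℤ} (hs : s ∈ S) :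
    -1 ≤ s.1 ∧ s.1 ≤ 1 ∧ -1 ≤ s.2 ∧ s.2 ≤ 1 ∧ s ≠ (0, 0) := by
  have := hS hs
  simp only [Finset.mem_erase, Finset.mem_product, Finset.mem_Icc] at this
  tauto

/-- The contribution of the continuations of a walk that ends at `p`: inclusion-exclusion over the
two boundary half lines. -/
lemma step_identity {S : Finset (ℤ × ℤ)} (hS : IsSmallStepSet S) {p : ℤ × ℤ} (hp : 0 ≤ p)
    (x y : ℂ) :
    x * y * ∑ s ∈ S with 0 ≤ p + s, x ^ (p + s).1.toNat * y ^ (p + s).2.toNat =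
      stepPoly S x y * (x ^ p.1.toNat * y ^ p.2.toNat)
      - stepPoly S x 0 * (x ^ p.1.toNat * 0 ^ p.2.toNat)
      - stepPoly S 0 y * (0 ^ p.1.toNat * y ^ p.2.toNat)
      + stepPoly S 0 0 * (0 ^ p.1.toNat * 0 ^ p.2.toNat) := by
  simp only [stepPoly, Finset.sum_filter, Finset.mul_sum, Finset.sum_mul]
  rw [← Finset.sum_sub_distrib, ← Finset.sum_sub_distrib, ← Finset.sum_add_distrib]
  refine Finset.sum_congr rfl fun s hs => ?_
  obtain ⟨h1, h2, h3, h4, -⟩ := neg_one_le_of_mem hS hs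
  obtain ⟨a, b⟩ := p
  obtain ⟨i, j⟩ := s
  obtain ⟨ha, hb⟩ : 0 ≤ a ∧ 0 ≤ b := hp
  simp only [Prod.mk_add_mk] at *
  have hle : (0 : ℤ × ℤ) ≤ (a + i, b + j) ↔ 0 ≤ a + i ∧ 0 ≤ b + j := Iff.rfl
  rw [if_congr hle rfl rfl]
  have key : ∀ (t : ℂ) (a i : ℤ), 0 ≤ a → -1 ≤ i →
      (if 0 ≤ a + i then t * t ^ (a + i).toNat else 0) =
        t ^ (i + 1).toNat * t ^ a.toNat - 0 ^ (i + 1).toNat * 0 ^ a.toNat := by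
    intro t a i ha hi
    rw [← pow_add, ← pow_add]
    split_ifs with h
    · rw [← pow_succ', show (i + 1).toNat + a.toNat = (a + i).toNat + 1 by lia,
        zero_pow (Nat.succ_ne_zero _), sub_zero]
    · rw [show (i + 1).toNat + a.toNat = 0 by lia]
      simp
  have kx := key x a i ha h1
  have ky := key y b j hb h3
  have : (x * y * if 0 ≤ a + i ∧ 0 ≤ b + j then x ^ (a + i).toNat * y ^ (b + j).toNat else 0) =
      (if 0 ≤ a + i then x * x ^ (a + i).toNat else 0) *
        (if 0 ≤ b + j then y * y ^ (b + j).toNat else 0) := by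
    by_cases h : 0 ≤ a + i <;> by_cases h' : 0 ≤ b + j <;> simp [h, h']
    ring
  rw [this, kx, ky]
  ring

lemma walkPoly_succ {S : Finset (ℤ × ℤ)} (hS : IsSmallStepSet S) (n : ℕ) (x y : ℂ) :
    x * y * walkPoly S (n + 1) x y = stepPoly S x y * walkPoly S n x y
      - stepPoly S x 0 * walkPoly S n x 0 - stepPoly S 0 y * walkPoly S n 0 y
      + stepPoly S 0 0 * walkPoly S n 0 0 := by
  have h1 : walkPoly S (n + 1) x y = _ :=
    sum_walks_succ (S := S) (n := n) fun p => x ^ p.1.toNat * y ^ p.2.toNat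
  rw [h1, Finset.mul_sum]
  simp only [walkPoly]
  rw [Finset.mul_sum, Finset.mul_sum, Finset.mul_sum, Finset.mul_sum, ← Finset.sum_sub_distrib,
    ← Finset.sum_sub_distrib, ← Finset.sum_add_distrib]
  exact Finset.sum_congr rfl fun w hw => step_identity hS (sum_nonneg_of_mem_walks hw) x y

lemma walkPoly_zero (S : Finset (ℤ × ℤ)) (x y : ℂ) : walkPoly S 0 x y = 1 := by
  have : walks S 0 = {default} := by
    ext w
    simp only [walks, Finset.mem_filter, Finset.mem_singleton]
    refine ⟨fun _ => Subsingleton.elim _ _, fun _ => ?_⟩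
    simp
    exact Subsingleton.elim _ _
  simp [walkPoly, this]

section

variable {S : Finset (ℤ × ℤ)} {z : ℝ} (hz₀ : 0 < z) (hz₁ : z * S.card < 1)
include hz₀ hz₁

lemma summable_walkPoly {x y : ℂ} (hx : ‖x‖ ≤ 1) (hy : ‖y‖ ≤ 1) :
    Summable fun n => walkPoly S n x y * (z : ℂ) ^ n := by
  refine Summable.of_norm_bounded (g := fun n => (z * S.card) ^ n)
    (summable_geometric_of_lt_one (by positivity) hz₁) fun n => ?_
  rw [norm_mul, norm_pow, Complex.norm_real, Real.norm_of_nonneg hz₀.le, mul_pow, mul_comm]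
  gcongr
  exact norm_walkPoly_le S n hx hy

/-- `Q(x, y)` is the sum over `n` of the generating polynomials of the walks with `n` steps. -/
lemma Q_eq_tsum {x y : ℂ} (hx : ‖x‖ ≤ 1) (hy : ‖y‖ ≤ 1) :
    Q S z x y = ∑' n, walkPoly S n x y * (z : ℂ) ^ n := by
  set f : ℕ × (ℕ × ℕ) → ℂ := fun p => (q S p.2.1 p.2.2 p.1 : ℂ) * x ^ p.2.1 * y ^ p.2.2 * z ^ p.1
  have hfib : ∀ n, HasSum (fun p : ℕ × ℕ => f (n, p)) (walkPoly S n x y * (z : ℂ) ^ n) :=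
    fun n => by simpa only [f] using (hasSum_q S n x y).mul_right ((z : ℂ) ^ n)
  have hnorm : ∀ n, HasSum (fun p : ℕ × ℕ => ‖f (n, p)‖)
      (∑' p, ‖f (n, p)‖) ∧ ∑' p, ‖f (n, p)‖ ≤ (z * S.card) ^ n := by
    intro n
    have h1 := ((hasSum_q S n (‖x‖ : ℂ) (‖y‖ : ℂ)).mul_right ((z : ℂ) ^ n))
    have h2 : HasSum (fun p : ℕ × ℕ => ((‖f (n, p)‖ : ℝ) : ℂ))
        (walkPoly S n (‖x‖ : ℂ) (‖y‖ : ℂ) * (z : ℂ) ^ n) := by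
      refine h1.congr_fun fun p => ?_
      simp [f, abs_of_pos hz₀]
    have h3 : Summable fun p : ℕ × ℕ => ‖f (n, p)‖ := by
      have := h2.summable
      rwa [Complex.summable_ofReal] at this
    refine ⟨h3.hasSum, ?_⟩
    have h4 : ((∑' p, ‖f (n, p)‖ : ℝ) : ℂ) = walkPoly S n (‖x‖ : ℂ) (‖y‖ : ℂ) * (z : ℂ) ^ n := by
      rw [Complex.ofReal_tsum]; exact h2.tsum_eq
    have h5 := congrArg norm h4
    rw [Complex.norm_real, Real.norm_of_nonneg (tsum_nonneg fun _ => norm_nonneg _)] at h5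
    rw [h5, norm_mul, norm_pow, Complex.norm_real, Real.norm_of_nonneg hz₀.le, mul_pow, mul_comm]
    gcongr
    exact norm_walkPoly_le S n (by simpa using hx) (by simpa using hy)
  have hsum : Summable f := by
    refine Summable.of_norm ((summable_prod_of_nonneg fun _ => norm_nonneg _).2
      ⟨fun n => (hnorm n).1.summable, ?_⟩)
    exact Summable.of_nonneg_of_le (fun n => tsum_nonneg fun _ => norm_nonneg _)
      (fun n => (hnorm n).2) (summable_geometric_of_lt_one (by positivity) hz₁)
  have hQ : Q S z x y = ∑' p, f p := by
    rw [← Equiv.tsum_eq ({ toFun := fun p => (p.2.2, p.1, p.2.1)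
                           invFun := fun p => (p.2.1, p.2.2, p.1)
                           left_inv := fun _ => rfl
                           right_inv := fun _ => rfl } : ℕ × ℕ × ℕ ≃ ℕ × (ℕ × ℕ)) f]
    rfl
  rw [hQ, hsum.tsum_prod' fun n => (hfib n).summable]
  exact tsum_congr fun n => (hfib n).tsum_eq

omit hz₀ hz₁ in
lemma K_eq_stepPoly (x y : ℂ) : K S z x y = z * stepPoly S x y - x * y := rfl

/-- The kernel form of the functional equation for the generating function. -/
theorem functional_equation (hS : IsSmallStepSet S) {x y : ℂ} (hx : ‖x‖ ≤ 1) (hy : ‖y‖ ≤ 1) :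
    K S z x y * Q S z x y = K S z x 0 * Q S z x 0 + K S z 0 y * Q S z 0 y
      - K S z 0 0 * Q S z 0 0 - x * y := by
  have h0 : ‖(0 : ℂ)‖ ≤ 1 := by simp
  have s1 := summable_walkPoly hz₀ hz₁ hx hy
  have s2 := summable_walkPoly hz₀ hz₁ hx h0
  have s3 := summable_walkPoly hz₀ hz₁ h0 hy
  have s4 := summable_walkPoly hz₀ hz₁ h0 h0
  have e : x * y * (∑' n, walkPoly S (n + 1) x y * (z : ℂ) ^ (n + 1)) =
      z * (stepPoly S x y * Q S z x y - stepPoly S x 0 * Q S z x 0 - stepPoly S 0 y * Q S z 0 y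
        + stepPoly S 0 0 * Q S z 0 0) := by
    rw [Q_eq_tsum hz₀ hz₁ hx hy, Q_eq_tsum hz₀ hz₁ hx h0, Q_eq_tsum hz₀ hz₁ h0 hy,
      Q_eq_tsum hz₀ hz₁ h0 h0]
    rw [← tsum_mul_left, ← tsum_mul_left, ← tsum_mul_left, ← tsum_mul_left, ← tsum_mul_left,
      ← (s1.mul_left _).tsum_sub (s2.mul_left _), ← ((s1.mul_left _).sub (s2.mul_left _)).tsum_sub
      (s3.mul_left _), ← (((s1.mul_left _).sub (s2.mul_left _)).sub (s3.mul_left _)).tsum_add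
      (s4.mul_left _), ← tsum_mul_left]
    refine tsum_congr fun n => ?_
    have := walkPoly_succ hS n x y
    linear_combination (z : ℂ) ^ (n + 1) * this
  have e2 : Q S z x y = 1 + ∑' n, walkPoly S (n + 1) x y * (z : ℂ) ^ (n + 1) := by
    rw [Q_eq_tsum hz₀ hz₁ hx hy, s1.tsum_eq_zero_add, walkPoly_zero]
    simp
  simp only [K_eq_stepPoly]
  linear_combination -x * y * e2 - e

lemma differentiableOn_Q_zero_right :
    DifferentiableOn ℂ (fun x => Q S z x 0) (Metric.ball 0 1) := by
  have h : DifferentiableOn ℂ (fun x => ∑' n, walkPoly S n x 0 * (z : ℂ) ^ n)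
      (Metric.ball 0 1) := by
    refine Complex.differentiableOn_tsum_of_summable_norm (u := fun n => (z * S.card) ^ n)
      (summable_geometric_of_lt_one (by positivity) hz₁) (fun n => ?_) Metric.isOpen_ball ?_
    · unfold walkPoly
      fun_prop
    · intro n x hx
      rw [norm_mul, norm_pow, Complex.norm_real, Real.norm_of_nonneg hz₀.le, mul_pow, mul_comm]
      gcongr
      exact norm_walkPoly_le S n (by simpa using (mem_ball_zero_iff.1 hx).le) (by simp)
  refine h.congr fun x hx => ?_
  exact Q_eq_tsum hz₀ hz₁ (mem_ball_zero_iff.1 hx).le (by simp)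

lemma differentiableOn_Q_zero_left :
    DifferentiableOn ℂ (fun y => Q S z 0 y) (Metric.ball 0 1) := by
  have h : DifferentiableOn ℂ (fun y => ∑' n, walkPoly S n 0 y * (z : ℂ) ^ n)
      (Metric.ball 0 1) := by
    refine Complex.differentiableOn_tsum_of_summable_norm (u := fun n => (z * S.card) ^ n)
      (summable_geometric_of_lt_one (by positivity) hz₁) (fun n => ?_) Metric.isOpen_ball ?_
    · unfold walkPoly
      fun_prop
    · intro n x hx
      rw [norm_mul, norm_pow, Complex.norm_real, Real.norm_of_nonneg hz₀.le, mul_pow, mul_comm]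
      gcongr
      exact norm_walkPoly_le S n (by simp) (by simpa using (mem_ball_zero_iff.1 hx).le)
  refine h.congr fun x hx => ?_
  exact Q_eq_tsum hz₀ hz₁ (by simp) (mem_ball_zero_iff.1 hx).le

end

end QuarterPlane

end

/-! ### Biquadratic polynomials and the branch points of the kernel -/

section

/-- A real polynomial `a(x) y² + b(x) y + c(x)` with `a`, `b`, `c` of degree at most two. -/
structure Biquad where
  a₀ : ℝ
  a₁ : ℝ
  a₂ : ℝ
  b₀ : ℝ
  b₁ : ℝ
  b₂ : ℝ
  c₀ : ℝ
  c₁ : ℝ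
  c₂ : ℝ

namespace Biquad

variable (k : Biquad)

/-- The exchange of the two variables. -/
def swap : Biquad := ⟨k.c₂, k.b₂, k.a₂, k.c₁, k.b₁, k.a₁, k.c₀, k.b₀, k.a₀⟩

/-- The substitution `x ↦ 1 / x`, with denominators cleared. -/
def rev : Biquad := ⟨k.a₂, k.a₁, k.a₀, k.b₂, k.b₁, k.b₀, k.c₂, k.c₁, k.c₀⟩

@[simp] lemma swap_swap : k.swap.swap = k := rfl

/-- The coefficient `a(x)` of `y²`. -/
noncomputable def a (x : ℝ) : ℝ := k.a₀ + k.a₁ * x + k.a₂ * x ^ 2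
/-- The coefficient `b(x)` of `y`. -/
noncomputable def b (x : ℝ) : ℝ := k.b₀ + k.b₁ * x + k.b₂ * x ^ 2
/-- The coefficient `c(x)` of `1`. -/
noncomputable def c (x : ℝ) : ℝ := k.c₀ + k.c₁ * x + k.c₂ * x ^ 2

/-- The constant coefficient of the discriminant `b² - 4 a c`. -/
noncomputable def d₀ : ℝ := k.b₀ ^ 2 - 4 * k.a₀ * k.c₀
/-- The coefficient of `x` in the discriminant. -/
noncomputable def d₁ : ℝ := 2 * k.b₀ * k.b₁ - 4 * (k.a₀ * k.c₁ + k.a₁ * k.c₀)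
/-- The coefficient of `x²` in the discriminant. -/
noncomputable def d₂ : ℝ :=
  k.b₁ ^ 2 + 2 * k.b₀ * k.b₂ - 4 * (k.a₀ * k.c₂ + k.a₁ * k.c₁ + k.a₂ * k.c₀)
/-- The coefficient of `x³` in the discriminant. -/
noncomputable def d₃ : ℝ := 2 * k.b₁ * k.b₂ - 4 * (k.a₁ * k.c₂ + k.a₂ * k.c₁)
/-- The coefficient of `x⁴` in the discriminant. -/
noncomputable def d₄ : ℝ := k.b₂ ^ 2 - 4 * k.a₂ * k.c₂

/-- The discriminant as a function. -/
noncomputable def disc (x : ℝ) : ℝ :=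
  k.d₀ + k.d₁ * x + k.d₂ * x ^ 2 + k.d₃ * x ^ 3 + k.d₄ * x ^ 4

lemma disc_eq (x : ℝ) : k.disc x = k.b x ^ 2 - 4 * k.a x * k.c x := by
  simp only [disc, d₀, d₁, d₂, d₃, d₄, a, b, c]; ring

/-- The quadratic invariants of the two discriminants of a biquadratic polynomial agree. -/
lemma invariant₂_swap : k.swap.d₂ ^ 2 - 3 * k.swap.d₁ * k.swap.d₃ + 12 * k.swap.d₀ * k.swap.d₄ =
    k.d₂ ^ 2 - 3 * k.d₁ * k.d₃ + 12 * k.d₀ * k.d₄ := by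
  simp only [d₀, d₁, d₂, d₃, d₄, swap]; ring

/-- The cubic invariants of the two discriminants of a biquadratic polynomial agree. -/
lemma invariant₃_swap : 2 * k.swap.d₂ ^ 3 - 9 * k.swap.d₁ * k.swap.d₂ * k.swap.d₃
    + 27 * k.swap.d₀ * k.swap.d₃ ^ 2 + 27 * k.swap.d₁ ^ 2 * k.swap.d₄
    - 72 * k.swap.d₀ * k.swap.d₂ * k.swap.d₄ =
    2 * k.d₂ ^ 3 - 9 * k.d₁ * k.d₂ * k.d₃ + 27 * k.d₀ * k.d₃ ^ 2 + 27 * k.d₁ ^ 2 * k.d₄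
    - 72 * k.d₀ * k.d₂ * k.d₄ := by
  simp only [d₀, d₁, d₂, d₃, d₄, swap]; ring

/-- The properties of the kernel of a non-singular walk that are used below: the coefficients other
than that of `x y` are `0` or `z`, and for each of the eight principal directions there is a step in
the opposite open half-plane. -/
structure IsWalk (z : ℝ) : Prop where
  z_pos : 0 < z
  a₀ : k.a₀ = 0 ∨ k.a₀ = z
  a₁ : k.a₁ = 0 ∨ k.a₁ = z
  a₂ : k.a₂ = 0 ∨ k.a₂ = z
  b₀ : k.b₀ = 0 ∨ k.b₀ = z
  b₁ : k.b₁ = -1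
  b₂ : k.b₂ = 0 ∨ k.b₂ = z
  c₀ : k.c₀ = 0 ∨ k.c₀ = z
  c₁ : k.c₁ = 0 ∨ k.c₁ = z
  c₂ : k.c₂ = 0 ∨ k.c₂ = z
  sum_lt : k.a₀ + k.a₁ + k.a₂ + k.b₀ + k.b₂ + k.c₀ + k.c₁ + k.c₂ < 1
  south : ¬ (k.c₀ = 0 ∧ k.c₁ = 0 ∧ k.c₂ = 0)
  north : ¬ (k.a₀ = 0 ∧ k.a₁ = 0 ∧ k.a₂ = 0)
  west : ¬ (k.a₀ = 0 ∧ k.b₀ = 0 ∧ k.c₀ = 0)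
  east : ¬ (k.a₂ = 0 ∧ k.b₂ = 0 ∧ k.c₂ = 0)
  southwest : ¬ (k.b₀ = 0 ∧ k.c₀ = 0 ∧ k.c₁ = 0)
  northwest : ¬ (k.b₀ = 0 ∧ k.a₀ = 0 ∧ k.a₁ = 0)
  southeast : ¬ (k.b₂ = 0 ∧ k.c₂ = 0 ∧ k.c₁ = 0)
  northeast : ¬ (k.b₂ = 0 ∧ k.a₂ = 0 ∧ k.a₁ = 0)

variable {k} {z : ℝ}

namespace IsWalk

variable (h : k.IsWalk z)
include h

lemma swap : k.swap.IsWalk z where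
  z_pos := h.z_pos
  a₀ := h.c₂
  a₁ := h.b₂
  a₂ := h.a₂
  b₀ := h.c₁
  b₁ := h.b₁
  b₂ := h.a₁
  c₀ := h.c₀
  c₁ := h.b₀
  c₂ := h.a₀
  sum_lt := by have := h.sum_lt; simp only [Biquad.swap]; linarith
  south := fun H => h.west ⟨H.2.2, H.2.1, H.1⟩
  north := fun H => h.east ⟨H.2.2, H.2.1, H.1⟩
  west := fun H => h.south ⟨H.2.2, H.2.1, H.1⟩
  east := fun H => h.north ⟨H.2.2, H.2.1, H.1⟩
  southwest := fun H => h.southwest ⟨H.2.2, H.2.1, H.1⟩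
  northwest := fun H => h.southeast ⟨H.2.2, H.2.1, H.1⟩
  southeast := fun H => h.northwest ⟨H.2.2, H.2.1, H.1⟩
  northeast := fun H => h.northeast ⟨H.2.2, H.2.1, H.1⟩

lemma rev : k.rev.IsWalk z where
  z_pos := h.z_pos
  a₀ := h.a₂
  a₁ := h.a₁
  a₂ := h.a₀
  b₀ := h.b₂
  b₁ := h.b₁
  b₂ := h.b₀
  c₀ := h.c₂
  c₁ := h.c₁
  c₂ := h.c₀
  sum_lt := by have := h.sum_lt; simp only [Biquad.rev]; linarith
  south := fun H => h.south ⟨H.2.2, H.2.1, H.1⟩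
  north := fun H => h.north ⟨H.2.2, H.2.1, H.1⟩
  west := h.east
  east := h.west
  southwest := h.southeast
  northwest := h.northeast
  southeast := h.southwest
  northeast := h.northwest

lemma nonneg {t : ℝ} (ht : t = 0 ∨ t = z) : 0 ≤ t := by
  have := h.z_pos
  rcases ht with ht | ht <;> rw [ht]
  exact this.le

lemma a_pos {t : ℝ} (ht : 0 < t) : 0 < k.a t := by
  have h0 := h.nonneg h.a₀
  have h1 := h.nonneg h.a₁
  have h2 := h.nonneg h.a₂
  have hn := h.north
  unfold a
  by_contra hle
  have e0 : 0 ≤ k.a₁ * t := by positivity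
  have e1 : 0 ≤ k.a₂ * t ^ 2 := by positivity
  refine hn ⟨by linarith, ?_, ?_⟩
  · have : k.a₁ * t = 0 := by linarith
    exact (mul_eq_zero.1 this).resolve_right ht.ne'
  · have : k.a₂ * t ^ 2 = 0 := by linarith
    exact (mul_eq_zero.1 this).resolve_right (by positivity)

lemma c_pos {t : ℝ} (ht : 0 < t) : 0 < k.c t := by
  have h0 := h.nonneg h.c₀
  have h1 := h.nonneg h.c₁
  have h2 := h.nonneg h.c₂
  have hn := h.south
  unfold c
  by_contra hle
  have e0 : 0 ≤ k.c₁ * t := by positivity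
  have e1 : 0 ≤ k.c₂ * t ^ 2 := by positivity
  refine hn ⟨by linarith, ?_, ?_⟩
  · have : k.c₁ * t = 0 := by linarith
    exact (mul_eq_zero.1 this).resolve_right ht.ne'
  · have : k.c₂ * t ^ 2 = 0 := by linarith
    exact (mul_eq_zero.1 this).resolve_right (by positivity)

lemma disc_one_pos : 0 < k.disc 1 := by
  have h0 := h.nonneg h.a₀
  have h1 := h.nonneg h.a₁
  have h2 := h.nonneg h.a₂
  have h3 := h.nonneg h.c₀
  have h4 := h.nonneg h.c₁
  have h5 := h.nonneg h.c₂
  have hs := h.sum_lt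
  rw [disc_eq]
  simp only [a, b, c, h.b₁]
  nlinarith [sq_nonneg ((k.a₀ + k.a₁ + k.a₂) - (k.c₀ + k.c₁ + k.c₂))]

lemma disc_neg_one_pos : 0 < k.disc (-1) := by
  have h0 := h.nonneg h.a₀
  have h1 := h.nonneg h.a₁
  have h2 := h.nonneg h.a₂
  have h3 := h.nonneg h.c₀
  have h4 := h.nonneg h.c₁
  have h5 := h.nonneg h.c₂
  have h6 := h.nonneg h.b₀
  have h7 := h.nonneg h.b₂
  have hs := h.sum_lt
  rw [disc_eq]
  simp only [a, b, c, h.b₁]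
  have hb : 1 ≤ (k.b₀ + -1 * -1 + k.b₂ * (-1) ^ 2) ^ 2 := by nlinarith
  have hac : 4 * (k.a₀ + k.a₁ * -1 + k.a₂ * (-1) ^ 2) * (k.c₀ + k.c₁ * -1 + k.c₂ * (-1) ^ 2) ≤
      4 * (k.a₀ + k.a₁ + k.a₂) * (k.c₀ + k.c₁ + k.c₂) := by
    have e1 := mul_nonneg h0 h4
    have e2 := mul_nonneg h1 h3
    have e3 := mul_nonneg h1 h5
    have e4 := mul_nonneg h2 h4
    nlinarith
  nlinarith [sq_nonneg ((k.a₀ + k.a₁ + k.a₂) - (k.c₀ + k.c₁ + k.c₂))]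

omit h in
lemma continuous_disc : Continuous k.disc := by unfold disc; fun_prop

/-- The discriminant is negative somewhere in `(0, 1)`; if `b(0) ≠ 0`, this happens at a zero of
`b`. -/
lemma exists_disc_neg : ∃ p, 0 < p ∧ p < 1 ∧ k.disc p < 0 ∧ (k.b₀ ≠ 0 → k.b p = 0) := by
  have hz := h.z_pos
  by_cases hb : k.b₀ = 0
  · simp only [hb, ne_eq, not_true_eq_false, false_imp_iff, and_true]
    have small : ∀ {f : ℝ → ℝ}, Continuous f → f 0 < 0 → ∃ p, 0 < p ∧ p < 1 ∧ f p < 0 := by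
      intro f hf h0
      have h1 : ∀ᶠ p in nhdsWithin (0 : ℝ) (Set.Ioi 0), f p < 0 :=
        (hf.continuousAt.eventually_lt_const h0).filter_mono nhdsWithin_le_nhds
      obtain ⟨p, hp, hp'⟩ := (h1.and (Ioo_mem_nhdsGT (zero_lt_one' ℝ))).exists
      exact ⟨p, hp'.1, hp'.2, hp⟩
    have hd0 : k.d₀ = -4 * k.a₀ * k.c₀ := by simp only [d₀, hb]; ring
    by_cases hac : k.d₀ = 0
    · have hd1 : k.d₁ < 0 := by
        simp only [d₁, hb]
        rcases h.a₀ with ha | ha <;> rcases h.c₀ with hc | hc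
        · exact absurd ⟨ha, hb, hc⟩ h.west
        · have := h.northwest
          have ha1 : k.a₁ = z := h.a₁.resolve_left fun h1 => this ⟨hb, ha, h1⟩
          rw [ha, hc, ha1]; nlinarith
        · have := h.southwest
          have hc1 : k.c₁ = z := h.c₁.resolve_left fun h1 => this ⟨hb, hc, h1⟩
          rw [ha, hc, hc1]; nlinarith
        · rw [hd0, ha, hc] at hac
          nlinarith
      obtain ⟨p, hp0, hp1, hp⟩ := small
        (f := fun x => k.d₁ + k.d₂ * x + k.d₃ * x ^ 2 + k.d₄ * x ^ 3) (by fun_prop) (by simpa)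
      refine ⟨p, hp0, hp1, ?_⟩
      have : k.disc p = p * (k.d₁ + k.d₂ * p + k.d₃ * p ^ 2 + k.d₄ * p ^ 3) := by
        simp only [disc, hac]; ring
      rw [this]
      exact mul_neg_of_pos_of_neg hp0 hp
    · refine small continuous_disc ?_
      have h0 := h.nonneg h.a₀
      have h3 := h.nonneg h.c₀
      have : k.disc 0 = k.d₀ := by simp [disc]
      rw [this]
      refine lt_of_le_of_ne ?_ hac
      rw [hd0]
      nlinarith [mul_nonneg h0 h3]
  · have hb0 : 0 < k.b₀ := lt_of_le_of_ne (h.nonneg h.b₀) (Ne.symm hb)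
    have hb1 : k.b 1 < 0 := by
      have h0 := h.nonneg h.a₀
      have h1 := h.nonneg h.a₁
      have h2 := h.nonneg h.a₂
      have h3 := h.nonneg h.c₀
      have h4 := h.nonneg h.c₁
      have h5 := h.nonneg h.c₂
      have hs := h.sum_lt
      simp only [b, h.b₁]
      linarith
    have hcont : ContinuousOn k.b (Set.Icc 0 1) := by unfold b; fun_prop
    obtain ⟨p, hp, hpb⟩ := intermediate_value_Ioo' (zero_le_one' ℝ) hcont
      (show (0 : ℝ) ∈ Set.Ioo (k.b 1) (k.b 0) from ⟨hb1, by simpa [b] using hb0⟩)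
    refine ⟨p, hp.1, hp.2, ?_, fun _ => hpb⟩
    rw [disc_eq, hpb]
    have := h.a_pos hp.1
    have := h.c_pos hp.1
    nlinarith [mul_pos (h.a_pos hp.1) (h.c_pos hp.1)]

lemma exists_roots : ∃ t₁ t₂, -1 < t₁ ∧ t₁ < t₂ ∧ t₂ < 1 ∧ 0 < t₂ ∧
    k.disc t₁ = 0 ∧ k.disc t₂ = 0 := by
  obtain ⟨p, hp0, hp1, hp, -⟩ := h.exists_disc_neg
  have hcont := continuous_disc (k := k)
  obtain ⟨t₁, ht₁, h₁⟩ := intermediate_value_Ioo' (by linarith : (-1 : ℝ) ≤ p) hcont.continuousOn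
    (show (0 : ℝ) ∈ Set.Ioo (k.disc p) (k.disc (-1)) from ⟨hp, h.disc_neg_one_pos⟩)
  obtain ⟨t₂, ht₂, h₂⟩ := intermediate_value_Ioo hp1.le hcont.continuousOn
    (show (0 : ℝ) ∈ Set.Ioo (k.disc p) (k.disc 1) from ⟨hp, h.disc_one_pos⟩)
  exact ⟨t₁, t₂, ht₁.1, ht₁.2.trans ht₂.1, ht₂.2, hp0.trans ht₂.1, h₁, h₂⟩

end IsWalk

end Biquad

/-- The branch points of a real quartic with two roots `t₁ < t₂` in `(-1, 1)` and two roots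
`1 / s₂`, `1 / s₁` outside (the last one possibly infinite), in projective normalization: the
quartic is `μ (x - t₁) (x - t₂) (1 - s₁ x) (1 - s₂ x)`. -/
structure Branch where
  μ : ℝ
  t₁ : ℝ
  t₂ : ℝ
  s₁ : ℝ
  s₂ : ℝ
  μ_pos : 0 < μ
  lt_t₁ : -1 < t₁
  t_lt : t₁ < t₂
  t₂_lt : t₂ < 1
  t₂_pos : 0 < t₂
  lt_s₁ : -1 < s₁
  s_lt : s₁ < s₂
  s₂_lt : s₂ < 1
  s₂_pos : 0 < s₂

namespace Branch

variable (β : Branch)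

lemma pos₁₁ : 0 < 1 - β.s₁ * β.t₁ := by
  nlinarith [β.lt_t₁, β.t_lt, β.t₂_lt, β.lt_s₁, β.s_lt, β.s₂_lt]
lemma pos₁₂ : 0 < 1 - β.s₁ * β.t₂ := by
  nlinarith [β.lt_t₁, β.t_lt, β.t₂_lt, β.lt_s₁, β.s_lt, β.s₂_lt]
lemma pos₂₁ : 0 < 1 - β.s₂ * β.t₁ := by
  nlinarith [β.lt_t₁, β.t_lt, β.t₂_lt, β.lt_s₁, β.s_lt, β.s₂_lt]
lemma pos₂₂ : 0 < 1 - β.s₂ * β.t₂ := by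
  nlinarith [β.lt_t₁, β.t_lt, β.t₂_lt, β.lt_s₁, β.s_lt, β.s₂_lt]

/-- The difference `e₁ - e₂` of the roots of the associated Weierstrass cubic. -/
def p : ℝ := β.μ * (β.s₂ - β.s₁) * (β.t₂ - β.t₁)

/-- The difference `e₂ - e₃` of the roots of the associated Weierstrass cubic. -/
def r : ℝ := β.μ * (1 - β.s₁ * β.t₁) * (1 - β.s₂ * β.t₂)

lemma p_pos : 0 < β.p :=
  mul_pos (mul_pos β.μ_pos (sub_pos.2 β.s_lt)) (sub_pos.2 β.t_lt)

lemma r_pos : 0 < β.r := mul_pos (mul_pos β.μ_pos β.pos₁₁) β.pos₂₂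

/-- The Weierstrass cubic of the quartic. -/
noncomputable def cubic : RealCubic where
  e₁ := (2 * β.p + β.r) / 3
  e₂ := (β.r - β.p) / 3
  e₃ := -(β.p + 2 * β.r) / 3
  lt₃₂ := by linarith [β.r_pos]
  lt₂₁ := by linarith [β.p_pos]
  sum_eq := by ring

/-- The branch points are those of the discriminant of a biquadratic polynomial. -/
structure IsBranch (k : Biquad) : Prop where
  d₀ : k.d₀ = β.μ * (β.t₁ * β.t₂)
  d₁ : k.d₁ = β.μ * (-(β.t₁ + β.t₂) - β.t₁ * β.t₂ * (β.s₁ + β.s₂))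
  d₂ : k.d₂ = β.μ * (1 + (β.t₁ + β.t₂) * (β.s₁ + β.s₂) + β.t₁ * β.t₂ * (β.s₁ * β.s₂))
  d₃ : k.d₃ = β.μ * (-(β.s₁ + β.s₂) - (β.t₁ + β.t₂) * (β.s₁ * β.s₂))
  d₄ : k.d₄ = β.μ * (β.s₁ * β.s₂)

lemma IsBranch.disc_eq {β : Branch} {k : Biquad} (h : β.IsBranch k) (x : ℝ) :
    k.disc x = β.μ * (x - β.t₁) * (x - β.t₂) * (1 - β.s₁ * x) * (1 - β.s₂ * x) := by
  rw [Biquad.disc, h.d₀, h.d₁, h.d₂, h.d₃, h.d₄]; ring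

/-- The elementary symmetric functions of `e₁, e₂, e₃` are invariants of the quartic. -/
lemma IsBranch.e_sum_mul {β : Branch} {k : Biquad} (h : β.IsBranch k) :
    β.cubic.e₁ * β.cubic.e₂ + β.cubic.e₁ * β.cubic.e₃ + β.cubic.e₂ * β.cubic.e₃ =
      -(k.d₂ ^ 2 - 3 * k.d₁ * k.d₃ + 12 * k.d₀ * k.d₄) / 3 := by
  rw [h.d₀, h.d₁, h.d₂, h.d₃, h.d₄]
  simp only [cubic, p, r]
  ring

lemma IsBranch.e_mul {β : Branch} {k : Biquad} (h : β.IsBranch k) :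
    β.cubic.e₁ * β.cubic.e₂ * β.cubic.e₃ =
      -(2 * k.d₂ ^ 3 - 9 * k.d₁ * k.d₂ * k.d₃ + 27 * k.d₀ * k.d₃ ^ 2 + 27 * k.d₁ ^ 2 * k.d₄
    - 72 * k.d₀ * k.d₂ * k.d₄) / 27 := by
  rw [h.d₀, h.d₁, h.d₂, h.d₃, h.d₄]
  simp only [cubic, p, r]
  ring

end Branch

lemma RealCubic.ext_of_symm {R R' : RealCubic}
    (h₂ : R.e₁ * R.e₂ + R.e₁ * R.e₃ + R.e₂ * R.e₃ = R'.e₁ * R'.e₂ + R'.e₁ * R'.e₃ + R'.e₂ * R'.e₃)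
    (h₃ : R.e₁ * R.e₂ * R.e₃ = R'.e₁ * R'.e₂ * R'.e₃) : R = R' := by
  have hle : ∀ {R R' : RealCubic}, R.e₁ * R.e₂ + R.e₁ * R.e₃ + R.e₂ * R.e₃ =
      R'.e₁ * R'.e₂ + R'.e₁ * R'.e₃ + R'.e₂ * R'.e₃ → R.e₁ * R.e₂ * R.e₃ = R'.e₁ * R'.e₂ * R'.e₃ →
      R.e₁ ≤ R'.e₁ ∧ R'.e₃ ≤ R.e₃ := by
    intro R R' h₂ h₃
    have hX : ∀ X : ℝ, (X - R.e₁) * (X - R.e₂) * (X - R.e₃) =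
        (X - R'.e₁) * (X - R'.e₂) * (X - R'.e₃) := fun X => by
      linear_combination X ^ 2 * (R'.sum_eq - R.sum_eq) + X * h₂ - h₃
    have a := R'.lt₃₂
    have b := R'.lt₂₁
    constructor
    · have := hX R.e₁
      rw [sub_self, zero_mul, zero_mul, eq_comm, mul_eq_zero, mul_eq_zero] at this
      rcases this with (h | h) | h <;> linarith
    · have := hX R.e₃
      rw [sub_self, mul_zero, eq_comm, mul_eq_zero, mul_eq_zero] at this
      rcases this with (h | h) | h <;> linarith
  have l := hle h₂ h₃
  have l' := hle h₂.symm h₃.symm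
  have s := R.sum_eq
  have s' := R'.sum_eq
  cases R
  cases R'
  simp only [RealCubic.mk.injEq] at *
  refine ⟨?_, ?_, ?_⟩ <;> linarith

/-- The two discriminants of a biquadratic polynomial have the same Weierstrass cubic. -/
theorem Branch.IsBranch.cubic_eq {β β' : Branch} {k : Biquad} (h : β.IsBranch k)
    (h' : β'.IsBranch k.swap) : β'.cubic = β.cubic := by
  apply RealCubic.ext_of_symm
  · rw [h.e_sum_mul, h'.e_sum_mul, k.invariant₂_swap]
  · rw [h.e_mul, h'.e_mul, k.invariant₃_swap]

lemma Biquad.IsWalk.exists_branch {k : Biquad} {z : ℝ} (h : k.IsWalk z) :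
    ∃ β : Branch, β.IsBranch k := by
  obtain ⟨t₁, t₂, ht₁, ht, ht₂, ht₀, h₁, h₂⟩ := h.exists_roots
  obtain ⟨s₁, s₂, hs₁, hs, hs₂, hs₀, g₁, g₂⟩ := h.rev.exists_roots
  have e0 : k.rev.d₀ = k.d₄ := by simp only [Biquad.rev, Biquad.d₀, Biquad.d₄]
  have e1 : k.rev.d₁ = k.d₃ := by simp only [Biquad.rev, Biquad.d₁, Biquad.d₃]; ring
  have e2 : k.rev.d₂ = k.d₂ := by simp only [Biquad.rev, Biquad.d₂]; ring
  have e3 : k.rev.d₃ = k.d₁ := by simp only [Biquad.rev, Biquad.d₁, Biquad.d₃]; ring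
  have e4 : k.rev.d₄ = k.d₀ := by simp only [Biquad.rev, Biquad.d₀, Biquad.d₄]
  simp only [Biquad.disc, e0, e1, e2, e3, e4] at h₁ h₂ g₁ g₂
  have hpos := h.disc_one_pos
  rw [Biquad.disc] at hpos
  generalize hd0 : k.d₀ = d0 at *
  generalize hd1 : k.d₁ = d1 at *
  generalize hd2 : k.d₂ = d2 at *
  generalize hd3 : k.d₃ = d3 at *
  generalize hd4 : k.d₄ = d4 at *
  -- the coefficients of the quotient by `(x - t₁) (x - t₂)`
  set q1 := d3 + d4 * (t₁ + t₂) with hq1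
  set q0 := d2 + (t₁ + t₂) * q1 - t₁ * t₂ * d4 with hq0
  have hne : t₁ - t₂ ≠ 0 := by linarith
  have f1 : d1 = -(t₁ + t₂) * q0 + t₁ * t₂ * q1 := by
    apply mul_left_cancel₀ hne
    rw [hq0, hq1]
    linear_combination h₁ - h₂
  have f0 : d0 = t₁ * t₂ * q0 := by
    rw [f1] at h₁
    have : d0 = -((-(t₁ + t₂) * q0 + t₁ * t₂ * q1) * t₁ + d2 * t₁ ^ 2 + d3 * t₁ ^ 3
      + d4 * t₁ ^ 4) := by linear_combination h₁
    rw [this, hq0, hq1]; ring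
  have hroot : ∀ s, -1 < s → s < 1 → d4 + d3 * s + d2 * s ^ 2 + d1 * s ^ 3 + d0 * s ^ 4 = 0 →
      q0 * s ^ 2 + q1 * s + d4 = 0 := by
    intro s hs1 hs2 hs
    have a1 : 1 - s * t₁ ≠ 0 := by nlinarith
    have a2 : 1 - s * t₂ ≠ 0 := by nlinarith
    apply mul_left_cancel₀ (mul_ne_zero a1 a2)
    rw [f0, f1] at hs
    rw [mul_zero, ← hs, hq0, hq1]; ring
  have r1 := hroot s₁ hs₁ (by linarith) g₁
  have r2 := hroot s₂ (by linarith) hs₂ g₂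
  have hne' : s₁ - s₂ ≠ 0 := by linarith
  have k1 : q1 = -q0 * (s₁ + s₂) := by
    apply mul_left_cancel₀ hne'
    linear_combination r1 - r2
  have k2 : d4 = q0 * (s₁ * s₂) := by
    rw [k1] at r1
    linear_combination r1
  have k3 : d3 = -q0 * (s₁ + s₂) - d4 * (t₁ + t₂) := by rw [← k1, hq1]; ring
  have k4 : d2 = q0 - (t₁ + t₂) * q1 + t₁ * t₂ * d4 := by rw [hq0]; ring
  have hμ : 0 < q0 := by
    have : d0 + d1 * 1 + d2 * 1 ^ 2 + d3 * 1 ^ 3 + d4 * 1 ^ 4 =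
        q0 * ((1 - t₁) * (1 - t₂) * (1 - s₁) * (1 - s₂)) := by
      rw [f0, f1, k4, k3, k2, k1]; ring
    rw [this] at hpos
    have hp : 0 < (1 - t₁) * (1 - t₂) * (1 - s₁) * (1 - s₂) := by
      have := sub_pos.2 ht₂
      have := sub_pos.2 hs₂
      have : 0 < 1 - t₁ := by linarith
      have : 0 < 1 - s₁ := by linarith
      positivity
    exact pos_of_mul_pos_left hpos hp.le
  clear_value q0 q1
  refine ⟨⟨q0, t₁, t₂, s₁, s₂, hμ, ht₁, ht, ht₂, ht₀, hs₁, hs, hs₂, hs₀⟩, ?_, ?_, ?_, ?_, ?_⟩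
  · simp only; rw [hd0, f0]; ring
  · simp only; rw [hd1, f1, k1]; ring
  · simp only; rw [hd2, k4, k1, k2]; ring
  · simp only; rw [hd3, k3, k2]; ring
  · simp only; rw [hd4, k2]

end

/-! ### The coordinate of the Weierstrass cubic -/

section

namespace Branch

variable (β : Branch)

/-- The Möbius transformation `u ↦ (u + B) / (s₁ u + D)` sends the roots `e₁, e₂, e₃, ∞` of the
Weierstrass cubic to the branch points `t₁, t₂, 1 / s₂, 1 / s₁`. -/
noncomputable def B : ℝ :=
  -β.cubic.e₂ - β.t₂ * (β.μ * (β.s₂ - β.s₁) * (1 - β.s₁ * β.t₁))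

/-- The constant term of the denominator of the Möbius transformation `u ↦ (u + B) / (s₁ u + D)`. -/
noncomputable def D : ℝ :=
  -β.s₁ * β.cubic.e₂ - β.μ * (β.s₂ - β.s₁) * (1 - β.s₁ * β.t₁)

/-- The determinant of the Möbius transformation. -/
noncomputable def det : ℝ := β.D - β.s₁ * β.B

lemma det_eq : β.det = -(β.μ * (β.s₂ - β.s₁) * (1 - β.s₁ * β.t₁) * (1 - β.s₁ * β.t₂)) := by
  simp only [det, B, D]; ring

lemma det_neg : β.det < 0 := by
  have h1 := β.μ_pos
  have h2 := sub_pos.2 β.s_lt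
  have h3 := β.pos₁₁
  have h4 := β.pos₁₂
  rw [det_eq, neg_lt_zero]
  positivity

lemma B_sub₁ : β.B - β.t₁ * β.D = -(1 - β.s₁ * β.t₁) * β.cubic.e₁ := by
  simp only [B, D, cubic, p, r]; ring

lemma B_sub₂ : β.B - β.t₂ * β.D = -(1 - β.s₁ * β.t₂) * β.cubic.e₂ := by
  simp only [B, D, cubic, p, r]; ring

lemma D_sub₃ : β.D - β.s₂ * β.B = (β.s₂ - β.s₁) * β.cubic.e₃ := by
  simp only [B, D, cubic, p, r]; ring

lemma den_e₁_neg : β.s₁ * β.cubic.e₁ + β.D < 0 := by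
  have h := β.B_sub₁
  have hd := β.det_neg
  have : (β.s₁ * β.cubic.e₁ + β.D) * (1 - β.s₁ * β.t₁) = β.det := by
    rw [det]; linear_combination β.s₁ * h
  rw [← this] at hd
  exact neg_of_mul_neg_left hd β.pos₁₁.le

lemma den_e₂_neg : β.s₁ * β.cubic.e₂ + β.D < 0 := by
  have h := β.B_sub₂
  have hd := β.det_neg
  have : (β.s₁ * β.cubic.e₂ + β.D) * (1 - β.s₁ * β.t₂) = β.det := by
    rw [det]; linear_combination β.s₁ * h
  rw [← this] at hd
  exact neg_of_mul_neg_left hd β.pos₁₂.le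

lemma num_e₁ : β.cubic.e₁ + β.B = β.t₁ * (β.s₁ * β.cubic.e₁ + β.D) := by
  linear_combination β.B_sub₁

lemma num_e₂ : β.cubic.e₂ + β.B = β.t₂ * (β.s₁ * β.cubic.e₂ + β.D) := by
  linear_combination β.B_sub₂

lemma den_e₃ : β.s₁ * β.cubic.e₃ + β.D = β.s₂ * (β.cubic.e₃ + β.B) := by
  linear_combination β.D_sub₃

lemma num_e₃_neg : β.cubic.e₃ + β.B < 0 := by
  have h := β.D_sub₃
  have hd := β.det_neg
  have : (β.cubic.e₃ + β.B) * (β.s₂ - β.s₁) = β.det := by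
    rw [det]; linear_combination -h
  rw [← this] at hd
  exact neg_of_mul_neg_left hd (sub_pos.2 β.s_lt).le

lemma den_e₃_neg : β.s₁ * β.cubic.e₃ + β.D < 0 := by
  rw [den_e₃]
  exact mul_neg_of_pos_of_neg β.s₂_pos β.num_e₃_neg

/-- The roots of a quartic with four different branch points are simple. -/
lemma IsBranch.deriv_ne_zero {β : Branch} {k : Biquad} (h : β.IsBranch k) {x : ℝ}
    (hx : k.disc x = 0) : k.d₁ + 2 * k.d₂ * x + 3 * k.d₃ * x ^ 2 + 4 * k.d₄ * x ^ 3 ≠ 0 := by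
  rw [h.disc_eq] at hx
  have hμ := β.μ_pos.ne'
  have e : k.d₁ + 2 * k.d₂ * x + 3 * k.d₃ * x ^ 2 + 4 * k.d₄ * x ^ 3 =
      β.μ * ((x - β.t₂) * (1 - β.s₁ * x) * (1 - β.s₂ * x)
      + (x - β.t₁) * (1 - β.s₁ * x) * (1 - β.s₂ * x)
      - β.s₁ * ((x - β.t₁) * (x - β.t₂) * (1 - β.s₂ * x))
      - β.s₂ * ((x - β.t₁) * (x - β.t₂) * (1 - β.s₁ * x))) := by
    rw [h.d₁, h.d₂, h.d₃, h.d₄]; ring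
  rw [e]
  have a1 := β.pos₁₁.ne'
  have a2 := β.pos₁₂.ne'
  have a3 := β.pos₂₁.ne'
  have a4 := β.pos₂₂.ne'
  have ht := (sub_pos.2 β.t_lt).ne'
  have ht' := (sub_neg.2 β.t_lt).ne
  have hs := (sub_pos.2 β.s_lt).ne'
  refine mul_ne_zero hμ ?_
  rcases mul_eq_zero.1 hx with hx | hx
  · rcases mul_eq_zero.1 hx with hx | hx
    · rcases mul_eq_zero.1 hx with hx | hx
      · have : x = β.t₁ := by
          linear_combination (mul_eq_zero.1 hx).resolve_left hμ
        subst this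
        simp [ht', a1, a3]
      · have : x = β.t₂ := by linear_combination hx
        subst this
        simp [ht, a2, a4]
    · rw [hx]
      have hs1 : β.s₁ ≠ 0 := fun h0 => by rw [h0] at hx; norm_num at hx
      have hx' : x = 1 / β.s₁ := by field_simp; linear_combination -hx
      have e1 : x - β.t₁ ≠ 0 := fun h0 => a1 (by
        rw [sub_eq_zero.1 h0] at hx; exact hx)
      have e2 : x - β.t₂ ≠ 0 := fun h0 => a2 (by
        rw [sub_eq_zero.1 h0] at hx; exact hx)
      have e3 : 1 - β.s₂ * x ≠ 0 := fun h0 => hs (by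
        rw [hx'] at h0; field_simp at h0; linear_combination -h0)
      simp [hs1, e1, e2, e3]
  · rw [hx]
    have hs1 : β.s₂ ≠ 0 := β.s₂_pos.ne'
    have hx' : x = 1 / β.s₂ := by field_simp; linear_combination -hx
    have e1 : x - β.t₁ ≠ 0 := fun h0 => a3 (by
      rw [sub_eq_zero.1 h0] at hx; exact hx)
    have e2 : x - β.t₂ ≠ 0 := fun h0 => a4 (by
      rw [sub_eq_zero.1 h0] at hx; exact hx)
    have e3 : 1 - β.s₁ * x ≠ 0 := fun h0 => hs (by
      rw [hx'] at h0; field_simp at h0; linear_combination h0)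
    simp [hs1, e1, e2, e3]

end Branch

namespace Biquad

variable {k : Biquad} {z : ℝ}

/-- At the left branch point `t₁` the coefficient `b` is nonnegative. -/
lemma IsWalk.b_t₁_nonneg (h : k.IsWalk z) {β : Branch} (hβ : β.IsBranch k) : 0 ≤ k.b β.t₁ := by
  have h0 := h.nonneg h.b₀
  have h2 := h.nonneg h.b₂
  by_cases hb : k.b₀ = 0
  · have hd : k.d₀ ≤ 0 := by
      have := mul_nonneg (h.nonneg h.a₀) (h.nonneg h.c₀)
      simp only [d₀, hb]; nlinarith
    rw [hβ.d₀] at hd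
    have : β.t₁ ≤ 0 := by
      by_contra! hlt
      have := mul_pos β.μ_pos (mul_pos hlt β.t₂_pos)
      linarith
    simp only [b, hb, h.b₁]
    nlinarith [mul_nonneg h2 (sq_nonneg β.t₁)]
  · obtain ⟨p, hp0, hp1, hp, hbp⟩ := h.exists_disc_neg
    have hbp := hbp hb
    have hlt : β.t₁ < p := by
      by_contra! hle
      rw [hβ.disc_eq] at hp
      have e1 := β.t_lt
      have e2 := β.s_lt
      have e3 : 0 < 1 - β.s₁ * p := by nlinarith [β.lt_s₁, β.s₂_lt]
      have e4 : 0 < 1 - β.s₂ * p := by nlinarith [β.lt_s₁, β.s₂_lt]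
      have : 0 ≤ β.μ * (p - β.t₁) * (p - β.t₂) * (1 - β.s₁ * p) * (1 - β.s₂ * p) := by
        have e5 : 0 ≤ (p - β.t₁) * (p - β.t₂) :=
          mul_nonneg_of_nonpos_of_nonpos (by linarith) (by linarith)
        have := β.μ_pos
        rw [mul_assoc β.μ]
        positivity
      linarith
    by_contra! hneg
    have hb1 : k.b 1 < 0 := by
      have h0 := h.nonneg h.a₀
      have h1 := h.nonneg h.a₁
      have h2 := h.nonneg h.a₂
      have h3 := h.nonneg h.c₀
      have h4 := h.nonneg h.c₁
      have h5 := h.nonneg h.c₂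
      have hs := h.sum_lt
      simp only [b, h.b₁]
      linarith
    -- `b` is convex, negative at `t₁` and at `1`, so it is negative at `p` in between
    have hconv : (1 - β.t₁) * k.b p ≤ (1 - p) * k.b β.t₁ + (p - β.t₁) * k.b 1 := by
      have : (1 - p) * k.b β.t₁ + (p - β.t₁) * k.b 1 - (1 - β.t₁) * k.b p =
          k.b₂ * ((1 - p) * (p - β.t₁) * (1 - β.t₁)) := by
        simp only [b]; ring
      have h6 : 0 < 1 - p := by linarith
      have h7 : 0 < p - β.t₁ := by linarith
      have h8 : 0 < 1 - β.t₁ := by linarith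
      have : 0 ≤ k.b₂ * ((1 - p) * (p - β.t₁) * (1 - β.t₁)) := by positivity
      linarith
    rw [hbp, mul_zero] at hconv
    nlinarith

/-- At the left branch point `t₁` the coefficient `a` is nonnegative. -/
lemma IsWalk.a_t₁_nonneg (h : k.IsWalk z) {β : Branch} (hβ : β.IsBranch k) : 0 ≤ k.a β.t₁ := by
  have h0 := h.nonneg h.a₀
  have h1 := h.nonneg h.a₁
  have h2 := h.nonneg h.a₂
  have hb0 := h.nonneg h.b₀
  have hb2 := h.nonneg h.b₂
  rcases le_or_gt 0 β.t₁ with ht | ht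
  · unfold a; positivity
  have hd : k.d₀ < 0 := by
    rw [hβ.d₀]
    exact mul_neg_of_pos_of_neg β.μ_pos (mul_neg_of_neg_of_pos ht β.t₂_pos)
  have ha0 : 0 < k.a₀ := by
    refine lt_of_le_of_ne h0 fun h' => ?_
    simp only [d₀, ← h'] at hd
    nlinarith [sq_nonneg k.b₀]
  by_contra! hneg
  have hcont : ContinuousOn k.a (Set.Icc β.t₁ 0) := by unfold a; fun_prop
  obtain ⟨p, hp, hpa⟩ := intermediate_value_Ioo ht.le hcont
    (show (0 : ℝ) ∈ Set.Ioo (k.a β.t₁) (k.a 0) from ⟨hneg, by simpa [a] using ha0⟩)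
  have hb : 0 < k.b p := by
    simp only [b, h.b₁]
    nlinarith [hp.2, mul_nonneg hb2 (sq_nonneg p)]
  have hd1 : 0 < k.disc p := by rw [disc_eq, hpa]; nlinarith
  have hd2 : k.disc p ≤ 0 := by
    rw [hβ.disc_eq]
    have e1 := β.t₂_pos
    have e3 : 0 < 1 - β.s₁ * p := by nlinarith [β.lt_s₁, β.s₂_lt, β.s_lt, β.lt_t₁, hp.1, hp.2]
    have e4 : 0 < 1 - β.s₂ * p := by nlinarith [β.lt_s₁, β.s₂_lt, β.s_lt, β.lt_t₁, hp.1, hp.2]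
    have e5 : (p - β.t₁) * (p - β.t₂) ≤ 0 :=
      mul_nonpos_of_nonneg_of_nonpos (by linarith [hp.1]) (by linarith [hp.2])
    have := β.μ_pos
    rw [mul_assoc β.μ]
    exact mul_nonpos_of_nonpos_of_nonneg (mul_nonpos_of_nonpos_of_nonneg
      (mul_nonpos_of_nonneg_of_nonpos this.le e5) e3.le) e4.le
  linarith

/-- The parameter `u > e₁` of the point `X(y₁)`: in the coordinate `u` of the Weierstrass cubic, the
point `X(y₁)` lies between `e₁` and `∞`. In the first case `X(y₁) = ∞`. -/
theorem IsWalk.exists_param (h : k.IsWalk z) {β β' : Branch} (hβ : β.IsBranch k)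
    (hβ' : β'.IsBranch k.swap) : ∃ u, β.cubic.e₁ < u ∧
      ((k.swap.a β'.t₁ = 0 ∧ k.swap.b β'.t₁ = 0 ∧ β.s₁ * u + β.D = 0) ∨
        (k.swap.a β'.t₁ ≠ 0 ∧ β.s₁ * u + β.D < 0 ∧
          -k.swap.b β'.t₁ / (2 * k.swap.a β'.t₁) < β.t₁ ∧
          u + β.B = -k.swap.b β'.t₁ / (2 * k.swap.a β'.t₁) * (β.s₁ * u + β.D))) := by
  have hb := h.swap.b_t₁_nonneg hβ'
  have ha := h.swap.a_t₁_nonneg hβ'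
  have hdisc : k.swap.disc β'.t₁ = 0 := by rw [hβ'.disc_eq]; ring
  rw [disc_eq] at hdisc
  set y := β'.t₁
  have hdet := β.det_neg
  by_cases ha0 : k.swap.a y = 0
  · have hb0 : k.swap.b y = 0 := by
      rw [ha0] at hdisc
      have : k.swap.b y ^ 2 = 0 := by linear_combination hdisc
      exact pow_eq_zero_iff two_ne_zero |>.1 this
    have ea : k.c₂ + k.b₂ * y + k.a₂ * y ^ 2 = 0 := ha0
    have eb : k.c₁ + k.b₁ * y + k.a₁ * y ^ 2 = 0 := hb0
    have hd4 : k.d₄ = (2 * k.a₂ * y + k.b₂) ^ 2 := by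
      simp only [d₄]; linear_combination -4 * k.a₂ * ea
    have hd4' : 0 < k.d₄ := by
      refine lt_of_le_of_ne (by rw [hd4]; positivity) fun h0 => ?_
      have hz : 2 * k.a₂ * y + k.b₂ = 0 := by
        rw [← h0] at hd4
        exact pow_eq_zero_iff two_ne_zero |>.1 hd4.symm
      have hd3 : k.d₃ = 0 := by
        simp only [d₃]
        linear_combination (2 * k.b₁ + 4 * k.a₁ * y) * hz - 4 * k.a₁ * ea - 4 * k.a₂ * eb
      rw [hβ.d₄] at h0
      rw [hβ.d₃] at hd3
      have hs1 : β.s₁ = 0 := by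
        have := mul_eq_zero.1 ((mul_eq_zero.1 h0.symm).resolve_left β.μ_pos.ne')
        exact this.resolve_right β.s₂_pos.ne'
      rw [hs1] at hd3
      have := mul_pos β.μ_pos β.s₂_pos
      linarith
    have hs1 : 0 < β.s₁ := by
      rw [hβ.d₄] at hd4'
      exact pos_of_mul_pos_left (pos_of_mul_pos_right hd4' β.μ_pos.le) β.s₂_pos.le
    refine ⟨-β.D / β.s₁, ?_, Or.inl ⟨ha0, hb0, by field_simp; ring⟩⟩
    rw [lt_div_iff₀ hs1]
    have := β.den_e₁_neg
    linarith
  · have ha1 : 0 < k.swap.a y := lt_of_le_of_ne ha (Ne.symm ha0)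
    obtain ⟨x, hx⟩ : ∃ x, x = -k.swap.b y / (2 * k.swap.a y) := ⟨_, rfl⟩
    have hx0 : x ≤ 0 := by
      rw [hx]; exact div_nonpos_of_nonpos_of_nonneg (by linarith) (by linarith)
    rw [← hx]
    have hxb : k.swap.b y = -2 * k.swap.a y * x := by rw [hx]; field_simp
    have hxc : k.swap.c y = k.swap.a y * x ^ 2 := by
      rw [hxb] at hdisc
      apply mul_left_cancel₀ ha0
      linear_combination -hdisc / 4
    have ea : k.swap.a y = k.c₂ + k.b₂ * y + k.a₂ * y ^ 2 := rfl
    have eb : k.swap.b y = k.c₁ + k.b₁ * y + k.a₁ * y ^ 2 := rfl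
    have ec : k.swap.c y = k.c₀ + k.b₀ * y + k.a₀ * y ^ 2 := rfl
    have hK : k.a x * y ^ 2 + k.b x * y + k.c x = 0 := by
      have : k.a x * y ^ 2 + k.b x * y + k.c x =
          k.swap.a y * x ^ 2 + k.swap.b y * x + k.swap.c y := by
        rw [ea, eb, ec]; simp only [a, b, c]; ring
      rw [this, hxb, hxc]; ring
    have hKx : 2 * k.swap.a y * x + k.swap.b y = 0 := by rw [hxb]; ring
    have hd : k.disc x = (2 * k.a x * y + k.b x) ^ 2 := by
      rw [disc_eq]; linear_combination -4 * k.a x * hK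
    have hdpos : 0 < k.disc x := by
      refine lt_of_le_of_ne (by rw [hd]; positivity) fun h0 => ?_
      have hz : 2 * k.a x * y + k.b x = 0 := by
        rw [← h0] at hd
        exact pow_eq_zero_iff two_ne_zero |>.1 hd.symm
      refine hβ.deriv_ne_zero h0.symm ?_
      rw [ea, eb] at hKx
      simp only [a, b, c] at hz hK
      simp only [d₁, d₂, d₃, d₄]
      linear_combination 2 * (2 * (k.a₁ + 2 * k.a₂ * x) * y + (k.b₁ + 2 * k.b₂ * x)) * hz
        - 4 * (k.a₀ + k.a₁ * x + k.a₂ * x ^ 2) * hKx - 4 * (k.a₁ + 2 * k.a₂ * x) * hK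
    rw [hβ.disc_eq] at hdpos
    have e2 : 0 < 1 - β.s₂ * x := by nlinarith [β.s₂_pos]
    have e3 : x - β.t₂ < 0 := by linarith [β.t₂_pos]
    have hprod : 0 < (β.t₁ - x) * (1 - β.s₁ * x) := by
      have h1 : 0 < ((β.t₁ - x) * (1 - β.s₁ * x)) * (β.μ * (β.t₂ - x) * (1 - β.s₂ * x)) := by
        linarith
      have h2 : 0 < β.t₂ - x := by linarith
      exact pos_of_mul_pos_left h1 (by have := β.μ_pos; positivity)
    have hxt : x < β.t₁ ∧ 0 < 1 - β.s₁ * x := by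
      by_contra hcon
      have h1 : β.t₁ < x := by
        by_contra! hle
        rcases hle.lt_or_eq with hlt | heq
        · exact hcon ⟨hlt, pos_of_mul_pos_right hprod (by linarith)⟩
        · rw [heq] at hprod; simp at hprod
      have h2 : 0 < 1 - β.s₁ * x := by nlinarith [β.lt_t₁, β.lt_s₁, β.s_lt, β.s₂_lt]
      nlinarith
    obtain ⟨hxt, hsx⟩ := hxt
    have hne : 1 - β.s₁ * x ≠ 0 := hsx.ne'
    have hne' : 1 - x * β.s₁ ≠ 0 := by rwa [mul_comm x]
    refine ⟨(β.D * x - β.B) / (1 - β.s₁ * x), ?_, Or.inr ⟨ha0, ?_, hxt, ?_⟩⟩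
    · rw [lt_div_iff₀ hsx]
      have := β.num_e₁
      have h1 := β.den_e₁_neg
      nlinarith
    · have : β.s₁ * ((β.D * x - β.B) / (1 - β.s₁ * x)) + β.D = β.det / (1 - β.s₁ * x) := by
        rw [Branch.det]; field_simp; ring
      rw [this]
      exact div_neg_of_neg_of_pos hdet hsx
    · field_simp; ring

end Biquad

end

/-! ### The kernel as a biquadratic polynomial -/

section

namespace Biquad

/-- The values of the biquadratic polynomial at complex points. -/
noncomputable def val (k : Biquad) (x y : ℂ) : ℂ :=
  (k.a₀ + k.a₁ * x + k.a₂ * x ^ 2) * y ^ 2 + (k.b₀ + k.b₁ * x + k.b₂ * x ^ 2) * y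
    + (k.c₀ + k.c₁ * x + k.c₂ * x ^ 2)

lemma val_swap (k : Biquad) (x y : ℂ) : k.swap.val y x = k.val x y := by
  simp only [val, swap]; ring

end Biquad

namespace QuarterPlane

variable {S : Finset (ℤ × ℤ)} {z : ℝ}

open Classical in
/-- The kernel of the walk as a biquadratic polynomial. -/
noncomputable def kernel (S : Finset (ℤ × ℤ)) (z : ℝ) : Biquad where
  a₀ := if (-1, 1) ∈ S then z else 0
  a₁ := if (0, 1) ∈ S then z else 0
  a₂ := if (1, 1) ∈ S then z else 0
  b₀ := if (-1, 0) ∈ S then z else 0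
  b₁ := -1
  b₂ := if (1, 0) ∈ S then z else 0
  c₀ := if (-1, -1) ∈ S then z else 0
  c₁ := if (0, -1) ∈ S then z else 0
  c₂ := if (1, -1) ∈ S then z else 0

lemma mem_transpose {i j : ℤ} : (i, j) ∈ transpose S ↔ (j, i) ∈ S := by
  simp only [transpose, Finset.mem_image, Prod.exists, Prod.swap_prod_mk, Prod.mk.injEq]
  constructor
  · rintro ⟨a, b, h, rfl, rfl⟩; exact h
  · exact fun h => ⟨j, i, h, rfl, rfl⟩

lemma kernel_transpose : kernel (transpose S) z = (kernel S z).swap := by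
  simp only [kernel, Biquad.swap, mem_transpose]

lemma IsSmallStepSet.transpose (hS : IsSmallStepSet S) : IsSmallStepSet (transpose S) := by
  rintro ⟨i, j⟩ h
  have := hS (mem_transpose.1 h)
  simp only [Finset.mem_erase, Finset.mem_product, Finset.mem_Icc, ne_eq, Prod.mk.injEq] at this ⊢
  tauto

open Classical in
lemma IsSmallStepSet.sum_eq (hS : IsSmallStepSet S) {M : Type*} [AddCommMonoid M]
    (f : ℤ × ℤ → M) : ∑ s ∈ S, f s =
      (if (-1, 1) ∈ S then f (-1, 1) else 0) + (if (0, 1) ∈ S then f (0, 1) else 0)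
      + (if (1, 1) ∈ S then f (1, 1) else 0) + (if (-1, 0) ∈ S then f (-1, 0) else 0)
      + (if (1, 0) ∈ S then f (1, 0) else 0) + (if (-1, -1) ∈ S then f (-1, -1) else 0)
      + (if (0, -1) ∈ S then f (0, -1) else 0) + (if (1, -1) ∈ S then f (1, -1) else 0) := by
  have hbox : (Finset.Icc (-1) 1 ×ˢ Finset.Icc (-1) 1).erase ((0 : ℤ), (0 : ℤ)) =
      {(-1, 1), (0, 1), (1, 1), (-1, 0), (1, 0), (-1, -1), (0, -1), (1, -1)} := by decide
  have : ∑ s ∈ S, f s = ∑ s ∈ ({(-1, 1), (0, 1), (1, 1), (-1, 0), (1, 0), (-1, -1), (0, -1),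
      (1, -1)} : Finset (ℤ × ℤ)), if s ∈ S then f s else 0 := by
    rw [← hbox, Finset.sum_ite_mem, Finset.inter_eq_right.2 hS]
  rw [this]
  simp [-Finset.sum_ite_mem, add_assoc]

lemma card_mul (hS : IsSmallStepSet S) : z * S.card =
    (kernel S z).a₀ + (kernel S z).a₁ + (kernel S z).a₂ + (kernel S z).b₀ + (kernel S z).b₂
    + (kernel S z).c₀ + (kernel S z).c₁ + (kernel S z).c₂ := by
  rw [Finset.card_eq_sum_ones, Nat.cast_sum, hS.sum_eq]
  simp only [kernel, mul_add, mul_ite, Nat.cast_one, mul_one, mul_zero]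

lemma kernel_isWalk (hS : IsSmallStepSet S) (hns : IsNonsingular S) (hz₀ : 0 < z)
    (hz₁ : z * S.card < 1) : (kernel S z).IsWalk z := by
  have hz := hz₀.ne'
  have main : ∀ (p q : ℝ) (T : Finset (ℤ × ℤ)), (p ≠ 0 ∨ q ≠ 0) →
      (∀ s ∈ (Finset.Icc (-1) 1 ×ˢ Finset.Icc (-1) 1).erase ((0 : ℤ), (0 : ℤ)),
        p * (s.1 : ℝ) + q * (s.2 : ℝ) < 0 → s ∈ T) → ∃ s ∈ T, s ∈ S := by
    intro p q T hpq h
    obtain ⟨s, hs, hs'⟩ := hns p q hpq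
    exact ⟨s, h s (hS hs) hs', hs⟩
  have box : ∀ P : ℤ × ℤ → Prop, P (-1, 1) → P (0, 1) → P (1, 1) → P (-1, 0) → P (1, 0) →
      P (-1, -1) → P (0, -1) → P (1, -1) →
      ∀ s ∈ (Finset.Icc (-1) 1 ×ˢ Finset.Icc (-1) 1).erase ((0 : ℤ), (0 : ℤ)), P s := by
    intro P h1 h2 h3 h4 h5 h6 h7 h8 s hs
    have hbox : (Finset.Icc (-1) 1 ×ˢ Finset.Icc (-1) 1).erase ((0 : ℤ), (0 : ℤ)) =
      {(-1, 1), (0, 1), (1, 1), (-1, 0), (1, 0), (-1, -1), (0, -1), (1, -1)} := by decide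
    rw [hbox] at hs
    simp only [Finset.mem_insert, Finset.mem_singleton] at hs
    rcases hs with rfl | rfl | rfl | rfl | rfl | rfl | rfl | rfl <;> assumption
  exact
  { z_pos := hz₀
    a₀ := by simp only [kernel]; split_ifs <;> simp
    a₁ := by simp only [kernel]; split_ifs <;> simp
    a₂ := by simp only [kernel]; split_ifs <;> simp
    b₀ := by simp only [kernel]; split_ifs <;> simp
    b₁ := rfl
    b₂ := by simp only [kernel]; split_ifs <;> simp
    c₀ := by simp only [kernel]; split_ifs <;> simp
    c₁ := by simp only [kernel]; split_ifs <;> simp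
    c₂ := by simp only [kernel]; split_ifs <;> simp
    sum_lt := by rw [← card_mul hS]; exact hz₁
    south := by
      obtain ⟨s, hs, hs'⟩ := main 0 1 {(-1, -1), (0, -1), (1, -1)} (by simp)
        (by apply box <;> norm_num)
      simp only [Finset.mem_insert, Finset.mem_singleton] at hs
      rcases hs with rfl | rfl | rfl <;> simp [kernel, hs', hz]
    north := by
      obtain ⟨s, hs, hs'⟩ := main 0 (-1) {(-1, 1), (0, 1), (1, 1)} (by simp)
        (by apply box <;> norm_num)
      simp only [Finset.mem_insert, Finset.mem_singleton] at hs
      rcases hs with rfl | rfl | rfl <;> simp [kernel, hs', hz]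
    west := by
      obtain ⟨s, hs, hs'⟩ := main 1 0 {(-1, 1), (-1, 0), (-1, -1)} (by simp)
        (by apply box <;> norm_num)
      simp only [Finset.mem_insert, Finset.mem_singleton] at hs
      rcases hs with rfl | rfl | rfl <;> simp [kernel, hs', hz]
    east := by
      obtain ⟨s, hs, hs'⟩ := main (-1) 0 {(1, 1), (1, 0), (1, -1)} (by simp)
        (by apply box <;> norm_num)
      simp only [Finset.mem_insert, Finset.mem_singleton] at hs
      rcases hs with rfl | rfl | rfl <;> simp [kernel, hs', hz]
    southwest := by
      obtain ⟨s, hs, hs'⟩ := main 1 1 {(-1, 0), (-1, -1), (0, -1)} (by simp)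
        (by apply box <;> norm_num)
      simp only [Finset.mem_insert, Finset.mem_singleton] at hs
      rcases hs with rfl | rfl | rfl <;> simp [kernel, hs', hz]
    northwest := by
      obtain ⟨s, hs, hs'⟩ := main 1 (-1) {(-1, 0), (-1, 1), (0, 1)} (by simp)
        (by apply box <;> norm_num)
      simp only [Finset.mem_insert, Finset.mem_singleton] at hs
      rcases hs with rfl | rfl | rfl <;> simp [kernel, hs', hz]
    southeast := by
      obtain ⟨s, hs, hs'⟩ := main (-1) 1 {(1, 0), (1, -1), (0, -1)} (by simp)
        (by apply box <;> norm_num)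
      simp only [Finset.mem_insert, Finset.mem_singleton] at hs
      rcases hs with rfl | rfl | rfl <;> simp [kernel, hs', hz]
    northeast := by
      obtain ⟨s, hs, hs'⟩ := main (-1) (-1) {(1, 0), (1, 1), (0, 1)} (by simp)
        (by apply box <;> norm_num)
      simp only [Finset.mem_insert, Finset.mem_singleton] at hs
      rcases hs with rfl | rfl | rfl <;> simp [kernel, hs', hz] }

lemma K_eq_val (hS : IsSmallStepSet S) (x y : ℂ) : K S z x y = (kernel S z).val x y := by
  rw [K, hS.sum_eq]
  simp only [kernel, Biquad.val, apply_ite (fun t : ℝ => (t : ℂ)), Complex.ofReal_zero,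
    mul_add, mul_ite, mul_zero, add_mul, ite_mul, zero_mul]
  norm_num [show Int.toNat 2 = 2 from rfl]
  ring_nf

lemma d_eq (hS : IsSmallStepSet S) : d S z = C (kernel S z).d₀ + C (kernel S z).d₁ * X
    + C (kernel S z).d₂ * X ^ 2 + C (kernel S z).d₃ * X ^ 3 + C (kernel S z).d₄ * X ^ 4 := by
  have ha : a S z = C (kernel S z).a₀ + C (kernel S z).a₁ * X + C (kernel S z).a₂ * X ^ 2 := by
    rw [a, Finset.sum_filter, hS.sum_eq]
    simp [kernel, apply_ite (C : ℝ → ℝ[X]), mul_add]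
  have hb : b S z = C (kernel S z).b₀ + C (kernel S z).b₁ * X + C (kernel S z).b₂ * X ^ 2 := by
    rw [b, Finset.sum_filter, hS.sum_eq]
    simp [kernel, apply_ite (C : ℝ → ℝ[X]), mul_add]
    ring
  have hc : c S z = C (kernel S z).c₀ + C (kernel S z).c₁ * X + C (kernel S z).c₂ * X ^ 2 := by
    rw [c, Finset.sum_filter, hS.sum_eq]
    simp [kernel, apply_ite (C : ℝ → ℝ[X]), mul_add]
  rw [d, ha, hb, hc]
  simp only [Biquad.d₀, Biquad.d₁, Biquad.d₂, Biquad.d₃, Biquad.d₄, C_add, C_sub, C_mul, C_pow,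
    C_ofNat]
  ring

lemma eval_a (hS : IsSmallStepSet S) (t : ℝ) : (a S z).eval t = (kernel S z).a t := by
  rw [a, Finset.sum_filter, hS.sum_eq]
  simp [kernel, Biquad.a, mul_add, apply_ite (eval t)]

lemma eval_b (hS : IsSmallStepSet S) (t : ℝ) : (b S z).eval t = (kernel S z).b t := by
  rw [b, Finset.sum_filter, hS.sum_eq]
  simp [kernel, Biquad.b, mul_add, apply_ite (eval t)]
  ring

lemma eval_d (hS : IsSmallStepSet S) (t : ℝ) : (d S z).eval t = (kernel S z).disc t := by
  simp [d_eq hS, Biquad.disc]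

lemma eval_d' (hS : IsSmallStepSet S) (t : ℝ) : (derivative (d S z)).eval t =
    (kernel S z).d₁ + 2 * (kernel S z).d₂ * t + 3 * (kernel S z).d₃ * t ^ 2
      + 4 * (kernel S z).d₄ * t ^ 3 := by
  simp [d_eq hS]; ring

lemma eval_d'' (hS : IsSmallStepSet S) (t : ℝ) : (derivative^[2] (d S z)).eval t =
    2 * (kernel S z).d₂ + 6 * (kernel S z).d₃ * t + 12 * (kernel S z).d₄ * t ^ 2 := by
  simp [d_eq hS]; ring

lemma eval_d''' (hS : IsSmallStepSet S) : (derivative^[3] (d S z)).eval 0 =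
    6 * (kernel S z).d₃ := by
  simp [d_eq hS]; ring

end QuarterPlane

end

/-! ### The branch points in terms of the step set -/

section

open Classical in
/-- The Möbius transformation of a branch datum on the Riemann sphere. -/
noncomputable def Branch.mob (β : Branch) : OnePoint ℂ → OnePoint ℂ
  | OnePoint.some u => if (β.s₁ : ℂ) * u + β.D = 0 then ∞ else
      (((u + β.B) / (β.s₁ * u + β.D) : ℂ) : OnePoint ℂ)
  | ∞ => if β.s₁ = 0 then ∞ else (((1 / β.s₁ : ℝ) : ℂ) : OnePoint ℂ)

namespace QuarterPlane

variable {S : Finset (ℤ × ℤ)} {z : ℝ}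

section
variable (hS : IsSmallStepSet S) {β : Branch} (hβ : β.IsBranch (kernel S z))
include hS hβ

lemma isRoot_iff (t : ℝ) : (d S z).IsRoot t ↔
    t = β.t₁ ∨ t = β.t₂ ∨ 1 - β.s₁ * t = 0 ∨ 1 - β.s₂ * t = 0 := by
  rw [IsRoot.def, eval_d hS, hβ.disc_eq]
  simp only [mul_eq_zero, β.μ_pos.ne', false_or, sub_eq_zero (b := β.t₁), sub_eq_zero (b := β.t₂),
    or_assoc]

lemma setOf_roots : {t : ℝ | |t| < 1 ∧ (d S z).IsRoot t} = {β.t₁, β.t₂} := by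
  have := β.lt_t₁
  have := β.t_lt
  have := β.t₂_lt
  ext t
  simp only [Set.mem_ofPred_eq, Set.mem_insert_iff, Set.mem_singleton_iff, isRoot_iff hS hβ]
  have key : ∀ s, -1 < s → s < 1 → |t| < 1 → 1 - s * t ≠ 0 := by
    intro s h1 h2 h3 h4
    rw [abs_lt] at h3
    nlinarith
  constructor
  · rintro ⟨ht, h | h | h | h⟩
    · exact Or.inl h
    · exact Or.inr h
    · exact absurd h (key _ β.lt_s₁ (β.s_lt.trans β.s₂_lt) ht)
    · exact absurd h (key _ (β.lt_s₁.trans β.s_lt) β.s₂_lt ht)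
  · rintro (rfl | rfl)
    · exact ⟨abs_lt.2 ⟨by linarith, by linarith⟩, Or.inl rfl⟩
    · exact ⟨abs_lt.2 ⟨by linarith, by linarith⟩, Or.inr (Or.inl rfl)⟩

lemma x₁_eq : x₁ S z = β.t₁ := by
  rw [x₁, setOf_roots hS hβ, csInf_pair, inf_eq_left]
  exact β.t_lt.le

lemma x₂_eq : x₂ S z = β.t₂ := by
  rw [x₂, setOf_roots hS hβ, csSup_pair, sup_eq_right]
  exact β.t_lt.le

lemma x₃_eq : x₃ S z = 1 / β.s₂ := by
  have h1 := β.lt_t₁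
  have h2 := β.t_lt
  have h3 := β.t₂_lt
  have h0 := β.s₂_pos
  have h4 := β.s_lt
  have h5 := β.s₂_lt
  refine IsLeast.csInf_eq ⟨⟨by rw [lt_div_iff₀ h0]; linarith, ?_⟩, ?_⟩
  · rw [isRoot_iff hS hβ]
    right; right; right
    field_simp; ring
  · rintro t ⟨ht, hr⟩
    rw [div_le_iff₀ h0]
    rw [isRoot_iff hS hβ] at hr
    rcases hr with h | h | h | h <;> nlinarith

lemma x₄_eq : x₄ S z = if β.s₁ = 0 then ∞ else ((1 / β.s₁ : ℝ) : OnePoint ℝ) := by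
  have h1 := β.lt_t₁
  have h2 := β.t_lt
  have h3 := β.t₂_lt
  have h0 := β.s₂_pos
  have h4 := β.s_lt
  have h5 := β.s₂_lt
  have h6 := β.lt_s₁
  have key : ∀ t : ℝ, 1 < |t| ∧ (d S z).IsRoot t ∧ t ≠ x₃ S z → β.s₁ * t = 1 := by
    rintro t ⟨ht, hr, hne⟩
    rw [x₃_eq hS hβ] at hne
    rw [isRoot_iff hS hβ] at hr
    rcases hr with h | h | h | h
    · rw [h, lt_abs] at ht
      rcases ht with ht | ht <;> linarith
    · rw [h, lt_abs] at ht
      rcases ht with ht | ht <;> linarith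
    · linarith
    · refine absurd ?_ hne
      field_simp
      linarith
  rw [x₄]
  split_ifs with h hs hs
  · have := key _ h.choose_spec
    rw [hs, zero_mul] at this
    exact absurd this zero_ne_one
  · have := key _ h.choose_spec
    congr 1
    field_simp
    linarith
  · rfl
  · refine absurd ⟨1 / β.s₁, ?_, ?_, ?_⟩ h
    · rw [abs_div, abs_one, lt_div_iff₀ (abs_pos.2 hs), one_mul, abs_lt]
      exact ⟨by linarith, by linarith⟩
    · rw [isRoot_iff hS hβ]
      right; right; left
      field_simp; ring
    · rw [x₃_eq hS hβ, Ne, div_eq_div_iff hs h0.ne']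
      intro h'; linarith

/-- The inverse of the transformation `g` is the Möbius transformation of the branch datum. -/
lemma gInv_eq (u : OnePoint ℂ) : gInv (d S z) (x₄ S z) u = β.mob u := by
  rw [x₄_eq hS hβ]
  by_cases hs : β.s₁ = 0
  · have hB : β.B = -(kernel S z).d₂ / 3 := by
      rw [hβ.d₂]; simp only [Branch.B, Branch.cubic, Branch.p, Branch.r, hs]; ring
    have hD : β.D = (kernel S z).d₃ := by
      rw [hβ.d₃]; simp only [Branch.D, hs]; ring
    have hD0 : β.D ≠ 0 := by
      have := β.det_neg.ne
      rwa [Branch.det, hs, zero_mul, sub_zero] at this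
    rw [if_pos hs]
    induction u using OnePoint.rec with
    | infty => simp [gInv, Branch.mob, hs]
    | coe u =>
      have hDC : (β.D : ℂ) ≠ 0 := by exact_mod_cast hD0
      simp only [gInv, Branch.mob, hs, Complex.ofReal_zero, zero_mul, zero_add, if_neg hDC]
      rw [eval_d'' hS, eval_d''' hS, hB, ← hD]
      congr 1
      push_cast
      field_simp
      ring
  · have hs' : (β.s₁ : ℂ) ≠ 0 := by exact_mod_cast hs
    have h2 : (derivative^[2] (d S z)).eval (1 / β.s₁) / 6 = -β.D / β.s₁ := by
      rw [eval_d'' hS, hβ.d₂, hβ.d₃, hβ.d₄]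
      simp only [Branch.D, Branch.cubic, Branch.p, Branch.r]
      field_simp
      ring
    have h1 : (derivative (d S z)).eval (1 / β.s₁) = -β.det / β.s₁ ^ 2 := by
      rw [eval_d' hS, hβ.d₁, hβ.d₂, hβ.d₃, hβ.d₄, Branch.det_eq]
      field_simp
      ring
    rw [if_neg hs]
    induction u using OnePoint.rec with
    | infty => simp [gInv, Branch.mob, hs]
    | coe u =>
      simp only [gInv, Branch.mob]
      rw [h1, h2]
      have hiff : u = ((-β.D / β.s₁ : ℝ) : ℂ) ↔ (β.s₁ : ℂ) * u + β.D = 0 := by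
        push_cast
        rw [eq_div_iff hs']
        constructor <;> intro h <;> linear_combination h
      by_cases hu : (β.s₁ : ℂ) * u + β.D = 0
      · rw [if_pos (hiff.2 hu), if_pos hu]
      · rw [if_neg (mt hiff.1 hu), if_neg hu]
        congr 1
        rw [Branch.det]
        push_cast
        have e : u - -(β.D : ℂ) / β.s₁ = (β.s₁ * u + β.D) / β.s₁ := by field_simp; ring
        rw [e]
        field_simp
        ring

end

end QuarterPlane

end

/-! ### Elliptic integrals of the Weierstrass cubic -/

section

open Set MeasureTheory Jacobi

/-- A substitution `u` that is monotone on `[lo, hi]` and turns `|du| / √|f u|` into a multiple of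
the integrand of `F(φ | m)`. -/
lemma integral_image_eq_ellF {m κ : ℝ} (h0 : 0 < m) (h1 : m < 1) {f u u' : ℝ → ℝ} {lo hi : ℝ}
    (hle : lo ≤ hi) (hu : ∀ φ ∈ Ioo lo hi, HasDerivAt u (u' φ) φ) (hinj : InjOn u (Ioo lo hi))
    (hf : ∀ φ ∈ Ioo lo hi, |u' φ| / √|f (u φ)| = κ * (1 / √(1 - m * Real.sin φ ^ 2))) :
    ∫ t in u '' Ioo lo hi, 1 / √|f t| = κ * (ellF m hi - ellF m lo) := by
  rw [integral_image_eq_integral_abs_deriv_smul measurableSet_Ioo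
    (fun φ hφ => (hu φ hφ).hasDerivWithinAt) hinj]
  rw [setIntegral_congr_fun measurableSet_Ioo (g := fun φ => κ * (1 / √(1 - m * Real.sin φ ^ 2)))
    (fun φ hφ => by simp only [smul_eq_mul, ← hf φ hφ]; ring)]
  rw [integral_const_mul, ← integral_Ioc_eq_integral_Ioo, ← intervalIntegral.integral_of_le hle]
  congr 1
  exact intervalIntegral.integral_eq_sub_of_hasDerivAt (fun φ _ => hasDerivAt_ellF h0 h1 φ)
    ((continuous_ellF_integrand h0 h1).intervalIntegrable _ _)

namespace RealCubic

variable (R : RealCubic)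

/-- The cubic `(u - e₁) (u - e₂) (u - e₃)`. -/
noncomputable def cub (u : ℝ) : ℝ := (u - R.e₁) * (u - R.e₂) * (u - R.e₃)

lemma strictMonoOn_sin_sq : StrictMonoOn (fun φ => Real.sin φ ^ 2) (Icc 0 (Real.pi / 2)) := by
  intro a ha b hb hab
  have hpi := Real.pi_pos
  have h1 : 0 ≤ Real.sin a := Real.sin_nonneg_of_nonneg_of_le_pi ha.1 (by linarith [ha.2])
  have h2 := Real.sin_lt_sin_of_lt_of_le_pi_div_two (by linarith [ha.1]) hb.2 hab
  exact pow_lt_pow_left₀ h2 h1 two_ne_zero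

lemma integral_cub_Ioo₃₂ : ∫ t in Ioo R.e₃ R.e₂, 1 / √|R.cub t| = R.per₂ := by
  have hpi := Real.pi_pos
  have h0 := R.m_pos
  have h1 := R.m_lt_one
  have hk := R.kap_pos
  have h32 := sub_pos.2 R.lt₃₂
  have hmono : StrictMonoOn (fun φ => R.e₃ + (R.e₂ - R.e₃) * Real.sin φ ^ 2)
      (Icc 0 (Real.pi / 2)) := fun a ha b hb hab => by
    have := strictMonoOn_sin_sq ha hb hab
    simp only at this ⊢
    gcongr
  have himg := ContinuousOn.image_Ioo_of_strictMonoOn (by positivity : 0 ≤ Real.pi / 2)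
    (by fun_prop) hmono
  simp only [Real.sin_zero, Real.sin_pi_div_two] at himg
  rw [show Ioo R.e₃ R.e₂ = Ioo (R.e₃ + (R.e₂ - R.e₃) * 0 ^ 2) (R.e₃ + (R.e₂ - R.e₃) * 1 ^ 2) by
    congr 1 <;> ring, ← himg]
  rw [integral_image_eq_ellF (κ := 2 / R.kap) h0 h1 (by positivity : 0 ≤ Real.pi / 2)
    (u' := fun φ => (R.e₂ - R.e₃) * (2 * Real.sin φ * Real.cos φ)) (fun φ hφ => ?_)
    (hmono.injOn.mono Ioo_subset_Icc_self) (fun φ hφ => ?_)]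
  · rw [ellF_zero, per₂, ellK]; ring
  · have := ((Real.hasDerivAt_sin φ).fun_pow 2).const_mul (R.e₂ - R.e₃) |>.const_add R.e₃
    simpa using this
  · have hs : 0 < Real.sin φ := Real.sin_pos_of_pos_of_lt_pi hφ.1 (by linarith [hφ.2])
    have hc : 0 < Real.cos φ := Real.cos_pos_of_mem_Ioo ⟨by linarith [hφ.1], hφ.2⟩
    have hd := Real.sqrt_pos.2 (one_sub_mul_sin_sq_pos h0 h1 φ)
    have hd2 := Real.sq_sqrt (one_sub_mul_sin_sq_pos h0 h1 φ).le
    have e : |R.cub (R.e₃ + (R.e₂ - R.e₃) * Real.sin φ ^ 2)| =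
        ((R.e₂ - R.e₃) * Real.sin φ * Real.cos φ * R.kap * √(1 - R.m * Real.sin φ ^ 2)) ^ 2 := by
      rw [← abs_sq (_ * _), mul_pow _ √_, hd2]
      congr 1
      rw [cub]
      have := R.kap_sq
      have h2 := R.kap_sq_mul_m
      have h3 := Real.sin_sq_add_cos_sq φ
      grind
    rw [e, Real.sqrt_sq (by positivity), abs_of_pos (by positivity)]
    field_simp

lemma integral_cub_Ioo₂₁ : ∫ t in Ioo R.e₂ R.e₁, 1 / √|R.cub t| = R.per₁ := by
  have hpi := Real.pi_pos
  have h0 := R.m'_pos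
  have h1 := R.m'_lt_one
  have hk := R.kap_pos
  have h21 := sub_pos.2 R.lt₂₁
  have hmono : StrictAntiOn (fun φ => R.e₁ - (R.e₁ - R.e₂) * Real.sin φ ^ 2)
      (Icc 0 (Real.pi / 2)) := fun a ha b hb hab => by
    have := strictMonoOn_sin_sq ha hb hab
    simp only at this ⊢
    gcongr
  have himg := ContinuousOn.image_Ioo_of_strictAntiOn (by positivity : 0 ≤ Real.pi / 2)
    (by fun_prop) hmono
  simp only [Real.sin_zero, Real.sin_pi_div_two] at himg
  rw [show Ioo R.e₂ R.e₁ = Ioo (R.e₁ - (R.e₁ - R.e₂) * 1 ^ 2) (R.e₁ - (R.e₁ - R.e₂) * 0 ^ 2) by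
    congr 1 <;> ring, ← himg]
  rw [integral_image_eq_ellF (κ := 2 / R.kap) h0 h1 (by positivity : 0 ≤ Real.pi / 2)
    (u' := fun φ => -((R.e₁ - R.e₂) * (2 * Real.sin φ * Real.cos φ))) (fun φ hφ => ?_)
    (hmono.injOn.mono Ioo_subset_Icc_self) (fun φ hφ => ?_)]
  · rw [ellF_zero, per₁, ellK]; ring
  · have := ((Real.hasDerivAt_sin φ).fun_pow 2).const_mul (R.e₁ - R.e₂) |>.const_sub R.e₁
    simpa using this
  · have hs : 0 < Real.sin φ := Real.sin_pos_of_pos_of_lt_pi hφ.1 (by linarith [hφ.2])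
    have hc : 0 < Real.cos φ := Real.cos_pos_of_mem_Ioo ⟨by linarith [hφ.1], hφ.2⟩
    have hd := Real.sqrt_pos.2 (one_sub_mul_sin_sq_pos h0 h1 φ)
    have hd2 := Real.sq_sqrt (one_sub_mul_sin_sq_pos h0 h1 φ).le
    have e : |R.cub (R.e₁ - (R.e₁ - R.e₂) * Real.sin φ ^ 2)| =
        ((R.e₁ - R.e₂) * Real.sin φ * Real.cos φ * R.kap
          * √(1 - (1 - R.m) * Real.sin φ ^ 2)) ^ 2 := by
      rw [← abs_sq (_ * _), mul_pow _ √_, hd2, ← abs_neg]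
      congr 1
      rw [cub]
      have := R.kap_sq
      have h2 := R.kap_sq_mul_m
      have h3 := Real.sin_sq_add_cos_sq φ
      grind
    rw [e, Real.sqrt_sq (by positivity), abs_neg, abs_of_pos (by positivity)]
    field_simp

lemma integral_cub_Ioo₁ {u : ℝ} (hu : R.e₁ < u) : ∃ s, 0 < s ∧ s < R.per₂ / 2 ∧ R.realP s = u ∧
    ∫ t in Ioo R.e₁ u, 1 / √|R.cub t| = R.per₂ - 2 * s := by
  have hpi := Real.pi_pos
  have h0 := R.m_pos
  have h1 := R.m_lt_one
  have hk := R.kap_pos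
  obtain ⟨φ₀, hφ0, hφ1, hφu⟩ := R.exists_sin_eq hu.le
  have hlt : φ₀ < Real.pi / 2 := by
    refine lt_of_le_of_ne hφ1 fun h => ?_
    rw [h, Real.sin_pi_div_two, R.kap_sq] at hφu
    linarith
  refine ⟨ellF R.m φ₀ / R.kap, (R.ellF_div_kap_mem hφ0 hφ1).1, ?_, by rw [realP_ellF, hφu], ?_⟩
  · have := strictMono_ellF h0 h1 hlt
    rw [per₂, div_lt_iff₀ hk, ellK]
    field_simp
    linarith
  have hsin : ∀ φ ∈ Icc φ₀ (Real.pi / 2), 0 < Real.sin φ := fun φ hφ =>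
    Real.sin_pos_of_pos_of_lt_pi (hφ0.trans_le hφ.1) (by linarith [hφ.2])
  have hmono : StrictAntiOn (fun φ => R.e₃ + R.kap ^ 2 / Real.sin φ ^ 2)
      (Icc φ₀ (Real.pi / 2)) := fun a ha b hb hab => by
    have := strictMonoOn_sin_sq ⟨hφ0.le.trans ha.1, ha.2⟩ ⟨hφ0.le.trans hb.1, hb.2⟩ hab
    have h3 := hsin a ha
    have h4 := hsin b hb
    simp only at this ⊢
    gcongr
  have himg := ContinuousOn.image_Ioo_of_strictAntiOn hφ1
    (by
      refine continuousOn_const.add (continuousOn_const.div (by fun_prop) fun φ hφ => ?_)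
      have := hsin φ hφ
      positivity) hmono
  simp only [hφu, Real.sin_pi_div_two] at himg
  rw [show Ioo R.e₁ u = Ioo (R.e₃ + R.kap ^ 2 / 1 ^ 2) u by
    congr 1; rw [R.kap_sq]; ring, ← himg]
  rw [integral_image_eq_ellF (κ := 2 / R.kap) h0 h1 hφ1
    (u' := fun φ => -(2 * R.kap ^ 2 * Real.cos φ / Real.sin φ ^ 3)) (fun φ hφ => ?_)
    (hmono.injOn.mono Ioo_subset_Icc_self) (fun φ hφ => ?_)]
  · rw [per₂, ellK]; field_simp
  · have hs := hsin φ ⟨hφ.1.le, hφ.2.le⟩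
    have := (((Real.hasDerivAt_sin φ).fun_pow 2).inv (by positivity)).const_mul (R.kap ^ 2)
      |>.const_add R.e₃
    simp only [← div_eq_mul_inv, Pi.inv_apply] at this
    refine this.congr_deriv ?_
    push_cast
    field_simp
  · have hs := hsin φ ⟨hφ.1.le, hφ.2.le⟩
    have hc : 0 < Real.cos φ := Real.cos_pos_of_mem_Ioo ⟨by linarith [hφ.1], hφ.2⟩
    have hd := Real.sqrt_pos.2 (one_sub_mul_sin_sq_pos h0 h1 φ)
    have hd2 := Real.sq_sqrt (one_sub_mul_sin_sq_pos h0 h1 φ).le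
    have e : |R.cub (R.e₃ + R.kap ^ 2 / Real.sin φ ^ 2)| =
        (R.kap ^ 3 * Real.cos φ * √(1 - R.m * Real.sin φ ^ 2) / Real.sin φ ^ 3) ^ 2 := by
      rw [← abs_sq (_ / _), div_pow, mul_pow _ √_, hd2]
      congr 1
      rw [cub]
      have h5 : R.e₃ + R.kap ^ 2 / Real.sin φ ^ 2 - R.e₁ =
          R.kap ^ 2 * Real.cos φ ^ 2 / Real.sin φ ^ 2 := by
        field_simp
        rw [R.kap_sq, Real.cos_sq']; ring
      have h6 : R.e₃ + R.kap ^ 2 / Real.sin φ ^ 2 - R.e₂ =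
          R.kap ^ 2 * (1 - R.m * Real.sin φ ^ 2) / Real.sin φ ^ 2 := by
        field_simp
        linear_combination Real.sin φ ^ 2 * R.kap_sq_mul_m
      rw [h5, h6]
      field_simp
      ring
    rw [e, Real.sqrt_sq (by positivity), abs_neg, abs_of_pos (by positivity)]
    field_simp

end RealCubic

end

/-! ### The three periods of the walk -/

section

open Set MeasureTheory Jacobi

namespace Branch

variable (β : Branch)

/-- The Möbius transformation of a branch datum as a real function. -/
noncomputable def M (u : ℝ) : ℝ := (u + β.B) / (β.s₁ * u + β.D)

lemma M_sub {u v : ℝ} (hu : β.s₁ * u + β.D ≠ 0) (hv : β.s₁ * v + β.D ≠ 0) :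
    β.M u - β.M v = β.det * (u - v) / ((β.s₁ * u + β.D) * (β.s₁ * v + β.D)) := by
  rw [M, M, det, div_sub_div _ _ hu hv]; congr 1; ring

lemma one_sub_M {u : ℝ} (hu : β.s₁ * u + β.D ≠ 0) :
    1 - β.s₁ * β.M u = β.det / (β.s₁ * u + β.D) := by
  rw [M, det]; field_simp; ring

lemma hasDerivAt_M {u : ℝ} (hu : β.s₁ * u + β.D ≠ 0) :
    HasDerivAt β.M (β.det / (β.s₁ * u + β.D) ^ 2) u := by
  have := ((hasDerivAt_id u).add_const β.B).fun_div
    (((hasDerivAt_id u).const_mul β.s₁).add_const β.D) hu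
  refine this.congr_deriv ?_
  rw [det]; simp only [id]; congr 1; ring

lemma exists_M_eq {t : ℝ} (ht : 0 < 1 - β.s₁ * t) :
    ∃ u, β.s₁ * u + β.D < 0 ∧ β.M u = t := by
  have hd := β.det_neg
  have e : β.s₁ * ((β.D * t - β.B) / (1 - β.s₁ * t)) + β.D = β.det / (1 - β.s₁ * t) := by
    have hne := ht.ne'
    have hne' : 1 - t * β.s₁ ≠ 0 := by rwa [mul_comm t]
    rw [det]; field_simp; ring
  refine ⟨(β.D * t - β.B) / (1 - β.s₁ * t), by rw [e]; exact div_neg_of_neg_of_pos hd ht, ?_⟩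
  rw [M, e]
  have hne := ht.ne'
  have hne' : 1 - t * β.s₁ ≠ 0 := by rwa [mul_comm t]
  have hd' := hd.ne
  rw [div_eq_iff (by positivity)]
  field_simp
  rw [det]; ring

lemma M_lt_M_iff {u v : ℝ} (hu : β.s₁ * u + β.D < 0) (hv : β.s₁ * v + β.D < 0) :
    β.M u < β.M v ↔ v < u := by
  have h := β.M_sub hu.ne hv.ne
  have hp := mul_pos_of_neg_of_neg hu hv
  have hd := β.det_neg
  rw [← sub_neg, h, div_lt_iff₀ hp, zero_mul, ← neg_pos, ← neg_mul,
    mul_pos_iff_of_pos_left (neg_pos.2 hd), sub_pos]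

lemma den_neg_of_mem {lo hi u : ℝ} (hlo : β.s₁ * lo + β.D ≤ 0) (hhi : β.s₁ * hi + β.D < 0)
    (h : u ∈ Ioo lo hi) : β.s₁ * u + β.D < 0 := by
  have := sub_pos.2 h.1
  have := sub_pos.2 h.2
  nlinarith [h.1.trans h.2]

lemma den_neg_of_mem' {lo hi u : ℝ} (hlo : β.s₁ * lo + β.D < 0) (hhi : β.s₁ * hi + β.D ≤ 0)
    (h : u ∈ Ioo lo hi) : β.s₁ * u + β.D < 0 := by
  have := sub_pos.2 h.1
  have := sub_pos.2 h.2
  nlinarith [h.1.trans h.2]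

lemma image_M_Ioo {lo hi : ℝ} (hlo : β.s₁ * lo + β.D < 0) (hhi : β.s₁ * hi + β.D < 0) :
    β.M '' Ioo lo hi = Ioo (β.M hi) (β.M lo) := by
  ext t
  constructor
  · rintro ⟨u, hu, rfl⟩
    have hq := β.den_neg_of_mem hlo.le hhi hu
    exact ⟨(β.M_lt_M_iff hhi hq).2 hu.2, (β.M_lt_M_iff hq hlo).2 hu.1⟩
  · rintro ⟨h1, h2⟩
    have a1 : 0 < 1 - β.s₁ * β.M hi := by
      rw [β.one_sub_M hhi.ne]; exact div_pos_of_neg_of_neg β.det_neg hhi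
    have a2 : 0 < 1 - β.s₁ * β.M lo := by
      rw [β.one_sub_M hlo.ne]; exact div_pos_of_neg_of_neg β.det_neg hlo
    obtain ⟨u, hq, rfl⟩ := β.exists_M_eq (t := t) (by
      have := sub_pos.2 h1
      have := sub_pos.2 h2
      nlinarith [h1.trans h2])
    exact ⟨u, ⟨(β.M_lt_M_iff hq hlo).1 h2, (β.M_lt_M_iff hhi hq).1 h1⟩, rfl⟩

lemma image_M_Ioo_of_pole {lo hi : ℝ} (hlt : lo < hi) (hlo : β.s₁ * lo + β.D < 0)
    (hhi : β.s₁ * hi + β.D = 0) : β.M '' Ioo lo hi = Iio (β.M lo) := by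
  have hs : 0 < β.s₁ := by
    by_contra! h
    nlinarith
  ext t
  constructor
  · rintro ⟨u, hu, rfl⟩
    have hq := β.den_neg_of_mem' hlo hhi.le hu
    exact (β.M_lt_M_iff hq hlo).2 hu.1
  · intro h2
    rw [mem_Iio] at h2
    have a2 : 0 < 1 - β.s₁ * β.M lo := by
      rw [β.one_sub_M hlo.ne]; exact div_pos_of_neg_of_neg β.det_neg hlo
    obtain ⟨u, hq, rfl⟩ := β.exists_M_eq (t := t) (by nlinarith)
    exact ⟨u, ⟨(β.M_lt_M_iff hq hlo).1 h2, by nlinarith⟩, rfl⟩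

lemma disc_M {β : Branch} {k : Biquad} (h : β.IsBranch k) {u : ℝ}
    (hu : β.s₁ * u + β.D ≠ 0) :
    k.disc (β.M u) = (β.det / (β.s₁ * u + β.D) ^ 2) ^ 2 * β.cubic.cub u := by
  have e1 : β.M u - β.t₁ = (1 - β.s₁ * β.t₁) * (u - β.cubic.e₁) / (β.s₁ * u + β.D) := by
    rw [M, div_sub' hu]; congr 1; linear_combination β.B_sub₁
  have e2 : β.M u - β.t₂ = (1 - β.s₁ * β.t₂) * (u - β.cubic.e₂) / (β.s₁ * u + β.D) := by
    rw [M, div_sub' hu]; congr 1; linear_combination β.B_sub₂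
  have e3 : 1 - β.s₂ * β.M u = (β.s₁ - β.s₂) * (u - β.cubic.e₃) / (β.s₁ * u + β.D) := by
    rw [M, eq_div_iff hu, sub_mul, mul_assoc, div_mul_cancel₀ _ hu]
    linear_combination β.D_sub₃
  rw [h.disc_eq, e1, e2, e3, β.one_sub_M hu, RealCubic.cub]
  have hd := β.det_eq
  field_simp
  generalize β.det = δ at *
  rw [hd]
  ring

/-- The Möbius substitution turns the elliptic integral into the Weierstrass normal form. -/
lemma integral_image_M {β : Branch} {k : Biquad} (h : β.IsBranch k) {lo hi : ℝ}
    (hq : ∀ u ∈ Ioo lo hi, β.s₁ * u + β.D < 0) :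
    ∫ t in β.M '' Ioo lo hi, 1 / √|k.disc t| = ∫ u in Ioo lo hi, 1 / √|β.cubic.cub u| := by
  rw [integral_image_eq_integral_abs_deriv_smul measurableSet_Ioo
    (fun u hu => (β.hasDerivAt_M (hq u hu).ne).hasDerivWithinAt)
    (fun u hu v hv huv => by
      by_contra hne
      rcases lt_or_gt_of_ne hne with hlt | hlt
      · exact absurd ((β.M_lt_M_iff (hq v hv) (hq u hu)).2 hlt) (by simp [huv])
      · exact absurd ((β.M_lt_M_iff (hq u hu) (hq v hv)).2 hlt) (by simp [huv]))]
  refine setIntegral_congr_fun measurableSet_Ioo fun u hu => ?_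
  simp only [smul_eq_mul]
  have hp : 0 < |β.det / (β.s₁ * u + β.D) ^ 2| := by
    have h1 := (hq u hu).ne
    have h2 := β.det_neg.ne
    positivity
  rw [disc_M h (hq u hu).ne, abs_mul, Real.sqrt_mul (abs_nonneg _), abs_sq, Real.sqrt_sq_eq_abs]
  field_simp

lemma M_e₁ : β.M β.cubic.e₁ = β.t₁ := by
  rw [M, β.num_e₁, mul_div_cancel_right₀ _ β.den_e₁_neg.ne]
lemma M_e₂ : β.M β.cubic.e₂ = β.t₂ := by
  rw [M, β.num_e₂, mul_div_cancel_right₀ _ β.den_e₂_neg.ne]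
lemma M_e₃ : β.M β.cubic.e₃ = 1 / β.s₂ := by
  rw [M, β.den_e₃, one_div]
  have := β.num_e₃_neg.ne
  have := β.s₂_pos.ne'
  field_simp

end Branch

namespace QuarterPlane

variable {S : Finset (ℤ × ℤ)} {z : ℝ}

section
variable (hS : IsSmallStepSet S) {β : Branch} (hβ : β.IsBranch (kernel S z))
include hS hβ

lemma ω₂_eq : ω₂ S z = β.cubic.per₂ := by
  have hpos : ∀ u ∈ Ioo β.cubic.e₃ β.cubic.e₂, β.s₁ * u + β.D < 0 := fun u hu =>
    β.den_neg_of_mem β.den_e₃_neg.le β.den_e₂_neg hu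
  rw [ω₂, x₂_eq hS hβ, x₃_eq hS hβ, intervalIntegral.integral_of_le, integral_Ioc_eq_integral_Ioo,
    ← β.cubic.integral_cub_Ioo₃₂, ← Branch.integral_image_M hβ hpos,
    β.image_M_Ioo β.den_e₃_neg β.den_e₂_neg, β.M_e₂, β.M_e₃]
  · refine setIntegral_congr_fun measurableSet_Ioo fun t ht => ?_
    rw [← β.M_e₂, ← β.M_e₃, ← β.image_M_Ioo β.den_e₃_neg β.den_e₂_neg] at ht
    obtain ⟨u, hu, rfl⟩ := ht
    have : 0 ≤ (kernel S z).disc (β.M u) := by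
      rw [Branch.disc_M hβ (hpos u hu).ne]
      refine mul_nonneg (sq_nonneg _) (mul_nonneg (mul_nonneg_of_nonpos_of_nonpos ?_ ?_) ?_)
      · linarith [hu.2, β.cubic.lt₂₁]
      · linarith [hu.2]
      · linarith [hu.1]
    simp only [eval_d hS, abs_of_nonneg this]
  · rw [← β.M_e₂, ← β.M_e₃]
    exact ((β.M_lt_M_iff β.den_e₂_neg β.den_e₃_neg).2 β.cubic.lt₃₂).le

lemma ω₁_eq : ω₁ S z = Complex.I * β.cubic.per₁ := by
  have hpos : ∀ u ∈ Ioo β.cubic.e₂ β.cubic.e₁, β.s₁ * u + β.D < 0 := fun u hu =>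
    β.den_neg_of_mem β.den_e₂_neg.le β.den_e₁_neg hu
  rw [ω₁, x₁_eq hS hβ, x₂_eq hS hβ, intervalIntegral.integral_of_le β.t_lt.le,
    integral_Ioc_eq_integral_Ioo,
    ← β.cubic.integral_cub_Ioo₂₁, ← Branch.integral_image_M hβ hpos,
    β.image_M_Ioo β.den_e₂_neg β.den_e₁_neg, β.M_e₂, β.M_e₁]
  congr 2
  refine setIntegral_congr_fun measurableSet_Ioo fun t ht => ?_
  rw [← β.M_e₂, ← β.M_e₁, ← β.image_M_Ioo β.den_e₂_neg β.den_e₁_neg] at ht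
  obtain ⟨u, hu, rfl⟩ := ht
  have : (kernel S z).disc (β.M u) ≤ 0 := by
    rw [Branch.disc_M hβ (hpos u hu).ne]
    refine mul_nonpos_of_nonneg_of_nonpos (sq_nonneg _) (mul_nonpos_of_nonpos_of_nonneg
      (mul_nonpos_of_nonpos_of_nonneg ?_ ?_) ?_)
    · linarith [hu.2]
    · linarith [hu.1]
    · linarith [hu.1, β.cubic.lt₃₂]
  simp only [eval_d hS, abs_of_nonpos this]

/-- The quantity `ω₃` in the coordinate of the Weierstrass cubic: the point `X(y₁)` is the value of
`x` at the real point `s`, and `ω₃ = ω₂ - 2 s`. -/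
lemma exists_ω₃_eq (hW : (kernel S z).IsWalk z) {β' : Branch}
    (hβ' : β'.IsBranch (kernel S z).swap) : ∃ s, 0 < s ∧ s < β.cubic.per₂ / 2 ∧
      ω₃ S z = β.cubic.per₂ - 2 * s ∧
      (((kernel S z).swap.a β'.t₁ = 0 ∧ (kernel S z).swap.b β'.t₁ = 0 ∧
          β.s₁ * β.cubic.realP s + β.D = 0) ∨
        ((kernel S z).swap.a β'.t₁ ≠ 0 ∧ β.s₁ * β.cubic.realP s + β.D < 0 ∧
          β.cubic.realP s + β.B = -(kernel S z).swap.b β'.t₁ / (2 * (kernel S z).swap.a β'.t₁)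
            * (β.s₁ * β.cubic.realP s + β.D))) := by
  obtain ⟨u, hu, h⟩ := hW.exists_param hβ hβ'
  obtain ⟨s, hs0, hs1, rfl, hs⟩ := β.cubic.integral_cub_Ioo₁ hu
  set u := β.cubic.realP s
  have hy : y₁ S z = β'.t₁ := x₁_eq hS.transpose (by rw [kernel_transpose]; exact hβ')
  have hXy : Xy₁ S z = if (kernel S z).swap.a β'.t₁ = 0 then ∞ else
      ((-(kernel S z).swap.b β'.t₁ / (2 * (kernel S z).swap.a β'.t₁) : ℝ) : OnePoint ℝ) := by
    rw [Xy₁, branchValue, eval_a hS.transpose, eval_b hS.transpose, hy, kernel_transpose]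
  have hq : ∀ v ∈ Ioo β.cubic.e₁ u, β.s₁ * v + β.D < 0 := fun v hv => by
    rcases h with ⟨-, -, h⟩ | ⟨-, h, -⟩
    · exact β.den_neg_of_mem' β.den_e₁_neg h.le hv
    · exact β.den_neg_of_mem β.den_e₁_neg.le h hv
  have key : ∫ t in β.M '' Ioo β.cubic.e₁ u, 1 / √((d S z).eval t) = β.cubic.per₂ - 2 * s := by
    rw [← hs, ← Branch.integral_image_M hβ hq]
    refine setIntegral_congr_fun ?_ fun t ht => ?_
    · exact measurableSet_Ioo.image_of_continuousOn_injOn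
        (fun v hv => (β.hasDerivAt_M (hq v hv).ne).continuousAt.continuousWithinAt)
        (fun v hv w hw hvw => by
          by_contra hne
          rcases lt_or_gt_of_ne hne with hlt | hlt
          · exact absurd ((β.M_lt_M_iff (hq w hw) (hq v hv)).2 hlt) (by simp [hvw])
          · exact absurd ((β.M_lt_M_iff (hq v hv) (hq w hw)).2 hlt) (by simp [hvw]))
    · obtain ⟨v, hv, rfl⟩ := ht
      have : 0 ≤ (kernel S z).disc (β.M v) := by
        rw [Branch.disc_M hβ (hq v hv).ne]
        refine mul_nonneg (sq_nonneg _) (mul_nonneg (mul_nonneg ?_ ?_) ?_)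
        · linarith [hv.1]
        · linarith [hv.1, β.cubic.lt₂₁]
        · linarith [hv.1, β.cubic.lt₂₁, β.cubic.lt₃₂]
      simp only [eval_d hS, abs_of_nonneg this]
  refine ⟨s, hs0, hs1, ?_, ?_⟩
  · rw [ω₃, x₁_eq hS hβ, hXy, ← key]
    rcases h with ⟨ha, -, hD⟩ | ⟨ha, hD, hlt, hX⟩
    · rw [if_pos ha, β.image_M_Ioo_of_pole hu β.den_e₁_neg hD, β.M_e₁]
      exact integral_Iic_eq_integral_Iio
    · have hMu : β.M u = -(kernel S z).swap.b β'.t₁ / (2 * (kernel S z).swap.a β'.t₁) := by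
        rw [Branch.M, hX, mul_div_cancel_right₀ _ hD.ne]
      rw [if_neg ha, β.image_M_Ioo β.den_e₁_neg hD, β.M_e₁, hMu]
      simp only [arc, if_pos hlt.le]
      exact integral_Icc_eq_integral_Ioo
  · rcases h with h | ⟨ha, hD, -, hX⟩
    · exact Or.inl h
    · exact Or.inr ⟨ha, hD, hX⟩

end

end QuarterPlane

end

/-! ### Curves defined by normalized biquadratic polynomials -/

section

open Topology

/-- A solution of a homogeneous linear differential system with continuous coefficients that
vanishes at a point vanishes nearby. -/
theorem eventually_eq_zero_of_linear {ι : Type*} [Fintype ι] {v : ι → ℂ → ℂ}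
    {m : ι → ι → ℂ → ℂ} {w₀ : ℂ} (hm : ∀ i j, ContinuousAt (m i j) w₀)
    (hv : ∀ᶠ w in 𝓝 w₀, ∀ i, HasDerivAt (v i) (∑ j, m i j w * v j w) w)
    (h0 : ∀ i, v i w₀ = 0) : ∀ᶠ w in 𝓝 w₀, ∀ i, v i w = 0 := by
  have hb : ∀ᶠ w in 𝓝 w₀, ∀ i j, ‖m i j w‖ ≤ ‖m i j w₀‖ + 1 := by
    rw [eventually_all]; intro i
    rw [eventually_all]; intro j
    filter_upwards [(hm i j).norm.eventually_lt_const (lt_add_one _)] with w hw using hw.le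
  have := eventually_eq_zero_of_norm_deriv_le (v := fun w i => v i w) (w₀ := w₀)
    (v' := fun w i => ∑ j, m i j w * v j w) (K := ∑ i, ∑ j, (‖m i j w₀‖ + 1))
    (by
      filter_upwards [hv, hb] with w hw hw'
      refine ⟨hasDerivAt_pi.2 hw, (pi_norm_le_iff_of_nonneg (by positivity)).2 fun i => ?_⟩
      calc ‖∑ j, m i j w * v j w‖ ≤ ∑ j, ‖m i j w * v j w‖ := norm_sum_le _ _
        _ ≤ ∑ j, (‖m i j w₀‖ + 1) * ‖fun i => v i w‖ := by
            refine Finset.sum_le_sum fun j _ => ?_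
            rw [norm_mul]
            gcongr
            · exact hw' i j
            · exact norm_le_pi_norm (fun i => v i w) j
        _ = (∑ j, (‖m i j w₀‖ + 1)) * ‖fun i => v i w‖ := by rw [Finset.sum_mul]
        _ ≤ _ := by
            refine mul_le_mul_of_nonneg_right ?_ (norm_nonneg _)
            exact Finset.single_le_sum (f := fun i => ∑ j, (‖m i j w₀‖ + 1))
              (fun i _ => by positivity) (Finset.mem_univ i))
    (funext h0)
  exact this.mono fun w hw i => congrFun hw i

namespace Biquad

variable (k : Biquad)

/-- The partial derivative of a biquadratic polynomial in its first variable. -/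
noncomputable def valU (u v : ℂ) : ℂ :=
  (k.a₁ + 2 * k.a₂ * u) * v ^ 2 + (k.b₁ + 2 * k.b₂ * u) * v + (k.c₁ + 2 * k.c₂ * u)
/-- The partial derivative in the second variable. -/
noncomputable def valV (u v : ℂ) : ℂ :=
  2 * (k.a₀ + k.a₁ * u + k.a₂ * u ^ 2) * v + (k.b₀ + k.b₁ * u + k.b₂ * u ^ 2)
/-- The mixed second derivative. -/
noncomputable def valUV (u v : ℂ) : ℂ := 2 * (k.a₁ + 2 * k.a₂ * u) * v + (k.b₁ + 2 * k.b₂ * u)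
/-- The second derivative in the second variable, which depends on the first variable only. -/
noncomputable def valVV (u : ℂ) : ℂ := 2 * (k.a₀ + k.a₁ * u + k.a₂ * u ^ 2)

/-- The discriminant of the biquadratic polynomial with respect to its second variable is
`E² (u - e₁) (u - e₂) (u - e₃)`. -/
structure IsNormal (E : ℝ) (R : RealCubic) : Prop where
  d₀ : k.d₀ = -E ^ 2 * (R.e₁ * R.e₂ * R.e₃)
  d₁ : k.d₁ = E ^ 2 * (R.e₁ * R.e₂ + R.e₁ * R.e₃ + R.e₂ * R.e₃)
  d₂ : k.d₂ = 0
  d₃ : k.d₃ = E ^ 2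
  d₄ : k.d₄ = 0

variable {k} {E : ℝ} {R : RealCubic}

lemma IsNormal.valV_sq (h : k.IsNormal E R) (u v : ℂ) : k.valV u v ^ 2 =
    E ^ 2 * ((u - R.e₁) * (u - R.e₂) * (u - R.e₃)) + 2 * k.valVV u * k.val u v := by
  have h0 := congrArg Complex.ofReal h.d₀
  have h1 := congrArg Complex.ofReal h.d₁
  have h2 := congrArg Complex.ofReal h.d₂
  have h3 := congrArg Complex.ofReal h.d₃
  have h4 := congrArg Complex.ofReal h.d₄
  have hs := congrArg Complex.ofReal R.sum_eq
  simp only [Biquad.d₀, Biquad.d₁, Biquad.d₂, Biquad.d₃, Biquad.d₄] at h0 h1 h2 h3 h4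
  push_cast at h0 h1 h2 h3 h4 hs
  simp only [valV, valVV, val]
  linear_combination h0 + u * h1 + u ^ 2 * h2 + u ^ 3 * h3 + u ^ 4 * h4 + E ^ 2 * u ^ 2 * hs

lemma IsNormal.valV_mul (h : k.IsNormal E R) (u v : ℂ) :
    2 * k.valV u v * k.valUV u v - 4 * (k.a₁ + 2 * k.a₂ * u) * k.val u v
      - 2 * k.valVV u * k.valU u v =
    E ^ 2 * (3 * u ^ 2 + (R.e₁ * R.e₂ + R.e₁ * R.e₃ + R.e₂ * R.e₃)) := by
  have h1 := congrArg Complex.ofReal h.d₁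
  have h2 := congrArg Complex.ofReal h.d₂
  have h3 := congrArg Complex.ofReal h.d₃
  have h4 := congrArg Complex.ofReal h.d₄
  simp only [Biquad.d₁, Biquad.d₂, Biquad.d₃, Biquad.d₄] at h1 h2 h3 h4
  push_cast at h1 h2 h3 h4
  simp only [valV, valVV, valU, valUV, val]
  linear_combination h1 + 2 * u * h2 + 3 * u ^ 2 * h3 + 4 * u ^ 3 * h4

lemma hasDerivAt_val {u v : ℂ → ℂ} {u' v' w : ℂ} (hu : HasDerivAt u u' w)
    (hv : HasDerivAt v v' w) : HasDerivAt (fun w => k.val (u w) (v w))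
      (k.valU (u w) (v w) * u' + k.valV (u w) (v w) * v') w := by
  have ha := ((hu.const_mul (k.a₁ : ℂ)).const_add (k.a₀ : ℂ)).fun_add
    ((hu.fun_pow 2).const_mul (k.a₂ : ℂ))
  have hb := ((hu.const_mul (k.b₁ : ℂ)).const_add (k.b₀ : ℂ)).fun_add
    ((hu.fun_pow 2).const_mul (k.b₂ : ℂ))
  have hc := ((hu.const_mul (k.c₁ : ℂ)).const_add (k.c₀ : ℂ)).fun_add
    ((hu.fun_pow 2).const_mul (k.c₂ : ℂ))
  refine (((ha.fun_mul (hv.fun_pow 2)).fun_add (hb.fun_mul hv)).fun_add hc).congr_deriv ?_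
  simp only [valU, valV]
  push_cast
  ring

lemma hasDerivAt_valV {u v : ℂ → ℂ} {u' v' w : ℂ} (hu : HasDerivAt u u' w)
    (hv : HasDerivAt v v' w) : HasDerivAt (fun w => k.valV (u w) (v w))
      (k.valUV (u w) (v w) * u' + k.valVV (u w) * v') w := by
  have ha := ((hu.const_mul (k.a₁ : ℂ)).const_add (k.a₀ : ℂ)).fun_add
    ((hu.fun_pow 2).const_mul (k.a₂ : ℂ))
  have hb := ((hu.const_mul (k.b₁ : ℂ)).const_add (k.b₀ : ℂ)).fun_add
    ((hu.fun_pow 2).const_mul (k.b₂ : ℂ))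
  refine (((ha.const_mul 2).fun_mul hv).fun_add hb).congr_deriv ?_
  simp only [valUV, valVV]
  push_cast
  ring

lemma valU_eq_swap (k : Biquad) (u v : ℂ) : k.valU u v = k.swap.valV v u := by
  simp only [valU, valV, swap]; ring

lemma val_eq_swap (k : Biquad) (u v : ℂ) : k.val u v = k.swap.val v u := (val_swap k u v).symm

end Biquad

/-- The identity principle behind the uniformization of a biquadratic curve: if `(℘(ω), ℘(ω - c))`
satisfies the equation `k = 0` and the differential relations
`E ℘'(ω) = 2 ε k_v`, `E ℘'(ω - c) = -2 ε k_u` at one point, it does so everywhere. Indeed, the three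
defects satisfy a homogeneous linear differential system. -/
theorem Biquad.uniformization {k : Biquad} {E : ℝ} {R : RealCubic} (hE : E ≠ 0)
    (h : k.IsNormal E R) (h' : k.swap.IsNormal E R) {c ε w₀ : ℂ} (hε : ε ^ 2 = 1)
    (hw₀ : w₀ ∉ R.L.lattice) (hw₀' : w₀ - c ∉ R.L.lattice)
    (h0 : k.val (R.L.weierstrassP w₀) (R.L.weierstrassP (w₀ - c)) = 0)
    (h1 : E * R.L.derivWeierstrassP w₀ -
      2 * ε * k.valV (R.L.weierstrassP w₀) (R.L.weierstrassP (w₀ - c)) = 0)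
    (h2 : E * R.L.derivWeierstrassP (w₀ - c) +
      2 * ε * k.valU (R.L.weierstrassP w₀) (R.L.weierstrassP (w₀ - c)) = 0) :
    ∀ w ∉ R.L.lattice, w - c ∉ R.L.lattice →
      k.val (R.L.weierstrassP w) (R.L.weierstrassP (w - c)) = 0 ∧
      E * R.L.derivWeierstrassP w =
        2 * ε * k.valV (R.L.weierstrassP w) (R.L.weierstrassP (w - c)) ∧
      E * R.L.derivWeierstrassP (w - c) =
        -2 * ε * k.valU (R.L.weierstrassP w) (R.L.weierstrassP (w - c)) := by
  have hEC : (E : ℂ) ≠ 0 := by exact_mod_cast hE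
  obtain ⟨u, hu⟩ : ∃ u, u = R.L.weierstrassP := ⟨_, rfl⟩
  obtain ⟨u', hu'⟩ : ∃ u', u' = R.L.derivWeierstrassP := ⟨_, rfl⟩
  simp only [← hu, ← hu'] at h0 h1 h2 ⊢
  have du : ∀ w ∉ R.L.lattice, HasDerivAt u (u' w) w := fun w hw => by
    rw [hu, hu']; exact R.hasDerivAt_weierstrassP hw
  have du' : ∀ w ∉ R.L.lattice, HasDerivAt u'
      (6 * u w ^ 2 + 2 * (R.e₁ * R.e₂ + R.e₁ * R.e₃ + R.e₂ * R.e₃)) w := fun w hw => by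
    rw [hu, hu']; exact R.hasDerivAt_derivWeierstrassP hw
  have dv : ∀ w, w - c ∉ R.L.lattice → HasDerivAt (fun w => u (w - c)) (u' (w - c)) w :=
    fun w hw => (du _ hw).comp_sub_const w c
  have dv' : ∀ w, w - c ∉ R.L.lattice → HasDerivAt (fun w => u' (w - c))
      (6 * u (w - c) ^ 2 + 2 * (R.e₁ * R.e₂ + R.e₁ * R.e₃ + R.e₂ * R.e₃)) w :=
    fun w hw => (du' _ hw).comp_sub_const w c
  obtain ⟨F, hF⟩ : ∃ F : ℂ → ℂ, F = fun w => k.val (u w) (u (w - c)) := ⟨_, rfl⟩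
  obtain ⟨p, hp⟩ : ∃ p : ℂ → ℂ, p = fun w => E * u' w - 2 * ε * k.valV (u w) (u (w - c)) :=
    ⟨_, rfl⟩
  obtain ⟨r, hr⟩ : ∃ r : ℂ → ℂ,
    r = fun w => E * u' (w - c) + 2 * ε * k.valU (u w) (u (w - c)) := ⟨_, rfl⟩
  have dF : ∀ w ∉ R.L.lattice, w - c ∉ R.L.lattice → HasDerivAt F
      ((k.valU (u w) (u (w - c)) * p w + k.valV (u w) (u (w - c)) * r w) / E) w := by
    intro w hw hw'
    rw [hF]
    refine (k.hasDerivAt_val (du w hw) (dv w hw')).congr_deriv ?_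
    rw [hp, hr, eq_div_iff hEC]
    ring
  have dp : ∀ w ∉ R.L.lattice, w - c ∉ R.L.lattice → HasDerivAt p
      ((-8 * (k.a₁ + 2 * k.a₂ * u w) * F w - 2 * ε * k.valUV (u w) (u (w - c)) * p w
        - 2 * ε * k.valVV (u w) * r w) / E) w := by
    intro w hw hw'
    rw [hp]
    refine (((du' w hw).const_mul (E : ℂ)).fun_sub
      ((k.hasDerivAt_valV (du w hw) (dv w hw')).const_mul (2 * ε))).congr_deriv ?_
    have := h.valV_mul (u w) (u (w - c))
    rw [hr, hF, eq_div_iff hEC]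
    linear_combination -2 * this + 4 * (k.valV (u w) (u (w - c)) * k.valUV (u w) (u (w - c))
      - k.valVV (u w) * k.valU (u w) (u (w - c))) * -hε
  have dr : ∀ w ∉ R.L.lattice, w - c ∉ R.L.lattice → HasDerivAt r
      ((-8 * (k.b₂ + 2 * k.a₂ * u (w - c)) * F w
        + 2 * ε * k.swap.valUV (u (w - c)) (u w) * r w
        + 2 * ε * k.swap.valVV (u (w - c)) * p w) / E) w := by
    intro w hw hw'
    simp only [hr, Biquad.valU_eq_swap]
    refine (((dv' w hw').const_mul (E : ℂ)).fun_add
      ((k.swap.hasDerivAt_valV (dv w hw') (du w hw)).const_mul (2 * ε))).congr_deriv ?_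
    have := h'.valV_mul (u (w - c)) (u w)
    simp only [hp, hF]
    rw [eq_div_iff hEC]
    have e1 := k.val_eq_swap (u w) (u (w - c))
    have e2 := k.swap.valU_eq_swap (u (w - c)) (u w)
    have e3 : (k.swap.a₁ : ℂ) = k.b₂ := rfl
    have e4 : (k.swap.a₂ : ℂ) = k.a₂ := rfl
    rw [e2, e3, e4, Biquad.swap_swap] at this
    rw [e1]
    linear_combination -2 * this + 4 * (k.swap.valV (u (w - c)) (u w)
      * k.swap.valUV (u (w - c)) (u w)
      - k.swap.valVV (u (w - c)) * k.valV (u w) (u (w - c))) * -hε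
  have cu : ContinuousAt u w₀ := (du w₀ hw₀).continuousAt
  have cv : ContinuousAt (fun w => u (w - c)) w₀ := (dv w₀ hw₀').continuousAt
  have notMem : ∀ᶠ w in 𝓝 w₀, w ∉ R.L.lattice ∧ w - c ∉ R.L.lattice :=
    Filter.Eventually.and (R.L_isOpen.mem_nhds hw₀)
      ((continuous_sub_right c).continuousAt.preimage_mem_nhds (R.L_isOpen.mem_nhds hw₀'))
  have hcont : ∀ g : ℂ → ℂ, ContinuousAt g w₀ → ∀ i j, ContinuousAt
      ((![![fun w => 0, fun w => k.valU (u w) (g w) / E, fun w => k.valV (u w) (g w) / E],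
      ![fun w => -8 * (k.a₁ + 2 * k.a₂ * u w) / E,
        fun w => -2 * ε * k.valUV (u w) (g w) / E, fun w => -2 * ε * k.valVV (u w) / E],
      ![fun w => -8 * (k.b₂ + 2 * k.a₂ * g w) / E,
        fun w => 2 * ε * k.swap.valVV (g w) / E,
        fun w => 2 * ε * k.swap.valUV (g w) (u w) / E]] : Fin 3 → Fin 3 → ℂ → ℂ) i j) w₀ := by
    simp only [Biquad.valU, Biquad.valV, Biquad.valUV, Biquad.valVV]
    intro g hg i j
    fin_cases i <;> fin_cases j <;> simp <;> fun_prop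
  have key := eventually_eq_zero_of_linear (w₀ := w₀) (v := ![F, p, r])
    (hcont _ cv)
    (by
      filter_upwards [notMem] with w hw i
      fin_cases i
      · refine (dF w hw.1 hw.2).congr_deriv ?_
        simp [Fin.sum_univ_three]; ring
      · refine (dp w hw.1 hw.2).congr_deriv ?_
        simp [Fin.sum_univ_three]; ring
      · refine (dr w hw.1 hw.2).congr_deriv ?_
        simp [Fin.sum_univ_three]; ring)
    (by
      intro i
      fin_cases i
      · simpa [hF] using h0
      · simpa [hp] using h1
      · simpa [hr] using h2)
  obtain ⟨Z, hZ⟩ : ∃ Z : Set ℂ, Z = (R.L.lattice : Set ℂ) ∪ (fun w => w - c) ⁻¹' R.L.lattice := ⟨_, rfl⟩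
  have hZc : Z.Countable := by
    rw [hZ]
    exact R.countable_L.union (R.countable_L.preimage (sub_left_injective (b := c)))
  have memZ : ∀ w, w ∉ Z ↔ w ∉ R.L.lattice ∧ w - c ∉ R.L.lattice := fun w => by
    rw [hZ, Set.mem_union, not_or]; rfl
  have hopen : IsOpen Zᶜ := by
    have : Zᶜ = (R.L.lattice : Set ℂ)ᶜ ∩ (fun w => w - c) ⁻¹' (R.L.lattice : Set ℂ)ᶜ := by
      ext w; exact memZ w
    rw [this]
    exact R.L_isOpen.inter (R.L_isOpen.preimage (continuous_sub_right c))
  have analytic : ∀ {f f' : ℂ → ℂ}, (∀ w ∉ R.L.lattice, w - c ∉ R.L.lattice →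
      HasDerivAt f (f' w) w) → ∀ w ∉ Z, AnalyticAt ℂ f w := by
    intro f f' hf w hw
    refine DifferentiableOn.analyticAt (s := Zᶜ) (fun y hy => ?_) (hopen.mem_nhds hw)
    have := (memZ y).1 hy
    exact (hf y this.1 this.2).differentiableAt.differentiableWithinAt
  have zero : ∀ (i : Fin 3) (f' : ℂ → ℂ), (∀ w ∉ R.L.lattice, w - c ∉ R.L.lattice →
      HasDerivAt ((![F, p, r] : Fin 3 → ℂ → ℂ) i) (f' w) w) →
      ∀ w ∉ Z, (![F, p, r] : Fin 3 → ℂ → ℂ) i w = 0 := fun i f' hf =>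
    eqOn_compl_of_eventuallyEq (g := fun _ => 0) hZc (analytic hf) (fun w _ => analyticAt_const)
      ((memZ w₀).2 ⟨hw₀, hw₀'⟩) (key.mono fun w hw => hw i)
  intro w hw hw'
  have hwZ := (memZ w).2 ⟨hw, hw'⟩
  have z0 : F w = 0 := zero 0 _ dF w hwZ
  have z1 : p w = 0 := zero 1 _ dp w hwZ
  have z2 : r w = 0 := zero 2 _ dr w hwZ
  rw [hF] at z0
  rw [hp] at z1
  rw [hr] at z2
  exact ⟨z0, by linear_combination z1, by linear_combination z2⟩

end

/-! ### Normalization of the kernel -/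

section

open Topology

namespace Biquad

/-- The substitution of the Möbius transformation of a branch datum for the first variable, with
denominators cleared. -/
noncomputable def subst (k : Biquad) (β : Branch) : Biquad where
  a₀ := k.a₀ * β.D ^ 2 + k.a₁ * (β.B * β.D) + k.a₂ * β.B ^ 2
  a₁ := 2 * k.a₀ * (β.s₁ * β.D) + k.a₁ * (β.D + β.s₁ * β.B) + 2 * k.a₂ * β.B
  a₂ := k.a₀ * β.s₁ ^ 2 + k.a₁ * β.s₁ + k.a₂
  b₀ := k.b₀ * β.D ^ 2 + k.b₁ * (β.B * β.D) + k.b₂ * β.B ^ 2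
  b₁ := 2 * k.b₀ * (β.s₁ * β.D) + k.b₁ * (β.D + β.s₁ * β.B) + 2 * k.b₂ * β.B
  b₂ := k.b₀ * β.s₁ ^ 2 + k.b₁ * β.s₁ + k.b₂
  c₀ := k.c₀ * β.D ^ 2 + k.c₁ * (β.B * β.D) + k.c₂ * β.B ^ 2
  c₁ := 2 * k.c₀ * (β.s₁ * β.D) + k.c₁ * (β.D + β.s₁ * β.B) + 2 * k.c₂ * β.B
  c₂ := k.c₀ * β.s₁ ^ 2 + k.c₁ * β.s₁ + k.c₂

variable {k : Biquad} {β β' : Branch}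

/-- Two biquadratic polynomials whose discriminants are proportional with factor `l²`. -/
structure DiscMul (k k' : Biquad) (l : ℝ) : Prop where
  d₀ : k'.d₀ = l ^ 2 * k.d₀
  d₁ : k'.d₁ = l ^ 2 * k.d₁
  d₂ : k'.d₂ = l ^ 2 * k.d₂
  d₃ : k'.d₃ = l ^ 2 * k.d₃
  d₄ : k'.d₄ = l ^ 2 * k.d₄

lemma discMul_subst_swap (k : Biquad) (β : Branch) : DiscMul k.swap (k.subst β).swap β.det := by
  constructor <;> simp only [Biquad.d₀, Biquad.d₁, Biquad.d₂, Biquad.d₃, Biquad.d₄, swap, subst,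
    Branch.det] <;> ring

lemma disc_subst (k : Biquad) (β : Branch) (u : ℝ) : (k.subst β).disc u =
    k.d₀ * (β.s₁ * u + β.D) ^ 4 + k.d₁ * ((u + β.B) * (β.s₁ * u + β.D) ^ 3)
    + k.d₂ * ((u + β.B) ^ 2 * (β.s₁ * u + β.D) ^ 2) + k.d₃ * ((u + β.B) ^ 3 * (β.s₁ * u + β.D))
    + k.d₄ * (u + β.B) ^ 4 := by
  have ha : (k.subst β).a u = k.a₀ * (β.s₁ * u + β.D) ^ 2
      + k.a₁ * ((u + β.B) * (β.s₁ * u + β.D)) + k.a₂ * (u + β.B) ^ 2 := by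
    simp only [a, subst]; ring
  have hb : (k.subst β).b u = k.b₀ * (β.s₁ * u + β.D) ^ 2
      + k.b₁ * ((u + β.B) * (β.s₁ * u + β.D)) + k.b₂ * (u + β.B) ^ 2 := by
    simp only [b, subst]; ring
  have hc : (k.subst β).c u = k.c₀ * (β.s₁ * u + β.D) ^ 2
      + k.c₁ * ((u + β.B) * (β.s₁ * u + β.D)) + k.c₂ * (u + β.B) ^ 2 := by
    simp only [c, subst]; ring
  rw [disc_eq, ha, hb, hc]
  simp only [Biquad.d₀, Biquad.d₁, Biquad.d₂, Biquad.d₃, Biquad.d₄]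
  ring

lemma IsNormal.of_discMul {k' : Biquad} {l E : ℝ} {R : RealCubic} (h : k.IsNormal E R)
    (hm : DiscMul k k' l) : k'.IsNormal (l * E) R := by
  constructor
  · rw [hm.d₀, h.d₀]; ring
  · rw [hm.d₁, h.d₁]; ring
  · rw [hm.d₂, h.d₂]; ring
  · rw [hm.d₃, h.d₃]; ring
  · rw [hm.d₄, h.d₄]; ring

/-- In the coordinate of the Weierstrass cubic, the discriminant is normalized. -/
lemma isNormal_subst {k' : Biquad} {l : ℝ} (hβ : β.IsBranch k) (hm : DiscMul k k' l) :
    (k'.subst β).IsNormal (l * β.det) β.cubic := by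
  have key : ∀ u : ℝ, (k'.subst β).disc u = (l * β.det) ^ 2 * β.cubic.cub u := by
    intro u
    rw [disc_subst, hm.d₀, hm.d₁, hm.d₂, hm.d₃, hm.d₄, hβ.d₀, hβ.d₁, hβ.d₂, hβ.d₃, hβ.d₄]
    have e1 : u + β.B - β.t₁ * (β.s₁ * u + β.D) = (1 - β.s₁ * β.t₁) * (u - β.cubic.e₁) := by
      linear_combination β.B_sub₁
    have e2 : u + β.B - β.t₂ * (β.s₁ * u + β.D) = (1 - β.s₁ * β.t₂) * (u - β.cubic.e₂) := by
      linear_combination β.B_sub₂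
    have e3 : β.s₁ * u + β.D - β.s₂ * (u + β.B) = (β.s₁ - β.s₂) * (u - β.cubic.e₃) := by
      linear_combination β.D_sub₃
    have e4 : β.s₁ * u + β.D - β.s₁ * (u + β.B) = β.det := by rw [Branch.det]; ring
    have e5 : (l * β.det) ^ 2 * β.cubic.cub u = l ^ 2 * (β.μ *
        ((1 - β.s₁ * β.t₁) * (u - β.cubic.e₁)) * ((1 - β.s₁ * β.t₂) * (u - β.cubic.e₂))
        * ((β.s₁ - β.s₂) * (u - β.cubic.e₃)) * β.det) := by
      rw [RealCubic.cub, mul_pow, sq β.det]; nth_rw 1 [β.det_eq]; ring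
    rw [e5, ← e1, ← e2, ← e3, ← e4]
    ring
  have g0 := key 0
  have g1 := key 1
  have g2 := key (-1)
  have g3 := key 2
  have g4 := key (-2)
  have hs := β.cubic.sum_eq
  simp only [disc, RealCubic.cub] at g0 g1 g2 g3 g4
  constructor
  · linear_combination g0
  · linear_combination (2 / 3) * g1 - (2 / 3) * g2 - g3 / 12 + g4 / 12
  · linear_combination -(5 / 4) * g0 + (2 / 3) * g1 + (2 / 3) * g2 - g3 / 24 - g4 / 24
      - (l * β.det) ^ 2 * hs
  · linear_combination -g1 / 6 + g2 / 6 + g3 / 12 - g4 / 12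
  · linear_combination g0 / 4 - g1 / 6 - g2 / 6 + g3 / 24 + g4 / 24

/-- The kernel in the coordinates of the two Weierstrass cubics. -/
noncomputable def normalForm (k : Biquad) (β β' : Branch) : Biquad :=
  ((k.subst β).swap.subst β').swap

/-- The coefficient `a` of the square of the second variable, as a binary quadratic form in the
homogeneous coordinates `(N : q)` of the first variable. -/
noncomputable def homA (k : Biquad) (N q : ℂ) : ℂ := k.a₀ * q ^ 2 + k.a₁ * (N * q) + k.a₂ * N ^ 2
/-- The coefficient `b` as a binary quadratic form, see `homA`. -/
noncomputable def homB (k : Biquad) (N q : ℂ) : ℂ := k.b₀ * q ^ 2 + k.b₁ * (N * q) + k.b₂ * N ^ 2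
/-- The coefficient `c` as a binary quadratic form, see `homA`. -/
noncomputable def homC (k : Biquad) (N q : ℂ) : ℂ := k.c₀ * q ^ 2 + k.c₁ * (N * q) + k.c₂ * N ^ 2

lemma isNormal_normalForm (hβ : β.IsBranch k) :
    (k.normalForm β β').IsNormal (β.det * β'.det) β.cubic := by
  have h1 : (k.subst β).IsNormal (1 * β.det) β.cubic :=
    isNormal_subst hβ (by constructor <;> ring)
  have h2 := h1.of_discMul (discMul_subst_swap (k.subst β).swap β')
  rw [one_mul, mul_comm] at h2
  exact h2

lemma isNormal_normalForm_swap (hβ' : β'.IsBranch k.swap) (he : β'.cubic = β.cubic) :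
    (k.normalForm β β').swap.IsNormal (β.det * β'.det) β.cubic := by
  rw [← he]
  exact isNormal_subst hβ' (discMul_subst_swap k β)

lemma val_normalForm (u v : ℂ) : (k.normalForm β β').val u v =
    k.homA (u + β.B) (β.s₁ * u + β.D) * (v + β'.B) ^ 2
    + k.homB (u + β.B) (β.s₁ * u + β.D) * ((v + β'.B) * (β'.s₁ * v + β'.D))
    + k.homC (u + β.B) (β.s₁ * u + β.D) * (β'.s₁ * v + β'.D) ^ 2 := by
  simp only [normalForm, subst, swap, val, homA, homB, homC]
  push_cast
  ring

/-- The coefficients of the normal form in the second variable. -/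
lemma normalForm_coeff (u : ℂ) :
    ((k.normalForm β β').homA u 1 =
      k.homA (u + β.B) (β.s₁ * u + β.D) + k.homB (u + β.B) (β.s₁ * u + β.D) * β'.s₁
      + k.homC (u + β.B) (β.s₁ * u + β.D) * β'.s₁ ^ 2) ∧
    ((k.normalForm β β').homB u 1 =
      2 * k.homA (u + β.B) (β.s₁ * u + β.D) * β'.B
      + k.homB (u + β.B) (β.s₁ * u + β.D) * (β'.D + β'.s₁ * β'.B)
      + 2 * k.homC (u + β.B) (β.s₁ * u + β.D) * (β'.s₁ * β'.D)) ∧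
    ((k.normalForm β β').homC u 1 =
      k.homA (u + β.B) (β.s₁ * u + β.D) * β'.B ^ 2
      + k.homB (u + β.B) (β.s₁ * u + β.D) * (β'.B * β'.D)
      + k.homC (u + β.B) (β.s₁ * u + β.D) * β'.D ^ 2) := by
  refine ⟨?_, ?_, ?_⟩ <;>
  · simp only [normalForm, subst, swap, homA, homB, homC]
    push_cast
    ring

lemma normalForm_swap : (k.normalForm β β').swap = k.swap.normalForm β' β := by
  simp only [normalForm, subst, swap, Biquad.mk.injEq]
  refine ⟨?_, ?_, ?_, ?_, ?_, ?_, ?_, ?_, ?_⟩ <;> ring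

end Biquad

end

/-! ### The parametrization of the kernel curve -/

section

open Topology

open Classical in
/-- The function `℘` of a real cubic with values in the Riemann sphere. -/
noncomputable def RealCubic.sphereP (R : RealCubic) (w : ℂ) : OnePoint ℂ :=
  if w ∈ R.L.lattice then ∞ else ((R.L.weierstrassP w : ℂ) : OnePoint ℂ)

lemma RealCubic.sphereP_neg (R : RealCubic) (w : ℂ) : R.sphereP (-w) = R.sphereP w := by
  rw [RealCubic.sphereP, RealCubic.sphereP, neg_mem_iff, R.L.weierstrassP_neg]

lemma RealCubic.sphereP_add (R : RealCubic) {l : ℂ} (hl : l ∈ R.L.lattice) (w : ℂ) :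
    R.sphereP (w + l) = R.sphereP w := by
  rw [RealCubic.sphereP, RealCubic.sphereP, R.add_mem_L_iff hl, R.weierstrassP_add hl]

namespace Branch

variable (β : Branch)

/-- The numerator of the coordinate `(u + B) / (s₁ u + D)`, as a function on the Riemann sphere. -/
noncomputable def num : OnePoint ℂ → ℂ
  | OnePoint.some u => u + β.B
  | ∞ => 1

/-- The denominator of the coordinate `(u + B) / (s₁ u + D)`, as a function on the Riemann
sphere. -/
noncomputable def den : OnePoint ℂ → ℂ
  | OnePoint.some u => β.s₁ * u + β.D
  | ∞ => β.s₁

/-- The first homogeneous coordinate of the function `(℘ + B) / (s₁ ℘ + D)`. At a point of the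
lattice the pair of coordinates is `(1 : s₁)`, so that poles of `℘` need no separate treatment. -/
noncomputable def X (w : ℂ) : ℂ := β.num (β.cubic.sphereP w)
/-- The second homogeneous coordinate of the function `(℘ + B) / (s₁ ℘ + D)`, see `X`. -/
noncomputable def W (w : ℂ) : ℂ := β.den (β.cubic.sphereP w)

variable {β} {w : ℂ}

lemma X_of_mem (h : w ∈ β.cubic.L.lattice) : β.X w = 1 := by
  simp [X, RealCubic.sphereP, h, num]
lemma W_of_mem (h : w ∈ β.cubic.L.lattice) : β.W w = β.s₁ := by
  simp [W, RealCubic.sphereP, h, den]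
lemma X_of_notMem (h : w ∉ β.cubic.L.lattice) : β.X w = β.cubic.L.weierstrassP w + β.B := by
  simp [X, RealCubic.sphereP, h, num]
lemma W_of_notMem (h : w ∉ β.cubic.L.lattice) :
    β.W w = β.s₁ * β.cubic.L.weierstrassP w + β.D := by
  simp [W, RealCubic.sphereP, h, den]

lemma X_neg (β : Branch) (w : ℂ) : β.X (-w) = β.X w := by rw [X, X, RealCubic.sphereP_neg]
lemma W_neg (β : Branch) (w : ℂ) : β.W (-w) = β.W w := by rw [W, W, RealCubic.sphereP_neg]
lemma X_add {l : ℂ} (hl : l ∈ β.cubic.L.lattice) (w : ℂ) : β.X (w + l) = β.X w := by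
  rw [X, X, RealCubic.sphereP_add _ hl]
lemma W_add {l : ℂ} (hl : l ∈ β.cubic.L.lattice) (w : ℂ) : β.W (w + l) = β.W w := by
  rw [W, W, RealCubic.sphereP_add _ hl]

end Branch

namespace Biquad

/-- The functions `x = X / W` attached to `β` and `y = Y / V` attached to `β'` parametrize the curve
`k(x, y) = 0` by `ω ↦ (x(ω), y(ω - c))`, in such a way that the two values of `y` that belong to
`x(ω)` are `y(ω - c)` and `y(ω + c)`. This is stated in homogeneous coordinates, which includes the
poles: the quadratic form `A Y² + B Y V + C V²` is a multiple of the product of the linear forms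
that vanish at `(Y(ω - c) : V(ω - c))` and `(Y(ω + c) : V(ω + c))`. -/
def Uniformizes (k : Biquad) (β β' : Branch) (c : ℝ) : Prop :=
  ∀ w ∉ β.cubic.L.lattice, ∃ m : ℂ,
    k.homA (β.X w) (β.W w) = m * (β'.W (w - c) * β'.W (w + c)) ∧
    k.homC (β.X w) (β.W w) = m * (β'.X (w - c) * β'.X (w + c)) ∧
    k.homB (β.X w) (β.W w) =
      -m * (β'.X (w - c) * β'.W (w + c) + β'.W (w - c) * β'.X (w + c))

variable {k : Biquad} {β β' : Branch} {c : ℝ}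

/-- The factorization at points where `y` is finite in the coordinate of the Weierstrass cubic. -/
lemma hom_of_roots {u v₁ v₂ m : ℂ}
    (hs : (k.normalForm β β').homA u 1 * (v₁ + v₂) = -(k.normalForm β β').homB u 1)
    (hp : (k.normalForm β β').homA u 1 * (v₁ * v₂) = (k.normalForm β β').homC u 1)
    (hm : m = (k.normalForm β β').homA u 1 / β'.det ^ 2) :
    k.homA (u + β.B) (β.s₁ * u + β.D) = m * ((β'.s₁ * v₁ + β'.D) * (β'.s₁ * v₂ + β'.D)) ∧
    k.homC (u + β.B) (β.s₁ * u + β.D) = m * ((v₁ + β'.B) * (v₂ + β'.B)) ∧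
    k.homB (u + β.B) (β.s₁ * u + β.D) =
      -m * ((v₁ + β'.B) * (β'.s₁ * v₂ + β'.D) + (β'.s₁ * v₁ + β'.D) * (v₂ + β'.B)) := by
  obtain ⟨ha, hb, hc⟩ := k.normalForm_coeff (β := β) (β' := β') u
  rw [hb] at hs
  rw [hc] at hp
  have hd : ((β'.det : ℝ) : ℂ) ≠ 0 := by exact_mod_cast β'.det_neg.ne
  have hm' : m * (β'.det : ℂ) ^ 2 = (k.normalForm β β').homA u 1 := by rw [hm]; field_simp
  rw [← hm'] at hs hp ha
  rw [Branch.det] at hs hp ha hd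
  push_cast at hs hp ha hd
  generalize k.homA (u + β.B) (β.s₁ * u + β.D) = A at *
  generalize k.homB (u + β.B) (β.s₁ * u + β.D) = B at *
  generalize k.homC (u + β.B) (β.s₁ * u + β.D) = C at *
  refine ⟨?_, ?_, ?_⟩ <;> apply mul_left_cancel₀ (pow_ne_zero 2 hd)
  · linear_combination (-(β'.D : ℂ) ^ 2) * ha - β'.s₁ * β'.D * hs - (β'.s₁ : ℂ) ^ 2 * hp
  · linear_combination (-(β'.B : ℂ) ^ 2) * ha - β'.B * hs - hp
  · linear_combination (2 * β'.B * β'.D : ℂ) * ha + (β'.D + β'.s₁ * β'.B) * hs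
      + 2 * β'.s₁ * hp

lemma tendsto_hom (k : Biquad) {f g : ℂ → ℂ} {l : Filter ℂ} {x y : ℂ} (hf : Tendsto f l (𝓝 x))
    (hg : Tendsto g l (𝓝 y)) : Tendsto (fun v => k.homA (f v) (g v)) l (𝓝 (k.homA x y)) ∧
    Tendsto (fun v => k.homB (f v) (g v)) l (𝓝 (k.homB x y)) ∧
    Tendsto (fun v => k.homC (f v) (g v)) l (𝓝 (k.homC x y)) :=
  ⟨(((hg.pow 2).const_mul _).add ((hf.mul hg).const_mul _)).add ((hf.pow 2).const_mul _),
    (((hg.pow 2).const_mul _).add ((hf.mul hg).const_mul _)).add ((hf.pow 2).const_mul _),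
    (((hg.pow 2).const_mul _).add ((hf.mul hg).const_mul _)).add ((hf.pow 2).const_mul _)⟩

/-- The relation between sum and product of the roots extends to the poles. -/
lemma uniformizes_of_roots (hc0 : 0 < 2 * c) (hc1 : 2 * c < β.cubic.per₂)
    (he : β'.cubic = β.cubic)
    (h : ∀ w ∉ β.cubic.L.lattice, w - c ∉ β.cubic.L.lattice → w + c ∉ β.cubic.L.lattice →
      (k.normalForm β β').homA (β.cubic.L.weierstrassP w) 1 *
        (β.cubic.L.weierstrassP (w - c) + β.cubic.L.weierstrassP (w + c)) =
        -(k.normalForm β β').homB (β.cubic.L.weierstrassP w) 1 ∧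
      (k.normalForm β β').homA (β.cubic.L.weierstrassP w) 1 *
        (β.cubic.L.weierstrassP (w - c) * β.cubic.L.weierstrassP (w + c)) =
        (k.normalForm β β').homC (β.cubic.L.weierstrassP w) 1) : k.Uniformizes β β' c := by
  obtain ⟨R, hR⟩ : ∃ R, R = β.cubic := ⟨_, rfl⟩
  simp only [Uniformizes, ← hR] at h hc1 he ⊢
  have xβ : ∀ w ∉ R.L.lattice, β.X w = R.L.weierstrassP w + β.B ∧
      β.W w = β.s₁ * R.L.weierstrassP w + β.D := fun w hw => by
    rw [hR] at hw ⊢; exact ⟨Branch.X_of_notMem hw, Branch.W_of_notMem hw⟩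
  have xβ' : ∀ w ∉ R.L.lattice, β'.X w = R.L.weierstrassP w + β'.B ∧
      β'.W w = β'.s₁ * R.L.weierstrassP w + β'.D := fun w hw => by
    rw [← he] at hw ⊢; exact ⟨Branch.X_of_notMem hw, Branch.W_of_notMem hw⟩
  have mβ' : ∀ w ∈ R.L.lattice, β'.X w = 1 ∧ β'.W w = β'.s₁ := fun w hw => by
    rw [← he] at hw; exact ⟨Branch.X_of_mem hw, Branch.W_of_mem hw⟩
  obtain ⟨f, hf⟩ : ∃ f : ℂ → ℂ, f = fun v => (-(k.normalForm β β').homB (R.L.weierstrassP v) 1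
      - (k.normalForm β β').homA (R.L.weierstrassP v) 1 * R.L.weierstrassP (v + c))
        / β'.det ^ 2 := ⟨_, rfl⟩
  have key : ∀ w ∉ R.L.lattice, w - c ∉ R.L.lattice → w + c ∉ R.L.lattice → ∃ m : ℂ,
    m * R.L.weierstrassP (w - c) = f w ∧
    k.homA (β.X w) (β.W w) = m * (β'.W (w - c) * β'.W (w + c)) ∧
    k.homC (β.X w) (β.W w) = m * (β'.X (w - c) * β'.X (w + c)) ∧
    k.homB (β.X w) (β.W w) =
      -m * (β'.X (w - c) * β'.W (w + c) + β'.W (w - c) * β'.X (w + c)) := by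
    intro w h0 h1 h2
    obtain ⟨hs, hp⟩ := h w h0 h1 h2
    refine ⟨(k.normalForm β β').homA (R.L.weierstrassP w) 1 / β'.det ^ 2, ?_, ?_⟩
    · simp only [hf]
      rw [div_mul_eq_mul_div]
      congr 1
      linear_combination hs
    · rw [(xβ w h0).1, (xβ w h0).2, (xβ' _ h1).1, (xβ' _ h1).2, (xβ' _ h2).1, (xβ' _ h2).2]
      exact hom_of_roots hs hp rfl
  -- the case in which `ω - c` is a pole
  have pole : ∀ w ∉ R.L.lattice, w - c ∈ R.L.lattice → ∃ m : ℂ,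
      k.homA (β.X w) (β.W w) = m * (β'.W (w - c) * β'.W (w + c)) ∧
      k.homC (β.X w) (β.W w) = m * (β'.X (w - c) * β'.X (w + c)) ∧
      k.homB (β.X w) (β.W w) =
        -m * (β'.X (w - c) * β'.W (w + c) + β'.W (w - c) * β'.X (w + c)) := by
    intro w h0 h1
    have h2 : w + c ∉ R.L.lattice := by
      intro h2
      have h3 : ((2 * c : ℝ) : ℂ) ∈ R.L.lattice := by
        have := R.L.lattice.sub_mem h2 h1
        convert this using 1
        push_cast; ring
      exact R.notMem_L_of_re (by simpa using hc0) (by simpa using hc1) h3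
    have t1 : Tendsto (fun v : ℂ => v - c) (𝓝[≠] w) (𝓝[≠] (w - c)) := by
      refine tendsto_nhdsWithin_iff.2 ⟨(continuous_sub_right _).continuousAt.tendsto.mono_left
        nhdsWithin_le_nhds, ?_⟩
      filter_upwards [self_mem_nhdsWithin] with v hv h
      exact hv (sub_left_injective h)
    have ev : ∀ᶠ v in 𝓝[≠] w, v ∉ R.L.lattice ∧ v - c ∉ R.L.lattice ∧ v + c ∉ R.L.lattice := by
      have o1 : ∀ᶠ v in 𝓝 w, v ∉ R.L.lattice := R.L_isOpen.mem_nhds h0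
      have o2 : ∀ᶠ v : ℂ in 𝓝 w, v + (c : ℂ) ∉ R.L.lattice :=
        (continuous_add_const (c : ℂ)).continuousAt.preimage_mem_nhds (R.L_isOpen.mem_nhds h2)
      filter_upwards [o1.filter_mono nhdsWithin_le_nhds, o2.filter_mono nhdsWithin_le_nhds,
        t1.eventually (R.eventually_notMem_L' _)] with v a1 a2 a3 using ⟨a1, a3, a2⟩
    have t2 : Tendsto (fun v : ℂ => R.L.weierstrassP (v - c)) (𝓝[≠] w)
        (Bornology.cobounded ℂ) := (R.tendsto_weierstrassP_of_mem h1).comp t1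
    have cu : Tendsto R.L.weierstrassP (𝓝[≠] w) (𝓝 (R.L.weierstrassP w)) :=
      (R.P_continuousAt h0).tendsto.mono_left nhdsWithin_le_nhds
    have cv : Tendsto (fun v => R.L.weierstrassP (v + c)) (𝓝[≠] w) (𝓝 (R.L.weierstrassP (w + c))) :=
      ((R.P_continuousAt h2).comp_of_eq (continuous_add_const (c : ℂ)).continuousAt rfl).tendsto
        |>.mono_left nhdsWithin_le_nhds
    have tX : Tendsto β.X (𝓝[≠] w) (𝓝 (β.X w)) := by
      rw [(xβ w h0).1]
      exact (cu.add_const (β.B : ℂ)).congr' (ev.mono fun v hv => (xβ v hv.1).1.symm)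
    have tW : Tendsto β.W (𝓝[≠] w) (𝓝 (β.W w)) := by
      rw [(xβ w h0).2]
      exact ((cu.const_mul (β.s₁ : ℂ)).add_const (β.D : ℂ)).congr'
        (ev.mono fun v hv => (xβ v hv.1).2.symm)
    have tX' : Tendsto (fun v => β'.X (v + c)) (𝓝[≠] w) (𝓝 (β'.X (w + c))) := by
      rw [(xβ' _ h2).1]
      exact (cv.add_const (β'.B : ℂ)).congr' (ev.mono fun v hv => (xβ' _ hv.2.2).1.symm)
    have tW' : Tendsto (fun v => β'.W (v + c)) (𝓝[≠] w) (𝓝 (β'.W (w + c))) := by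
      rw [(xβ' _ h2).2]
      exact ((cv.const_mul (β'.s₁ : ℂ)).add_const (β'.D : ℂ)).congr'
        (ev.mono fun v hv => (xβ' _ hv.2.2).2.symm)
    obtain ⟨m₀, tf⟩ : ∃ m₀, Tendsto f (𝓝[≠] w) (𝓝 m₀) := by
      rw [hf]
      obtain ⟨c1, c2, -⟩ := (k.normalForm β β').tendsto_hom cu (tendsto_const_nhds (x := 1))
      exact ⟨_, (c2.neg.sub (c1.mul cv)).div_const _⟩
    have near : ∀ᶠ v in 𝓝[≠] w,
        k.homA (β.X v) (β.W v) =
          f v * ((β'.s₁ + β'.D * (R.L.weierstrassP (v - c))⁻¹) * β'.W (v + c)) ∧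
        k.homC (β.X v) (β.W v) =
          f v * ((1 + β'.B * (R.L.weierstrassP (v - c))⁻¹) * β'.X (v + c)) ∧
        k.homB (β.X v) (β.W v) =
          -f v * ((1 + β'.B * (R.L.weierstrassP (v - c))⁻¹) * β'.W (v + c)
          + (β'.s₁ + β'.D * (R.L.weierstrassP (v - c))⁻¹) * β'.X (v + c)) := by
      filter_upwards [ev, t2.eventually (Bornology.eventually_ne_cobounded 0)] with v hv hv0
      obtain ⟨m, hm, hA, hC, hB⟩ := key v hv.1 hv.2.1 hv.2.2
      rw [hA, hC, hB, ← hm, (xβ' _ hv.2.1).1, (xβ' _ hv.2.1).2]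
      refine ⟨?_, ?_, ?_⟩ <;> field_simp
    obtain ⟨c1, c2, c3⟩ := k.tendsto_hom tX tW
    have ti : ∀ a b : ℂ, Tendsto (fun v => a + b * (R.L.weierstrassP (v - c))⁻¹) (𝓝[≠] w)
        (𝓝 a) := fun a b => by
      simpa using ((tendsto_inv₀_cobounded.comp t2).const_mul b).const_add a
    rw [(mβ' _ h1).1, (mβ' _ h1).2]
    refine ⟨m₀, ?_, ?_, ?_⟩
    · exact tendsto_nhds_unique_of_eventuallyEq c1
        (tf.mul ((ti _ _).mul tW')) (near.mono fun v hv => hv.1)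
    · exact tendsto_nhds_unique_of_eventuallyEq c3
        (tf.mul ((ti _ _).mul tX')) (near.mono fun v hv => hv.2.1)
    · exact tendsto_nhds_unique_of_eventuallyEq c2
        (tf.neg.mul (((ti _ _).mul tW').add ((ti _ _).mul tX'))) (near.mono fun v hv => hv.2.2)
  intro w h0
  by_cases h1 : w - c ∈ R.L.lattice
  · exact pole w h0 h1
  by_cases h2 : w + c ∈ R.L.lattice
  · have hneg : ∀ v, -v ∈ R.L.lattice ↔ v ∈ R.L.lattice := fun v => neg_mem_iff
    obtain ⟨m, hA, hC, hB⟩ := pole (-w) (by rwa [hneg])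
      (by rw [← hneg]; convert h2 using 1; ring)
    have e1 : -w - (c : ℂ) = -(w + c) := by ring
    have e2 : -w + (c : ℂ) = -(w - c) := by ring
    simp only [e1, e2, Branch.X_neg, Branch.W_neg] at hA hC hB
    exact ⟨m, by rw [hA]; ring, by rw [hC]; ring, by rw [hB]; ring⟩
  · obtain ⟨m, -, hm⟩ := key w h0 h1 h2
    exact ⟨m, hm⟩

/-- The parametrization of the kernel curve. The hypothesis says that the point `(x, y)` with
`x` the value at the real point `s` and `y = t₁` lies on the curve; there `y` is a branch point. -/
theorem exists_uniformizes {s : ℝ} (hβ : β.IsBranch k) (hβ' : β'.IsBranch k.swap)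
    (hs0 : 0 < s) (hs1 : s < β.cubic.per₂ / 2) (hc : c = β.cubic.per₂ / 2 - s)
    (hpt : k.homA (β.cubic.realP s + β.B) (β.s₁ * β.cubic.realP s + β.D) * β'.t₁ ^ 2
      + k.homB (β.cubic.realP s + β.B) (β.s₁ * β.cubic.realP s + β.D) * β'.t₁
      + k.homC (β.cubic.realP s + β.B) (β.s₁ * β.cubic.realP s + β.D) = 0) :
    k.Uniformizes β β' c ∧ k.swap.Uniformizes β' β c := by
  have he : β'.cubic = β.cubic := hβ.cubic_eq hβ'
  obtain ⟨n, hn⟩ : ∃ n, n = k.normalForm β β' := ⟨_, rfl⟩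
  have h1 := isNormal_normalForm (β' := β') hβ
  have h2 := isNormal_normalForm_swap hβ' he
  have hval := k.val_normalForm (β := β) (β' := β') (β.cubic.realP s) β.cubic.e₁
  have hsw := k.normalForm_swap (β := β) (β' := β')
  rw [← hn] at h1 h2 hval hsw
  have hE : β.det * β'.det ≠ 0 := mul_ne_zero β.det_neg.ne β'.det_neg.ne
  obtain ⟨E, hEE⟩ : ∃ E, E = β.det * β'.det := ⟨_, rfl⟩
  rw [← hEE] at h1 h2 hE
  have hEC : (E : ℂ) ≠ 0 := by exact_mod_cast hE
  -- the point `w₀` at which the initial conditions hold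
  have hw₀ : ((β.cubic.per₂ - s : ℝ) : ℂ) ∉ β.cubic.L.lattice :=
    β.cubic.notMem_L_of_re (by rw [Complex.ofReal_re]; linarith [β.cubic.per₂_pos])
      (by rw [Complex.ofReal_re]; linarith)
  have hw₀c : ((β.cubic.per₂ - s : ℝ) : ℂ) - c = ((β.cubic.per₂ / 2 : ℝ) : ℂ) := by
    rw [hc]; push_cast; ring
  have hhalf : ((β.cubic.per₂ / 2 : ℝ) : ℂ) ∉ β.cubic.L.lattice :=
    β.cubic.notMem_L_of_re (by rw [Complex.ofReal_re]; linarith [β.cubic.per₂_pos])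
      (by rw [Complex.ofReal_re]; linarith [β.cubic.per₂_pos])
  have hP₀ : β.cubic.L.weierstrassP ((β.cubic.per₂ - s : ℝ) : ℂ) = β.cubic.realP s := by
    have hsmem : (s : ℂ) ∉ β.cubic.L.lattice :=
      β.cubic.notMem_L_of_re (by rwa [Complex.ofReal_re]) (by rw [Complex.ofReal_re]; linarith)
    have hper : (β.cubic.per₂ : ℂ) ∈ β.cubic.L.lattice :=
      β.cubic.mem_L.2 ⟨0, 1, by simp, by simp⟩
    rw [← β.cubic.weierstrassP_ofReal hsmem, ← β.cubic.L.weierstrassP_neg (s : ℂ),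
      ← β.cubic.weierstrassP_add hper (w := -(s : ℂ))]
    congr 1
    push_cast; ring
  have hPh : β.cubic.L.weierstrassP ((β.cubic.per₂ / 2 : ℝ) : ℂ) = β.cubic.e₁ := by
    rw [β.cubic.weierstrassP_ofReal hhalf, β.cubic.realP_half]
  have hP'h : β.cubic.L.derivWeierstrassP ((β.cubic.per₂ / 2 : ℝ) : ℂ) = 0 := by
    have := β.cubic.derivWeierstrassP_sq' hhalf
    rw [hPh, sub_self, mul_zero, zero_mul, zero_mul] at this
    exact pow_eq_zero_iff two_ne_zero |>.1 this
  have hP'₀ := β.cubic.derivWeierstrassP_sq' hw₀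
  rw [hP₀] at hP'₀
  have hF : n.val (β.cubic.realP s) β.cubic.e₁ = 0 := by
    have e : (β.cubic.e₁ + β'.B : ℂ) = β'.t₁ * (β'.s₁ * β.cubic.e₁ + β'.D) := by
      have := β'.num_e₁
      rw [he] at this
      exact_mod_cast this
    rw [hval, e]
    linear_combination (β'.s₁ * β.cubic.e₁ + β'.D : ℂ) ^ 2 * hpt
  have hU : n.valU (β.cubic.realP s) β.cubic.e₁ = 0 := by
    rw [valU_eq_swap]
    have := h2.valV_sq β.cubic.e₁ (β.cubic.realP s)
    rw [← val_eq_swap, hF, sub_self, zero_mul, zero_mul, mul_zero, mul_zero, add_zero] at this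
    exact pow_eq_zero_iff two_ne_zero |>.1 this
  have hV := h1.valV_sq (β.cubic.realP s) β.cubic.e₁
  rw [hF, mul_zero, add_zero] at hV
  obtain ⟨ε, hε, hεV⟩ : ∃ ε : ℂ, ε ^ 2 = 1 ∧
      E * β.cubic.L.derivWeierstrassP ((β.cubic.per₂ - s : ℝ) : ℂ) -
        2 * ε * n.valV (β.cubic.realP s) β.cubic.e₁ = 0 := by
    have : (E * β.cubic.L.derivWeierstrassP ((β.cubic.per₂ - s : ℝ) : ℂ)) ^ 2 =
        (2 * n.valV (β.cubic.realP s) β.cubic.e₁) ^ 2 := by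
      rw [mul_pow, hP'₀, mul_pow, hV]; ring
    rcases sq_eq_sq_iff_eq_or_eq_neg.1 this with h | h
    · exact ⟨1, by ring, by rw [h]; ring⟩
    · exact ⟨-1, by ring, by rw [h]; ring⟩
  have main := Biquad.uniformization (c := c) (ε := ε) hE h1 h2 hε hw₀ (by rwa [hw₀c])
    (by rw [hw₀c, hP₀, hPh, hF]) (by rw [hw₀c, hP₀, hPh, hεV])
    (by rw [hw₀c, hP₀, hPh, hP'h, hU]; ring)
  have hε0 : ε ≠ 0 := by rintro rfl; norm_num at hε
  have neg_mem : ∀ v : ℂ, -v ∈ β.cubic.L.lattice ↔ v ∈ β.cubic.L.lattice := fun v => neg_mem_iff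
  have hc0 : 0 < 2 * c := by linarith
  have hc1 : 2 * c < β.cubic.per₂ := by linarith
  refine ⟨uniformizes_of_roots hc0 hc1 he fun w m0 m1 m2 => ?_,
    uniformizes_of_roots hc0 (by rwa [he]) he.symm ?_⟩
  · rw [← hn]
    obtain ⟨f1, g1, -⟩ := main w m0 m1
    have e2 : -w - (c : ℂ) = -(w + c) := by ring
    obtain ⟨f2, g2, -⟩ := main (-w) (by rwa [neg_mem]) (by rwa [e2, neg_mem])
    rw [e2, β.cubic.L.weierstrassP_neg, β.cubic.L.weierstrassP_neg] at f2 g2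
    rw [β.cubic.L.derivWeierstrassP_neg] at g2
    have hsum : n.valV (β.cubic.L.weierstrassP w) (β.cubic.L.weierstrassP (w - c)) +
        n.valV (β.cubic.L.weierstrassP w) (β.cubic.L.weierstrassP (w + c)) = 0 := by
      apply mul_left_cancel₀ (mul_ne_zero two_ne_zero hε0)
      linear_combination -g1 - g2
    simp only [valV, val] at hsum f1 f2
    simp only [homA, homB, homC]
    constructor
    · linear_combination hsum / 2
    · linear_combination β.cubic.L.weierstrassP (w - c) * hsum / 2 - f1
  · rw [he, ← hsw]
    intro w m0 m1 m2
    have e1 : w + c - (c : ℂ) = w := by ring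
    have e2 : -(w - (c : ℂ)) - c = -w := by ring
    obtain ⟨f1, -, g1⟩ := main (w + c) m2 (by rwa [e1])
    obtain ⟨f2, -, g2⟩ := main (-(w - c)) (by rwa [neg_mem]) (by rwa [e2, neg_mem])
    rw [e1] at f1 g1
    rw [e2, β.cubic.L.weierstrassP_neg, β.cubic.L.weierstrassP_neg] at f2 g2
    rw [β.cubic.L.derivWeierstrassP_neg] at g2
    have hsum : n.valU (β.cubic.L.weierstrassP (w + c)) (β.cubic.L.weierstrassP w) +
        n.valU (β.cubic.L.weierstrassP (w - c)) (β.cubic.L.weierstrassP w) = 0 := by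
      apply mul_left_cancel₀ (mul_ne_zero two_ne_zero hε0)
      linear_combination g1 + g2
    simp only [valU, val] at hsum f1 f2
    simp only [homA, homB, homC, swap]
    constructor
    · linear_combination hsum / 2
    · linear_combination β.cubic.L.weierstrassP (w - c) * hsum / 2 - f2

end Biquad

end

/-! ### The domains in which a coordinate lies in the unit disc -/

section

open Topology

namespace Branch

variable (β : Branch)

/-- The set of all `ω` with `|x(ω)| < 1`. -/
def inner : Set ℂ := {w | ‖β.X w‖ < ‖β.W w‖}

/-- The set of all `ω` with `|x(ω)| > 1` (including the poles). -/
def outer : Set ℂ := {w | ‖β.W w‖ < ‖β.X w‖}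

variable {β}

lemma disjoint_inner_outer : Disjoint β.inner β.outer :=
  Set.disjoint_left.2 fun w (h : ‖β.X w‖ < ‖β.W w‖) (h' : ‖β.W w‖ < ‖β.X w‖) => lt_asymm h h'

lemma neg_mem_inner {w : ℂ} : -w ∈ β.inner ↔ w ∈ β.inner := by
  simp only [inner, Set.mem_ofPred_eq, X_neg, W_neg]
lemma neg_mem_outer {w : ℂ} : -w ∈ β.outer ↔ w ∈ β.outer := by
  simp only [outer, Set.mem_ofPred_eq, X_neg, W_neg]
lemma add_mem_inner {l : ℂ} (hl : l ∈ β.cubic.L.lattice) {w : ℂ} :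
    w + l ∈ β.inner ↔ w ∈ β.inner := by
  simp only [inner, Set.mem_ofPred_eq, X_add hl, W_add hl]
lemma add_mem_outer {l : ℂ} (hl : l ∈ β.cubic.L.lattice) {w : ℂ} :
    w + l ∈ β.outer ↔ w ∈ β.outer := by
  simp only [outer, Set.mem_ofPred_eq, X_add hl, W_add hl]

lemma abs_s₁_lt : |β.s₁| < 1 := abs_lt.2 ⟨β.lt_s₁, β.s_lt.trans β.s₂_lt⟩

lemma mem_outer_of_mem_L {w : ℂ} (h : w ∈ β.cubic.L.lattice) : w ∈ β.outer := by
  change ‖β.W w‖ < ‖β.X w‖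
  rw [X_of_mem h, W_of_mem h, norm_one, Complex.norm_real]
  exact abs_s₁_lt

lemma notMem_L_of_mem_inner {w : ℂ} (h : w ∈ β.inner) : w ∉ β.cubic.L.lattice := fun h' =>
  Set.disjoint_left.1 disjoint_inner_outer h (mem_outer_of_mem_L h')

lemma continuousAt_X {w : ℂ} (h : w ∉ β.cubic.L.lattice) : ContinuousAt β.X w :=
  ((β.cubic.P_continuousAt h).add_const (β.B : ℂ)).congr
    (Filter.mem_of_superset (β.cubic.L_isOpen.mem_nhds h) fun _ hv => (X_of_notMem hv).symm)

lemma continuousAt_W {w : ℂ} (h : w ∉ β.cubic.L.lattice) : ContinuousAt β.W w :=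
  (((β.cubic.P_continuousAt h).const_mul (β.s₁ : ℂ)).add_const (β.D : ℂ)).congr
    (Filter.mem_of_superset (β.cubic.L_isOpen.mem_nhds h) fun _ hv => (W_of_notMem hv).symm)

lemma isOpen_inner : IsOpen β.inner := by
  rw [isOpen_iff_mem_nhds]
  intro w hw
  have hL := notMem_L_of_mem_inner hw
  exact (continuousAt_X hL).norm.eventually_lt (continuousAt_W hL).norm hw

lemma isOpen_outer : IsOpen β.outer := by
  rw [isOpen_iff_mem_nhds]
  intro w hw
  by_cases hL : w ∈ β.cubic.L.lattice
  · have h1 := β.cubic.tendsto_weierstrassP_of_mem hL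
    rw [← tendsto_norm_atTop_iff_cobounded] at h1
    have hs := abs_s₁_lt (β := β)
    have h2 : ∀ᶠ v in 𝓝[≠] w, v ∈ β.outer := by
      filter_upwards [h1.eventually_gt_atTop ((|β.D| + |β.B|) / (1 - |β.s₁|)),
        β.cubic.eventually_notMem_L' w] with v hv hvL
      change ‖β.W v‖ < ‖β.X v‖
      rw [X_of_notMem hvL, W_of_notMem hvL]
      rw [div_lt_iff₀ (by linarith)] at hv
      have e1 : ‖(β.s₁ : ℂ) * β.cubic.L.weierstrassP v + β.D‖ ≤
          |β.s₁| * ‖β.cubic.L.weierstrassP v‖ + |β.D| := by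
        refine (norm_add_le _ _).trans_eq ?_
        rw [norm_mul, Complex.norm_real, Complex.norm_real]; rfl
      have e2 : ‖β.cubic.L.weierstrassP v‖ - |β.B| ≤ ‖β.cubic.L.weierstrassP v + (β.B : ℂ)‖ := by
        have := norm_sub_le (β.cubic.L.weierstrassP v + (β.B : ℂ)) (β.B : ℂ)
        rw [add_sub_cancel_right, Complex.norm_real, Real.norm_eq_abs] at this
        linarith
      linarith
    have := eventually_nhdsWithin_iff.1 h2
    filter_upwards [this] with v hv
    by_cases h : v = w
    · rw [h]; exact hw
    · exact hv h
  · exact (continuousAt_W hL).norm.eventually_lt (continuousAt_X hL).norm hw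

/-- The quadratic polynomial that is negative where the real coordinate has modulus `< 1`. -/
noncomputable def quad (β : Branch) (u : ℝ) : ℝ := (u + β.B) ^ 2 - (β.s₁ * u + β.D) ^ 2

lemma mem_inner_iff_quad {w : ℂ} {u : ℝ} (h : w ∉ β.cubic.L.lattice)
    (hu : β.cubic.L.weierstrassP w = u) : w ∈ β.inner ↔ β.quad u < 0 := by
  change ‖β.X w‖ < ‖β.W w‖ ↔ _
  rw [X_of_notMem h, W_of_notMem h, hu]
  norm_cast
  rw [quad, sub_neg, sq_lt_sq]
  rfl

lemma mem_outer_iff_quad {w : ℂ} {u : ℝ} (h : w ∉ β.cubic.L.lattice)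
    (hu : β.cubic.L.weierstrassP w = u) : w ∈ β.outer ↔ 0 < β.quad u := by
  change ‖β.W w‖ < ‖β.X w‖ ↔ _
  rw [X_of_notMem h, W_of_notMem h, hu]
  norm_cast
  rw [quad, sub_pos, sq_lt_sq]
  rfl

lemma sq_s₁_lt : β.s₁ ^ 2 < 1 := by
  have := abs_s₁_lt (β := β)
  rwa [sq_lt_one_iff_abs_lt_one]

lemma quad_e₁ : β.quad β.cubic.e₁ < 0 := by
  rw [quad, β.num_e₁, mul_pow]
  have h := pow_pos (neg_pos.2 β.den_e₁_neg) 2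
  rw [neg_sq] at h
  have : β.t₁ ^ 2 < 1 := by
    rw [sq_lt_one_iff_abs_lt_one, abs_lt]; exact ⟨β.lt_t₁, β.t_lt.trans β.t₂_lt⟩
  nlinarith

lemma quad_e₂ : β.quad β.cubic.e₂ < 0 := by
  rw [quad, β.num_e₂, mul_pow]
  have h := pow_pos (neg_pos.2 β.den_e₂_neg) 2
  rw [neg_sq] at h
  have : β.t₂ ^ 2 < 1 := by
    rw [sq_lt_one_iff_abs_lt_one, abs_lt]; exact ⟨by linarith [β.t₂_pos], β.t₂_lt⟩
  nlinarith

lemma quad_e₃ : 0 < β.quad β.cubic.e₃ := by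
  rw [quad, β.den_e₃, mul_pow]
  have h := pow_pos (neg_pos.2 β.num_e₃_neg) 2
  rw [neg_sq] at h
  have : β.s₂ ^ 2 < 1 := by
    rw [sq_lt_one_iff_abs_lt_one, abs_lt]; exact ⟨by linarith [β.s₂_pos], β.s₂_lt⟩
  nlinarith

lemma quad_convex {p q u : ℝ} (h1 : p ≤ u) (h2 : u ≤ q) :
    (q - p) * β.quad u ≤ (q - u) * β.quad p + (u - p) * β.quad q := by
  have h3 := sq_s₁_lt (β := β)
  have : (q - u) * β.quad p + (u - p) * β.quad q - (q - p) * β.quad u =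
      (1 - β.s₁ ^ 2) * ((q - p) * ((q - u) * (u - p))) := by
    simp only [quad]; ring
  have : 0 ≤ (1 - β.s₁ ^ 2) * ((q - p) * ((q - u) * (u - p))) := by
    have := sub_nonneg.2 h1
    have := sub_nonneg.2 h2
    have : 0 ≤ q - p := by linarith
    have : 0 ≤ 1 - β.s₁ ^ 2 := by linarith
    positivity
  linarith

lemma quad_neg_of_mem {p q u : ℝ} (h1 : p ≤ u) (h2 : u ≤ q) (hp : β.quad p < 0)
    (hq : β.quad q < 0) : β.quad u < 0 := by
  rcases h1.eq_or_lt with rfl | h1'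
  · exact hp
  by_contra! h
  have := quad_convex (β := β) h1 h2
  nlinarith

lemma mem_inner_of_re {w : ℂ} (h : w.re = β.cubic.per₂ / 2) : w ∈ β.inner := by
  obtain ⟨hL, r, h2, h1, hr⟩ := β.cubic.weierstrassP_of_re_half h
  rw [mem_inner_iff_quad hL hr]
  exact quad_neg_of_mem h2 h1 quad_e₂ quad_e₁

lemma mem_outer_of_re {w : ℂ} (h : w.re = 0) : w ∈ β.outer := by
  by_cases hL : w ∈ β.cubic.L.lattice
  · exact mem_outer_of_mem_L hL
  obtain ⟨r, hr3, hr⟩ := β.cubic.weierstrassP_of_re_zero h hL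
  rw [mem_outer_iff_quad hL hr]
  by_contra! hle
  have := quad_convex (β := β) hr3 β.cubic.lt₃₂.le
  have h3 := quad_e₃ (β := β)
  have h2 := quad_e₂ (β := β)
  have := β.cubic.lt₃₂
  nlinarith

/-- On the real line, `|x|` decreases from the pole at `0` to the half period. -/
lemma mem_inner_of_le {s t : ℝ} (hs : 0 < s) (hst : s ≤ t) (ht : t ≤ β.cubic.per₂ / 2)
    (h : (s : ℂ) ∈ β.inner) : (t : ℂ) ∈ β.inner := by
  have hp := β.cubic.per₂_pos
  have hsL : (s : ℂ) ∉ β.cubic.L.lattice :=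
    β.cubic.notMem_L_of_re (by simpa) (by rw [Complex.ofReal_re]; linarith)
  have htL : (t : ℂ) ∉ β.cubic.L.lattice :=
    β.cubic.notMem_L_of_re (by rw [Complex.ofReal_re]; linarith)
      (by rw [Complex.ofReal_re]; linarith)
  rw [mem_inner_iff_quad hsL (β.cubic.weierstrassP_ofReal hsL)] at h
  rw [mem_inner_iff_quad htL (β.cubic.weierstrassP_ofReal htL)]
  exact quad_neg_of_mem (β.cubic.e₁_le_realP (hs.trans_le hst) ht)
    (β.cubic.strictAntiOn_realP.antitoneOn ⟨hs, hst.trans ht⟩ ⟨hs.trans_le hst, ht⟩ hst) quad_e₁ h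

end Branch

open Branch

namespace Biquad

/-- The data of the uniformization of the kernel of a walk. -/
structure IsUniform (k : Biquad) (z : ℝ) (β β' : Branch) (c : ℝ) : Prop where
  walk : k.IsWalk z
  cubic_eq : β'.cubic = β.cubic
  c_pos : 0 < c
  c_lt : 2 * c < β.cubic.per₂
  unif : k.Uniformizes β β' c
  unif' : k.swap.Uniformizes β' β c

variable {k : Biquad} {z : ℝ} {β β' : Branch} {c : ℝ}

lemma IsUniform.swap (h : k.IsUniform z β β' c) : k.swap.IsUniform z β' β c :=
  ⟨h.walk.swap, h.cubic_eq.symm, h.c_pos, by rw [h.cubic_eq]; exact h.c_lt, h.unif', h.unif⟩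

/-- On the unit circle the middle coefficient of the kernel dominates. -/
lemma IsWalk.hom_lt (h : k.IsWalk z) {N q : ℂ} (hq : q ≠ 0) (hN : ‖N‖ = ‖q‖) :
    ‖k.homA N q‖ + ‖k.homC N q‖ < ‖k.homB N q‖ := by
  have h0 := h.nonneg h.a₀
  have h1 := h.nonneg h.a₁
  have h2 := h.nonneg h.a₂
  have h3 := h.nonneg h.c₀
  have h4 := h.nonneg h.c₁
  have h5 := h.nonneg h.c₂
  have h6 := h.nonneg h.b₀
  have h7 := h.nonneg h.b₂
  have hs := h.sum_lt
  have hq0 : 0 < ‖q‖ ^ 2 := by positivity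
  have key : ∀ p₀ p₁ p₂ : ℝ, 0 ≤ p₀ → 0 ≤ p₁ → 0 ≤ p₂ →
      ‖(p₀ * q ^ 2 + p₁ * (N * q) + p₂ * N ^ 2 : ℂ)‖ ≤ (p₀ + p₁ + p₂) * ‖q‖ ^ 2 := by
    intro p₀ p₁ p₂ g0 g1 g2
    refine (norm_add₃_le).trans_eq ?_
    simp only [norm_mul, norm_pow, Complex.norm_real, Real.norm_eq_abs, hN, abs_of_nonneg g0,
      abs_of_nonneg g1, abs_of_nonneg g2]
    ring
  have hA := key _ _ _ h0 h1 h2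
  have hC := key _ _ _ h3 h4 h5
  have hB := key k.b₀ 0 k.b₂ h6 le_rfl h7
  have hB' : ‖N * q‖ - ‖(k.b₀ * q ^ 2 + (0 : ℝ) * (N * q) + k.b₂ * N ^ 2 : ℂ)‖ ≤ ‖k.homB N q‖ := by
    have := norm_sub_le (k.b₀ * q ^ 2 + (0 : ℝ) * (N * q) + k.b₂ * N ^ 2 : ℂ) (k.homB N q)
    have e : (k.b₀ * q ^ 2 + (0 : ℝ) * (N * q) + k.b₂ * N ^ 2 : ℂ) - k.homB N q = N * q := by
      simp only [homB, h.b₁]; push_cast; ring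
    rw [e] at this
    linarith
  rw [norm_mul, hN] at hB'
  change ‖k.homA N q‖ ≤ _ at hA
  change ‖k.homC N q‖ ≤ _ at hC
  nlinarith

/-- If `|x| = 1`, exactly one of the two associated values of `y` lies in the open unit disc, and
the other one outside of the closed unit disc. -/
lemma IsUniform.inner_outer (h : k.IsUniform z β β' c) {w : ℂ} (h1 : w ∉ β.inner)
    (h2 : w ∉ β.outer) : (w - c ∈ β'.inner ∧ w + c ∈ β'.outer) ∨
      (w - c ∈ β'.outer ∧ w + c ∈ β'.inner) := by
  have hL : w ∉ β.cubic.L.lattice := fun hL => h2 (mem_outer_of_mem_L hL)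
  have hXW : ‖β.X w‖ = ‖β.W w‖ := le_antisymm (not_lt.1 h2) (not_lt.1 h1)
  have hW0 : β.W w ≠ 0 := by
    intro h0
    rw [h0, norm_zero, norm_eq_zero] at hXW
    rw [X_of_notMem hL] at hXW
    rw [W_of_notMem hL] at h0
    have : ((β.det : ℝ) : ℂ) = 0 := by
      rw [Branch.det]; push_cast; linear_combination h0 - β.s₁ * hXW
    exact β.det_neg.ne (by exact_mod_cast this)
  have hlt := h.walk.hom_lt hW0 hXW
  obtain ⟨m, hA, hC, hB⟩ := h.unif w hL
  rw [hA, hC, hB, norm_mul, norm_mul m, norm_mul (-m), norm_neg, ← mul_add] at hlt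
  have hlt := lt_of_mul_lt_mul_left hlt (norm_nonneg m)
  have hlt := hlt.trans_le (norm_add_le _ _)
  simp only [norm_mul] at hlt
  change (‖β'.X (w - c)‖ < ‖β'.W (w - c)‖ ∧ ‖β'.W (w + c)‖ < ‖β'.X (w + c)‖) ∨
    (‖β'.W (w - c)‖ < ‖β'.X (w - c)‖ ∧ ‖β'.X (w + c)‖ < ‖β'.W (w + c)‖)
  generalize ‖β'.X (w - c)‖ = y₁ at *
  generalize ‖β'.X (w + c)‖ = y₂ at *
  generalize ‖β'.W (w - c)‖ = v₁ at *
  generalize ‖β'.W (w + c)‖ = v₂ at *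
  have hneg : (v₁ - y₁) * (v₂ - y₂) < 0 := by linarith
  rcases mul_neg_iff.1 hneg with ⟨a, b⟩ | ⟨a, b⟩
  · exact Or.inl ⟨by linarith, by linarith⟩
  · exact Or.inr ⟨by linarith, by linarith⟩

lemma _root_.RealCubic.per₂_mem (R : RealCubic) : (R.per₂ : ℂ) ∈ R.L.lattice :=
  R.mem_L.2 ⟨0, 1, by simp, by simp⟩

/-- The real points with `|x| = 1` to the right of the half period have `|y| < 1`. -/
lemma IsUniform.inner_of_real (h : k.IsUniform z β β' c) {α : ℝ} (hα₁ : β.cubic.per₂ / 2 < α)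
    (hα₂ : α < β.cubic.per₂) (h1 : (α : ℂ) ∉ β.inner) (h2 : (α : ℂ) ∉ β.outer) :
    (α - c : ℂ) ∈ β'.inner := by
  rcases h.inner_outer h1 h2 with ⟨h3, -⟩ | ⟨h3, h4⟩
  · exact h3
  exfalso
  refine Set.disjoint_left.1 disjoint_inner_outer ?_ h3
  have hc := h.c_pos
  have hc' := h.c_lt
  have hP : (β.cubic.per₂ : ℂ) ∈ β'.cubic.L.lattice := by
    rw [h.cubic_eq]; exact β.cubic.per₂_mem
  have hR := h.cubic_eq
  -- both arguments are folded into the interval `(0, ω₂ / 2]`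
  obtain ⟨s, hs0, hs1, hs⟩ : ∃ s : ℝ, 0 < s ∧ (s = β.cubic.per₂ - (α + c) ∨
      s = α + c - β.cubic.per₂) ∧ (s : ℂ) ∈ β'.inner := by
    rcases lt_trichotomy (α + c) β.cubic.per₂ with hlt | heq | hlt
    · refine ⟨_, sub_pos.2 hlt, Or.inl rfl, ?_⟩
      rw [← neg_mem_inner, ← add_mem_inner hP]
      convert h4 using 1
      push_cast; ring
    · refine absurd h4 (fun h4 => notMem_L_of_mem_inner h4 ?_)
      convert hP using 1
      exact_mod_cast heq
    · refine ⟨_, sub_pos.2 hlt, Or.inr rfl, ?_⟩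
      rw [← add_mem_inner hP]
      convert h4 using 1
      push_cast; ring
  by_cases hle : α - c ≤ β.cubic.per₂ / 2
  · have := mem_inner_of_le (β := β') (s := s) (t := α - c) hs0
      (by rcases hs1 with rfl | rfl <;> linarith) (by rw [hR]; exact hle) hs
    exact_mod_cast this
  · have := mem_inner_of_le (β := β') (s := s) (t := β.cubic.per₂ - (α - c)) hs0
      (by rcases hs1 with rfl | rfl <;> linarith) (by rw [hR]; linarith) hs
    rw [← neg_mem_inner, ← add_mem_inner hP] at this
    convert this using 1
    push_cast; ring

end Biquad

end

/-! ### The covering of the strip between the lines of symmetry -/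

section

open Topology

/-- Up to the lattice and the reflection in the origin, every complex number lies in the right half
of the fundamental rectangle. -/
lemma RealCubic.exists_mem_half (R : RealCubic) (w : ℂ) : ∃ v : ℂ,
    (v - w ∈ R.L.lattice ∨ v + w ∈ R.L.lattice) ∧ v.re ∈ Set.Icc (R.per₂ / 2) R.per₂ ∧
      v.im ∈ Set.Icc 0 R.per₁ := by
  have hp₁ := R.per₁_pos
  have hp₂ := R.per₂_pos
  obtain ⟨u, hu, hre⟩ : ∃ u : ℂ, (u - w ∈ R.L.lattice ∨ u + w ∈ R.L.lattice) ∧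
      u.re ∈ Set.Icc (R.per₂ / 2) R.per₂ := by
    obtain ⟨n, hn, -⟩ := existsUnique_sub_zsmul_mem_Ico hp₂ w.re 0
    rw [zsmul_eq_mul, zero_add] at hn
    rcases le_total (R.per₂ / 2) (w.re - n * R.per₂) with h | h
    · refine ⟨w - (n * R.per₂ : ℝ), Or.inl (R.mem_L.2 ⟨0, -n, ?_, ?_⟩), ?_⟩
      · simp
      · simp
      · rw [Complex.sub_re, Complex.ofReal_re]; exact ⟨h, hn.2.le⟩
    · refine ⟨-w + ((n + 1) * R.per₂ : ℝ), Or.inr (R.mem_L.2 ⟨0, n + 1, ?_, ?_⟩), ?_⟩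
      · simp
      · simp
      · rw [Complex.add_re, Complex.ofReal_re, Complex.neg_re]
        constructor <;> linarith [hn.1]
  obtain ⟨n, hn, -⟩ := existsUnique_sub_zsmul_mem_Ico hp₁ u.im 0
  rw [zsmul_eq_mul, zero_add] at hn
  have hl : -((n * R.per₁ : ℝ) * Complex.I) ∈ R.L.lattice := R.mem_L.2 ⟨-n, 0, by simp, by simp⟩
  refine ⟨u + -((n * R.per₁ : ℝ) * Complex.I), ?_, ?_, ?_⟩
  · rcases hu with hu | hu
    · left; convert add_mem hu hl using 1; ring
    · right; convert add_mem hu hl using 1; ring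
  · simpa using hre
  · simp only [Complex.add_im, Complex.neg_im, Complex.mul_im, Complex.I_im, Complex.I_re,
      Complex.ofReal_re, Complex.ofReal_im]
    constructor <;> linarith [hn.1, hn.2]

open Branch

namespace Branch

variable {β : Branch}

/-- The preimage of the unit circle in the right half of the fundamental rectangle. -/
def circlePre (β : Branch) : Set ℂ :=
  ((Set.Icc (β.cubic.per₂ / 2) β.cubic.per₂ ×ℂ Set.Icc 0 β.cubic.per₁) \ β.inner) \ β.outer

lemma isCompact_circlePre : IsCompact β.circlePre :=
  ((isCompact_Icc.reProdIm isCompact_Icc).diff isOpen_inner).diff isOpen_outer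

lemma re_mem_of_mem_circlePre {w : ℂ} (h : w ∈ β.circlePre) :
    w.re ∈ Set.Ioo (β.cubic.per₂ / 2) β.cubic.per₂ := by
  obtain ⟨⟨⟨h1, -⟩, h2⟩, h3⟩ := h
  refine ⟨lt_of_le_of_ne h1.1 fun he => h2 (mem_inner_of_re he.symm),
    lt_of_le_of_ne h1.2 fun he => h3 ?_⟩
  rw [← add_mem_outer (neg_mem β.cubic.per₂_mem)]
  apply mem_outer_of_re
  simp [he]

lemma notMem_L_of_notMem_outer {w : ℂ} (h : w ∉ β.outer) : w ∉ β.cubic.L.lattice :=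
  fun h' => h (mem_outer_of_mem_L h')

lemma norm_X_eq {w : ℂ} (h1 : w ∉ β.inner) (h2 : w ∉ β.outer) : ‖β.X w‖ = ‖β.W w‖ :=
  le_antisymm (not_lt.1 h2) (not_lt.1 h1)

lemma W_ne_zero_of_X_eq_zero (w : ℂ) (hX : β.X w = 0) : β.W w ≠ 0 := by
  intro h0
  by_cases hL : w ∈ β.cubic.L.lattice
  · rw [X_of_mem hL] at hX; exact one_ne_zero hX
  rw [X_of_notMem hL] at hX
  rw [W_of_notMem hL] at h0
  have : ((β.det : ℝ) : ℂ) = 0 := by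
    rw [Branch.det]; push_cast; linear_combination h0 - β.s₁ * hX
  exact β.det_neg.ne (by exact_mod_cast this)

lemma W_ne_zero_of_notMem_outer {w : ℂ} (h : w ∉ β.outer) : β.W w ≠ 0 := by
  intro h0
  refine W_ne_zero_of_X_eq_zero w ?_ h0
  have : ‖β.X w‖ ≤ ‖β.W w‖ := not_lt.1 h
  rw [h0, norm_zero, norm_le_zero_iff] at this
  exact this

/-- The coordinate determines the point up to sign and up to the lattice. -/
lemma sub_mem_or_add_mem {w v : ℂ} (hw : w ∉ β.outer) (hv : v ∉ β.outer)
    (h : β.X w / β.W w = β.X v / β.W v) :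
    w - v ∈ β.cubic.L.lattice ∨ w + v ∈ β.cubic.L.lattice := by
  have hwL := notMem_L_of_notMem_outer hw
  have hvL := notMem_L_of_notMem_outer hv
  apply β.cubic.sub_mem_or_add_mem_of_weierstrassP_eq hwL hvL
  rw [div_eq_div_iff (W_ne_zero_of_notMem_outer hw) (W_ne_zero_of_notMem_outer hv), X_of_notMem hwL,
    X_of_notMem hvL, W_of_notMem hwL, W_of_notMem hvL] at h
  have hd : ((β.det : ℝ) : ℂ) ≠ 0 := by exact_mod_cast β.det_neg.ne
  apply mul_left_cancel₀ hd
  rw [Branch.det]; push_cast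
  linear_combination h

/-- Every point of the closed unit disc is a value of the coordinate. -/
lemma exists_X_div_W {t : ℂ} (ht : ‖t‖ ≤ 1) : ∃ w ∉ β.cubic.L.lattice, β.W w ≠ 0 ∧
    β.X w / β.W w = t := by
  have h1 : (1 - β.s₁ * t : ℂ) ≠ 0 := by
    intro h0
    have : ‖(β.s₁ * t : ℂ)‖ < 1 := by
      rw [norm_mul, Complex.norm_real]
      have := abs_s₁_lt (β := β)
      calc |β.s₁| * ‖t‖ ≤ |β.s₁| * 1 := by gcongr
        _ < 1 := by linarith
    rw [← sub_eq_zero.1 h0, norm_one] at this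
    exact lt_irrefl _ this
  obtain ⟨w, hL, hw⟩ := β.cubic.exists_weierstrassP_eq ((β.D * t - β.B) / (1 - β.s₁ * t))
  have hX : β.X w = t * β.W w := by
    have hw' := (eq_div_iff h1).1 hw
    rw [X_of_notMem hL, W_of_notMem hL]
    linear_combination hw'
  have hW : β.W w ≠ 0 := fun h0 => W_ne_zero_of_X_eq_zero w (by rw [hX, h0, mul_zero]) h0
  exact ⟨w, hL, hW, by rw [hX, mul_div_cancel_right₀ _ hW]⟩

end Branch

namespace Biquad

variable {k : Biquad} {z : ℝ} {β β' : Branch} {c : ℝ}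

/-- In the right half of the fundamental rectangle, `|x| = 1` implies `|y| < 1`. The coordinate `x`
maps the relevant curve homeomorphically to the unit circle, which is connected, so that the
alternative of `IsUniform.inner_outer` is decided by a single point, and the real one is known. -/
lemma IsUniform.inner_of_circle (h : k.IsUniform z β β' c) {w : ℂ}
    (hw₁ : β.cubic.per₂ / 2 < w.re) (hw₂ : w.re < β.cubic.per₂) (h1 : w ∉ β.inner)
    (h2 : w ∉ β.outer) : w - c ∈ β'.inner := by
  have hp₂ := β.cubic.per₂_pos
  obtain ⟨f, hf⟩ : ∃ f : ℂ → ℂ, f = fun w => β.X w / β.W w := ⟨_, rfl⟩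
  have fcont : ContinuousOn f β.circlePre := fun v hv => by
    have hL := notMem_L_of_notMem_outer hv.2
    rw [hf]
    exact ((continuousAt_X hL).div (continuousAt_W hL)
      (W_ne_zero_of_notMem_outer hv.2)).continuousWithinAt
  have c1 : ∀ U : Set ℂ, IsOpen U → IsClosed (f '' (β.circlePre \ (fun v : ℂ => v - c) ⁻¹' U)) :=
    fun U hU => ((isCompact_circlePre.diff (hU.preimage (by fun_prop))).image_of_continuousOn
      (fcont.mono Set.sdiff_subset)).isClosed
  -- translation to the fundamental rectangle
  have shift : ∀ v : ℂ, β.cubic.per₂ / 2 < v.re → v.re < β.cubic.per₂ → v ∉ β.inner →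
      v ∉ β.outer → ∃ l ∈ β.cubic.L.lattice, v + l ∈ β.circlePre := by
    intro v v1 v2 v3 v4
    obtain ⟨n, hn, -⟩ := existsUnique_sub_zsmul_mem_Ico β.cubic.per₁_pos v.im 0
    rw [zsmul_eq_mul, zero_add] at hn
    have hl : -((n * β.cubic.per₁ : ℝ) * Complex.I) ∈ β.cubic.L.lattice :=
      β.cubic.mem_L.2 ⟨-n, 0, by simp, by simp⟩
    refine ⟨_, hl, ⟨⟨⟨?_, ?_⟩, ?_⟩, ?_⟩⟩
    · simpa using ⟨v1.le, v2.le⟩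
    · simp only [Set.mem_preimage, Complex.add_im, Complex.neg_im, Complex.mul_im, Complex.I_im,
        Complex.I_re, Complex.ofReal_re, Complex.ofReal_im]
      constructor <;> linarith [hn.1, hn.2]
    · rwa [add_mem_inner hl]
    · rwa [add_mem_outer hl]
  have fadd : ∀ v, ∀ l ∈ β.cubic.L.lattice, f (v + l) = f v := fun v l hl => by
    simp only [hf, X_add hl, W_add hl]
  have sph : ∀ v ∈ β.circlePre, f v ∈ Metric.sphere (0 : ℂ) 1 := fun v hv => by
    have := norm_X_eq hv.1.2 hv.2
    rw [mem_sphere_zero_iff_norm, hf]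
    simp only
    rw [norm_div, this, div_self (norm_ne_zero_iff.2 (W_ne_zero_of_notMem_outer hv.2))]
  -- the distinguished real point
  obtain ⟨α, hα, hα1, hα2⟩ : ∃ α ∈ Set.Icc (β.cubic.per₂ / 2) β.cubic.per₂,
      (α : ℂ) ∉ β.inner ∧ (α : ℂ) ∉ β.outer := by
    by_contra! hcon
    obtain ⟨x, -, hx1, hx2⟩ := isPreconnected_Icc
      (a := β.cubic.per₂ / 2) (b := β.cubic.per₂) _ _
      (isOpen_inner.preimage Complex.continuous_ofReal)
      (isOpen_outer.preimage Complex.continuous_ofReal)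
      (fun x hx => or_iff_not_imp_left.2 (hcon x hx))
      ⟨β.cubic.per₂ / 2, ⟨le_rfl, by linarith⟩, mem_inner_of_re (Complex.ofReal_re _)⟩
      ⟨β.cubic.per₂, ⟨by linarith, le_rfl⟩, mem_outer_of_mem_L β.cubic.per₂_mem⟩
    exact Set.disjoint_left.1 disjoint_inner_outer hx1 hx2
  have hα' : (α : ℂ) ∈ β.circlePre := ⟨⟨⟨by simpa using hα, by
    simpa using β.cubic.per₁_pos.le⟩, hα1⟩, hα2⟩
  have hαI : (α - c : ℂ) ∈ β'.inner := by
    have := re_mem_of_mem_circlePre hα'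
    exact h.inner_of_real (by simpa using this.1) (by simpa using this.2) hα1 hα2
  by_contra hw
  obtain ⟨l, hl, hwl⟩ := shift w hw₁ hw₂ h1 h2
  have hl' : l ∈ β'.cubic.L.lattice := by rwa [h.cubic_eq]
  have hwi : w + l - c ∉ β'.inner := by
    have e : w + l - c = w - c + l := by ring
    rwa [e, add_mem_inner hl']
  have cover : Metric.sphere (0 : ℂ) 1 ⊆
      f '' (β.circlePre \ (fun v : ℂ => v - c) ⁻¹' β'.outer) ∪
        f '' (β.circlePre \ (fun v : ℂ => v - c) ⁻¹' β'.inner) := by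
    intro t ht
    rw [mem_sphere_zero_iff_norm] at ht
    obtain ⟨u, huL, huW, hut⟩ := β.exists_X_div_W ht.le
    have huXW : ‖β.X u‖ = ‖β.W u‖ := by
      rw [← hut, norm_div, div_eq_one_iff_eq (norm_ne_zero_iff.2 huW)] at ht
      exact ht
    obtain ⟨v, hv, hre, him⟩ := β.cubic.exists_mem_half u
    have hXW : β.X v = β.X u ∧ β.W v = β.W u := by
      rcases hv with hv | hv
      · have e : v = u + (v - u) := by ring
        rw [e, X_add hv, W_add hv]; exact ⟨rfl, rfl⟩
      · have e : v = -u + (v + u) := by ring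
        rw [e, X_add hv, W_add hv, X_neg, W_neg]; exact ⟨rfl, rfl⟩
    have hv1 : v ∈ β.circlePre := by
      refine ⟨⟨⟨hre, him⟩, ?_⟩, ?_⟩
      · change ¬ ‖β.X v‖ < ‖β.W v‖
        rw [hXW.1, hXW.2, huXW]; exact lt_irrefl _
      · change ¬ ‖β.W v‖ < ‖β.X v‖
        rw [hXW.1, hXW.2, huXW]; exact lt_irrefl _
    have hft : f v = t := by rw [hf]; simp only [hXW.1, hXW.2, hut]
    by_cases hvo : v - c ∈ β'.outer
    · exact Or.inr ⟨v, ⟨hv1, fun hm => Set.disjoint_left.1 disjoint_inner_outer hm hvo⟩, hft⟩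
    · exact Or.inl ⟨v, ⟨hv1, hvo⟩, hft⟩
  obtain ⟨t, ht, ⟨v₁, hv₁, hvt₁⟩, v₂, hv₂, hvt₂⟩ := isPreconnected_closed_iff.1
    (isPreconnected_sphere (by simp) (0 : ℂ) 1) _ _
    (c1 _ (isOpen_outer (β := β'))) (c1 _ (isOpen_inner (β := β'))) cover
    ⟨f α, sph _ hα', α, ⟨hα', fun hm => Set.disjoint_left.1 disjoint_inner_outer hαI hm⟩, rfl⟩
    ⟨f (w + l), sph _ hwl, w + l, ⟨hwl, hwi⟩, rfl⟩
  -- the two preimages of `t` coincide up to a multiple of the imaginary period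
  have r1 := re_mem_of_mem_circlePre hv₁.1
  have r2 := re_mem_of_mem_circlePre hv₂.1
  have hsub : v₂ - v₁ ∈ β'.cubic.L.lattice := by
    rw [h.cubic_eq]
    rcases sub_mem_or_add_mem hv₂.1.2 hv₁.1.2
      (by have := hvt₂.trans hvt₁.symm; rwa [hf] at this) with hm | hm
    · exact hm
    · refine absurd (sub_mem hm β.cubic.per₂_mem) (β.cubic.notMem_L_of_re ?_ ?_)
      · simp only [Complex.sub_re, Complex.add_re, Complex.ofReal_re]; linarith [r1.1, r2.1]
      · simp only [Complex.sub_re, Complex.add_re, Complex.ofReal_re]; linarith [r1.2, r2.2]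
  have o1 : v₁ - c ∉ β'.outer := hv₁.2
  have o2 : v₁ - c ∉ β'.inner := by
    rw [← add_mem_inner hsub]
    have : v₂ - c ∉ β'.inner := hv₂.2
    convert this using 2; ring
  rcases h.inner_outer hv₁.1.1.2 hv₁.1.2 with ⟨h3, -⟩ | ⟨h3, -⟩
  · exact o2 h3
  · exact o1 h3

/-- The strip between the lines of symmetry of `x` and of `y` is covered by the domains `|x| < 1`
and `|y| < 1`. -/
theorem IsUniform.strip (h : k.IsUniform z β β' c) {w : ℂ} (h1 : β.cubic.per₂ / 2 ≤ w.re)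
    (h2 : w.re ≤ β.cubic.per₂ / 2 + c) : w ∈ β.inner ∨ w - c ∈ β'.inner := by
  have hc := h.c_pos
  have hc' := h.c_lt
  have hR := h.cubic_eq
  obtain ⟨T, hT⟩ : ∃ T : Set ℂ, T = Complex.re ⁻¹' Set.Icc (β.cubic.per₂ / 2)
    (β.cubic.per₂ / 2 + c) := ⟨_, rfl⟩
  have hTc : IsPreconnected T := by
    rw [hT]
    exact ((convex_Icc _ _).linear_preimage Complex.reLm).isPreconnected
  have oy : ∀ U : Set ℂ, IsOpen U → IsOpen ((fun v : ℂ => v - c) ⁻¹' U) := fun U hU =>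
    hU.preimage (by fun_prop)
  have hwT : w ∈ T := by rw [hT]; exact ⟨h1, h2⟩
  refine hTc.subset_left_of_subset_union
    ((isOpen_inner (β := β)).union (oy _ (isOpen_inner (β := β'))))
    ((isOpen_outer (β := β)).inter (oy _ (isOpen_outer (β := β')))) ?_ ?_ ?_ hwT
  · rw [Set.disjoint_left]
    rintro v (hv | hv) ⟨hv1, hv2⟩
    · exact Set.disjoint_left.1 disjoint_inner_outer hv hv1
    · exact Set.disjoint_left.1 disjoint_inner_outer hv hv2
  · intro v hv
    rw [hT] at hv
    obtain ⟨v1, v2⟩ : β.cubic.per₂ / 2 ≤ v.re ∧ v.re ≤ β.cubic.per₂ / 2 + c := hv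
    by_cases vi : v ∈ β.inner
    · exact Or.inl (Or.inl vi)
    by_cases vo : v ∈ β.outer
    swap
    · refine Or.inl (Or.inr (h.inner_of_circle ?_ (by linarith) vi vo))
      exact lt_of_le_of_ne v1 fun he => vi (mem_inner_of_re he.symm)
    by_cases yi : v - c ∈ β'.inner
    · exact Or.inl (Or.inr yi)
    by_cases yo : v - c ∈ β'.outer
    · exact Or.inr ⟨vo, yo⟩
    exfalso
    have hP : (β'.cubic.per₂ : ℂ) ∈ β'.cubic.L.lattice := β'.cubic.per₂_mem
    have e : -v + c + (β.cubic.per₂ : ℂ) = -(v - c) + β'.cubic.per₂ := by rw [hR]; ring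
    have := h.swap.inner_of_circle (w := -v + c + β.cubic.per₂) ?_ ?_ ?_ ?_
    · refine vi ?_
      rw [← neg_mem_inner, ← add_mem_inner β.cubic.per₂_mem]
      convert this using 1; ring
    · have : v.re ≠ β.cubic.per₂ / 2 + c := fun he => yi (mem_inner_of_re (by simp [he, hR]))
      have := lt_of_le_of_ne v2 this
      simp only [Complex.add_re, Complex.neg_re, Complex.ofReal_re, hR]
      linarith
    · simp only [Complex.add_re, Complex.neg_re, Complex.ofReal_re, hR]
      linarith
    · rwa [e, add_mem_inner hP, neg_mem_inner]
    · rwa [e, add_mem_outer hP, neg_mem_outer]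
  · refine ⟨(β.cubic.per₂ / 2 : ℝ), ?_, Or.inl (mem_inner_of_re (Complex.ofReal_re _))⟩
    rw [hT]
    exact ⟨by simp, by simp [hc.le]⟩

end Biquad

end

/-! ### Meromorphic functions and difference equations -/

section

open Topology

namespace Branch

variable {β : Branch}

/-- The coordinate `(℘ + B) / (s₁ ℘ + D)` as a meromorphic function, with the value `0` at its
poles. -/
noncomputable def coord (β : Branch) (w : ℂ) : ℂ := β.X w / β.W w

lemma coord_neg (w : ℂ) : β.coord (-w) = β.coord w := by rw [coord, coord, X_neg, W_neg]

lemma coord_add {l : ℂ} (hl : l ∈ β.cubic.L.lattice) (w : ℂ) : β.coord (w + l) = β.coord w := by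
  rw [coord, coord, X_add hl, W_add hl]

lemma analyticAt_X {w : ℂ} (h : w ∉ β.cubic.L.lattice) : AnalyticAt ℂ β.X w :=
  ((β.cubic.L.analyticOnNhd_weierstrassP w h).add analyticAt_const).congr
    (Filter.mem_of_superset (β.cubic.L_isOpen.mem_nhds h) fun _ hv => (X_of_notMem hv).symm)

lemma analyticAt_W {w : ℂ} (h : w ∉ β.cubic.L.lattice) : AnalyticAt ℂ β.W w :=
  ((analyticAt_const.mul (β.cubic.L.analyticOnNhd_weierstrassP w h)).add analyticAt_const).congr
    (Filter.mem_of_superset (β.cubic.L_isOpen.mem_nhds h) fun _ hv => (W_of_notMem hv).symm)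

lemma meromorphic_coord : Meromorphic β.coord := by
  intro w
  have h := β.cubic.L.meromorphic_weierstrassP w
  refine ((h.add (.const (β.B : ℂ) w)).div
    (((MeromorphicAt.const (β.s₁ : ℂ) w).mul h).add (.const (β.D : ℂ) w))).congr ?_
  filter_upwards [β.cubic.eventually_notMem_L' w] with v hv
  rw [coord, X_of_notMem hv, W_of_notMem hv]
  rfl

lemma W_ne_zero_of_mem_inner {w : ℂ} (h : w ∈ β.inner) : β.W w ≠ 0 :=
  W_ne_zero_of_notMem_outer fun h' => Set.disjoint_left.1 disjoint_inner_outer h h'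

lemma analyticAt_coord {w : ℂ} (h : w ∈ β.inner) : AnalyticAt ℂ β.coord w :=
  (analyticAt_X (notMem_L_of_mem_inner h)).div (analyticAt_W (notMem_L_of_mem_inner h))
    (W_ne_zero_of_mem_inner h)

lemma coord_mem_ball {w : ℂ} (h : w ∈ β.inner) : β.coord w ∈ Metric.ball (0 : ℂ) 1 := by
  rw [mem_ball_zero_iff, coord, norm_div,
    div_lt_one (norm_pos_iff.2 (W_ne_zero_of_mem_inner h))]
  exact h

lemma analyticAt_comp_coord {F : ℂ → ℂ} (hF : DifferentiableOn ℂ F (Metric.ball 0 1)) {w : ℂ}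
    (h : w ∈ β.inner) : AnalyticAt ℂ (fun v => F (β.coord v)) w :=
  (hF.analyticAt (Metric.isOpen_ball.mem_nhds (coord_mem_ball h))).comp_of_eq
    (analyticAt_coord h) rfl

end Branch

open Branch

lemma Biquad.Uniformizes.val_eq_zero {k : Biquad} {β β' : Branch} {c : ℝ}
    (h : k.Uniformizes β β' c) {w : ℂ} (h1 : w ∈ β.inner) (h2 : w - c ∈ β'.inner) :
    k.val (β.coord w) (β'.coord (w - c)) = 0 := by
  obtain ⟨m, hA, hC, hB⟩ := h w (notMem_L_of_mem_inner h1)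
  have hW := W_ne_zero_of_mem_inner h1
  have hV := W_ne_zero_of_mem_inner h2
  simp only [homA, homB, homC] at hA hB hC
  rw [coord, coord]
  generalize β.X w = X at *
  generalize β.W w = W at *
  generalize β'.X (w - c) = Y at *
  generalize β'.W (w - c) = V at *
  have e : k.val (X / W) (Y / V) * (W ^ 2 * V ^ 2) = 0 := by
    have e1 : k.val (X / W) (Y / V) * (W ^ 2 * V ^ 2) =
        (k.a₀ * W ^ 2 + k.a₁ * (X * W) + k.a₂ * X ^ 2) * Y ^ 2 +
        (k.b₀ * W ^ 2 + k.b₁ * (X * W) + k.b₂ * X ^ 2) * (Y * V) +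
        (k.c₀ * W ^ 2 + k.c₁ * (X * W) + k.c₂ * X ^ 2) * V ^ 2 := by
      rw [val]; field_simp
    rw [e1, hA, hB, hC]; ring
  exact (mul_eq_zero.1 e).resolve_right (mul_ne_zero (pow_ne_zero 2 hW) (pow_ne_zero 2 hV))

/-- The identity theorem for meromorphic functions on the complex plane. -/
lemma Meromorphic.eventuallyEq_of_eventuallyEq {f g : ℂ → ℂ} (hf : Meromorphic f)
    (hg : Meromorphic g) {w₀ : ℂ} (h : f =ᶠ[𝓝[≠] w₀] g) (w : ℂ) : f =ᶠ[𝓝[≠] w] g := by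
  have hfg : MeromorphicOn (f - g) Set.univ := (hf.sub hg).meromorphicOn
  have h0 : meromorphicOrderAt (f - g) w₀ = ⊤ := meromorphicOrderAt_eq_top_iff.2 <|
    h.mono fun v hv => by simp [hv]
  by_contra hcon
  refine hfg.meromorphicOrderAt_ne_top_of_isPreconnected isPreconnected_univ (Set.mem_univ w)
    (Set.mem_univ w₀) ?_ h0
  rw [Ne, meromorphicOrderAt_eq_top_iff]
  exact fun h' => hcon <| h'.mono fun v hv => sub_eq_zero.1 hv

/-- A punctured neighbourhood is preserved by affine substitutions. -/
lemma eventuallyEq_comp_affine {p q : ℂ → ℂ} {a b w : ℂ} (ha : a ≠ 0)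
    (h : p =ᶠ[𝓝[≠] (a * w + b)] q) :
    (fun v => p (a * v + b)) =ᶠ[𝓝[≠] w] fun v => q (a * v + b) := by
  refine Tendsto.eventually (f := fun v : ℂ => a * v + b) ?_ h
  refine tendsto_nhdsWithin_iff.2 ⟨((by fun_prop : Continuous fun v => a * v + b).tendsto
    w).mono_left nhdsWithin_le_nhds, ?_⟩
  filter_upwards [self_mem_nhdsWithin] with v hv hvw
  exact hv (mul_left_cancel₀ ha (add_right_cancel hvw))

section DifferenceEquation

variable (H : ℂ → ℂ) (ℓ : ℂ)

/-- The functional equation `r (ω - ℓ) = r ω + H ω` as a fixed point equation for a permutation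
of the set of functions. -/
def shiftPerm : Equiv.Perm (ℂ → ℂ) where
  toFun r ω := r (ω - ℓ) - H ω
  invFun r ω := r (ω + ℓ) + H (ω + ℓ)
  left_inv r := by ext ω; simp
  right_inv r := by ext ω; simp

variable {H ℓ}

lemma meromorphicAt_of_shift (hH : Meromorphic H) {r : ℂ → ℂ}
    (h : ∀ ω, r (ω - ℓ) = r ω + H ω) (n : ℤ) : ∀ {w : ℂ}, MeromorphicAt r (w - n * ℓ) →
      MeromorphicAt r w := by
  have h1 : ∀ {w : ℂ}, MeromorphicAt r (w - ℓ) → MeromorphicAt r w := fun {w} hw => by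
    have e : r = (fun v => r (v - ℓ)) - H := by ext v; simp [h]
    rw [e]
    exact (MeromorphicAt.comp_analyticAt (g := fun v : ℂ => v - ℓ) hw (by fun_prop)).sub (hH w)
  have h2 : ∀ {w : ℂ}, MeromorphicAt r (w + ℓ) → MeromorphicAt r w := fun {w} hw => by
    have e : r = (fun v => r (v + ℓ)) + fun v => H (v + ℓ) := by
      ext v
      have := h (v + ℓ)
      rwa [add_sub_cancel_right] at this
    rw [e]
    exact (MeromorphicAt.comp_analyticAt (g := fun v : ℂ => v + ℓ) hw (by fun_prop)).add
      (MeromorphicAt.comp_analyticAt (g := fun v : ℂ => v + ℓ) (hH _) (by fun_prop))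
  induction n using Int.induction_on with
  | zero => intro w hw; simpa using hw
  | succ n ih =>
    intro w hw
    refine h1 (ih ?_)
    convert hw using 1; push_cast; ring
  | pred n ih =>
    intro w hw
    refine h2 (ih ?_)
    convert hw using 1; push_cast; ring

/-- A function that is meromorphic on a closed vertical strip, and compatible with the functional
equation `r (ω - ℓ) = r ω + H ω` near its right boundary, extends to a meromorphic solution. -/
theorem exists_meromorphic_of_strip {a ℓ : ℝ} (hℓ : 0 < ℓ) {H R : ℂ → ℂ} (hH : Meromorphic H)
    (hR : ∀ w : ℂ, a ≤ w.re → w.re < a + ℓ → MeromorphicAt R w)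
    (hc : ∀ w : ℂ, w.re = a + ℓ → ∀ᶠ v in 𝓝 w, R (v - ℓ) = R v + H v) :
    ∃ r : ℂ → ℂ, Meromorphic r ∧ (∀ w, r (w - ℓ) = r w + H w) ∧
      ∀ w : ℂ, a ≤ w.re → w.re ≤ a + ℓ → r =ᶠ[𝓝 w] R := by
  obtain ⟨N, hN⟩ : ∃ N : ℂ → ℤ, N = fun ω => ⌊(ω.re - a) / ℓ⌋ := ⟨_, rfl⟩
  have N_eq : ∀ (ω : ℂ) (n : ℤ), a + n * ℓ ≤ ω.re → ω.re < a + (n + 1) * ℓ → N ω = n := by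
    intro ω n h1 h2
    simp only [hN]
    rw [Int.floor_eq_iff, le_div_iff₀ hℓ, div_lt_iff₀ hℓ]
    constructor <;> linarith
  obtain ⟨r, hr⟩ : ∃ r : ℂ → ℂ, r = fun ω => (shiftPerm H ℓ ^ N ω) R ω := ⟨_, rfl⟩
  have r0 : ∀ ω : ℂ, a ≤ ω.re → ω.re < a + ℓ → r ω = R ω := by
    intro ω h1 h2
    simp only [hr]
    rw [N_eq ω 0 (by simpa using h1) (by simpa using h2)]
    simp
  have shift : ∀ ω, r (ω - ℓ) = r ω + H ω := by
    intro ω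
    have hn : N ω = 1 + N (ω - ℓ) := by
      simp only [hN, Complex.sub_re, Complex.ofReal_re]
      rw [add_comm, ← Int.floor_add_one]
      congr 1
      field_simp; ring
    simp only [hr]
    rw [hn, zpow_one_add, Equiv.Perm.mul_apply]
    exact (sub_add_cancel _ _).symm
  have left : ∀ w : ℂ, w.re = a → r =ᶠ[𝓝 w] R := by
    intro w hw
    have h1 : ∀ᶠ v : ℂ in 𝓝 w, R (v + ℓ - ℓ) = R (v + ℓ) + H (v + ℓ) :=
      (continuous_add_const (ℓ : ℂ)).continuousAt.eventually
        (hc (w + ℓ) (by simp [hw]))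
    have h2 : ∀ᶠ v : ℂ in 𝓝 w, a - ℓ < v.re ∧ v.re < a + ℓ :=
      (Complex.continuous_re.isOpen_preimage _ isOpen_Ioo).mem_nhds
        (⟨by linarith, by linarith⟩ : w.re ∈ Set.Ioo (a - ℓ) (a + ℓ))
    filter_upwards [h1, h2] with v hv hv'
    rcases le_or_gt a v.re with h | h
    · exact r0 v h hv'.2
    · have h3 := shift (v + ℓ)
      rw [add_sub_cancel_right] at h3 hv
      rw [h3, hv, r0 (v + ℓ) (by simp; linarith) (by simpa using h)]
  have inside : ∀ w : ℂ, a ≤ w.re → w.re < a + ℓ → r =ᶠ[𝓝 w] R := by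
    intro w h1 h2
    rcases h1.eq_or_lt with h1 | h1
    · exact left w h1.symm
    · filter_upwards [(Complex.continuous_re.isOpen_preimage _ isOpen_Ioo).mem_nhds
        (⟨h1, h2⟩ : w.re ∈ Set.Ioo a (a + ℓ))] with v hv
      exact r0 v (le_of_lt hv.1) hv.2
  refine ⟨r, fun w => ?_, shift, fun w h1 h2 => ?_⟩
  · obtain ⟨n, hn, -⟩ := existsUnique_sub_zsmul_mem_Ico hℓ w.re a
    rw [zsmul_eq_mul] at hn
    refine meromorphicAt_of_shift hH shift n ?_
    have hre : (w - n * (ℓ : ℂ)).re = w.re - n * ℓ := by simp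
    exact (hR _ (by rw [hre]; exact hn.1) (by rw [hre]; exact hn.2)).congr
      ((inside _ (by rw [hre]; exact hn.1) (by rw [hre]; exact hn.2)).symm.filter_mono
        nhdsWithin_le_nhds)
  · rcases h2.lt_or_eq with h2 | h2
    · exact inside w h1 h2
    · have h3 : ∀ᶠ v : ℂ in 𝓝 w, r (v - ℓ) = R (v - ℓ) :=
        (continuous_sub_right (ℓ : ℂ)).continuousAt.eventually (left (w - ℓ) (by simp [h2]))
      filter_upwards [h3, hc w h2] with v hv hv'
      have := shift v
      rw [hv, hv'] at this
      exact (add_right_cancel this).symm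

end DifferenceEquation

end

/-! ### Functions of one coordinate -/

section

open Topology

open Branch

/-- The map `℘` is open. -/
lemma RealCubic.isOpen_image_weierstrassP (R : RealCubic) {U : Set ℂ} (hU : IsOpen U)
    (hUL : ∀ w ∈ U, w ∉ R.L.lattice) : IsOpen (R.L.weierstrassP '' U) := by
  rw [isOpen_iff_mem_nhds]
  rintro _ ⟨w, hw, rfl⟩
  rcases (R.L.analyticOnNhd_weierstrassP w (hUL w hw)).eventually_constant_or_nhds_le_map_nhds
    with h | h
  · exfalso
    have t1 : Tendsto (fun v : ℂ => v - w) (𝓝[≠] w) (𝓝[≠] (w - w)) := by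
      refine tendsto_nhdsWithin_iff.2 ⟨(continuous_sub_right _).continuousAt.tendsto.mono_left
        nhdsWithin_le_nhds, ?_⟩
      filter_upwards [self_mem_nhdsWithin] with v hv h
      exact hv (sub_left_injective h)
    have t2 : Tendsto (fun v : ℂ => v + w) (𝓝[≠] w) (𝓝[≠] (w + w)) := by
      refine tendsto_nhdsWithin_iff.2 ⟨(continuous_add_const _).continuousAt.tendsto.mono_left
        nhdsWithin_le_nhds, ?_⟩
      filter_upwards [self_mem_nhdsWithin] with v hv h
      exact hv (add_left_injective _ h)
    have hUw : ∀ᶠ v in 𝓝[≠] w, v ∈ U := nhdsWithin_le_nhds (hU.mem_nhds hw)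
    obtain ⟨v, h1, h2, h3, h4⟩ := ((h.filter_mono nhdsWithin_le_nhds).and
      ((t1.eventually (R.eventually_notMem_L' _)).and
      ((t2.eventually (R.eventually_notMem_L' _)).and hUw))).exists
    rcases R.sub_mem_or_add_mem_of_weierstrassP_eq (hUL v h4) (hUL w hw) h1 with h5 | h5
    · exact h2 h5
    · exact h3 h5
  · exact h (Filter.image_mem_map (hU.mem_nhds hw))

namespace Branch

variable {β : Branch}

/-- The unit disc in the coordinate `u` of the Weierstrass cubic is a disc, hence connected. -/
lemma isPreconnected_disc (β : Branch) :
    IsPreconnected {u : ℂ | ‖u + β.B‖ < ‖β.s₁ * u + β.D‖} := by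
  have h1 : 0 < 1 - β.s₁ ^ 2 := by linarith [sq_s₁_lt (β := β)]
  obtain ⟨p, hp⟩ : ∃ p : ℝ, p * (1 - β.s₁ ^ 2) = β.B - β.s₁ * β.D :=
    ⟨_, div_mul_cancel₀ _ h1.ne'⟩
  obtain ⟨q, hq⟩ : ∃ q : ℝ, q * (1 - β.s₁ ^ 2) = β.D ^ 2 - β.B ^ 2 :=
    ⟨_, div_mul_cancel₀ _ h1.ne'⟩
  have e : {u : ℂ | ‖u + β.B‖ < ‖β.s₁ * u + β.D‖} = Metric.ball (-p : ℂ) √(q + p ^ 2) := by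
    ext u
    rw [Set.mem_ofPred_eq, mem_ball_iff_norm, sub_neg_eq_add, Real.lt_sqrt (norm_nonneg _),
      ← sq_lt_sq₀ (norm_nonneg _) (norm_nonneg _), Complex.sq_norm, Complex.sq_norm,
      Complex.sq_norm]
    simp only [Complex.normSq_apply, Complex.add_re, Complex.add_im, Complex.mul_re,
      Complex.mul_im, Complex.ofReal_re, Complex.ofReal_im]
    have key : ((u.re + β.B) * (u.re + β.B) + (u.im + 0) * (u.im + 0)) -
        ((β.s₁ * u.re - 0 * u.im + β.D) * (β.s₁ * u.re - 0 * u.im + β.D) +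
        (β.s₁ * u.im + 0 * u.re + 0) * (β.s₁ * u.im + 0 * u.re + 0)) = (1 - β.s₁ ^ 2) *
        ((u.re + p) * (u.re + p) + (u.im + 0) * (u.im + 0) - (q + p ^ 2)) := by
      linear_combination (-2 * u.re) * hp + hq
    rw [← sub_neg, key, ← sub_neg (b := q + p ^ 2)]
    exact ⟨fun h => (pos_iff_neg_of_mul_neg h).1 h1, fun h => mul_neg_of_pos_of_neg h1 h⟩
  rw [e]
  exact (convex_ball _ _).isPreconnected

/-- A meromorphic function that is a holomorphic function of the coordinate `x` near the line of
symmetry is the same function of `x` in the whole domain `|x| < 1` of the fundamental strip: the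
domain in which it is, and the one in which it is not, have disjoint open images under `x`, and
the unit disc is connected. This lemma deals with the right half of the strip. -/
lemma eventuallyEq_comp_coord_right {M F : ℂ → ℂ} (hM : Meromorphic M)
    (hF : DifferentiableOn ℂ F (Metric.ball 0 1)) {δ : ℝ} (hδ : 0 < δ)
    (hδ' : δ < β.cubic.per₂ / 2)
    (hper : ∀ l ∈ β.cubic.L.lattice, l.re = 0 → ∀ w, (fun v => M (v + l)) =ᶠ[𝓝[≠] w] M)
    (h : ∀ w ∈ β.inner, |w.re - β.cubic.per₂ / 2| < δ → M =ᶠ[𝓝[≠] w] fun v => F (β.coord v))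
    {w : ℂ} (hw : w ∈ β.inner) (h1 : β.cubic.per₂ / 2 ≤ w.re) (h2 : w.re < β.cubic.per₂) :
    M =ᶠ[𝓝[≠] w] fun v => F (β.coord v) := by
  obtain ⟨A, hA⟩ : ∃ A : Set ℂ, A = β.inner ∩ Complex.re ⁻¹' Set.Ioo (β.cubic.per₂ / 2 - δ)
    β.cubic.per₂ := ⟨_, rfl⟩
  have hAo : IsOpen A := by
    rw [hA]; exact isOpen_inner.inter (isOpen_Ioo.preimage Complex.continuous_re)
  obtain ⟨G, hG⟩ : ∃ G : Set ℂ, G = {w ∈ A | M =ᶠ[𝓝[≠] w] fun v => F (β.coord v)} := ⟨_, rfl⟩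
  have hGA : G ⊆ A := by rw [hG]; exact Set.sep_subset _ _
  have dich : ∀ w ∈ A, (∀ᶠ v in 𝓝[≠] w, M v = F (β.coord v)) ∨
      ∀ᶠ v in 𝓝[≠] w, M v ≠ F (β.coord v) := by
    intro w hw
    rw [hA] at hw
    have hm : MeromorphicAt (fun v => M v - F (β.coord v)) w :=
      (hM w).sub (analyticAt_comp_coord hF hw.1).meromorphicAt
    rcases hm.eventually_eq_zero_or_eventually_ne_zero with h | h
    · exact Or.inl (h.mono fun v hv => sub_eq_zero.1 hv)
    · exact Or.inr (h.mono fun v hv => sub_ne_zero.1 hv)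
  have hGo : IsOpen G := by
    rw [isOpen_iff_mem_nhds]
    intro w hw
    rw [hG] at hw ⊢
    filter_upwards [hAo.mem_nhds hw.1, eventually_eventually_nhdsWithin.2 hw.2 |>
      eventually_nhdsWithin_iff.1] with v hv hv'
    refine ⟨hv, ?_⟩
    by_cases hvw : v = w
    · rw [hvw]; exact hw.2
    · have := hv' hvw
      rw [isOpen_compl_singleton.nhdsWithin_eq hvw] at this
      exact this.filter_mono nhdsWithin_le_nhds
  have hBo : IsOpen (A \ G) := by
    rw [isOpen_iff_mem_nhds]
    intro w hw
    have hne := (dich w hw.1).resolve_left fun h => hw.2 (by rw [hG]; exact ⟨hw.1, h⟩)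
    filter_upwards [hAo.mem_nhds hw.1, eventually_eventually_nhdsWithin.2 hne |>
      eventually_nhdsWithin_iff.1] with v hv hv'
    refine ⟨hv, fun hvG => ?_⟩
    by_cases hvw : v = w
    · rw [hvw] at hvG; exact hw.2 hvG
    · rw [hG] at hvG
      have := hv' hvw
      rw [isOpen_compl_singleton.nhdsWithin_eq hvw] at this
      obtain ⟨u, h1, h2⟩ := ((this.filter_mono nhdsWithin_le_nhds).and hvG.2).exists
      exact h1 h2
  have hAL : ∀ w ∈ A, w ∉ β.cubic.L.lattice := fun w hw => by
    rw [hA] at hw; exact notMem_L_of_mem_inner hw.1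
  have hAre : ∀ w ∈ A, β.cubic.per₂ / 2 - δ < w.re ∧ w.re < β.cubic.per₂ := fun w hw => by
    rw [hA] at hw; exact hw.2
  have hBre : ∀ w ∈ A \ G, β.cubic.per₂ / 2 + δ ≤ w.re := by
    intro w hw
    by_contra! hlt
    refine hw.2 ?_
    rw [hG]
    refine ⟨hw.1, h w (by have := hw.1; rw [hA] at this; exact this.1) ?_⟩
    rw [abs_lt]
    have := (hAre w hw.1).1
    constructor <;> linarith
  have mem_disc : ∀ w ∉ β.cubic.L.lattice, (w ∈ β.inner ↔ β.cubic.L.weierstrassP w ∈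
      {u : ℂ | ‖u + β.B‖ < ‖β.s₁ * u + β.D‖}) := fun w hw => by
    change ‖β.X w‖ < ‖β.W w‖ ↔ _
    rw [X_of_notMem hw, W_of_notMem hw]; rfl
  -- the images of the two sets are disjoint
  have hdisj : Disjoint (β.cubic.L.weierstrassP '' G) (β.cubic.L.weierstrassP '' (A \ G)) := by
    rw [Set.disjoint_left]
    rintro _ ⟨v, hv, rfl⟩ ⟨u, hu, huv⟩
    have hvr := hAre v (hGA hv)
    have hur := hAre u hu.1
    have hur' := hBre u hu
    have key : u - v ∈ β.cubic.L.lattice := by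
      rcases β.cubic.sub_mem_or_add_mem_of_weierstrassP_eq (hAL u hu.1) (hAL v (hGA hv)) huv with hm | hm
      · exact hm
      · refine absurd (sub_mem hm β.cubic.per₂_mem) (β.cubic.notMem_L_of_re ?_ ?_)
        · simp only [Complex.sub_re, Complex.add_re, Complex.ofReal_re]; linarith
        · simp only [Complex.sub_re, Complex.add_re, Complex.ofReal_re]; linarith
    have hre : (u - v).re = 0 := by
      obtain ⟨a, b, -, hb⟩ := β.cubic.mem_L.1 key
      have hp := β.cubic.per₂_pos
      rw [Complex.sub_re] at hb ⊢
      have b1 : b < 1 := by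
        by_contra! hb1
        have : (1 : ℝ) ≤ b := by exact_mod_cast hb1
        nlinarith
      have b2 : -1 < b := by
        by_contra! hb1
        have : (b : ℝ) ≤ -1 := by exact_mod_cast hb1
        nlinarith
      have : b = 0 := by omega
      rw [hb, this]; simp
    refine hu.2 ?_
    rw [hG] at hv ⊢
    refine ⟨hu.1, ?_⟩
    have e1 : ∀ᶠ x in 𝓝[≠] v, M (x + (u - v)) = F (β.coord (x + (u - v))) := by
      filter_upwards [hv.2, hper _ key hre v] with x hx hx'
      rw [hx', hx, coord_add key]
    have t1 : Tendsto (fun x : ℂ => x + -(u - v)) (𝓝[≠] u) (𝓝[≠] v) := by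
      refine tendsto_nhdsWithin_iff.2 ⟨?_, ?_⟩
      · have := (continuous_add_const (-(u - v))).tendsto u
        rw [neg_sub, add_sub_cancel] at this
        rw [neg_sub]
        exact this.mono_left nhdsWithin_le_nhds
      · filter_upwards [self_mem_nhdsWithin] with x hx h
        exact hx (Set.mem_singleton_iff.2 (by linear_combination Set.mem_singleton_iff.1 h))
    filter_upwards [t1.eventually e1] with x hx
    rwa [neg_add_cancel_right] at hx
  by_contra hcon
  have hwA : w ∈ A := by rw [hA]; exact ⟨hw, by linarith, h2⟩
  have hwB : w ∈ A \ G := ⟨hwA, fun hwG => hcon (by rw [hG] at hwG; exact hwG.2)⟩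
  have hp := β.cubic.per₂_pos
  have hhalf : ((β.cubic.per₂ / 2 : ℝ) : ℂ) ∈ G := by
    have hi : ((β.cubic.per₂ / 2 : ℝ) : ℂ) ∈ β.inner := mem_inner_of_re (Complex.ofReal_re _)
    rw [hG, hA]
    refine ⟨⟨hi, ?_⟩, h _ hi (by simpa using hδ)⟩
    rw [Set.mem_preimage, Complex.ofReal_re]
    constructor <;> linarith
  have cover : {u : ℂ | ‖u + β.B‖ < ‖β.s₁ * u + β.D‖} ⊆
      β.cubic.L.weierstrassP '' G ∪ β.cubic.L.weierstrassP '' (A \ G) := by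
    intro u hu
    obtain ⟨v₀, hv₀, rfl⟩ := β.cubic.exists_weierstrassP_eq u
    obtain ⟨v, hv, hre, -⟩ := β.cubic.exists_mem_half v₀
    have hvv : v ∉ β.cubic.L.lattice ∧ β.cubic.L.weierstrassP v = β.cubic.L.weierstrassP v₀ := by
      rcases hv with hv | hv
      · have e : v = v₀ + (v - v₀) := by ring
        rw [e, β.cubic.add_mem_L_iff hv, β.cubic.weierstrassP_add hv]; exact ⟨hv₀, rfl⟩
      · have e : v = -v₀ + (v + v₀) := by ring
        rw [e, β.cubic.add_mem_L_iff hv, β.cubic.weierstrassP_add hv, neg_mem_iff,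
          β.cubic.L.weierstrassP_neg]
        exact ⟨hv₀, rfl⟩
    rw [← hvv.2] at hu ⊢
    have hvi := (mem_disc v hvv.1).2 hu
    have hvA : v ∈ A := by
      rw [hA]
      refine ⟨hvi, by linarith [hre.1], lt_of_le_of_ne hre.2 fun he => ?_⟩
      refine Set.disjoint_left.1 disjoint_inner_outer hvi ?_
      rw [← add_mem_outer (neg_mem β.cubic.per₂_mem)]
      exact mem_outer_of_re (by simp [he])
    by_cases hvG : v ∈ G
    · exact Or.inl ⟨v, hvG, rfl⟩
    · exact Or.inr ⟨v, ⟨hvA, hvG⟩, rfl⟩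
  obtain ⟨u, -, hu1, hu2⟩ := β.isPreconnected_disc _ _
    (β.cubic.isOpen_image_weierstrassP hGo fun w hw => hAL w (hGA hw))
    (β.cubic.isOpen_image_weierstrassP hBo fun w hw => hAL w hw.1) cover
    ⟨_, (mem_disc _ (hAL _ (hGA hhalf))).1 (by
      have := hGA hhalf; rw [hA] at this; exact this.1), _, hhalf, rfl⟩
    ⟨_, (mem_disc _ (hAL _ hwA)).1 hw, _, hwB, rfl⟩
  exact Set.disjoint_left.1 hdisj hu1 hu2

/-- A meromorphic function that is a holomorphic function of the coordinate `x` near the line of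
symmetry is the same function of `x` in the whole domain `|x| < 1` of the fundamental strip. -/
theorem eventuallyEq_comp_coord {M F : ℂ → ℂ} (hM : Meromorphic M)
    (hF : DifferentiableOn ℂ F (Metric.ball 0 1)) {δ : ℝ} (hδ : 0 < δ)
    (hδ' : δ < β.cubic.per₂ / 2)
    (hper : ∀ l ∈ β.cubic.L.lattice, l.re = 0 → ∀ w, (fun v => M (v + l)) =ᶠ[𝓝[≠] w] M)
    (h : ∀ w ∈ β.inner, |w.re - β.cubic.per₂ / 2| < δ → M =ᶠ[𝓝[≠] w] fun v => F (β.coord v))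
    {w : ℂ} (hw : w ∈ β.inner) (h1 : 0 < w.re) (h2 : w.re < β.cubic.per₂) :
    M =ᶠ[𝓝[≠] w] fun v => F (β.coord v) := by
  rcases le_total (β.cubic.per₂ / 2) w.re with h3 | h3
  · exact eventuallyEq_comp_coord_right hM hF hδ hδ' hper h hw h3 h2
  -- reflection in the line of symmetry
  have hP := β.cubic.per₂_mem
  have refl_coord : ∀ v, β.coord (-v + β.cubic.per₂) = β.coord v := fun v => by
    rw [coord_add hP, coord_neg]
  have refl_inner : ∀ v, -v + (β.cubic.per₂ : ℂ) ∈ β.inner ↔ v ∈ β.inner := fun v => by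
    rw [add_mem_inner hP, neg_mem_inner]
  have trans : ∀ (f g : ℂ → ℂ) (v : ℂ), f =ᶠ[𝓝[≠] (-v + (β.cubic.per₂ : ℂ))] g →
      (fun x => f (-x + (β.cubic.per₂ : ℂ))) =ᶠ[𝓝[≠] v] fun x => g (-x + (β.cubic.per₂ : ℂ)) := by
    intro f g v hfg
    have := eventuallyEq_comp_affine (a := -1) (b := β.cubic.per₂) (w := v) (by norm_num)
      (by simpa using hfg)
    simpa only [neg_mul, one_mul] using this
  have key := eventuallyEq_comp_coord_right (M := fun v => M (-v + (β.cubic.per₂ : ℂ)))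
    (fun v => MeromorphicAt.comp_analyticAt (g := fun v : ℂ => -v + (β.cubic.per₂ : ℂ)) (hM _)
      (by fun_prop)) hF hδ hδ'
    (fun l hl hl0 v => by
      have := trans _ _ v (hper (-l) (neg_mem hl) (by simp [hl0]) _)
      refine (EventuallyEq.of_eq (funext fun x => ?_)).trans this
      congr 1; ring)
    (fun v hv hd => by
      have := trans _ _ v (h (-v + (β.cubic.per₂ : ℂ)) ((refl_inner v).2 hv) (by
        rw [← abs_neg]; convert hd using 2; simp; ring))
      simpa only [refl_coord] using this)
    (w := -w + (β.cubic.per₂ : ℂ)) ((refl_inner w).2 hw) (by simp; linarith) (by simpa using h1)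
  have := trans _ _ w key
  simp only [refl_coord] at this
  refine (EventuallyEq.of_eq (funext fun x => ?_)).trans this
  congr 1; ring

end Branch

end

/-! ### Continuation to the plane -/

section

open Topology

open Branch

namespace Biquad

variable {k : Biquad} {z : ℝ} {β β' : Branch} {c : ℝ}

/-- The imaginary period. -/
lemma _root_.RealCubic.per₁_mem (R : RealCubic) : (Complex.I * R.per₁ : ℂ) ∈ R.L.lattice :=
  R.mem_L.2 ⟨1, 0, by simp, by simp⟩

/-- The continuation to the whole plane. The functions `F (x)` and `C + x y - G (y)`, given in the
domains `|x| < 1` and `|y| < 1`, agree on the intersection and therefore define a function on the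
strip between the lines of symmetry of `x` and `y`, which is extended by reflection in the line of
symmetry of `x` and then by the functional equation. -/
theorem IsUniform.exists_continuation (h : k.IsUniform z β β' c) {F G : ℂ → ℂ} {C : ℂ}
    (hF : DifferentiableOn ℂ F (Metric.ball 0 1)) (hG : DifferentiableOn ℂ G (Metric.ball 0 1))
    (hFG : ∀ x y : ℂ, ‖x‖ < 1 → ‖y‖ < 1 → k.val x y = 0 → F x = C + x * y - G y) :
    ∃ r : ℂ → ℂ, Meromorphic r ∧
      (∀ w ∈ β.inner, 0 < w.re → w.re < β.cubic.per₂ →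
        r =ᶠ[𝓝[≠] w] fun v => F (β.coord v)) ∧
      (∀ w : ℂ, w - c ∈ β'.inner → c < w.re → w.re < c + β.cubic.per₂ →
        (fun v => C + β.coord v * β'.coord (v - c) - r v) =ᶠ[𝓝[≠] w]
          fun v => G (β'.coord (v - c))) ∧
      (∀ w, r (w - (2 * c : ℝ)) = r w + β'.coord (w - c) *
        (β.coord (-w + β.cubic.per₂ + 2 * c) - β.coord w)) ∧
      (∀ w, (fun v => r (-v + β.cubic.per₂)) =ᶠ[𝓝[≠] w] r) ∧
      (∀ l ∈ β.cubic.L.lattice, l.re = 0 → ∀ w, (fun v => r (v + l)) =ᶠ[𝓝[≠] w] r) := by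
  classical
  have hc := h.c_pos
  have hc' := h.c_lt
  have hP := β.cubic.per₂_mem
  have hP' : (β.cubic.per₂ : ℂ) ∈ β'.cubic.L.lattice := by rw [h.cubic_eq]; exact hP
  have hhalf := β.cubic.per₂_pos
  obtain ⟨x, hx⟩ : ∃ x : ℂ → ℂ, x = β.coord := ⟨_, rfl⟩
  obtain ⟨y, hy⟩ : ∃ y : ℂ → ℂ, y = fun v => β'.coord (v - c) := ⟨_, rfl⟩
  obtain ⟨A', hA'⟩ : ∃ A' : Set ℂ, A' = (fun v : ℂ => v - c) ⁻¹' β'.inner := ⟨_, rfl⟩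
  obtain ⟨ξ, hξ⟩ : ∃ ξ : ℂ → ℂ, ξ = fun v : ℂ => -v + β.cubic.per₂ := ⟨_, rfl⟩
  obtain ⟨η, hη⟩ : ∃ η : ℂ → ℂ, η = fun v : ℂ => -v + β.cubic.per₂ + 2 * c := ⟨_, rfl⟩
  obtain ⟨H, hH⟩ : ∃ H : ℂ → ℂ, H = fun v => y v * (x (η v) - x v) := ⟨_, rfl⟩
  -- symmetries of `x` and `y`
  have xξ : ∀ v, x (ξ v) = x v := fun v => by rw [hx, hξ]; simp only; rw [coord_add hP, coord_neg]
  have yη : ∀ v, y (η v) = y v := fun v => by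
    rw [hy, hη]; simp only
    have e : -v + (β.cubic.per₂ : ℂ) + 2 * c - c = -(v - c) + β.cubic.per₂ := by ring
    rw [e, coord_add hP', coord_neg]
  have ξA : ∀ v, ξ v ∈ β.inner ↔ v ∈ β.inner := fun v => by
    rw [hξ]; simp only; rw [add_mem_inner hP, neg_mem_inner]
  have ηA : ∀ v, η v ∈ A' ↔ v ∈ A' := fun v => by
    rw [hA', hη]; simp only [Set.mem_preimage]
    have e : -v + (β.cubic.per₂ : ℂ) + 2 * c - c = -(v - c) + β.cubic.per₂ := by ring
    rw [e, add_mem_inner hP', neg_mem_inner]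
  have ξre : ∀ v, (ξ v).re = -v.re + β.cubic.per₂ := fun v => by simp [hξ]
  have ξc : Continuous ξ := by rw [hξ]; fun_prop
  have hA'o : IsOpen A' := by
    rw [hA']; exact (isOpen_inner (β := β')).preimage (by fun_prop)
  have xmer : Meromorphic x := by rw [hx]; exact meromorphic_coord
  have ymer : Meromorphic y := by
    rw [hy]
    exact fun v => MeromorphicAt.comp_analyticAt (g := fun v : ℂ => v - c) (meromorphic_coord _)
      (by fun_prop)
  have Hmer : Meromorphic H := by
    rw [hH]
    refine fun v => (ymer v).mul (MeromorphicAt.sub ?_ (xmer v))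
    rw [hη]
    exact MeromorphicAt.comp_analyticAt (g := fun v : ℂ => -v + β.cubic.per₂ + 2 * c) (xmer _)
      (by fun_prop)
  have Fan : ∀ v ∈ β.inner, AnalyticAt ℂ (fun v => F (x v)) v := fun v hv => by
    rw [hx]; exact analyticAt_comp_coord hF hv
  have Gmer : ∀ v ∈ A', MeromorphicAt (fun v => C + x v * y v - G (y v)) v := fun v hv => by
    rw [hA'] at hv
    refine ((MeromorphicAt.const C v).add ((xmer v).mul (ymer v))).sub ?_
    rw [hy]
    exact (AnalyticAt.comp_of_eq (analyticAt_comp_coord hG hv)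
      (by fun_prop : AnalyticAt ℂ (fun v : ℂ => v - c) v) rfl).meromorphicAt
  have agree : ∀ v ∈ β.inner, v ∈ A' → F (x v) = C + x v * y v - G (y v) := fun v h1 h2 => by
    rw [hA'] at h2
    rw [hx, hy]
    exact hFG _ _ (mem_ball_zero_iff.1 (coord_mem_ball h1)) (mem_ball_zero_iff.1 (coord_mem_ball h2))
      (h.unif.val_eq_zero h1 h2)
  -- the function on the union of the two domains
  obtain ⟨r₀, hr₀⟩ : ∃ r₀ : ℂ → ℂ, r₀ = fun v =>
    if v ∈ β.inner then F (x v) else C + x v * y v - G (y v) := ⟨_, rfl⟩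
  have r₀A : ∀ v ∈ β.inner, r₀ v = F (x v) := fun v hv => by rw [hr₀]; simp only [if_pos hv]
  have r₀A' : ∀ v ∈ A', r₀ v = C + x v * y v - G (y v) := fun v hv => by
    by_cases hv' : v ∈ β.inner
    · rw [r₀A v hv', agree v hv' hv]
    · rw [hr₀]; simp only [if_neg hv']
  have r₀mer : ∀ v : ℂ, β.cubic.per₂ / 2 ≤ v.re → v.re ≤ β.cubic.per₂ / 2 + c →
      MeromorphicAt r₀ v := by
    intro v h1 h2
    rcases h.strip h1 h2 with hv | hv
    · exact (Fan v hv).meromorphicAt.congr (nhdsWithin_le_nhds (Filter.mem_of_superset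
        (isOpen_inner.mem_nhds hv) fun u hu => (r₀A u hu).symm))
    · have hv : v ∈ A' := by rw [hA']; exact hv
      exact (Gmer v hv).congr (nhdsWithin_le_nhds (Filter.mem_of_superset
        (hA'o.mem_nhds hv) fun u hu => (r₀A' u hu).symm))
  -- reflection in the line of symmetry of `x`
  obtain ⟨R, hR⟩ : ∃ R : ℂ → ℂ, R = fun v =>
    if β.cubic.per₂ / 2 ≤ v.re then r₀ v else r₀ (ξ v) := ⟨_, rfl⟩
  have RA : ∀ v ∈ β.inner, R v = F (x v) := fun v hv => by
    rw [hR]; simp only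
    split_ifs
    · exact r₀A v hv
    · rw [r₀A _ ((ξA v).2 hv), xξ]
  have Rr : ∀ v : ℂ, β.cubic.per₂ / 2 ≤ v.re → R v = r₀ v := fun v hv => by
    rw [hR]; simp only [if_pos hv]
  have Rl : ∀ v : ℂ, v.re < β.cubic.per₂ / 2 → R v = r₀ (ξ v) := fun v hv => by
    rw [hR]; simp only [if_neg (not_le.2 hv)]
  have Rmer : ∀ v : ℂ, β.cubic.per₂ / 2 - c ≤ v.re → v.re < β.cubic.per₂ / 2 - c + 2 * c →
      MeromorphicAt R v := by
    intro v h1 h2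
    rcases lt_trichotomy v.re (β.cubic.per₂ / 2) with hlt | heq | hlt
    · have : MeromorphicAt (fun v => r₀ (ξ v)) v := by
        refine MeromorphicAt.comp_analyticAt (g := ξ) (r₀mer _ ?_ ?_) (by rw [hξ]; fun_prop)
        · rw [ξre]; linarith
        · rw [ξre]; linarith
      exact this.congr (nhdsWithin_le_nhds (Filter.mem_of_superset
        ((isOpen_Iio.preimage Complex.continuous_re).mem_nhds hlt) fun u hu => (Rl u hu).symm))
    · have hv : v ∈ β.inner := mem_inner_of_re heq
      exact (Fan v hv).meromorphicAt.congr (nhdsWithin_le_nhds (Filter.mem_of_superset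
        (isOpen_inner.mem_nhds hv) fun u hu => (RA u hu).symm))
    · exact (r₀mer v hlt.le (by linarith)).congr (nhdsWithin_le_nhds (Filter.mem_of_superset
        ((isOpen_Ioi.preimage Complex.continuous_re).mem_nhds hlt)
          fun u hu => (Rr u (le_of_lt hu)).symm))
  -- compatibility with the functional equation on the line of symmetry of `y`
  have Rc : ∀ w : ℂ, w.re = β.cubic.per₂ / 2 - c + 2 * c →
      ∀ᶠ v in 𝓝 w, R (v - (2 * c : ℝ)) = R v + H v := by
    intro w hw
    have hwA : w ∈ A' := by
      rw [hA']
      refine mem_inner_of_re (β := β') ?_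
      rw [h.cubic_eq, Complex.sub_re, hw, Complex.ofReal_re]; ring
    filter_upwards [hA'o.mem_nhds hwA, (isOpen_Ioo.preimage Complex.continuous_re).mem_nhds
      (⟨by linarith, by linarith⟩ : w.re ∈ Set.Ioo (β.cubic.per₂ / 2) (β.cubic.per₂ / 2 + 2 * c))]
      with v hv hv'
    have e : ξ (v - (2 * c : ℝ)) = η v := by rw [hξ, hη]; push_cast; ring
    rw [Rl (v - (2 * c : ℝ)) (by
        rw [Complex.sub_re, Complex.ofReal_re]; linarith [hv'.2]), e, Rr v hv'.1.le, r₀A' v hv,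
      r₀A' _ ((ηA v).2 hv), yη, hH]
    ring
  obtain ⟨r, rmer, rshift, rR⟩ := exists_meromorphic_of_strip (a := β.cubic.per₂ / 2 - c)
    (ℓ := 2 * c) (by linarith) Hmer Rmer Rc
  have rA : ∀ v ∈ β.inner, β.cubic.per₂ / 2 - c ≤ v.re → v.re ≤ β.cubic.per₂ / 2 + c →
      r =ᶠ[𝓝 v] fun v => F (x v) := fun v hv h1 h2 =>
    (rR v h1 (by linarith)).trans (Filter.mem_of_superset (isOpen_inner.mem_nhds hv) RA)
  have hmid : ∀ v : ℂ, v.re = β.cubic.per₂ / 2 → r =ᶠ[𝓝 v] fun v => F (x v) := fun v hv =>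
    rA v (mem_inner_of_re hv) (by linarith) (by linarith)
  have rper : ∀ l ∈ β.cubic.L.lattice, l.re = 0 → ∀ w, (fun v => r (v + l)) =ᶠ[𝓝[≠] w] r := by
    intro l hl hl0
    refine Meromorphic.eventuallyEq_of_eventuallyEq (w₀ := (β.cubic.per₂ / 2 : ℝ))
      (fun v => MeromorphicAt.comp_analyticAt (g := fun v : ℂ => v + l) (rmer _) (by fun_prop))
      rmer ?_
    have h1 := hmid (β.cubic.per₂ / 2 : ℝ) (Complex.ofReal_re _)
    have h2 : ∀ᶠ v : ℂ in 𝓝 ((β.cubic.per₂ / 2 : ℝ) : ℂ), r (v + l) = F (x (v + l)) :=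
      (continuous_add_const l).continuousAt.eventually
        (hmid ((β.cubic.per₂ / 2 : ℝ) + l) (by simp [hl0]))
    refine Filter.Eventually.filter_mono nhdsWithin_le_nhds ?_
    filter_upwards [h1, h2] with v h3 h4
    rw [h3, h4, hx, coord_add hl]
  have rξ : ∀ w, (fun v => r (ξ v)) =ᶠ[𝓝[≠] w] r := by
    refine Meromorphic.eventuallyEq_of_eventuallyEq (w₀ := (β.cubic.per₂ / 2 : ℝ))
      (fun v => MeromorphicAt.comp_analyticAt (g := ξ) (rmer _) (by rw [hξ]; fun_prop)) rmer ?_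
    have h1 := hmid (β.cubic.per₂ / 2 : ℝ) (Complex.ofReal_re _)
    have h2 : ∀ᶠ v : ℂ in 𝓝 ((β.cubic.per₂ / 2 : ℝ) : ℂ), r (ξ v) = F (x (ξ v)) :=
      ξc.continuousAt.eventually (hmid _ (by rw [ξre, Complex.ofReal_re]; ring))
    refine Filter.Eventually.filter_mono nhdsWithin_le_nhds ?_
    filter_upwards [h1, h2] with v h3 h4
    rw [h3, h4, xξ]
  have xper : ∀ l ∈ β.cubic.L.lattice, ∀ v, x (v + l) = x v := fun l hl v => by
    rw [hx, coord_add hl]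
  have yper : ∀ l ∈ β.cubic.L.lattice, ∀ v, y (v + l) = y v := fun l hl v => by
    have e : v + l - c = v - c + l := by ring
    rw [hy]; simp only
    rw [e, coord_add (by rwa [h.cubic_eq])]
  refine ⟨r, rmer, fun w hw h1 h2 => ?_, fun w hw h1 h2 => ?_, fun w => ?_, ?_, rper⟩
  · rw [← hx]
    have := eventuallyEq_comp_coord (β := β) rmer hF hc (by linarith) rper (fun v hv hd => by
      rw [abs_lt] at hd
      have := (rA v hv (by linarith [hd.1]) (by linarith [hd.2])).filter_mono
        (nhdsWithin_le_nhds (s := {v}ᶜ))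
      rwa [hx] at this) hw h1 h2
    rwa [hx]
  · -- the same argument for `y`, after a translation
    obtain ⟨M, hM⟩ : ∃ M : ℂ → ℂ, M = fun v => C + x v * y v - r v := ⟨_, rfl⟩
    have Mmer : Meromorphic M := by
      rw [hM]
      exact fun v => ((MeromorphicAt.const C v).add ((xmer v).mul (ymer v))).sub (rmer v)
    have rA' : ∀ v ∈ A', |v.re - c - β.cubic.per₂ / 2| < c →
        M =ᶠ[𝓝[≠] v] fun v => G (y v) := by
      intro v hv hd
      rw [abs_lt] at hd
      refine Filter.Eventually.filter_mono nhdsWithin_le_nhds ?_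
      rcases le_or_gt v.re (β.cubic.per₂ / 2 + c) with hle | hgt
      · filter_upwards [rR v (by linarith [hd.1]) (by linarith), hA'o.mem_nhds hv,
          (isOpen_Ioi.preimage Complex.continuous_re).mem_nhds
            (show β.cubic.per₂ / 2 < v.re by linarith [hd.1])] with u hu hu' hu''
        rw [hM]; simp only
        rw [hu, Rr u (le_of_lt hu''), r₀A' u hu']; ring
      · have h1 : ∀ᶠ u : ℂ in 𝓝 v, r (u - (2 * c : ℝ)) = R (u - (2 * c : ℝ)) :=
          (continuous_sub_right ((2 * c : ℝ) : ℂ)).continuousAt.eventually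
            (rR _ (by simp; linarith) (by simp; linarith))
        filter_upwards [h1, hA'o.mem_nhds hv,
          (isOpen_Iio.preimage Complex.continuous_re).mem_nhds
            (show v.re < β.cubic.per₂ / 2 + 2 * c by linarith [hd.2])] with u hu hu' hu''
        have e : ξ (u - (2 * c : ℝ)) = η u := by rw [hξ, hη]; push_cast; ring
        have hu'' : u.re < β.cubic.per₂ / 2 + 2 * c := hu''
        have hs := rshift u
        rw [hu, Rl _ (by rw [Complex.sub_re, Complex.ofReal_re]; linarith), e,
          r₀A' _ ((ηA u).2 hu'), yη, hH] at hs
        rw [hM]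
        linear_combination hs
    have Mper : ∀ l ∈ β.cubic.L.lattice, l.re = 0 → ∀ w, (fun v => M (v + l)) =ᶠ[𝓝[≠] w] M := by
      intro l hl hl0 w
      filter_upwards [rper l hl hl0 w] with v hv
      rw [hM]; simp only [hv, xper l hl, yper l hl]
    have tr : ∀ (f g : ℂ → ℂ) (a b : ℂ), f =ᶠ[𝓝[≠] (a + b)] g →
        (fun v => f (v + b)) =ᶠ[𝓝[≠] a] fun v => g (v + b) := by
      intro f g a b hfg
      have := eventuallyEq_comp_affine (a := 1) (b := b) (w := a) one_ne_zero (by simpa using hfg)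
      simpa only [one_mul] using this
    have hre : (w - c).re < β'.cubic.per₂ := by
      rw [h.cubic_eq, Complex.sub_re, Complex.ofReal_re]; linarith
    have key := eventuallyEq_comp_coord (β := β') (M := fun v => M (v + c)) (F := G) (δ := c)
      (fun v => MeromorphicAt.comp_analyticAt (g := fun v : ℂ => v + c) (Mmer _) (by fun_prop))
      hG hc (by rw [h.cubic_eq]; linarith)
      (fun l hl hl0 v => by
        rw [h.cubic_eq] at hl
        have := tr _ _ v c (Mper l hl hl0 (v + c))
        refine (EventuallyEq.of_eq (funext fun u => ?_)).trans this
        congr 1; ring)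
      (fun v hv hd => by
        rw [h.cubic_eq] at hd
        have := tr _ _ v c (rA' (v + c) (by
          rw [hA', Set.mem_preimage, add_sub_cancel_right]; exact hv) (by simpa using hd))
        simpa only [hy, add_sub_cancel_right] using this)
      (w := w - c) hw (by simpa using h1) hre
    have := tr (fun v => M (v + c)) (fun v => G (β'.coord v)) w (-(c : ℂ))
      (by simpa only [← sub_eq_add_neg] using key)
    simpa only [hM, hx, hy, ← sub_eq_add_neg, sub_add_cancel] using this
  · have := rshift w
    rw [hH, hx, hy, hη] at this
    exact this
  · rw [hξ] at rξ; exact rξ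

end Biquad

end

/-! ### Identification with the objects of the walk -/

section

open Topology

open Branch

lemma Branch.fin_mob (β : Branch) (p : OnePoint ℂ) : fin (β.mob p) = β.num p / β.den p := by
  induction p using OnePoint.rec with
  | infty =>
    by_cases h : β.s₁ = 0
    · simp [mob, num, den, h, fin]
    · simp [mob, num, den, h, fin]
  | coe u =>
    by_cases h : (β.s₁ : ℂ) * u + β.D = 0
    · simp [mob, num, den, h, fin]
    · simp [mob, num, den, h, fin]

lemma Branch.exists_mob_eq_iff (β : Branch) (p : OnePoint ℂ) :
    (∃ t : ℂ, β.mob p = t ∧ ‖t‖ < 1) ↔ ‖β.num p‖ < ‖β.den p‖ := by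
  have key : ∀ n m : ℂ, m ≠ 0 → ((∃ t : ℂ, ((n / m : ℂ) : OnePoint ℂ) = t ∧ ‖t‖ < 1) ↔
      ‖n‖ < ‖m‖) := by
    intro n m hm
    simp only [OnePoint.coe_eq_coe, exists_eq_left', norm_div]
    exact div_lt_one (norm_pos_iff.2 hm)
  have key0 : ∀ n : ℂ, ¬ ‖n‖ < ‖(0 : ℂ)‖ := fun n => by
    rw [norm_zero]; exact not_lt.2 (norm_nonneg n)
  induction p using OnePoint.rec with
  | infty =>
    by_cases h : β.s₁ = 0
    · simp [mob, num, den, h]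
    · simp only [mob, num, den, h, if_false]
      rw [← key 1 β.s₁ (by exact_mod_cast h)]
      push_cast
      rfl
  | coe u =>
    by_cases h : (β.s₁ : ℂ) * u + β.D = 0
    · simp [mob, num, den, h]
    · simp only [mob, num, den, h, if_false]
      exact key _ _ h

namespace QuarterPlane

variable {S : Finset (ℤ × ℤ)} {z : ℝ}

/-- The parametrization by the functions `x` and `y`, in terms of the branch points of the two
discriminants. -/
structure IsParam (S : Finset (ℤ × ℤ)) (z : ℝ) (β β' : Branch) (c : ℝ) : Prop where
  branch : β.IsBranch (kernel S z)
  branch' : β'.IsBranch (kernel S z).swap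
  uniform : (kernel S z).IsUniform z β β' c
  ω₃_eq : ω₃ S z = 2 * c

theorem exists_isParam (hS : IsSmallStepSet S) (hns : IsNonsingular S) (hz₀ : 0 < z)
    (hz₁ : z * S.card < 1) : ∃ β β' c, IsParam S z β β' c := by
  have hW := kernel_isWalk hS hns hz₀ hz₁
  obtain ⟨β, hβ⟩ := hW.exists_branch
  obtain ⟨β', hβ'⟩ := hW.swap.exists_branch
  obtain ⟨s, hs0, hs1, hω₃, hs⟩ := exists_ω₃_eq hS hβ hW hβ'
  have hpt : (kernel S z).swap.a β'.t₁ * (β.cubic.realP s + β.B) ^ 2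
      + (kernel S z).swap.b β'.t₁ * ((β.cubic.realP s + β.B) * (β.s₁ * β.cubic.realP s + β.D))
      + (kernel S z).swap.c β'.t₁ * (β.s₁ * β.cubic.realP s + β.D) ^ 2 = 0 := by
    rcases hs with ⟨ha, hb, hq⟩ | ⟨ha, -, hN⟩
    · rw [ha, hb, hq]; ring
    · have hd : (kernel S z).swap.disc β'.t₁ = 0 := by rw [hβ'.disc_eq]; ring
      rw [Biquad.disc_eq] at hd
      rw [hN]
      field_simp
      linear_combination (-1 : ℝ) * (β.s₁ * β.cubic.realP s + β.D) ^ 2 * hd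
  obtain ⟨h1, h2⟩ := Biquad.exists_uniformizes hβ hβ' hs0 hs1 rfl (by
    simp only [Biquad.homA, Biquad.homB, Biquad.homC]
    simp only [Biquad.a, Biquad.b, Biquad.c, Biquad.swap] at hpt
    have hpt' := congrArg (fun t : ℝ => (t : ℂ)) hpt
    push_cast at hpt'
    linear_combination hpt')
  exact ⟨β, β', _, hβ, hβ', ⟨hW, hβ.cubic_eq hβ', by linarith, by linarith, h1, h2⟩,
    by rw [hω₃]; ring⟩

namespace IsParam

variable {β β' : Branch} {c : ℝ} (h : IsParam S z β β' c) (hS : IsSmallStepSet S)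

include h hS

lemma wp_eq (w : ℂ) : wp (ω₁ S z) (ω₂ S z) w = β.cubic.sphereP w := by
  rw [ω₁_eq hS h.branch, ω₂_eq hS h.branch, wp,
    dif_pos (RealCubic.linearIndependent_I_mul β.cubic.per₁_pos β.cubic.per₂_pos)]
  rfl

lemma xS_eq (w : ℂ) : xS S z w = β.mob (β.cubic.sphereP w) := by
  rw [xS, h.wp_eq hS, gInv_eq hS h.branch]

lemma yS_eq (w : ℂ) : yS S z w = β'.mob (β'.cubic.sphereP (w - c)) := by
  have e : w - (ω₃ S z : ℂ) / 2 = w - c := by rw [h.ω₃_eq]; push_cast; ring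
  rw [yS, h.wp_eq hS, y₄, gInv_eq hS.transpose (by rw [kernel_transpose]; exact h.branch'), e,
    h.uniform.cubic_eq]

lemma x_eq : x S z = β.coord := by
  ext w; rw [x, h.xS_eq hS, Branch.fin_mob]; rfl

lemma y_eq (w : ℂ) : y S z w = β'.coord (w - c) := by
  rw [y, h.yS_eq hS, Branch.fin_mob]; rfl

lemma mem_Δx {w : ℂ} : w ∈ Δx S z ↔ (0 < w.re ∧ w.re < β.cubic.per₂) ∧ w ∈ β.inner := by
  rw [Δx, Set.mem_ofPred_eq, h.xS_eq hS, Branch.exists_mob_eq_iff, ω₂_eq hS h.branch]; rfl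

lemma mem_Δy {w : ℂ} : w ∈ Δy S z ↔
    (c < w.re ∧ w.re < c + β.cubic.per₂) ∧ w - c ∈ β'.inner := by
  rw [Δy, Set.mem_ofPred_eq, h.yS_eq hS, Branch.exists_mob_eq_iff, ω₂_eq hS h.branch, h.ω₃_eq,
    mul_div_cancel_left₀ _ (two_ne_zero)]
  rfl

end IsParam

variable (S z) in
lemma differentiable_K_zero_right : Differentiable ℂ fun t => K S z t 0 := by
  unfold K; fun_prop

variable (S z) in
lemma differentiable_K_zero_left : Differentiable ℂ fun t => K S z 0 t := by
  unfold K; fun_prop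

end QuarterPlane

/-- Two functions that agree near every point, except possibly at the point, agree up to a discrete
set. -/
lemma eventuallyEq_codiscreteWithin {f g : ℂ → ℂ} {U : Set ℂ} (h : ∀ w ∈ U, f =ᶠ[𝓝[≠] w] g) :
    f =ᶠ[codiscreteWithin U] g :=
  mem_codiscreteWithin_iff_forall_mem_nhdsNE.2 fun w hw =>
    Filter.mem_of_superset (h w hw) Set.subset_union_left

/-- Functions in normal form inherit invariance under an analytic substitution. -/
lemma MeromorphicNFOn.comp_eq_self {f : ℂ → ℂ} (hf : MeromorphicNFOn f Set.univ) {g : ℂ → ℂ}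
    (hg : Differentiable ℂ g) (h : ∀ w, (fun v => f (g v)) =ᶠ[𝓝[≠] w] f) (w : ℂ) :
    f (g w) = f w := by
  have h1 : MeromorphicNFAt (f ∘ g) w :=
    (hf (Set.mem_univ (g w))).comp_analyticAt (hg.analyticAt w)
  exact ((h1.eventuallyEq_nhdsNE_iff_eventuallyEq_nhds (hf (Set.mem_univ w))).1 (h w)).eq_of_nhds

end

/-! ### Continuation of the generating functions -/

open Topology in
theorem theorem4 (S : Finset (ℤ × ℤ)) (hS : IsSmallStepSet S) (hns : IsNonsingular S)
    (z : ℝ) (hz₀ : 0 < z) (hz₁ : z < 1 / (S.card : ℝ)) :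
    ∃ rx ry : ℂ → ℂ,
      -- `rx` and `ry` are meromorphic on `ℂ` (with the value `0` at their poles)
      MeromorphicNFOn rx Set.univ ∧ MeromorphicNFOn ry Set.univ ∧
      -- they continue the lifted functions from `Δx ∪ Δy`
      (∀ ω ∈ Δx S z, rx ω = K S z (x S z ω) 0 * Q S z (x S z ω) 0) ∧
      (rx =ᶠ[codiscreteWithin (Δy S z)] fun ω =>
        -(K S z 0 (y S z ω) * Q S z 0 (y S z ω)) + K S z 0 0 * Q S z 0 0 + x S z ω * y S z ω) ∧
      (∀ ω ∈ Δy S z, ry ω = K S z 0 (y S z ω) * Q S z 0 (y S z ω)) ∧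
      (ry =ᶠ[codiscreteWithin (Δx S z)] fun ω =>
        -(K S z (x S z ω) 0 * Q S z (x S z ω) 0) + K S z 0 0 * Q S z 0 0 + x S z ω * y S z ω) ∧
      -- the shift relations and the linear identity, as identities of meromorphic functions
      ((fun ω => rx (ω - ω₃ S z)) =ᶠ[codiscrete ℂ] fun ω =>
        rx ω + y S z ω * (x S z (-ω + 2 * ωy₂ S z) - x S z ω)) ∧
      ((fun ω => ry (ω + ω₃ S z)) =ᶠ[codiscrete ℂ] fun ω =>
        ry ω + x S z ω * (y S z (-ω + 2 * ωx₂ S z) - y S z ω)) ∧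
      ((fun ω => rx ω + ry ω - K S z 0 0 * Q S z 0 0 - x S z ω * y S z ω) =ᶠ[codiscrete ℂ] 0) ∧
      -- invariance and periodicity
      (∀ ω, rx (ξ S z ω) = rx ω) ∧ (∀ ω, ry (η S z ω) = ry ω) ∧
      (∀ ω, rx (ω + ω₁ S z) = rx ω) ∧ (∀ ω, ry (ω + ω₁ S z) = ry ω) := by
  have hne : 0 < (S.card : ℝ) := by
    obtain ⟨s, hs, -⟩ := hns 1 0 (Or.inl one_ne_zero)
    exact_mod_cast Finset.card_pos.2 ⟨s, hs⟩
  have hz : z * S.card < 1 := (lt_div_iff₀ hne).1 hz₁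
  obtain ⟨β, β', c, h⟩ := exists_isParam hS hns hz₀ hz
  have hP := β.cubic.per₂_mem
  have hI := β.cubic.per₁_mem
  have hP' : (β.cubic.per₂ : ℂ) ∈ β'.cubic.L.lattice := by rw [h.uniform.cubic_eq]; exact hP
  have hI' : (Complex.I * β.cubic.per₁ : ℂ) ∈ β'.cubic.L.lattice := by
    rw [h.uniform.cubic_eq]; exact hI
  have hIre : (Complex.I * β.cubic.per₁ : ℂ).re = 0 := by simp
  have hx := h.x_eq hS
  have hy := h.y_eq hS
  have hω₁ := ω₁_eq hS h.branch
  have hω₂ := ω₂_eq hS h.branch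
  obtain ⟨C, hC⟩ : ∃ C, C = K S z 0 0 * Q S z 0 0 := ⟨_, rfl⟩
  have hF : DifferentiableOn ℂ (fun t => K S z t 0 * Q S z t 0) (Metric.ball 0 1) :=
    (differentiable_K_zero_right S z).differentiableOn.mul (differentiableOn_Q_zero_right hz₀ hz)
  have hG : DifferentiableOn ℂ (fun t => K S z 0 t * Q S z 0 t) (Metric.ball 0 1) :=
    (differentiable_K_zero_left S z).differentiableOn.mul (differentiableOn_Q_zero_left hz₀ hz)
  obtain ⟨r, rmer, rx, ry, rshift, rξ, rper⟩ := h.uniform.exists_continuation hF hG (C := C)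
    (fun u v hu hv huv => by
      have := functional_equation hz₀ hz hS hu.le hv.le
      rw [K_eq_val hS u v, huv, zero_mul] at this
      rw [hC]
      linear_combination -this)
  -- the second function
  obtain ⟨s, hs⟩ : ∃ s : ℂ → ℂ, s = fun w => C + β.coord w * β'.coord (w - c) - r w := ⟨_, rfl⟩
  have smer : Meromorphic s := by
    rw [hs]
    refine fun v => ((MeromorphicAt.const C v).add ((Branch.meromorphic_coord v).mul ?_)).sub
      (rmer v)
    exact MeromorphicAt.comp_analyticAt (g := fun v : ℂ => v - c) (Branch.meromorphic_coord _)
      (by fun_prop)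
  obtain ⟨f, hf⟩ : ∃ f, f = toMeromorphicNFOn r Set.univ := ⟨_, rfl⟩
  obtain ⟨g, hg⟩ : ∃ g, g = toMeromorphicNFOn s Set.univ := ⟨_, rfl⟩
  have fNF : MeromorphicNFOn f Set.univ := by
    rw [hf]; exact meromorphicNFOn_toMeromorphicNFOn r _
  have gNF : MeromorphicNFOn g Set.univ := by
    rw [hg]; exact meromorphicNFOn_toMeromorphicNFOn s _
  have fr : ∀ w, f =ᶠ[𝓝[≠] w] r := fun w => by
    rw [hf]; exact rmer.meromorphicOn.toMeromorphicNFOn_eq_self_on_nhdsNE (Set.mem_univ w)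
  have gs : ∀ w, g =ᶠ[𝓝[≠] w] s := fun w => by
    rw [hg]; exact smer.meromorphicOn.toMeromorphicNFOn_eq_self_on_nhdsNE (Set.mem_univ w)
  -- substitutions of the form `± ω + b`
  have inv : ∀ (p q : ℂ → ℂ), MeromorphicNFOn p Set.univ → (∀ w, p =ᶠ[𝓝[≠] w] q) → ∀ (a : ℂ),
      a ≠ 0 → ∀ b : ℂ, (∀ w, (fun v => q (a * v + b)) =ᶠ[𝓝[≠] w] q) → ∀ w, p (a * w + b) = p w :=
    fun p q hp hpq a ha b hq => hp.comp_eq_self (g := fun w => a * w + b) (by fun_prop) fun w =>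
      (eventuallyEq_comp_affine ha (hpq _)).trans ((hq w).trans (hpq w).symm)
  have sper : ∀ w, (fun v => s (1 * v + Complex.I * β.cubic.per₁)) =ᶠ[𝓝[≠] w] s := by
    intro w
    filter_upwards [rper _ hI hIre w] with v hv
    have e : v + Complex.I * β.cubic.per₁ - c = v - c + Complex.I * β.cubic.per₁ := by ring
    rw [hs]
    simp only
    rw [one_mul, hv, Branch.coord_add hI, e, Branch.coord_add hI']
  have fper : ∀ w, f (w + ω₁ S z) = f w := fun w => by
    have := inv f r fNF fr 1 one_ne_zero _ (fun w => by
      simpa only [one_mul] using rper _ hI hIre w) w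
    rwa [one_mul, ← hω₁] at this
  have gper : ∀ w, g (w + ω₁ S z) = g w := fun w => by
    have := inv g s gNF gs 1 one_ne_zero _ sper w
    rwa [one_mul, ← hω₁] at this
  have fx : ∀ w ∈ Δx S z, f =ᶠ[𝓝[≠] w] fun v => K S z (x S z v) 0 * Q S z (x S z v) 0 := by
    intro w hw
    rw [h.mem_Δx hS] at hw
    rw [hx]
    exact (fr w).trans (rx w hw.2 hw.1.1 hw.1.2)
  have gy : ∀ w ∈ Δy S z, g =ᶠ[𝓝[≠] w] fun v => K S z 0 (y S z v) * Q S z 0 (y S z v) := by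
    intro w hw
    rw [h.mem_Δy hS] at hw
    simp only [hy]
    refine (gs w).trans ?_
    rw [hs]
    exact ry w hw.2 hw.1.1 hw.1.2
  have rel : ∀ w, ∀ᶠ v in 𝓝[≠] w, f v + g v - C - x S z v * y S z v = 0 := by
    intro w
    filter_upwards [fr w, gs w] with v h1 h2
    rw [h1, h2, hs, hx, hy]
    ring
  refine ⟨f, g, fNF, gNF, fun w hw => ?_, ?_, fun w hw => ?_, ?_, ?_, ?_, ?_, ?_, ?_, fper, gper⟩
  · have hw' := (h.mem_Δx hS).1 hw
    have h1 := (Branch.analyticAt_comp_coord hF hw'.2).meromorphicNFAt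
    have h2 := fx w hw
    rw [hx] at h2 ⊢
    exact (((fNF (Set.mem_univ w)).eventuallyEq_nhdsNE_iff_eventuallyEq_nhds h1).1 h2).eq_of_nhds
  · refine eventuallyEq_codiscreteWithin fun w hw => ?_
    filter_upwards [rel w, gy w hw] with v h1 h2
    rw [h2] at h1
    rw [← hC]
    linear_combination h1
  · have hw' := (h.mem_Δy hS).1 hw
    have h1 := (AnalyticAt.comp_of_eq (Branch.analyticAt_comp_coord hG hw'.2)
      (by fun_prop : AnalyticAt ℂ (fun v : ℂ => v - c) w) rfl).meromorphicNFAt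
    have h2 := gy w hw
    simp only [hy] at h2 ⊢
    exact (((gNF (Set.mem_univ w)).eventuallyEq_nhdsNE_iff_eventuallyEq_nhds h1).1 h2).eq_of_nhds
  · refine eventuallyEq_codiscreteWithin fun w hw => ?_
    filter_upwards [rel w, fx w hw] with v h1 h2
    rw [h2] at h1
    rw [← hC]
    linear_combination h1
  · refine eventuallyEq_codiscreteWithin fun w _ => ?_
    filter_upwards [fr w,
      eventuallyEq_comp_affine one_ne_zero (fr (1 * w + -(2 * c : ℝ)))] with v h1 h2
    rw [one_mul, ← sub_eq_add_neg] at h2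
    rw [h.ω₃_eq, h1, h2, rshift, hx, hy]
    congr 3
    rw [ωy₂, hω₁, hω₂, h.ω₃_eq, ← Branch.coord_add hI]
    congr 1
    push_cast; ring
  · refine eventuallyEq_codiscreteWithin fun w _ => ?_
    filter_upwards [gs w,
      eventuallyEq_comp_affine one_ne_zero (gs (1 * w + (2 * c : ℝ)))] with v h1 h2
    rw [one_mul] at h2
    have h3 := rshift (v + (2 * c : ℝ))
    have e1 : -(v + (2 * c : ℝ)) + (β.cubic.per₂ : ℂ) + 2 * c = -v + β.cubic.per₂ := by
      push_cast; ring
    have e2 : v + (2 * c : ℝ) - (c : ℂ) = v + c := by push_cast; ring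
    have e3 : -v + 2 * ωx₂ S z - c = -(v + c) + β.cubic.per₂ + Complex.I * β.cubic.per₁ := by
      rw [ωx₂, hω₁, hω₂]; ring
    rw [add_sub_cancel_right, e1, e2, Branch.coord_add hP, Branch.coord_neg] at h3
    rw [h.ω₃_eq, h1, h2, hx, hy, hy, hs, e3, Branch.coord_add hI', Branch.coord_add hP',
      Branch.coord_neg]
    simp only
    rw [e2, h3]
    ring
  · refine eventuallyEq_codiscreteWithin fun w _ => ?_
    filter_upwards [rel w] with v h1
    rw [← hC]
    exact h1
  · intro w
    have h1 := inv f r fNF fr (-1) (by norm_num) (β.cubic.per₂ : ℂ) (fun w => by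
      simpa only [neg_mul, one_mul] using rξ w) w
    rw [← h1, ← fper (-1 * w + _), ξ, ωx₂, hω₂]
    congr 1
    ring
  · intro w
    have h1 := inv g s gNF gs (-1) (by norm_num) (β.cubic.per₂ + 2 * c : ℂ) (fun w => by
      -- the reflection is the composite of a translation and the reflection that fixes `r`
      filter_upwards [eventuallyEq_comp_affine one_ne_zero (rξ (1 * w + -(2 * c : ℝ)))] with v hv
      have e1 : -(1 * v + -((2 * c : ℝ) : ℂ)) + (β.cubic.per₂ : ℂ) =
          -1 * v + (β.cubic.per₂ + 2 * c) := by push_cast; ring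
      have e2 : -1 * v + (β.cubic.per₂ + 2 * c) - (c : ℂ) = -(v - c) + β.cubic.per₂ := by ring
      have e3 : -1 * v + (β.cubic.per₂ + 2 * c : ℂ) = -v + β.cubic.per₂ + 2 * c := by ring
      rw [e1, one_mul, ← sub_eq_add_neg, rshift] at hv
      rw [hs]
      simp only
      rw [hv, e2, Branch.coord_add hP', Branch.coord_neg, e3]
      ring) w
    rw [← h1, ← gper (-1 * w + _), η, ωy₂, hω₂, h.ω₃_eq]
    congr 1
    push_cast
    ring
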